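/- Let $N\ge 1$, let $\Omega\subset\mathbb R^N$ be a bounded domain with smooth boundary, let $1<p,q<2$, $m,n>0$, and assume $(p-1)(q-1)<mn$. Let $0\le u_0\in L^\infty(\Omega)\cap W^{1,p}_0(\Omega)$ and $0\le v_0\in L^\infty(\Omega)\cap W^{1,q}_0(\Omega)$ be nontrivial, and consider $$u_t=\operatorname{div}(|\nabla u|^{p-2}\nabla u)+v^m,\qquad v_t=\operatorname{div}(|\nabla v|^{q-2}\nabla v)+u^n\quad\text{in }\Omega\times(0,\infty),$$ with $u=v=0$ on $\partial\Omega\times(0,\infty)$ and $(u,v)(\cdot,0)=(u_0,v_0)$. A (nonnegative) weak solution is a pair $(u,v)$, $u,v\ge0$ a.e. in $\Omega\times(0,\infty)$, such that for every $T>0$, with $Q_T=\Omega\times(0,T)$: $u\in L^{2n}(Q_T)\cap L^2(Q_T)$, $v\in L^{2m}(Q_T)\cap L^2(Q_T)$, $u_t,v_t\in L^2(Q_T)$, $\nabla u\in L^p(Q_T)$, $\nabla v\in L^q(Q_T)$ (weak derivatives), $u=v=0$ on $\partial\Omega\times(0,T)$ in the sense of traces, $u(\cdot,t)\to u_0$ and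 $v(\cdot,t)\to v_0$ in $L^2(\Omega)$ as $t\to0^+$ (essential limits), and $$\iint_{Q_T}\big(u_t\phi_1+|\nabla u|^{p-2}\nabla u\cdot\nabla\phi_1\big)=\iint_{Q_T}v^m\phi_1,\qquad \iint_{Q_T}\big(v_t\phi_2+|\nabla v|^{q-2}\nabla v\cdot\nabla\phi_2\big)=\iint_{Q_T}u^n\phi_2$$ for all $0\le\phi_1,\phi_2\in L^2(Q_T)$ vanishing on $\partial\Omega\times(0,T)$ with $\nabla\phi_1\in L^p(Q_T)$, $\nabla\phi_2\in L^q(Q_T)$. It vanishes in finite time if there is a smallest $T>0$ such that $u=v=0$ a.e. in $\Omega\times(T,\infty)$. Put $p^*=\frac{Np}{N-p}$ and $s_p=\frac{N(2-p)}{p}$ if $N\ge2$, and $p^*=s_p=2$ if $N=1$; let $\gamma_p$ be the best constant in $\|w\|_{L^{p^*}(\Omega)}\le\gamma_p\|\nabla w\|_{L^p(\Omega)}$, $w\in W_0^{1,p}(\Omega)$, and define $q^*$, $s_q$, $\gamma_q$ in the same way from $q$. For $s,r>1$ and $\mu,\nu>0$ set $$A_p(s)=\frac{(s-1)p^p}{(s+p-2)^p}\,\gamma_p^{-p}\,|\Omega|^{-p\left(\frac{s+p-2}{sp}-\frac1{p^*}\right)},\qquad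 B_\mu(s,r)=|\Omega|^{\frac1s-\frac{\mu}{r}},$$ and $A_q$ likewise from $q$. Call $(s,r)$ admissible for $(\mu,\nu)$ if $s,r>1$, $\mu\le\frac rs\le\frac1\nu$, $s\ge s_p$ and $r\ge s_q$. (I) Let $mn\le1$. Then admissible $(s,r)$ for $(m,n)$ exist. For every such $(s,r)$, put $a_1=A_p(s)$, $b_1=B_m(s,r)$, $a_2=A_q(r)$, $b_2=B_n(r,s)$. If for some $0<\delta_1<1$ $$\Big(\frac{b_1}{\delta_1a_1}\Big)^{\frac1{p-1}}\|v_0\|_{L^r(\Omega)}^{\frac m{p-1}}\le\|u_0\|_{L^s(\Omega)}\le\Big(\frac{\delta_1a_2}{b_2}\Big)^{\frac1n}\|v_0\|_{L^r(\Omega)}^{\frac{q-1}n},$$ then every weak solution vanishes in finite time. (II) Let $mn>1$. Then there are $l_1,l_2>0$ with $\frac{q-1}n<\frac{l_1}{l_2}<\frac m{p-1}$, and there are $0<m_1<m$, $0<n_1\le n$ with $(p-1)(q-1)<m_1n_1\le1$ and pairs $(s',r')$ admissible for $(m_1,n_1)$. For every such $l_1,l_2$ and every $\delta_0>0$, let $\psi_p$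 be the weak solution of $-\operatorname{div}(|\nabla\psi|^{p-2}\nabla\psi)=1$ in $\Omega$, $\psi=\delta_0$ on $\partial\Omega$, let $\psi_q$ be the one with $q$ in place of $p$, and put $M_p=\|\psi_p\|_{L^\infty(\Omega)}$, $M_q=\|\psi_q\|_{L^\infty(\Omega)}$. Then there is $k_0>0$ such that for all $0<k\le k_0$, all $0<m_1\le m$, $0<n_1\le n$ with $(p-1)(q-1)<m_1n_1\le1$, and all $(s',r')$ admissible for $(m_1,n_1)$ the following holds with $$a_1'=A_p(s'),\quad b_1'=k^{l_2(m-m_1)}M_q^{m-m_1}B_{m_1}(s',r'),\quad a_2'=A_q(r'),\quad b_2'=k^{l_1(n-n_1)}M_p^{n-n_1}B_{n_1}(r',s').$$ If the initial data are so small that $u_0\le k^{l_1}\psi_p$ and $v_0\le k^{l_2}\psi_q$ a.e. in $\Omega$, and if for some $0<\delta_2<1$ $$\Big(\frac{b_1'}{\delta_2a_1'}\Big)^{\frac1{p-1}}\|v_0\|_{L^{r'}(\Omega)}^{\frac{m_1}{p-1}}\le\|u_0\|_{L^{s'}(\Omega)}\le\Big(\frac{\delta_2a_2'}{b_2'}\Big)^{\frac1{n_1}}\|v_0\|_{L^{r'}(\Omega)}^{\frac{q-1}{n_1}},$$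 then every weak solution that is bounded in $Q_T$ for every $T>0$ vanishes in finite time. -/

import Mathlib

open MeasureTheory Set Filter Topology
open scoped ContDiff ENNReal

noncomputable section

namespace FastDiffusion

/-- The Euclidean space `ℝ^N`. -/
abbrev Space (N : ℕ) : Type := EuclideanSpace ℝ (Fin N)

/-- A bounded domain (nonempty, open, connected) with `C^∞` boundary: near every boundary point
it is the sublevel set `{ρ < 0}` of a smooth function with nonvanishing differential. -/
structure IsSmoothBoundedDomain {N : ℕ} (Ω : Set (Space N)) : Prop where
  isOpen : IsOpen Ω
  isConnected : IsConnected Ω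
  isBounded : Bornology.IsBounded Ω
  smooth_boundary : ∀ x ∈ frontier Ω, ∃ (U : Set (Space N)) (ρ : Space N → ℝ),
    IsOpen U ∧ x ∈ U ∧ ContDiffOn ℝ ∞ ρ U ∧ fderiv ℝ ρ x ≠ 0 ∧ Ω ∩ U = {y ∈ U | ρ y < 0}

/-- `φ ∈ C_c^∞(Q)`. -/
structure IsTestFunction {X : Type*} [NormedAddCommGroup X] [NormedSpace ℝ X]
    (Q : Set X) (φ : X → ℝ) : Prop where
  smooth : ContDiff ℝ ∞ φ
  compact : HasCompactSupport φ
  support : tsupport φ ⊆ Q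

/-- `f ∈ W_0^{1,p}(Ω)` with weak gradient `g`: the pair `(f, g)` is the limit in
`L^p(Ω) × L^p(Ω)` of `(φ_k, ∇φ_k)` with `φ_k ∈ C_c^∞(Ω)`. -/
def MemW0 {N : ℕ} (p : ℝ) (Ω : Set (Space N)) (f : Space N → ℝ) (g : Space N → Space N) : Prop :=
  MemLp f (ENNReal.ofReal p) (volume.restrict Ω) ∧
  MemLp g (ENNReal.ofReal p) (volume.restrict Ω) ∧
  ∃ φ : ℕ → Space N → ℝ, (∀ k, IsTestFunction Ω (φ k)) ∧
    Tendsto (fun k => eLpNorm (fun x => φ k x - f x) (ENNReal.ofReal p) (volume.restrict Ω))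
      atTop (𝓝 0) ∧
    Tendsto (fun k => eLpNorm (fun x => gradient (φ k) x - g x) (ENNReal.ofReal p)
      (volume.restrict Ω)) atTop (𝓝 0)

/-- The cylinder `Q_T = Ω × (0, T)`. -/
def cylinder {N : ℕ} (Ω : Set (Space N)) (T : ℝ) : Set (Space N × ℝ) := Ω ×ˢ Ioo 0 T

/-- Lebesgue measure on `Q_T`. -/
def cylMeasure {N : ℕ} (Ω : Set (Space N)) (T : ℝ) : Measure (Space N × ℝ) :=
  volume.restrict (cylinder Ω T)

/-- `w'` is the weak time derivative of `w` in `Q_T`. -/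
def HasWeakTimeDeriv {N : ℕ} (Ω : Set (Space N)) (T : ℝ) (w w' : Space N × ℝ → ℝ) : Prop :=
  ∀ φ : Space N × ℝ → ℝ, IsTestFunction (cylinder Ω T) φ →
    ∫ z, w z * fderiv ℝ φ z (0, 1) ∂(cylMeasure Ω T) = -∫ z, w' z * φ z ∂(cylMeasure Ω T)

/-- `g` is the weak spatial gradient of `w` in `Q_T`. -/
def HasWeakGrad {N : ℕ} (Ω : Set (Space N)) (T : ℝ) (w : Space N × ℝ → ℝ)
    (g : Space N × ℝ → Space N) : Prop :=
  ∀ φ : Space N × ℝ → ℝ, IsTestFunction (cylinder Ω T) φ → ∀ e : Space N,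
    ∫ z, w z * fderiv ℝ φ z (e, 0) ∂(cylMeasure Ω T)
      = -∫ z, inner ℝ (g z) e * φ z ∂(cylMeasure Ω T)

/-- `w = 0` on `∂Ω × (0, T)`: almost every time slice lies in `W_0^{1,p}(Ω)`. -/
def HasZeroTrace {N : ℕ} (p : ℝ) (Ω : Set (Space N)) (T : ℝ) (w : Space N × ℝ → ℝ)
    (g : Space N × ℝ → Space N) : Prop :=
  ∀ᵐ t ∂(volume.restrict (Ioo 0 T)), MemW0 p Ω (fun x => w (x, t)) (fun x => g (x, t))

/-- `w ∈ L^{2a}(Q_T) ∩ L^2(Q_T)` with `∂w/∂t = w' ∈ L^2(Q_T)` and `∇w = g ∈ L^p(Q_T)`.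
The space `E_n` is the case `a = n`, and `E_m` is the case `a = m` with `q` in place of `p`. -/
structure MemSolutionSpace {N : ℕ} (p a : ℝ) (Ω : Set (Space N)) (T : ℝ)
    (w w' : Space N × ℝ → ℝ) (g : Space N × ℝ → Space N) : Prop where
  memLp_pow : MemLp w (ENNReal.ofReal (2 * a)) (cylMeasure Ω T)
  memLp_two : MemLp w 2 (cylMeasure Ω T)
  memLp_deriv : MemLp w' 2 (cylMeasure Ω T)
  memLp_grad : MemLp g (ENNReal.ofReal p) (cylMeasure Ω T)
  weakDeriv : HasWeakTimeDeriv Ω T w w'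
  weakGrad : HasWeakGrad Ω T w g

/-- `φ ∈ E_{p0}` with weak spatial gradient `g`: `φ ∈ L^2(Q_T)`, `∇φ = g ∈ L^p(Q_T)` and
`φ = 0` on the lateral boundary. -/
structure MemTestSpace {N : ℕ} (p : ℝ) (Ω : Set (Space N)) (T : ℝ)
    (φ : Space N × ℝ → ℝ) (g : Space N × ℝ → Space N) : Prop where
  memLp_two : MemLp φ 2 (cylMeasure Ω T)
  memLp_grad : MemLp g (ENNReal.ofReal p) (cylMeasure Ω T)
  weakGrad : HasWeakGrad Ω T φ g
  zeroTrace : HasZeroTrace p Ω T φ g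

/-- Weak form of `w_t = div(|∇w|^{p-2} ∇w) + f` in `Q_T` (both inequalities, for all
nonnegative test functions in `E_{p0}`), where `w' = w_t` and `g = ∇w`. -/
def SatisfiesEquation {N : ℕ} (p : ℝ) (Ω : Set (Space N)) (T : ℝ)
    (w' : Space N × ℝ → ℝ) (g : Space N × ℝ → Space N) (f : Space N × ℝ → ℝ) : Prop :=
  ∀ (φ : Space N × ℝ → ℝ) (gφ : Space N × ℝ → Space N), MemTestSpace p Ω T φ gφ →
    (∀ᵐ z ∂(cylMeasure Ω T), 0 ≤ φ z) →
    ∫ z, (w' z * φ z + ‖g z‖ ^ (p - 2) * inner ℝ (g z) (gφ z)) ∂(cylMeasure Ω T)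
      = ∫ z, f z * φ z ∂(cylMeasure Ω T)

/-- `w(·, 0) = w₀`: the essential limit of `w(·, t)` in `L^2(Ω)` as `t → 0+` is `w₀`. -/
def HasInitialValue {N : ℕ} (Ω : Set (Space N)) (w : Space N × ℝ → ℝ) (w₀ : Space N → ℝ) :
    Prop :=
  Tendsto (fun t : ℝ => eLpNorm (fun x => w (x, t) - w₀ x) 2 (volume.restrict Ω))
    (ae (volume : Measure ℝ) ⊓ 𝓝[>] 0) (𝓝 0)

/-- `(u, v)` is a nonnegative weak solution in `Q_T` of
`u_t = div(|∇u|^{p-2}∇u) + v^m`, `v_t = div(|∇v|^{q-2}∇v) + u^n` with zero lateral boundary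
values and initial data `(u₀, v₀)`. -/
def IsWeakSolutionOn {N : ℕ} (p q m n : ℝ) (Ω : Set (Space N)) (u₀ v₀ : Space N → ℝ) (T : ℝ)
    (u v : Space N × ℝ → ℝ) : Prop :=
  (∀ᵐ z ∂(cylMeasure Ω T), 0 ≤ u z ∧ 0 ≤ v z) ∧
  HasInitialValue Ω u u₀ ∧ HasInitialValue Ω v v₀ ∧
  ∃ (u' v' : Space N × ℝ → ℝ) (gu gv : Space N × ℝ → Space N),
    MemSolutionSpace p n Ω T u u' gu ∧ MemSolutionSpace q m Ω T v v' gv ∧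
    HasZeroTrace p Ω T u gu ∧ HasZeroTrace q Ω T v gv ∧
    SatisfiesEquation p Ω T u' gu (fun z => v z ^ m) ∧
    SatisfiesEquation q Ω T v' gv (fun z => u z ^ n)

/-- A weak solution in `Ω × (0, ∞)`. -/
def IsWeakSolution {N : ℕ} (p q m n : ℝ) (Ω : Set (Space N)) (u₀ v₀ : Space N → ℝ)
    (u v : Space N × ℝ → ℝ) : Prop :=
  ∀ T : ℝ, 0 < T → IsWeakSolutionOn p q m n Ω u₀ v₀ T u v

/-- `w` is bounded in `Q_T` for every finite `T`. -/
def IsLocallyBoundedInTime {N : ℕ} (Ω : Set (Space N)) (w : Space N × ℝ → ℝ) : Prop :=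
  ∀ T : ℝ, 0 < T → MemLp w ∞ (cylMeasure Ω T)

/-- `w₀` is a nonnegative, nontrivial element of `L^∞(Ω) ∩ W_0^{1,p}(Ω)`. -/
structure IsInitialDatum {N : ℕ} (p : ℝ) (Ω : Set (Space N)) (w₀ : Space N → ℝ) : Prop where
  bounded : MemLp w₀ ∞ (volume.restrict Ω)
  sobolev : ∃ g : Space N → Space N, MemW0 p Ω w₀ g
  nonneg : ∀ᵐ x ∂(volume.restrict Ω), 0 ≤ w₀ x
  nontrivial : ¬ ∀ᵐ x ∂(volume.restrict Ω), w₀ x = 0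

/-- `(u, v)` has a finite extinction time: there is a smallest `T > 0` such that `u = v = 0`
a.e. in `Ω × (T, ∞)`. -/
def VanishesInFiniteTime {N : ℕ} (Ω : Set (Space N)) (u v : Space N × ℝ → ℝ) : Prop :=
  ∃ T : ℝ, IsLeast {τ : ℝ | 0 < τ ∧
    ∀ᵐ z ∂((volume : Measure (Space N × ℝ)).restrict (Ω ×ˢ Ioi τ)), u z = 0 ∧ v z = 0} T

/-- The norm `‖f‖_{L^s(Ω)}`. -/
def normLs {N : ℕ} (Ω : Set (Space N)) (s : ℝ) (f : Space N → ℝ) : ℝ :=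
  (eLpNorm f (ENNReal.ofReal s) (volume.restrict Ω)).toReal

/-- The norm `‖f‖_{L^∞(Ω)}`. -/
def normLinfty {N : ℕ} (Ω : Set (Space N)) (f : Space N → ℝ) : ℝ :=
  (eLpNorm f ∞ (volume.restrict Ω)).toReal

/-- The exponent `p^*` of the embedding `W_0^{1,p}(Ω) ↪ L^{p^*}(Ω)`: `Np/(N-p)` if `N ≥ 2`,
and `2` if `N = 1`. -/
def sobolevExponent (N : ℕ) (p : ℝ) : ℝ := if N = 1 then 2 else N * p / (N - p)

/-- The (best) constant `γ` in `‖w‖_{L^{p^*}(Ω)} ≤ γ ‖∇w‖_{L^p(Ω)}`, `w ∈ W_0^{1,p}(Ω)`. -/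
def embeddingConst {N : ℕ} (p : ℝ) (Ω : Set (Space N)) : ℝ :=
  sInf {γ : ℝ | 0 ≤ γ ∧ ∀ (w : Space N → ℝ) (g : Space N → Space N), MemW0 p Ω w g →
    eLpNorm w (ENNReal.ofReal (sobolevExponent N p)) (volume.restrict Ω)
      ≤ ENNReal.ofReal γ * eLpNorm g (ENNReal.ofReal p) (volume.restrict Ω)}

/-- The lower bound on the integrability exponent `s`: `N(2-p)/p` if `N ≥ 2`, and `2` if
`N = 1`. -/
def minExponent (N : ℕ) (p : ℝ) : ℝ := if N = 1 then 2 else N * (2 - p) / p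

/-- The requirements on the exponents `s, r` for sources with powers `m, n`. -/
structure AdmissibleExponents (N : ℕ) (p q m n s r : ℝ) : Prop where
  one_lt_s : 1 < s
  one_lt_r : 1 < r
  lower : m ≤ r / s
  upper : r / s ≤ 1 / n
  min_s : minExponent N p ≤ s
  min_r : minExponent N q ≤ r

/-- `((s-1) p^p / (s+p-2)^p) γ^{-p} |Ω|^{-p((s+p-2)/(sp) - 1/p^*)}`. -/
def diffusionCoeff {N : ℕ} (p : ℝ) (Ω : Set (Space N)) (s : ℝ) : ℝ :=
  (s - 1) * p ^ p / (s + p - 2) ^ p * embeddingConst p Ω ^ (-p) *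
    volume.real Ω ^ (-p * ((s + p - 2) / (s * p) - 1 / sobolevExponent N p))

/-- `|Ω|^{1/s - m/r}`. -/
def sourceCoeff {N : ℕ} (m : ℝ) (Ω : Set (Space N)) (s r : ℝ) : ℝ :=
  volume.real Ω ^ (1 / s - m / r)

/-- `(b₁/(δ a₁))^{1/(p-1)} Y^{m/(p-1)} ≤ X ≤ (δ a₂/b₂)^{1/n} Y^{(q-1)/n}`. -/
def Comparable (p q m n a₁ b₁ a₂ b₂ δ X Y : ℝ) : Prop :=
  (b₁ / (δ * a₁)) ^ (1 / (p - 1)) * Y ^ (m / (p - 1)) ≤ X ∧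
  X ≤ (δ * a₂ / b₂) ^ (1 / n) * Y ^ ((q - 1) / n)

/-- `ψ` is the weak solution of `-div(|∇ψ|^{p-2}∇ψ) = 1` in `Ω`, `ψ = δ₀` on `∂Ω`. -/
def IsTorsionFunction {N : ℕ} (p : ℝ) (Ω : Set (Space N)) (δ₀ : ℝ) (ψ : Space N → ℝ) : Prop :=
  ∃ g : Space N → Space N, MemW0 p Ω (fun x => ψ x - δ₀) g ∧
    ∀ φ : Space N → ℝ, IsTestFunction Ω φ →
      ∫ x in Ω, ‖g x‖ ^ (p - 2) * inner ℝ (g x) (gradient φ x) = ∫ x in Ω, φ x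

end FastDiffusion

end

namespace FastDiffusion

variable {N : ℕ}

/-! For 1 < p, q < 2 diffusion alone extinguishes bounded solutions in finite time; the theorem says
that a coupling with (p-1)(q-1) < mn does not prevent this when the data are suitably balanced.

Formally, test the first equation with u^(s-1). Up to constants, u^(s-2)|∇u|^p is
|∇u^((s+p-2)/p)|^p, so the Sobolev inequality bounds it below by a power of X = ‖u‖_s, while
Hölder's inequality bounds the source by Y = ‖v‖_r. This gives X' ≤ b₁ Y^m - a₁ X^(p-1), and
symmetrically Y' ≤ b₂ X^n - a₂ Y^(q-1). The bounds s ≥ s_p and r ≥ s_q are what Sobolev needs; m ≤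
r/s ≤ 1/n is what Hölder needs. The comparability hypothesis says that at time 0 each source is at
most δ times the matching absorption.

This balance survives along the curve (X₀ θ^σ₁, Y₀ θ^σ₂) as θ decreases, if σ₁ : σ₂ = m : (p-1): the
first ratio is then constant and the second does not increase, because mn ≥ (p-1)(q-1). Since p-1
and q-1 are below 1, large σ₁ and σ₂ allow θ to reach 0 in finite time while the curve remains a
strict supersolution. A first-contact argument keeps (X, Y) below it. See `integral_rpow_le`,
`rate_le`, `profile_rate_neg`, `neg_of_integral_bound` and `exists_extinction_time`.

Powers of u are legitimate test functions only for bounded solutions. If mn ≤ 1, boundedness on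
finite cylinders follows by comparison with exponentials in time (`exists_bound_of_sublinear`). If
mn > 1, boundedness is assumed, and small data stay below the stationary supersolutions k^l₁ ψ_p and
k^l₂ ψ_q (`le_torsion_of_bounded`). Then v^m ≤ (sup v)^(m-m₁) v^(m₁), and likewise for u, so the
argument applies with m₁ n₁ ≤ 1 and the small suprema absorbed into the coefficients.

Both comparisons rest on `comparison`. The sources need not be Lipschitz, so the excesses x of u and
y of v over the barriers are measured by energies of different growth, quadratic in x and of order
y^(2ρ) in y for large values. These are matched so that the coupling terms are bounded by the
energies and Gronwall's inequality applies (`coupling_le_energy`).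

All of this is carried out for weak solutions. The weak time derivative and the essential initial
limit give a representative that is absolutely continuous in time (`ae_eq_timeRep`), whence an
energy identity between any two times (`energy`). -/

/-! ### Convergence in L^p and calculus in W_0^{1,p} -/

theorem tendsto_eLpNorm_zero_of_dominated {α E : Type*} [MeasurableSpace α] {μ : Measure α}
    [NormedAddCommGroup E] {p : ℝ} (hp : 0 < p) {F : ℕ → α → E} {b : α → ℝ}
    (hb : MemLp b (ENNReal.ofReal p) μ) (hF : ∀ k, AEStronglyMeasurable (F k) μ)
    (hbound : ∀ k, ∀ᵐ x ∂μ, ‖F k x‖ ≤ b x)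
    (hlim : ∀ᵐ x ∂μ, Tendsto (fun k => F k x) atTop (𝓝 0)) :
    Tendsto (fun k => eLpNorm (F k) (ENNReal.ofReal p) μ) atTop (𝓝 0) := by
  have hp0 : ENNReal.ofReal p ≠ 0 := by simpa using hp
  have hpt : ENNReal.ofReal p ≠ ⊤ := ENNReal.ofReal_ne_top
  have htr : (ENNReal.ofReal p).toReal = p := ENNReal.toReal_ofReal hp.le
  simp_rw [eLpNorm_eq_lintegral_rpow_enorm_toReal hp0 hpt, htr]
  have key : Tendsto (fun k => ∫⁻ x, ‖F k x‖ₑ ^ p ∂μ) atTop (𝓝 (∫⁻ _, 0 ∂μ)) := by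
    refine tendsto_lintegral_of_dominated_convergence' (fun x => ‖b x‖ₑ ^ p)
      (fun k => (hF k).enorm.pow_const p) (fun k => ?_) ?_ ?_
    · filter_upwards [hbound k] with x hx
      have : ‖F k x‖ₑ ≤ ‖b x‖ₑ := by
        rw [enorm_le_iff_norm_le]
        exact hx.trans (le_abs_self _)
      gcongr
    · have := lintegral_rpow_enorm_lt_top_of_eLpNorm_lt_top hp0 hpt hb.2
      rw [htr] at this
      exact this.ne
    · filter_upwards [hlim] with x hx
      have h1 : Tendsto (fun k => ‖F k x‖ₑ) atTop (𝓝 0) := by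
        simpa using hx.enorm
      have := (ENNReal.continuous_rpow_const (y := p)).tendsto 0 |>.comp h1
      simpa [ENNReal.zero_rpow_of_pos hp, Function.comp_def] using this
  have := (ENNReal.continuous_rpow_const (y := 1 / p)).tendsto _ |>.comp key
  simpa [ENNReal.zero_rpow_of_pos (inv_pos.2 hp), Function.comp_def] using this

theorem tendsto_eLpNorm_zero_of_norm_le {α E F : Type*} [MeasurableSpace α] {μ : Measure α}
    [NormedAddCommGroup E] [NormedAddCommGroup F] {p : ℝ≥0∞} {G : ℕ → α → F} {f : ℕ → α → E}
    {C : ℝ} (h : ∀ k, ∀ᵐ x ∂μ, ‖f k x‖ ≤ C * ‖G k x‖)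
    (hG : Tendsto (fun k => eLpNorm (G k) p μ) atTop (𝓝 0)) :
    Tendsto (fun k => eLpNorm (f k) p μ) atTop (𝓝 0) := by
  refine tendsto_of_tendsto_of_tendsto_of_le_of_le tendsto_const_nhds
    (h := fun k => ENNReal.ofReal C * eLpNorm (G k) p μ) ?_ (fun _ => zero_le) (fun k => ?_)
  · simpa using ENNReal.Tendsto.const_mul hG (Or.inr ENNReal.ofReal_ne_top)
  · exact eLpNorm_le_mul_eLpNorm_of_ae_le_mul (h k) p

theorem tendsto_eLpNorm_zero_of_uniform {α E : Type*} [MeasurableSpace α] {μ : Measure α}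
    [IsFiniteMeasure μ] [NormedAddCommGroup E] {p : ℝ≥0∞} {f : ℕ → α → E} {ε : ℕ → ℝ}
    (h : ∀ k, ∀ᵐ x ∂μ, ‖f k x‖ ≤ ε k) (hε : Tendsto ε atTop (𝓝 0)) :
    Tendsto (fun k => eLpNorm (f k) p μ) atTop (𝓝 0) := by
  refine tendsto_of_tendsto_of_tendsto_of_le_of_le tendsto_const_nhds
    (h := fun k => μ univ ^ p.toReal⁻¹ * ENNReal.ofReal (ε k)) ?_ (fun _ => zero_le)
    (fun k => eLpNorm_le_of_ae_bound (h k))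
  have h1 : Tendsto (fun k => ENNReal.ofReal (ε k)) atTop (𝓝 0) := by
    simpa using ENNReal.tendsto_ofReal hε
  have h2 : μ univ ^ p.toReal⁻¹ ≠ ⊤ := ENNReal.rpow_ne_top_of_nonneg (inv_nonneg.2 ENNReal.toReal_nonneg) (by finiteness)
  simpa using ENNReal.Tendsto.const_mul h1 (Or.inr h2)

theorem norm_gradient_sub (f g : Space N → ℝ) (x : Space N) :
    ‖gradient f x - gradient g x‖ = ‖fderiv ℝ f x - fderiv ℝ g x‖ := by
  simp only [gradient, ← map_sub, LinearIsometryEquiv.norm_map]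

theorem continuous_gradient {f : Space N → ℝ} (hf : ContDiff ℝ 1 f) : Continuous (gradient f) :=
  (InnerProductSpace.toDual ℝ (Space N)).symm.continuous.comp
    (hf.continuous_fderiv one_ne_zero)

theorem hasCompactSupport_gradient {f : Space N → ℝ} (hf : HasCompactSupport f) :
    HasCompactSupport (gradient f) :=
  (hf.fderiv ℝ).comp_left (map_zero _)

/-- A compactly supported `C^1` function is a uniform limit, together with its gradient, of test
functions. -/
theorem exists_testFunction_approx {Ω : Set (Space N)} (hΩ : IsOpen Ω) {f : Space N → ℝ}
    (hf : ContDiff ℝ 1 f) (hc : HasCompactSupport f) (hs : tsupport f ⊆ Ω) {ε : ℝ} (hε : 0 < ε) :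
    ∃ ζ : Space N → ℝ, IsTestFunction Ω ζ ∧ ∀ x, ‖ζ x - f x‖ ≤ ε ∧
      ‖gradient ζ x - gradient f x‖ ≤ ε := by
  have hfc : UniformContinuous f := hc.uniformContinuous_of_continuous hf.continuous
  have hdfc : UniformContinuous (fderiv ℝ f) :=
    (hc.fderiv ℝ).uniformContinuous_of_continuous (hf.continuous_fderiv one_ne_zero)
  obtain ⟨δ₁, hδ₁, h₁⟩ := Metric.uniformContinuous_iff.1 hfc ε hε
  obtain ⟨δ₂, hδ₂, h₂⟩ := Metric.uniformContinuous_iff.1 hdfc ε hε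
  obtain ⟨δ₃, hδ₃, h₃⟩ := hc.isCompact.exists_cthickening_subset_open hΩ hs
  -- One mollification radius serves three purposes: `δ₁` controls the function, `δ₂` its
  -- differential, and `δ₃` keeps the support of the mollification inside `Ω`.
  set r := min δ₁ (min δ₂ δ₃) with hr
  have hr0 : 0 < r := by positivity
  have hr1 : r ≤ δ₁ := min_le_left _ _
  have hr2 : r ≤ δ₂ := (min_le_right _ _).trans (min_le_left _ _)
  have hr3 : r ≤ δ₃ := (min_le_right _ _).trans (min_le_right _ _)
  let b : ContDiffBump (0 : Space N) := ⟨r / 2, r, by positivity, by linarith⟩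
  have hbi : LocallyIntegrable (b.normed volume) volume :=
    b.continuous_normed.locallyIntegrable
  have hfd : ∀ x, fderiv ℝ (convolution (b.normed volume) f (ContinuousLinearMap.lsmul ℝ ℝ) volume) x
      = convolution (b.normed volume) (fderiv ℝ f) (ContinuousLinearMap.lsmul ℝ ℝ) volume x := by
    intro x
    rw [(hc.hasFDerivAt_convolution_right (ContinuousLinearMap.lsmul ℝ ℝ) hbi hf x).fderiv]
    simp only [convolution_def]
    congr 1
  have hsub : Function.support
      (convolution (b.normed volume) f (ContinuousLinearMap.lsmul ℝ ℝ) volume) ⊆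
      Metric.cthickening r (tsupport f) := by
    refine (support_convolution_subset _).trans ?_
    rw [b.support_normed_eq]
    rintro _ ⟨y, hy, z, hz, rfl⟩
    refine Metric.mem_cthickening_of_dist_le _ z _ _ (subset_tsupport f hz) ?_
    simpa using (mem_ball_zero_iff.1 hy).le
  have hsub' := closure_minimal hsub Metric.isClosed_cthickening
  refine ⟨convolution (b.normed volume) f (ContinuousLinearMap.lsmul ℝ ℝ) volume,
    ⟨?_, ?_, ?_⟩, fun x => ⟨?_, ?_⟩⟩
  · exact b.hasCompactSupport_normed.contDiff_convolution_left _ b.contDiff_normed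
      hf.continuous.locallyIntegrable
  · exact HasCompactSupport.of_support_subset_isCompact
      hc.isCompact.cthickening hsub
  · exact hsub'.trans ((Metric.cthickening_mono hr3 _).trans h₃)
  · rw [← dist_eq_norm]
    refine b.dist_normed_convolution_le hf.continuous.aestronglyMeasurable fun y hy => ?_
    exact (h₁ (lt_of_lt_of_le hy hr1)).le
  · rw [norm_gradient_sub, hfd, ← dist_eq_norm]
    refine b.dist_normed_convolution_le
      (hf.continuous_fderiv one_ne_zero).aestronglyMeasurable fun y hy => ?_
    exact (h₂ (lt_of_lt_of_le hy hr2)).le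

/-- Composition with a C¹ nonlinearity takes test functions out of C_c^∞ but leaves them in C_c^1.
On a set of finite measure the uniform approximations converge in L^p, so nothing is lost. -/
theorem MemW0.of_contDiff {Ω : Set (Space N)} (hΩ : IsOpen Ω)
    [IsFiniteMeasure (volume.restrict Ω)] {f : Space N → ℝ} (p : ℝ)
    (hf : ContDiff ℝ 1 f) (hc : HasCompactSupport f) (hs : tsupport f ⊆ Ω) :
    MemW0 p Ω f (gradient f) := by
  refine ⟨(hf.continuous.memLp_of_hasCompactSupport hc).restrict _,
    ((continuous_gradient hf).memLp_of_hasCompactSupport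
      (hasCompactSupport_gradient hc)).restrict _, ?_⟩
  choose ζ hζ hζ' using fun k : ℕ =>
    exists_testFunction_approx hΩ hf hc hs (ε := 1 / ((k : ℝ) + 1)) (by positivity)
  refine ⟨ζ, hζ, ?_, ?_⟩
  · exact tendsto_eLpNorm_zero_of_uniform (fun k => Eventually.of_forall fun x => (hζ' k x).1)
      tendsto_one_div_add_atTop_nhds_zero_nat
  · exact tendsto_eLpNorm_zero_of_uniform (fun k => Eventually.of_forall fun x => (hζ' k x).2)
      tendsto_one_div_add_atTop_nhds_zero_nat

theorem tendsto_eLpNorm_sub_trans {α E : Type*} [MeasurableSpace α] {μ : Measure α}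
    [NormedAddCommGroup E] {p : ℝ≥0∞} (hp : 1 ≤ p) {a b : ℕ → α → E} {c : α → E}
    (ha : ∀ k, AEStronglyMeasurable (a k) μ) (hb : ∀ k, AEStronglyMeasurable (b k) μ)
    (hc : AEStronglyMeasurable c μ)
    (hab : Tendsto (fun k => eLpNorm (fun x => a k x - b k x) p μ) atTop (𝓝 0))
    (hbc : Tendsto (fun k => eLpNorm (fun x => b k x - c x) p μ) atTop (𝓝 0)) :
    Tendsto (fun k => eLpNorm (fun x => a k x - c x) p μ) atTop (𝓝 0) := by
  refine tendsto_of_tendsto_of_tendsto_of_le_of_le tendsto_const_nhds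
    (by simpa using hab.add hbc) (fun _ => zero_le) (fun k => ?_)
  have : (fun x => a k x - c x) = (fun x => a k x - b k x) + (fun x => b k x - c x) := by
    ext x; simp
  simp only [this]
  exact eLpNorm_add_le ((ha k).sub (hb k)) ((hb k).sub hc) hp

/-- The space is closed under joint L^p convergence of function and gradient: a test function is
picked within 1/(k+1) of the k-th approximant, and the two errors add. -/
theorem MemW0.of_tendsto {Ω : Set (Space N)} {p : ℝ} (hp : 1 ≤ p) {f : Space N → ℝ}
    {g : Space N → Space N} {F : ℕ → Space N → ℝ} {G : ℕ → Space N → Space N}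
    (hf : MemLp f (ENNReal.ofReal p) (volume.restrict Ω))
    (hg : MemLp g (ENNReal.ofReal p) (volume.restrict Ω)) (h : ∀ k, MemW0 p Ω (F k) (G k))
    (hF : Tendsto (fun k => eLpNorm (fun x => F k x - f x) (ENNReal.ofReal p) (volume.restrict Ω))
      atTop (𝓝 0))
    (hG : Tendsto (fun k => eLpNorm (fun x => G k x - g x) (ENNReal.ofReal p) (volume.restrict Ω))
      atTop (𝓝 0)) :
    MemW0 p Ω f g := by
  have hp' : 1 ≤ ENNReal.ofReal p := by simpa using ENNReal.ofReal_le_ofReal hp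
  have key : ∀ k : ℕ, ∃ ζ, IsTestFunction Ω ζ ∧
      eLpNorm (fun x => ζ x - F k x) (ENNReal.ofReal p) (volume.restrict Ω)
        ≤ ENNReal.ofReal (1 / ((k : ℝ) + 1)) ∧
      eLpNorm (fun x => gradient ζ x - G k x) (ENNReal.ofReal p) (volume.restrict Ω)
        ≤ ENNReal.ofReal (1 / ((k : ℝ) + 1)) := by
    intro k
    obtain ⟨-, -, ζ, hζ, h1, h2⟩ := h k
    have hpos : (0 : ℝ≥0∞) < ENNReal.ofReal (1 / ((k : ℝ) + 1)) :=
      ENNReal.ofReal_pos.2 (by positivity)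
    obtain ⟨i, hi1, hi2⟩ := ((h1.eventually_le_const hpos).and (h2.eventually_le_const hpos)).exists
    exact ⟨ζ i, hζ i, hi1, hi2⟩
  choose ζ hζ h1 h2 using key
  have h0 : Tendsto (fun k : ℕ => ENNReal.ofReal (1 / ((k : ℝ) + 1))) atTop (𝓝 0) := by
    simpa using ENNReal.tendsto_ofReal tendsto_one_div_add_atTop_nhds_zero_nat
  refine ⟨hf, hg, ζ, hζ, ?_, ?_⟩
  · exact tendsto_eLpNorm_sub_trans hp' (fun k => (hζ k).smooth.continuous.aestronglyMeasurable)
      (fun k => (h k).1.1) hf.1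
      (tendsto_of_tendsto_of_tendsto_of_le_of_le tendsto_const_nhds h0 (fun _ => zero_le) h1) hF
  · exact tendsto_eLpNorm_sub_trans hp'
      (fun k => (continuous_gradient ((hζ k).smooth.of_le (by simp))).aestronglyMeasurable)
      (fun k => (h k).2.1.1) hg.1
      (tendsto_of_tendsto_of_tendsto_of_le_of_le tendsto_const_nhds h0 (fun _ => zero_le) h2) hG

theorem gradient_sub' {f g : Space N → ℝ} (hf : ContDiff ℝ 1 f) (hg : ContDiff ℝ 1 g)
    (x : Space N) : gradient (fun y => f y - g y) x = gradient f x - gradient g x := by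
  simp only [gradient, ← map_sub]
  congr 1
  exact fderiv_fun_sub (hf.differentiable one_ne_zero x) (hg.differentiable one_ne_zero x)

theorem gradient_const_mul' {f : Space N → ℝ} (c : ℝ) (hf : ContDiff ℝ 1 f)
    (x : Space N) : gradient (fun y => c * f y) x = c • gradient f x := by
  simp only [gradient, ← map_smul]
  congr 1
  exact fderiv_const_mul (hf.differentiable one_ne_zero x) c

theorem IsTestFunction.contDiff_one {Q : Set (Space N)} {f : Space N → ℝ}
    (hf : IsTestFunction Q f) : ContDiff ℝ 1 f := hf.smooth.of_le (by simp)

theorem MemW0.sub {Ω : Set (Space N)} {p : ℝ} (hp : 1 ≤ p) {f₁ f₂ : Space N → ℝ}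
    {g₁ g₂ : Space N → Space N} (h₁ : MemW0 p Ω f₁ g₁) (h₂ : MemW0 p Ω f₂ g₂) :
    MemW0 p Ω (fun x => f₁ x - f₂ x) (fun x => g₁ x - g₂ x) := by
  have hp' : 1 ≤ ENNReal.ofReal p := by simpa using ENNReal.ofReal_le_ofReal hp
  obtain ⟨a1, b1, ζ, hζ, c1, d1⟩ := h₁
  obtain ⟨a2, b2, ξ, hξ, c2, d2⟩ := h₂
  refine ⟨a1.sub a2, b1.sub b2, fun k x => ζ k x - ξ k x, fun k => ⟨?_, ?_, ?_⟩, ?_, ?_⟩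
  · exact (hζ k).smooth.sub (hξ k).smooth
  · exact (hζ k).compact.sub (hξ k).compact
  · exact (tsupport_sub _ _).trans (union_subset (hζ k).support (hξ k).support)
  · refine tendsto_of_tendsto_of_tendsto_of_le_of_le tendsto_const_nhds
      (by simpa using c1.add c2) (fun _ => zero_le) (fun k => ?_)
    have : (fun x => ζ k x - ξ k x - (f₁ x - f₂ x))
        = (fun x => ζ k x - f₁ x) - (fun x => ξ k x - f₂ x) := by ext x; simp; ring
    simp only [this]
    exact eLpNorm_sub_le ((hζ k).smooth.continuous.aestronglyMeasurable.sub a1.1)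
      ((hξ k).smooth.continuous.aestronglyMeasurable.sub a2.1) hp'
  · refine tendsto_of_tendsto_of_tendsto_of_le_of_le tendsto_const_nhds
      (by simpa using d1.add d2) (fun _ => zero_le) (fun k => ?_)
    have : (fun x => gradient (fun x => ζ k x - ξ k x) x - (g₁ x - g₂ x))
        = (fun x => gradient (ζ k) x - g₁ x) - (fun x => gradient (ξ k) x - g₂ x) := by
      ext1 x
      rw [gradient_sub' (hζ k).contDiff_one (hξ k).contDiff_one, Pi.sub_apply]
      abel
    simp only [this]
    exact eLpNorm_sub_le ((continuous_gradient (hζ k).contDiff_one).aestronglyMeasurable.sub b1.1)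
      ((continuous_gradient (hξ k).contDiff_one).aestronglyMeasurable.sub b2.1) hp'

theorem MemW0.const_mul {Ω : Set (Space N)} {p : ℝ} (c : ℝ) {f : Space N → ℝ}
    {g : Space N → Space N} (h : MemW0 p Ω f g) :
    MemW0 p Ω (fun x => c * f x) (fun x => c • g x) := by
  obtain ⟨a1, b1, ζ, hζ, c1, d1⟩ := h
  refine ⟨a1.const_mul c, b1.const_smul c, fun k x => c * ζ k x, fun k => ⟨?_, ?_, ?_⟩, ?_, ?_⟩
  · exact contDiff_const.mul (hζ k).smooth
  · exact (hζ k).compact.mul_left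
  · exact (tsupport_mul_subset_right).trans (hζ k).support
  · refine tendsto_eLpNorm_zero_of_norm_le (C := |c|) (fun k => Eventually.of_forall fun x => ?_) c1
    rw [← mul_sub, norm_mul, Real.norm_eq_abs]
  · refine tendsto_eLpNorm_zero_of_norm_le (C := |c|) (fun k => Eventually.of_forall fun x => ?_) d1
    rw [gradient_const_mul' c (hζ k).contDiff_one, ← smul_sub, norm_smul, Real.norm_eq_abs]

/-- L^p convergence implies convergence in measure, hence almost everywhere along a subsequence. The
pointwise limit is needed for dominated convergence in the chain rule and for Fatou's lemma in the
Sobolev inequality. -/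
theorem exists_seq_testFunction_ae {Ω : Set (Space N)} {p : ℝ} (hp : 1 ≤ p) {f : Space N → ℝ}
    {g : Space N → Space N} (h : MemW0 p Ω f g) :
    ∃ ζ : ℕ → Space N → ℝ, (∀ k, IsTestFunction Ω (ζ k)) ∧
    Tendsto (fun k => eLpNorm (fun x => ζ k x - f x) (ENNReal.ofReal p) (volume.restrict Ω))
      atTop (𝓝 0) ∧
    Tendsto (fun k => eLpNorm (fun x => gradient (ζ k) x - g x) (ENNReal.ofReal p)
      (volume.restrict Ω)) atTop (𝓝 0) ∧
    ∀ᵐ x ∂(volume.restrict Ω), Tendsto (fun k => ζ k x) atTop (𝓝 (f x)) := by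
  obtain ⟨h1, h2, ζ, hζ, h3, h4⟩ := h
  have hp0 : ENNReal.ofReal p ≠ 0 := by simp; linarith
  obtain ⟨ns, hns, hae⟩ := (tendstoInMeasure_of_tendsto_eLpNorm hp0
    (fun k => (hζ k).smooth.continuous.aestronglyMeasurable) h1.1 h3).exists_seq_tendsto_ae
  exact ⟨fun k => ζ (ns k), fun k => hζ _, h3.comp hns.tendsto_atTop, h4.comp hns.tendsto_atTop,
    hae⟩

theorem hasGradientAt_comp {φ : ℝ → ℝ} (hφ : ContDiff ℝ 1 φ) {f : Space N → ℝ}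
    (hf : ContDiff ℝ 1 f) (x : Space N) :
    gradient (fun y => φ (f y)) x = deriv φ (f x) • gradient f x := by
  simp only [gradient, ← map_smul]
  congr 1
  have h1 : HasDerivAt φ (deriv φ (f x)) (f x) :=
    (hφ.differentiable one_ne_zero _).hasDerivAt
  exact (h1.comp_hasFDerivAt x (hf.differentiable one_ne_zero x).hasFDerivAt).fderiv

theorem abs_sub_le_of_deriv_le {φ : ℝ → ℝ} (hφ : ContDiff ℝ 1 φ) {L : ℝ}
    (hL : ∀ y, |deriv φ y| ≤ L) (a b : ℝ) : |φ a - φ b| ≤ L * |a - b| := by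
  have := convex_univ.norm_image_sub_le_of_norm_deriv_le (f := φ) (C := L) (x := b) (y := a)
    (fun y _ => hφ.differentiable one_ne_zero y) (fun y _ => hL y) (mem_univ _) (mem_univ _)
  simpa using this

/-- Chain rule in `W_0^{1,p}` for a `C^1` function with bounded derivative, applied to the
difference of a `W_0^{1,p}` function and a `C^1` barrier. -/
theorem MemW0.comp_sub {Ω : Set (Space N)} (hΩ : IsOpen Ω) [IsFiniteMeasure (volume.restrict Ω)]
    {p : ℝ} (hp : 1 ≤ p) {f : Space N → ℝ} {g : Space N → Space N} (h : MemW0 p Ω f g)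
    {φ : ℝ → ℝ} (hφ : ContDiff ℝ 1 φ) {L : ℝ} (hL : ∀ y, |deriv φ y| ≤ L) {Ψ : Space N → ℝ}
    (hΨ : ContDiff ℝ 1 Ψ) {B : ℝ} (hB : ∀ x ∈ Ω, ‖gradient Ψ x‖ ≤ B)
    (h0 : ∀ x ∈ Ω, φ (-Ψ x) = 0) :
    MemW0 p Ω (fun x => φ (f x - Ψ x)) (fun x => deriv φ (f x - Ψ x) • (g x - gradient Ψ x)) := by
  have hp' : 1 ≤ ENNReal.ofReal p := by simpa using ENNReal.ofReal_le_ofReal hp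
  have hL0 : 0 ≤ L := (abs_nonneg _).trans (hL 0)
  have hlip := abs_sub_le_of_deriv_le hφ hL
  have hmΩ : MeasurableSet Ω := hΩ.measurableSet
  have hcd : Continuous (deriv φ) := hφ.continuous_deriv le_rfl
  obtain ⟨ζ, hζ, hζ1, hζ2, hae⟩ := exists_seq_testFunction_ae hp h
  have hfm := h.1.1
  have hgm := h.2.1.1
  have hΨm : AEStronglyMeasurable Ψ (volume.restrict Ω) := hΨ.continuous.aestronglyMeasurable
  have hgΨm : AEStronglyMeasurable (gradient Ψ) (volume.restrict Ω) :=
    (continuous_gradient hΨ).aestronglyMeasurable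
  have hgΨ : MemLp (gradient Ψ) (ENNReal.ofReal p) (volume.restrict Ω) :=
    MemLp.of_bound hgΨm B ((ae_restrict_iff' hmΩ).2 (Eventually.of_forall hB))
  have hgs : MemLp (fun x => g x - gradient Ψ x) (ENNReal.ofReal p) (volume.restrict Ω) :=
    h.2.1.sub hgΨ
  -- approximations
  set F : ℕ → Space N → ℝ := fun k x => φ (ζ k x - Ψ x) - φ (-Ψ x) with hF
  have hFc : ∀ k, ContDiff ℝ 1 (F k) := fun k =>
    (hφ.comp ((hζ k).contDiff_one.sub hΨ)).sub (hφ.comp hΨ.neg)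
  -- The term φ(-Ψ) subtracted in `F k` is zero on `Ω`; outside `Ω` it makes `F k` vanish wherever
  -- `ζ k` does, so `F k` has compact support in `Ω` although `Ψ` does not.
  have hFs : ∀ k, Function.support (F k) ⊆ Function.support (ζ k) := by
    intro k x hx hx'
    apply hx
    simp only [hF]
    rw [hx']
    simp
  have hFW : ∀ k, MemW0 p Ω (F k) (gradient (F k)) := fun k =>
    MemW0.of_contDiff hΩ p (hFc k) ((hζ k).compact.mono (hFs k))
      ((closure_mono (hFs k)).trans (hζ k).support)
  have hgradF : ∀ k, ∀ x ∈ Ω, gradient (F k) x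
      = deriv φ (ζ k x - Ψ x) • (gradient (ζ k) x - gradient Ψ x) := by
    intro k x hx
    rw [hF, ← gradient_sub' (hζ k).contDiff_one hΨ,
      ← hasGradientAt_comp hφ ((hζ k).contDiff_one.sub hΨ)]
    simp only [gradient]
    congr 1
    apply Filter.EventuallyEq.fderiv_eq
    filter_upwards [hΩ.mem_nhds hx] with y hy
    rw [h0 y hy, sub_zero]
  refine MemW0.of_tendsto hp (F := F) (G := fun k => gradient (F k)) ?_ ?_ hFW ?_ ?_
  · refine h.1.of_le_mul (c := L) (hφ.continuous.comp_aestronglyMeasurable (hfm.sub hΨm)) ?_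
    refine (ae_restrict_iff' hmΩ).2 (Eventually.of_forall fun x hx => ?_)
    have := hlip (f x - Ψ x) (-Ψ x)
    simpa [h0 x hx] using this
  · refine hgs.of_le_mul (c := L) ((hcd.comp_aestronglyMeasurable (hfm.sub hΨm)).smul
      (hgm.sub hgΨm)) (Eventually.of_forall fun x => ?_)
    rw [norm_smul]
    gcongr
    exact hL _
  · refine tendsto_eLpNorm_zero_of_norm_le (C := L) (fun k => ?_) hζ1
    refine (ae_restrict_iff' hmΩ).2 (Eventually.of_forall fun x hx => ?_)
    have := hlip (ζ k x - Ψ x) (f x - Ψ x)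
    simpa [hF, h0 x hx] using this
  -- The gradient is passed to the limit in two stages: ∇ζ_k is replaced by g while the bounded
  -- factor φ'(ζ_k - Ψ) is kept, then that factor converges almost everywhere, dominated by 2L |g -
  -- ∇Ψ|.
  · refine tendsto_eLpNorm_sub_trans hp' (b := fun k x => deriv φ (ζ k x - Ψ x) •
      (g x - gradient Ψ x)) (fun k => (hFW k).2.1.1) (fun k => ?_) ?_ ?_ ?_
    · exact (hcd.comp_aestronglyMeasurable
        ((hζ k).smooth.continuous.aestronglyMeasurable.sub hΨm)).smul (hgm.sub hgΨm)
    · exact (hcd.comp_aestronglyMeasurable (hfm.sub hΨm)).smul (hgm.sub hgΨm)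
    · refine tendsto_eLpNorm_zero_of_norm_le (C := L) (fun k => ?_) hζ2
      refine (ae_restrict_iff' hmΩ).2 (Eventually.of_forall fun x hx => ?_)
      rw [hgradF k x hx, ← smul_sub, norm_smul, sub_sub_sub_cancel_right]
      gcongr
      exact hL _
    · refine tendsto_eLpNorm_zero_of_dominated (by linarith)
        (b := fun x => 2 * L * ‖g x - gradient Ψ x‖) (hgs.norm.const_mul _) (fun k => ?_)
        (fun k => Eventually.of_forall fun x => ?_) ?_
      · exact ((hcd.comp_aestronglyMeasurable
          ((hζ k).smooth.continuous.aestronglyMeasurable.sub hΨm)).smul (hgm.sub hgΨm)).sub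
          ((hcd.comp_aestronglyMeasurable (hfm.sub hΨm)).smul (hgm.sub hgΨm))
      · rw [← sub_smul, norm_smul]
        gcongr
        calc ‖deriv φ (ζ k x - Ψ x) - deriv φ (f x - Ψ x)‖
            ≤ ‖deriv φ (ζ k x - Ψ x)‖ + ‖deriv φ (f x - Ψ x)‖ := norm_sub_le _ _
          _ ≤ L + L := add_le_add (hL _) (hL _)
          _ = 2 * L := by ring
      · filter_upwards [hae] with x hx
        have h1 : Tendsto (fun k => deriv φ (ζ k x - Ψ x)) atTop (𝓝 (deriv φ (f x - Ψ x))) :=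
          (hcd.tendsto _).comp (hx.sub_const _)
        have h2 := (h1.smul_const (g x - gradient Ψ x)).sub_const
          (deriv φ (f x - Ψ x) • (g x - gradient Ψ x))
        simpa using h2

/-- The chain rule with a constant shift. -/
theorem MemW0.comp_sub_const {Ω : Set (Space N)} (hΩ : IsOpen Ω)
    [IsFiniteMeasure (volume.restrict Ω)] {p : ℝ} (hp : 1 ≤ p) {f : Space N → ℝ}
    {g : Space N → Space N} (h : MemW0 p Ω f g) {φ : ℝ → ℝ} (hφ : ContDiff ℝ 1 φ) {L : ℝ}
    (hL : ∀ y, |deriv φ y| ≤ L) {c : ℝ} (h0 : φ (-c) = 0) :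
    MemW0 p Ω (fun x => φ (f x - c)) (fun x => deriv φ (f x - c) • g x) := by
  have := h.comp_sub hΩ hp hφ hL (Ψ := fun _ => c) contDiff_const (B := 0)
    (fun x _ => by simp [gradient]) (fun x _ => h0)
  simpa [gradient] using this

/-- Hölder duality: a fixed field in the conjugate space pairs continuously with L^p convergence. -/
theorem tendsto_integral_inner {α E : Type*} [MeasurableSpace α] {μ : Measure α}
    [NormedAddCommGroup E] [InnerProductSpace ℝ E] {p q : ℝ≥0∞} [q.HolderTriple p 1] {b f : α → E}
    {F : ℕ → α → E} (hb : MemLp b q μ) (hf : MemLp f p μ) (hF : ∀ k, MemLp (F k) p μ)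
    (h : Tendsto (fun k => eLpNorm (fun x => F k x - f x) p μ) atTop (𝓝 0)) :
    Tendsto (fun k => ∫ x, inner ℝ (b x) (F k x) ∂μ) atTop (𝓝 (∫ x, inner ℝ (b x) (f x) ∂μ)) := by
  have hinteg : ∀ {G : α → E}, MemLp G p μ → MemLp (fun x => inner ℝ (b x) (G x)) 1 μ := by
    intro G hG
    refine MemLp.of_bilin (fun u v => inner ℝ u v) 1 hb hG (hb.1.inner hG.1)
      (Eventually.of_forall fun x => ?_)
    simpa using nnnorm_inner_le_nnnorm (𝕜 := ℝ) (b x) (G x)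
  refine tendsto_integral_of_L1' _ (hinteg hf).1
    (Eventually.of_forall fun k => memLp_one_iff_integrable.1 (hinteg (hF k))) ?_
  refine tendsto_of_tendsto_of_tendsto_of_le_of_le tendsto_const_nhds
    (h := fun k => eLpNorm b q μ * eLpNorm (fun x => F k x - f x) p μ) ?_
    (fun _ => zero_le) (fun k => ?_)
  · simpa using ENNReal.Tendsto.const_mul h (Or.inr hb.2.ne)
  · have := eLpNorm_le_eLpNorm_mul_eLpNorm_of_nnnorm (p := q) (q := p) (r := 1) hb.1 ((hF k).sub hf).1
      (fun u v => inner ℝ u v) 1 (Eventually.of_forall fun x => by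
        simpa using nnnorm_inner_le_nnnorm (𝕜 := ℝ) (b x) ((F k - f) x))
    simpa [inner_sub_right, Pi.sub_def] using this

theorem holderTriple_conj {p : ℝ} (hp : 1 < p) :
    (ENNReal.ofReal (p / (p - 1))).HolderTriple (ENNReal.ofReal p) 1 := by
  have h : Real.HolderConjugate (p / (p - 1)) p := (Real.HolderConjugate.conjExponent hp).symm
  exact h.ennrealOfReal

/-- The weak gradient of a `W_0^{1,p}` function can be tested against `C^1` functions that do not
vanish on the boundary. -/
theorem MemW0.integral_mul_fderiv {Ω : Set (Space N)} (hΩ : IsOpen Ω)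
    [IsFiniteMeasure (volume.restrict Ω)] {p : ℝ} (hp : 1 < p) {f : Space N → ℝ}
    {g : Space N → Space N} (h : MemW0 p Ω f g) {ζ : Space N → ℝ} (hζ : ContDiff ℝ 1 ζ)
    {B : ℝ} (e : Space N) (hB : ∀ x ∈ Ω, |ζ x| ≤ B) (hB' : ∀ x ∈ Ω, |fderiv ℝ ζ x e| ≤ B) :
    ∫ x in Ω, f x * fderiv ℝ ζ x e = -∫ x in Ω, inner ℝ (g x) e * ζ x := by
  have hmΩ : MeasurableSet Ω := hΩ.measurableSet
  obtain ⟨h1, h2, ξ, hξ, h3, h4⟩ := h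
  have := holderTriple_conj hp
  have hζ1 : Continuous (fun x => fderiv ℝ ζ x e) :=
    (hζ.continuous_fderiv one_ne_zero).clm_apply continuous_const
  have hL : Tendsto (fun k => ∫ x in Ω, inner ℝ (fderiv ℝ ζ x e) (ξ k x)) atTop
      (𝓝 (∫ x in Ω, inner ℝ (fderiv ℝ ζ x e) (f x))) := by
    refine tendsto_integral_inner (q := ENNReal.ofReal (p / (p - 1))) ?_ h1 (fun k => ?_) h3
    · exact MemLp.of_bound hζ1.aestronglyMeasurable B
        ((ae_restrict_iff' hmΩ).2 (Eventually.of_forall hB'))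
    · exact ((hξ k).smooth.continuous.memLp_of_hasCompactSupport (hξ k).compact).restrict _
  have hR : Tendsto (fun k => ∫ x in Ω, inner ℝ (ζ x • e) (gradient (ξ k) x)) atTop
      (𝓝 (∫ x in Ω, inner ℝ (ζ x • e) (g x))) := by
    refine tendsto_integral_inner (q := ENNReal.ofReal (p / (p - 1))) ?_ h2 (fun k => ?_) h4
    · refine MemLp.of_bound (hζ.continuous.smul continuous_const).aestronglyMeasurable (B * ‖e‖)
        ((ae_restrict_iff' hmΩ).2 (Eventually.of_forall fun x hx => ?_))
      rw [norm_smul]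
      exact mul_le_mul_of_nonneg_right (hB x hx) (norm_nonneg _)
    · exact ((continuous_gradient (hξ k).contDiff_one).memLp_of_hasCompactSupport
        (hasCompactSupport_gradient (hξ k).compact)).restrict _
  -- For compactly supported `ξ k` the set integrals are integrals over the whole space, where
  -- integration by parts has no boundary term, whatever `ζ` does on the boundary.
  have hk : ∀ k, ∫ x in Ω, inner ℝ (fderiv ℝ ζ x e) (ξ k x)
      = -∫ x in Ω, inner ℝ (ζ x • e) (gradient (ξ k) x) := by
    intro k
    have hsupp : ∀ x, x ∉ Ω → x ∉ tsupport (ξ k) := fun x hx hx' => hx ((hξ k).support hx')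
    have hd : Continuous (fun x => fderiv ℝ (ξ k) x e) :=
      ((hξ k).contDiff_one.continuous_fderiv one_ne_zero).clm_apply continuous_const
    have hdc : HasCompactSupport (fun x => fderiv ℝ (ξ k) x e) := (hξ k).compact.fderiv_apply ℝ e
    have e1 : ∀ x, inner ℝ (fderiv ℝ ζ x e) (ξ k x) = ξ k x * fderiv ℝ ζ x e := fun x => by
      simp
    have e2 : ∀ x, inner ℝ (ζ x • e) (gradient (ξ k) x) = fderiv ℝ (ξ k) x e * ζ x := fun x => by
      rw [real_inner_comm, inner_smul_right, gradient, InnerProductSpace.toDual_symm_apply, mul_comm]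
    simp_rw [e1, e2]
    rw [setIntegral_eq_integral_of_forall_compl_eq_zero,
      setIntegral_eq_integral_of_forall_compl_eq_zero]
    · refine integral_mul_fderiv_eq_neg_fderiv_mul_of_integrable ?_ ?_ ?_
        (fun x _ => (hξ k).contDiff_one.differentiable one_ne_zero x)
        (fun x _ => hζ.differentiable one_ne_zero x)
      · exact (hd.mul hζ.continuous).integrable_of_hasCompactSupport hdc.mul_right
      · exact ((hξ k).smooth.continuous.mul hζ1).integrable_of_hasCompactSupport
          (hξ k).compact.mul_right
      · exact ((hξ k).smooth.continuous.mul hζ.continuous).integrable_of_hasCompactSupport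
          (hξ k).compact.mul_right
    · intro x hx
      have : fderiv ℝ (ξ k) x = 0 := by
        by_contra hne
        exact hsupp x hx (support_fderiv_subset ℝ hne)
      simp [this]
    · intro x hx
      rw [image_eq_zero_of_notMem_tsupport (hsupp x hx), zero_mul]
  have := tendsto_nhds_unique (hL.congr hk) hR.neg
  simpa [inner_smul_left, mul_comm, real_inner_comm] using this

/-! ### The Sobolev embedding and its best constant -/

theorem enorm_gradient (f : Space N → ℝ) (x : Space N) : ‖gradient f x‖ₑ = ‖fderiv ℝ f x‖ₑ := by
  simp only [← ofReal_norm, gradient, LinearIsometryEquiv.norm_map]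

theorem IsTestFunction.eLpNorm_restrict {Ω : Set (Space N)} {ζ : Space N → ℝ}
    (hζ : IsTestFunction Ω ζ) (q : ℝ≥0∞) : eLpNorm ζ q (volume.restrict Ω) = eLpNorm ζ q volume :=
  eLpNorm_restrict_eq_of_support_subset ((subset_tsupport ζ).trans hζ.support)

theorem IsTestFunction.eLpNorm_gradient {Ω : Set (Space N)} {ζ : Space N → ℝ}
    (hζ : IsTestFunction Ω ζ) (q : ℝ≥0∞) :
    eLpNorm (gradient ζ) q (volume.restrict Ω) = eLpNorm (fderiv ℝ ζ) q volume := by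
  rw [eLpNorm_restrict_eq_of_support_subset]
  · exact eLpNorm_congr_enorm_ae (Eventually.of_forall (enorm_gradient ζ))
  · intro x hx
    refine hζ.support (support_fderiv_subset ℝ (f := ζ) fun h => hx ?_)
    simp [gradient, h]

/-- In one dimension a test function is bounded by the total mass of its derivative. -/
theorem enorm_le_eLpNorm_one_fderiv {ζ : Space 1 → ℝ} (hζ : ContDiff ℝ 1 ζ)
    (hc : HasCompactSupport ζ) (x : Space 1) : ‖ζ x‖ₑ ≤ eLpNorm (fderiv ℝ ζ) 1 volume := by
  set e : Space 1 := EuclideanSpace.single 0 1 with he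
  have hne : ‖e‖ = 1 := by simp [he]
  have he0 : e ≠ 0 := fun h => by simp [h] at hne
  have hx : (x 0) • e = x := by
    ext i
    fin_cases i
    simp [he]
  -- The map t ↦ t e identifies ℝ with the one-dimensional Euclidean space, preserving Lebesgue
  -- measure, so the fundamental theorem of calculus on a half-line applies.
  have hmp : MeasurePreserving (fun t : ℝ => t • e) volume volume := by
    have h1 := (PiLp.volume_preserving_toLp (Fin 1)).comp
      (volume_preserving_funUnique (Fin 1) ℝ).symm
    have h2 : (fun t : ℝ => t • e)
        = WithLp.toLp 2 ∘ ⇑(MeasurableEquiv.funUnique (Fin 1) ℝ).symm := by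
      funext t
      ext i
      fin_cases i
      simp [he, MeasurableEquiv.funUnique]
    rw [h2]
    exact h1
  have hemb : IsClosedEmbedding (fun t : ℝ => t • e) := isClosedEmbedding_smul_left he0
  have hlin : ContDiff ℝ 1 (fun t : ℝ => t • e) := contDiff_id.smul contDiff_const
  have h2 := (hc.comp_isClosedEmbedding hemb).enorm_le_lintegral_Ici_deriv
    (hζ.comp hlin) (x 0)
  simp only [Function.comp_apply, hx] at h2
  refine h2.trans ?_
  rw [eLpNorm_one_eq_lintegral_enorm, ← hmp.lintegral_comp_emb hemb.measurableEmbedding]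
  refine (setLIntegral_le_lintegral _ _).trans (lintegral_mono fun t => ?_)
  have hd : HasDerivAt (ζ ∘ fun t : ℝ => t • e) (fderiv ℝ ζ (t • e) e) t := by
    have h3 : HasDerivAt (fun t : ℝ => t • e) e t := by
      simpa using (hasDerivAt_id t).smul_const e
    exact (hζ.differentiable one_ne_zero (t • e)).hasFDerivAt.comp_hasDerivAt t h3
  rw [hd.deriv, enorm_le_iff_norm_le]
  have := (fderiv ℝ ζ (t • e)).le_opNorm e
  rwa [hne, mul_one] at this

/-- For N ≥ 2 this is the Gagliardo–Nirenberg–Sobolev inequality. For N = 1 a test function is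
bounded by the L¹ norm of its derivative, and finiteness of the measure does the rest. A finite
constant is needed because otherwise the infimum defining the best constant would be over the empty
set. -/
theorem exists_embedding_bound_testFunction (hN : 1 ≤ N) {Ω : Set (Space N)}
    [IsFiniteMeasure (volume.restrict Ω)] {p : ℝ} (hp : 1 < p) (hp2 : p < 2) :
    ∃ C : ℝ, 0 ≤ C ∧ ∀ ζ : Space N → ℝ, IsTestFunction Ω ζ →
      eLpNorm ζ (ENNReal.ofReal (sobolevExponent N p)) (volume.restrict Ω)
        ≤ ENNReal.ofReal C * eLpNorm (gradient ζ) (ENNReal.ofReal p) (volume.restrict Ω) := by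
  rcases hN.eq_or_lt with rfl | hN2
  · set A := (volume.restrict Ω) univ with hA
    have hAt : A ≠ ⊤ := by simp only [hA]; finiteness
    -- The first factor turns a uniform bound into an L² bound, 2 being the exponent chosen for N =
    -- 1; the second is the Hölder factor from the L¹ to the L^p norm of the gradient.
    set K : ℝ≥0∞ := A ^ (ENNReal.ofReal 2).toReal⁻¹ * A ^ (1 / (1 : ℝ≥0∞).toReal - 1 / (ENNReal.ofReal p).toReal) with hK
    have h1p : 1 - p⁻¹ ≥ 0 := by
      have := inv_le_one_of_one_le₀ hp.le
      linarith
    have hKt : K ≠ ⊤ := by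
      refine ENNReal.mul_ne_top (ENNReal.rpow_ne_top_of_nonneg (by simp) hAt)
        (ENNReal.rpow_ne_top_of_nonneg ?_ hAt)
      rw [ENNReal.toReal_ofReal (by linarith)]
      simpa using inv_le_one_of_one_le₀ hp.le
    refine ⟨K.toReal, ENNReal.toReal_nonneg, fun ζ hζ => ?_⟩
    rw [ENNReal.ofReal_toReal hKt]
    have hgm : AEStronglyMeasurable (gradient ζ) (volume.restrict Ω) :=
      (continuous_gradient hζ.contDiff_one).aestronglyMeasurable
    have hb : ∀ x, ‖ζ x‖ₑ ≤ eLpNorm (gradient ζ) 1 (volume.restrict Ω) := fun x => by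
      rw [hζ.eLpNorm_gradient]
      exact enorm_le_eLpNorm_one_fderiv hζ.contDiff_one hζ.compact x
    have hfin : eLpNorm (gradient ζ) 1 (volume.restrict Ω) ≠ ⊤ :=
      (((continuous_gradient hζ.contDiff_one).memLp_of_hasCompactSupport
        (hasCompactSupport_gradient hζ.compact)).restrict _).2.ne
    have h1 : eLpNorm ζ (ENNReal.ofReal (sobolevExponent 1 p)) (volume.restrict Ω)
        ≤ A ^ (ENNReal.ofReal 2).toReal⁻¹ * eLpNorm (gradient ζ) 1 (volume.restrict Ω) := by
      have := eLpNorm_le_of_ae_bound (p := ENNReal.ofReal 2) (f := ζ) (μ := volume.restrict Ω)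
        (C := (eLpNorm (gradient ζ) 1 (volume.restrict Ω)).toReal)
        (Eventually.of_forall fun x => by
          rw [← toReal_enorm]
          exact ENNReal.toReal_mono hfin (hb x))
      rw [ENNReal.ofReal_toReal hfin] at this
      simpa [sobolevExponent, hA] using this
    have h2 := eLpNorm_le_eLpNorm_mul_rpow_measure_univ (p := 1) (q := ENNReal.ofReal p)
      (by simpa using ENNReal.ofReal_le_ofReal hp.le) hgm
    calc _ ≤ _ := h1
      _ ≤ A ^ (ENNReal.ofReal 2).toReal⁻¹ * _ := mul_le_mul_right h2 _
      _ = _ := by rw [hK]; ring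
  · have hNr : (2 : ℝ) ≤ N := by exact_mod_cast hN2
    have hNp : 0 < (N : ℝ) - p := by linarith
    have hq : sobolevExponent N p = N * p / (N - p) := by
      rw [sobolevExponent, if_neg (by omega)]
    refine ⟨eLpNormLESNormFDerivOfEqInnerConst (volume : Measure (Space N)) p.toNNReal,
      NNReal.coe_nonneg _, fun ζ hζ => ?_⟩
    rw [hζ.eLpNorm_restrict, hζ.eLpNorm_gradient, ENNReal.ofReal_coe_nnreal]
    have hpc : (p.toNNReal : ℝ) = p := Real.coe_toNNReal _ (by linarith)
    refine eLpNorm_le_eLpNorm_fderiv_of_eq_inner volume hζ.contDiff_one hζ.compact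
      (by simpa using hp.le) (by simp; omega) ?_
    rw [hq, finrank_euclideanSpace_fin]
    rw [NNReal.coe_inv, hpc, Real.coe_toNNReal _ (by positivity)]
    have : p ≠ 0 := by linarith
    have : (N : ℝ) ≠ 0 := by linarith
    field_simp

/-- The left side is lower semicontinuous under almost everywhere convergence by Fatou's lemma, and
the right side converges along approximating test functions. -/
theorem MemW0.eLpNorm_le_of_testFunction {Ω : Set (Space N)} {p : ℝ} (hp : 1 ≤ p) {q : ℝ≥0∞}
    {C : ℝ} (hC : ∀ ζ : Space N → ℝ, IsTestFunction Ω ζ → eLpNorm ζ q (volume.restrict Ω)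
        ≤ ENNReal.ofReal C * eLpNorm (gradient ζ) (ENNReal.ofReal p) (volume.restrict Ω))
    {f : Space N → ℝ} {g : Space N → Space N} (h : MemW0 p Ω f g) :
    eLpNorm f q (volume.restrict Ω)
      ≤ ENNReal.ofReal C * eLpNorm g (ENNReal.ofReal p) (volume.restrict Ω) := by
  have hp' : 1 ≤ ENNReal.ofReal p := by simpa using ENNReal.ofReal_le_ofReal hp
  obtain ⟨ζ, hζ, hζ1, hζ2, hae⟩ := exists_seq_testFunction_ae hp h
  refine (Lp.eLpNorm_lim_le_liminf_eLpNorm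
    (fun k => (hζ k).smooth.continuous.aestronglyMeasurable) f hae).trans ?_
  have hlim : Tendsto (fun k => ENNReal.ofReal C *
      (eLpNorm (fun x => gradient (ζ k) x - g x) (ENNReal.ofReal p) (volume.restrict Ω)
        + eLpNorm g (ENNReal.ofReal p) (volume.restrict Ω))) atTop
      (𝓝 (ENNReal.ofReal C * (0 + eLpNorm g (ENNReal.ofReal p) (volume.restrict Ω)))) :=
    ENNReal.Tendsto.const_mul (hζ2.add_const _) (Or.inr ENNReal.ofReal_ne_top)
  rw [zero_add] at hlim
  rw [← hlim.liminf_eq]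
  refine liminf_le_liminf (Eventually.of_forall fun k => (hC _ (hζ k)).trans ?_)
  gcongr
  have : gradient (ζ k) = (fun x => gradient (ζ k) x - g x) + g := by ext1 x; simp
  conv_lhs => rw [this]
  exact eLpNorm_add_le
    ((continuous_gradient (hζ k).contDiff_one).aestronglyMeasurable.sub h.2.1.1) h.2.1.1 hp'

/-- The infimum is itself an admissible constant: it is approached by admissible constants, and the
inequality, having a finite gradient norm on the right, passes to the limit. -/
theorem MemW0.eLpNorm_le_embeddingConst (hN : 1 ≤ N) {Ω : Set (Space N)}
    [IsFiniteMeasure (volume.restrict Ω)] {p : ℝ} (hp : 1 < p) (hp2 : p < 2)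
    {f : Space N → ℝ} {g : Space N → Space N} (h : MemW0 p Ω f g) :
    eLpNorm f (ENNReal.ofReal (sobolevExponent N p)) (volume.restrict Ω)
      ≤ ENNReal.ofReal (embeddingConst p Ω) *
        eLpNorm g (ENNReal.ofReal p) (volume.restrict Ω) := by
  obtain ⟨C, hC0, hC⟩ := exists_embedding_bound_testFunction hN (Ω := Ω) hp hp2
  set S : Set ℝ := {γ : ℝ | 0 ≤ γ ∧ ∀ (w : Space N → ℝ) (g : Space N → Space N), MemW0 p Ω w g →
    eLpNorm w (ENNReal.ofReal (sobolevExponent N p)) (volume.restrict Ω)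
      ≤ ENNReal.ofReal γ * eLpNorm g (ENNReal.ofReal p) (volume.restrict Ω)} with hS
  have hne : S.Nonempty := ⟨C, hC0, fun w g hw => hw.eLpNorm_le_of_testFunction hp.le hC⟩
  obtain ⟨γ, -, hγ, hγS⟩ := exists_seq_tendsto_sInf hne ⟨0, fun γ hγ => hγ.1⟩
  have : Tendsto (fun k => ENNReal.ofReal (γ k) *
      eLpNorm g (ENNReal.ofReal p) (volume.restrict Ω)) atTop
      (𝓝 (ENNReal.ofReal (embeddingConst p Ω) *
        eLpNorm g (ENNReal.ofReal p) (volume.restrict Ω))) :=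
    ENNReal.Tendsto.mul_const (ENNReal.tendsto_ofReal hγ) (Or.inr h.2.1.2.ne)
  exact ge_of_tendsto' this fun k => (hγS k).2 f g h

theorem sobolevExponent_pos (hN : 1 ≤ N) {p : ℝ} (hp : 1 < p) (hp2 : p < 2) :
    0 < sobolevExponent N p := by
  rw [sobolevExponent]
  split_ifs with h
  · norm_num
  · have hNr : (2 : ℝ) ≤ N := by exact_mod_cast (show 2 ≤ N by omega)
    exact div_pos (by positivity) (by linarith)

/-- The diffusion coefficient contains γ^(-p), so γ = 0 must be excluded. A nontrivial element of
the space does so, and the initial datum is one. -/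
theorem embeddingConst_pos (hN : 1 ≤ N) {Ω : Set (Space N)}
    [IsFiniteMeasure (volume.restrict Ω)] {p : ℝ} (hp : 1 < p) (hp2 : p < 2)
    {f : Space N → ℝ} {g : Space N → Space N} (h : MemW0 p Ω f g)
    (hf : ¬ ∀ᵐ x ∂(volume.restrict Ω), f x = 0) : 0 < embeddingConst p Ω := by
  by_contra hle
  have h1 := h.eLpNorm_le_embeddingConst hN hp hp2
  rw [ENNReal.ofReal_of_nonpos (not_lt.1 hle), zero_mul, nonpos_iff_eq_zero,
    eLpNorm_eq_zero_iff h.1.1 (by simpa using sobolevExponent_pos hN hp hp2)] at h1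
  exact hf h1

/-! ### Primitives as C¹ test nonlinearities -/

/-- The primitive of `h` vanishing at `0`. -/
noncomputable def primitive (h : ℝ → ℝ) (x : ℝ) : ℝ := ∫ t in (0 : ℝ)..x, h t

theorem hasDerivAt_primitive {h : ℝ → ℝ} (hh : Continuous h) (x : ℝ) :
    HasDerivAt (primitive h) (h x) x :=
  intervalIntegral.integral_hasDerivAt_right (hh.intervalIntegrable _ _)
    hh.stronglyMeasurable.stronglyMeasurableAtFilter hh.continuousAt

theorem deriv_primitive {h : ℝ → ℝ} (hh : Continuous h) : deriv (primitive h) = h :=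
  funext fun x => (hasDerivAt_primitive hh x).deriv

theorem contDiff_primitive {h : ℝ → ℝ} (hh : Continuous h) : ContDiff ℝ 1 (primitive h) := by
  rw [contDiff_one_iff_deriv, deriv_primitive hh]
  exact ⟨fun x => (hasDerivAt_primitive hh x).differentiableAt, hh⟩

theorem continuous_primitive {h : ℝ → ℝ} (hh : Continuous h) : Continuous (primitive h) :=
  (contDiff_primitive hh).continuous

theorem primitive_zero (h : ℝ → ℝ) : primitive h 0 = 0 := by simp [primitive]

theorem monotone_primitive {h : ℝ → ℝ} (hh : Continuous h) (h0 : ∀ t, 0 ≤ h t) :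
    Monotone (primitive h) :=
  monotone_of_deriv_nonneg (fun x => (hasDerivAt_primitive hh x).differentiableAt)
    fun x => by rw [deriv_primitive hh]; exact h0 x

theorem primitive_of_nonpos {h : ℝ → ℝ} (h0 : ∀ t ≤ 0, h t = 0) {x : ℝ} (hx : x ≤ 0) :
    primitive h x = 0 := by
  rw [primitive, intervalIntegral.integral_symm, neg_eq_zero]
  refine intervalIntegral.integral_zero_ae (Eventually.of_forall fun t ht => h0 t ?_)
  rw [uIoc_of_le hx] at ht
  exact ht.2

theorem primitive_nonneg {h : ℝ → ℝ} (hh : Continuous h) (h0 : ∀ t, 0 ≤ h t) {x : ℝ}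
    (hx : 0 ≤ x) : 0 ≤ primitive h x := by
  rw [← primitive_zero h]
  exact monotone_primitive hh h0 hx

theorem primitive_nonneg_of_nonpos_eq_zero {h : ℝ → ℝ} (hh : Continuous h) (h0 : ∀ t, 0 ≤ h t)
    (h1 : ∀ t ≤ 0, h t = 0) (x : ℝ) : 0 ≤ primitive h x := by
  rcases le_total 0 x with hx | hx
  · exact primitive_nonneg hh h0 hx
  · rw [primitive_of_nonpos h1 hx]

/-- For a nondecreasing integrand, the primitive is bounded below by the value at the midpoint. -/
theorem half_mul_le_primitive {h : ℝ → ℝ} (hh : Continuous h) (h0 : ∀ t, 0 ≤ h t)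
    (hm : MonotoneOn h (Ici 0)) {x : ℝ} (hx : 0 ≤ x) : x / 2 * h (x / 2) ≤ primitive h x := by
  have h1 : primitive h x = (∫ t in (0 : ℝ)..(x / 2), h t) + ∫ t in (x / 2)..x, h t :=
    (intervalIntegral.integral_add_adjacent_intervals (hh.intervalIntegrable _ _)
      (hh.intervalIntegrable _ _)).symm
  have h2 : (0 : ℝ) ≤ ∫ t in (0 : ℝ)..(x / 2), h t :=
    intervalIntegral.integral_nonneg (by linarith) fun t _ => h0 t
  have h3 : ∫ _ in (x / 2)..x, h (x / 2) ≤ ∫ t in (x / 2)..x, h t :=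
    intervalIntegral.integral_mono_on (by linarith) (by simp) (hh.intervalIntegrable _ _)
      fun t ht => hm (show (0 : ℝ) ≤ x / 2 by linarith) (show (0 : ℝ) ≤ t by linarith [ht.1]) ht.1
  rw [intervalIntegral.integral_const, smul_eq_mul] at h3
  rw [h1]
  nlinarith

theorem primitive_le_mul {h : ℝ → ℝ} (hh : Continuous h)
    (hm : MonotoneOn h (Ici 0)) {x : ℝ} (hx : 0 ≤ x) : primitive h x ≤ x * h x := by
  have h3 : ∫ t in (0 : ℝ)..x, h t ≤ ∫ _ in (0 : ℝ)..x, h x :=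
    intervalIntegral.integral_mono_on hx (hh.intervalIntegrable _ _) (by simp)
      fun t ht => hm ht.1 hx ht.2
  rw [intervalIntegral.integral_const, smul_eq_mul] at h3
  simpa [primitive] using h3

/-- The piecewise linear function `min (t_+) 1`. -/
noncomputable def ramp (t : ℝ) : ℝ := min (max t 0) 1

theorem continuous_ramp : Continuous ramp := by unfold ramp; fun_prop

theorem ramp_nonneg (t : ℝ) : 0 ≤ ramp t := by simp [ramp]

theorem ramp_le_one (t : ℝ) : ramp t ≤ 1 := by simp [ramp]

theorem ramp_of_nonpos {t : ℝ} (ht : t ≤ 0) : ramp t = 0 := by simp [ramp, ht]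

theorem ramp_pos {t : ℝ} (ht : 0 < t) : 0 < ramp t := by simp [ramp, ht]

theorem monotone_ramp : Monotone ramp := fun a b h => by unfold ramp; gcongr

/-- `primitive ramp` is a C¹ substitute for the positive part: its derivative is bounded, it
vanishes on the negative half-line, and positivity elsewhere lets a vanishing integral of it force a
sign. -/
theorem primitive_ramp_pos {x : ℝ} (hx : 0 < x) : 0 < primitive ramp x := by
  have := half_mul_le_primitive continuous_ramp ramp_nonneg (monotone_ramp.monotoneOn _) hx.le
  have := ramp_pos (half_pos hx)
  nlinarith [half_pos hx]

/-! ### The p-Laplacian flux -/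

/-- The vector field `|ξ|^{p-2} ξ`. -/
noncomputable def flux (p : ℝ) (ξ : Space N) : Space N := ‖ξ‖ ^ (p - 2) • ξ

theorem inner_flux (p : ℝ) (ξ η : Space N) :
    inner ℝ (flux p ξ) η = ‖ξ‖ ^ (p - 2) * inner ℝ ξ η := by
  rw [flux, real_inner_smul_left]

theorem norm_flux {p : ℝ} (hp : 1 < p) (ξ : Space N) : ‖flux p ξ‖ = ‖ξ‖ ^ (p - 1) := by
  rw [flux, norm_smul, Real.norm_of_nonneg (by positivity)]
  rcases eq_or_ne ξ 0 with rfl | h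
  · simp [Real.zero_rpow (show p - 1 ≠ 0 by linarith)]
  · have : 0 < ‖ξ‖ := norm_pos_iff.2 h
    rw [← Real.rpow_add_one this.ne']
    congr 1
    ring

theorem inner_flux_self {p : ℝ} (hp : 1 < p) (ξ : Space N) :
    inner ℝ (flux p ξ) ξ = ‖ξ‖ ^ p := by
  rw [inner_flux, real_inner_self_eq_norm_sq]
  rcases eq_or_ne ξ 0 with rfl | h
  · simp [Real.zero_rpow (show p ≠ 0 by linarith)]
  · have : 0 < ‖ξ‖ := norm_pos_iff.2 h
    rw [← Real.rpow_natCast, ← Real.rpow_add this]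
    congr 1
    norm_num

/-- The `p`-Laplacian flux is monotone. -/
theorem flux_monotone {p : ℝ} (hp : 1 < p) (ξ η : Space N) :
    0 ≤ inner ℝ (flux p ξ - flux p η) (ξ - η) := by
  have h1 : inner ℝ (flux p ξ) η ≤ ‖ξ‖ ^ (p - 1) * ‖η‖ := by
    rw [← norm_flux hp]; exact real_inner_le_norm _ _
  have h2 : inner ℝ (flux p η) ξ ≤ ‖η‖ ^ (p - 1) * ‖ξ‖ := by
    rw [← norm_flux hp]; exact real_inner_le_norm _ _
  have h3 : ∀ ζ : Space N, ‖ζ‖ ^ p = ‖ζ‖ ^ (p - 1) * ‖ζ‖ := fun ζ => by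
    rw [← Real.rpow_add_one' (norm_nonneg _) (by linarith)]
    congr 1
    ring
  -- By the Cauchy–Schwarz bounds above, the inner product is at least this product, which is
  -- nonnegative because t ↦ t^(p-1) is increasing.
  have h4 : 0 ≤ (‖ξ‖ ^ (p - 1) - ‖η‖ ^ (p - 1)) * (‖ξ‖ - ‖η‖) := by
    rcases le_total ‖ξ‖ ‖η‖ with h | h
    · have := Real.rpow_le_rpow (norm_nonneg _) h (show 0 ≤ p - 1 by linarith)
      exact mul_nonneg_of_nonpos_of_nonpos (by linarith) (by linarith)
    · have := Real.rpow_le_rpow (norm_nonneg _) h (show 0 ≤ p - 1 by linarith)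
      exact mul_nonneg (by linarith) (by linarith)
  rw [inner_sub_left, inner_sub_right, inner_sub_right, inner_flux_self hp, inner_flux_self hp,
    h3, h3]
  linarith

theorem aestronglyMeasurable_flux {α : Type*} [MeasurableSpace α] {μ : Measure α} (p : ℝ)
    {g : α → Space N} (hg : AEStronglyMeasurable g μ) :
    AEStronglyMeasurable (fun x => flux p (g x)) μ :=
  (hg.norm.aemeasurable.pow_const (p - 2)).aestronglyMeasurable.smul hg

theorem memLp_flux {α : Type*} [MeasurableSpace α] {μ : Measure α} {p : ℝ} (hp : 1 < p)
    {g : α → Space N} (hg : MemLp g (ENNReal.ofReal p) μ) :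
    MemLp (fun x => flux p (g x)) (ENNReal.ofReal (p / (p - 1))) μ := by
  have h1 := hg.norm_rpow_div (ENNReal.ofReal (p - 1))
  rw [ENNReal.toReal_ofReal (by linarith), ← ENNReal.ofReal_div_of_pos (by linarith)] at h1
  refine h1.of_le (aestronglyMeasurable_flux p hg.1) (Eventually.of_forall fun x => ?_)
  rw [norm_flux hp]
  exact le_abs_self _

theorem integrable_inner_flux {α : Type*} [MeasurableSpace α] {μ : Measure α} {p : ℝ} (hp : 1 < p)
    {g k : α → Space N} (hg : MemLp g (ENNReal.ofReal p) μ) (hk : MemLp k (ENNReal.ofReal p) μ) :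
    Integrable (fun x => inner ℝ (flux p (g x)) (k x)) μ := by
  have := holderTriple_conj hp
  rw [← memLp_one_iff_integrable]
  refine MemLp.of_bilin (p := ENNReal.ofReal (p / (p - 1))) (q := ENNReal.ofReal p)
    (fun u v => inner ℝ u v) 1 (memLp_flux hp hg) hk
    ((aestronglyMeasurable_flux p hg.1).inner hk.1) (Eventually.of_forall fun x => ?_)
  simpa using nnnorm_inner_le_nnnorm (𝕜 := ℝ) (flux p (g x)) (k x)

/-! ### The torsion function -/

theorem tendsto_integral_of_eLpNorm {α : Type*} [MeasurableSpace α] {μ : Measure α}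
    [IsFiniteMeasure μ] {p : ℝ} (hp : 1 < p) {f : α → ℝ} {F : ℕ → α → ℝ}
    (hf : MemLp f (ENNReal.ofReal p) μ) (hF : ∀ k, MemLp (F k) (ENNReal.ofReal p) μ)
    (h : Tendsto (fun k => eLpNorm (fun x => F k x - f x) (ENNReal.ofReal p) μ) atTop (𝓝 0)) :
    Tendsto (fun k => ∫ x, F k x ∂μ) atTop (𝓝 (∫ x, f x ∂μ)) := by
  have := holderTriple_conj hp
  have := tendsto_integral_inner (q := ENNReal.ofReal (p / (p - 1))) (b := fun _ => (1 : ℝ))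
    (memLp_const 1) hf hF h
  simpa using this

/-- The weak equation `-div(flux) = κ` may be tested with all of `W_0^{1,p}`. -/
theorem integral_flux_of_testFunction {Ω : Set (Space N)} [IsFiniteMeasure (volume.restrict Ω)]
    {p : ℝ} (hp : 1 < p) {g : Space N → Space N}
    (hg : MemLp g (ENNReal.ofReal p) (volume.restrict Ω)) {κ : ℝ}
    (h : ∀ ζ : Space N → ℝ, IsTestFunction Ω ζ →
      ∫ x in Ω, inner ℝ (flux p (g x)) (gradient ζ x) = κ * ∫ x in Ω, ζ x)
    {φ : Space N → ℝ} {gφ : Space N → Space N} (hφ : MemW0 p Ω φ gφ) :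
    ∫ x in Ω, inner ℝ (flux p (g x)) (gφ x) = κ * ∫ x in Ω, φ x := by
  obtain ⟨h1, h2, ζ, hζ, h3, h4⟩ := hφ
  have := holderTriple_conj hp
  have hL := tendsto_integral_inner (memLp_flux hp hg) h2 (fun k =>
    ((continuous_gradient (hζ k).contDiff_one).memLp_of_hasCompactSupport
        (hasCompactSupport_gradient (hζ k).compact)).restrict _) h4
  have hR := tendsto_integral_of_eLpNorm hp h1 (fun k =>
    ((hζ k).smooth.continuous.memLp_of_hasCompactSupport (hζ k).compact).restrict _) h3
  exact tendsto_nhds_unique (hL.congr fun k => h _ (hζ k)) (hR.const_mul κ)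

/-- The one-dimensional barrier `C (R - |⟨e, x⟩|^{p'})`, whose flux is linear. -/
theorem exists_barrier (hN : 1 ≤ N) {Ω : Set (Space N)} (hb : Bornology.IsBounded Ω) {p : ℝ}
    (hp : 1 < p) :
    ∃ (Ψ : Space N → ℝ) (e : Space N) (M : ℝ), ContDiff ℝ 1 Ψ ∧ (∀ x ∈ Ω, 0 ≤ Ψ x) ∧
      (∀ x ∈ Ω, Ψ x ≤ M) ∧ (∀ x ∈ Ω, ‖gradient Ψ x‖ ≤ M) ∧
      ‖e‖ = 1 ∧ ∀ x, flux p (gradient Ψ x) = (-2 * inner ℝ e x) • e := by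
  obtain ⟨r, hr⟩ := hb.exists_norm_le
  set e : Space N := EuclideanSpace.single ⟨0, hN⟩ 1 with he
  have hne : ‖e‖ = 1 := by simp [he]
  set p' := p / (p - 1) with hp'
  have hp1 : 0 < p - 1 := by linarith
  have hp'1 : 1 < p' := by rw [hp', one_lt_div hp1]; linarith
  have hconj : (p' - 1) * (p - 1) = 1 := by rw [hp']; field_simp; ring
  -- With this `D` one has D^(p-1) = 2, so minus the divergence of the barrier's flux is 2, strictly
  -- more than the right side 1 of the torsion equation.
  set D : ℝ := 2 ^ (p' - 1) with hD
  have hD0 : 0 < D := by positivity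
  set R : ℝ := (max r 0) ^ p' with hR
  set Ψ : Space N → ℝ := fun x => D / p' * (R - |inner ℝ e x| ^ p') with hΨ
  have hin : ∀ x ∈ Ω, |inner ℝ e x| ≤ max r 0 := fun x hx => by
    have := abs_real_inner_le_norm e x
    rw [hne, one_mul] at this
    exact this.trans ((hr x hx).trans (le_max_left _ _))
  have hlin : ∀ x, HasFDerivAt (fun x : Space N => inner ℝ e x) (innerSL ℝ e) x :=
    fun x => (innerSL ℝ e).hasFDerivAt
  have hgrad : ∀ x, gradient Ψ x = (-(D * |inner ℝ e x| ^ (p' - 2) * inner ℝ e x)) • e := by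
    intro x
    have h1 := (((hasDerivAt_abs_rpow (inner ℝ e x) hp'1).comp_hasFDerivAt x (hlin x)).const_sub
      R).const_mul (D / p')
    have h2 : fderiv ℝ Ψ x = _ := h1.fderiv
    rw [gradient, h2]
    apply (InnerProductSpace.toDual ℝ (Space N)).injective
    rw [LinearIsometryEquiv.apply_symm_apply]
    ext y
    simp
    field_simp
  have habs : ∀ z : ℝ, |z| ^ (p' - 2) * |z| = |z| ^ (p' - 1) := fun z => by
    rw [← Real.rpow_add_one' (abs_nonneg _) (by linarith)]
    congr 1
    ring
  have hng : ∀ x, ‖gradient Ψ x‖ = D * |inner ℝ e x| ^ (p' - 1) := by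
    intro x
    rw [hgrad, norm_smul, hne, mul_one, norm_neg, norm_mul, norm_mul,
      Real.norm_of_nonneg hD0.le, Real.norm_of_nonneg (by positivity), Real.norm_eq_abs, mul_assoc,
      habs]
  refine ⟨Ψ, e, max (D / p' * R) (D * (max r 0) ^ (p' - 1)), ?_, ?_, ?_, ?_, hne, ?_⟩
  · have : ContDiff ℝ 1 (fun x : Space N => |inner ℝ e x| ^ p') :=
      (contDiff_const.inner ℝ contDiff_id).norm_rpow hp'1
    exact contDiff_const.mul (contDiff_const.sub this)
  · intro x hx
    have : |inner ℝ e x| ^ p' ≤ R := Real.rpow_le_rpow (abs_nonneg _) (hin x hx) (by linarith)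
    exact mul_nonneg (by positivity) (by linarith)
  · intro x hx
    refine le_trans (mul_le_mul_of_nonneg_left ?_ (by positivity)) (le_max_left _ _)
    have : 0 ≤ |inner ℝ e x| ^ p' := by positivity
    linarith
  · intro x hx
    rw [hng]
    refine le_trans ?_ (le_max_right _ _)
    gcongr
    exact hin x hx
  · intro x
    rw [flux, hng, hgrad, smul_smul]
    congr 1
    rw [Real.mul_rpow hD0.le (by positivity), ← Real.rpow_mul (abs_nonneg _)]
    rcases eq_or_ne (inner ℝ e x : ℝ) 0 with h0 | h0
    · simp [h0]
    · have hz : 0 < |(inner ℝ e x : ℝ)| := abs_pos.2 h0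
      have e1 : |(inner ℝ e x : ℝ)| ^ ((p' - 1) * (p - 2)) * |(inner ℝ e x : ℝ)| ^ (p' - 2) = 1 := by
        rw [← Real.rpow_add hz, show (p' - 1) * (p - 2) + (p' - 2) = 0 by linarith, Real.rpow_zero]
      have e2 : D ^ (p - 2) * D = 2 := by
        rw [← Real.rpow_add_one hD0.ne', hD, ← Real.rpow_mul (by norm_num),
          show (p' - 1) * (p - 2 + 1) = 1 by linarith, Real.rpow_one]
      calc _ = -((D ^ (p - 2) * D) * (|(inner ℝ e x : ℝ)| ^ ((p' - 1) * (p - 2)) *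
            |(inner ℝ e x : ℝ)| ^ (p' - 2)) * inner ℝ e x) := by ring
        _ = _ := by rw [e1, e2]; ring

theorem IsTorsionFunction.integral_eq {Ω : Set (Space N)} [IsFiniteMeasure (volume.restrict Ω)]
    {p : ℝ} (hp : 1 < p) {g : Space N → Space N}
    (hg : MemLp g (ENNReal.ofReal p) (volume.restrict Ω))
    (h : ∀ φ : Space N → ℝ, IsTestFunction Ω φ →
      ∫ x in Ω, ‖g x‖ ^ (p - 2) * inner ℝ (g x) (gradient φ x) = ∫ x in Ω, φ x)
    {φ : Space N → ℝ} {gφ : Space N → Space N} (hφ : MemW0 p Ω φ gφ) :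
    ∫ x in Ω, inner ℝ (flux p (g x)) (gφ x) = ∫ x in Ω, φ x := by
  have := integral_flux_of_testFunction hp hg (κ := 1)
    (fun ζ hζ => by simp only [inner_flux, one_mul]; exact h ζ hζ) hφ
  simpa using this

/-- The torsion function is bounded, and bounded below by its boundary value. -/
theorem IsTorsionFunction.bounded (hN : 1 ≤ N) {Ω : Set (Space N)} (hΩ : IsOpen Ω)
    (hb : Bornology.IsBounded Ω) [IsFiniteMeasure (volume.restrict Ω)]
    {p : ℝ} (hp : 1 < p) {δ₀ : ℝ} {ψ : Space N → ℝ} (h : IsTorsionFunction p Ω δ₀ ψ) :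
    ∃ M : ℝ, ∀ᵐ x ∂(volume.restrict Ω), δ₀ ≤ ψ x ∧ ψ x ≤ M := by
  obtain ⟨g, hψ, heq⟩ := h
  obtain ⟨Ψ, e, M, hΨ, hΨ0, hΨM, hΨg, hne, hΨf⟩ := exists_barrier hN hb hp
  have hmΩ := hΩ.measurableSet
  have hr1 := contDiff_primitive continuous_ramp
  have hdr := deriv_primitive continuous_ramp
  have hr2 : ∀ y, |deriv (primitive ramp) y| ≤ 1 := fun y => by
    rw [hdr, abs_of_nonneg (ramp_nonneg _)]; exact ramp_le_one _
  have hr3 : ∀ y, 0 ≤ primitive ramp y := primitive_nonneg_of_nonpos_eq_zero continuous_ramp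
    ramp_nonneg fun t => ramp_of_nonpos
  have hzero : ∀ {F : Space N → ℝ} {G : Space N → Space N}, MemW0 p Ω (fun x => primitive ramp (F x)) G →
      ∫ x in Ω, primitive ramp (F x) ≤ 0 → ∀ᵐ x ∂(volume.restrict Ω), F x ≤ 0 := by
    intro F G hF hle
    have hinteg : Integrable (fun x => primitive ramp (F x)) (volume.restrict Ω) :=
      hF.1.integrable (by simpa using ENNReal.ofReal_le_ofReal hp.le)
    have h0 := (integral_eq_zero_iff_of_nonneg (fun x => hr3 (F x)) hinteg).1
      (le_antisymm hle (integral_nonneg fun x => hr3 _))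
    filter_upwards [h0] with x hx
    by_contra hpos
    exact (primitive_ramp_pos (not_le.1 hpos)).ne' hx
  -- Testing with a nonnegative function of δ₀ - ψ makes the diffusion side nonpositive, while the
  -- other side is the integral of that function.
  have hlow : ∀ᵐ x ∂(volume.restrict Ω), -1 * (ψ x - δ₀) - 0 ≤ 0 := by
    have hW := (hψ.const_mul (-1)).comp_sub_const hΩ hp.le hr1 hr2 (c := 0)
      (by simp [primitive_zero])
    refine hzero hW ?_
    rw [← IsTorsionFunction.integral_eq hp hψ.2.1 heq hW]
    refine integral_nonpos fun x => ?_
    rw [hdr, real_inner_smul_right, real_inner_smul_right, inner_flux_self hp]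
    have := ramp_nonneg (-1 * (ψ x - δ₀) - 0)
    have : 0 ≤ ‖g x‖ ^ p := by positivity
    simp only [Pi.zero_apply]
    nlinarith
  -- The difference of the two weak formulations is tested with a nonnegative function of ψ - δ₀ -
  -- Ψ. Monotonicity of the flux yields 0 ≤ (1 - 2) times its integral, so it vanishes.
  have hup : ∀ᵐ x ∂(volume.restrict Ω), (ψ x - δ₀) - Ψ x ≤ 0 := by
    have hW := hψ.comp_sub hΩ hp.le hr1 hr2 hΨ hΨg
      (fun x hx => primitive_of_nonpos (fun t => ramp_of_nonpos) (by linarith [hΨ0 x hx]))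
    refine hzero hW ?_
    have hgΨ : MemLp (gradient Ψ) (ENNReal.ofReal p) (volume.restrict Ω) :=
      MemLp.of_bound (continuous_gradient hΨ).aestronglyMeasurable M
        ((ae_restrict_iff' hmΩ).2 (Eventually.of_forall hΨg))
    have h1 := IsTorsionFunction.integral_eq hp hψ.2.1 heq hW
    obtain ⟨r, hr⟩ := hb.exists_norm_le
    have h2 := hW.integral_mul_fderiv hΩ hp (ζ := fun x => inner ℝ e x)
      (contDiff_const.inner ℝ contDiff_id) e (B := max r 1)
      (fun x hx => by
        have := abs_real_inner_le_norm e x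
        rw [hne, one_mul] at this
        exact this.trans ((hr x hx).trans (le_max_left _ _)))
      (fun x hx => by
        have : fderiv ℝ (fun x : Space N => (inner ℝ e x : ℝ)) x = innerSL ℝ e :=
          (innerSL ℝ e).hasFDerivAt.fderiv
        rw [this]
        simp [hne])
    have h3 : ∫ x in Ω, inner ℝ (flux p (gradient Ψ x)) (deriv (primitive ramp) (ψ x - δ₀ - Ψ x) •
        (g x - gradient Ψ x)) = 2 * ∫ x in Ω, primitive ramp (ψ x - δ₀ - Ψ x) := by
      have h4 : ∀ x, fderiv ℝ (fun x : Space N => (inner ℝ e x : ℝ)) x e = 1 := fun x => by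
        have : fderiv ℝ (fun x : Space N => (inner ℝ e x : ℝ)) x = innerSL ℝ e :=
          (innerSL ℝ e).hasFDerivAt.fderiv
        rw [this]
        simp [hne]
      simp only [h4, mul_one] at h2
      rw [h2, mul_neg, ← integral_const_mul, ← integral_neg]
      congr 1
      ext x
      rw [hΨf, real_inner_smul_left, real_inner_comm e]
      ring
    have h5 : 0 ≤ ∫ x in Ω, (inner ℝ (flux p (g x)) (deriv (primitive ramp) (ψ x - δ₀ - Ψ x) •
        (g x - gradient Ψ x)) - inner ℝ (flux p (gradient Ψ x))
        (deriv (primitive ramp) (ψ x - δ₀ - Ψ x) • (g x - gradient Ψ x))) := by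
      refine integral_nonneg fun x => ?_
      rw [← inner_sub_left, real_inner_smul_right, hdr]
      exact mul_nonneg (ramp_nonneg _) (flux_monotone hp _ _)
    rw [integral_sub (integrable_inner_flux hp hψ.2.1 hW.2.1)
      (integrable_inner_flux hp hgΨ hW.2.1), h1, h3] at h5
    linarith
  refine ⟨δ₀ + M, ?_⟩
  filter_upwards [hlow, hup, ae_restrict_mem hmΩ] with x h1 h2 h3
  exact ⟨by linarith, by linarith [hΨM x h3]⟩

/-! ### Weak time derivatives and the time-continuous representative -/

theorem cylMeasure_eq_prod (Ω : Set (Space N)) (T : ℝ) :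
    cylMeasure Ω T = (volume.restrict Ω).prod (volume.restrict (Ioo 0 T)) := by
  rw [cylMeasure, cylinder, Measure.prod_restrict, Measure.volume_eq_prod]

instance isFiniteMeasure_cylMeasure (Ω : Set (Space N)) [IsFiniteMeasure (volume.restrict Ω)]
    (T : ℝ) : IsFiniteMeasure (cylMeasure Ω T) := by
  rw [cylMeasure_eq_prod]; infer_instance

theorem exists_Icc_of_isCompact_subset_Ioo {K : Set ℝ} (hK : IsCompact K) {T : ℝ} (hT : 0 < T)
    (h : K ⊆ Ioo 0 T) : ∃ a b : ℝ, 0 < a ∧ a < b ∧ b < T ∧ K ⊆ Icc a b := by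
  rcases K.eq_empty_or_nonempty with rfl | hne
  · exact ⟨T / 3, T / 2, by linarith, by linarith, by linarith, by simp⟩
  · obtain ⟨a, ha, ha'⟩ := hK.exists_isLeast hne
    obtain ⟨b, hb, hb'⟩ := hK.exists_isGreatest hne
    have h1 := h ha
    have h2 := h hb
    have h3 := ha' hb
    exact ⟨a / 2, b, by linarith [h1.1], by linarith [h1.1], h2.2,
      fun x hx => ⟨by linarith [ha' hx, h1.1], hb' hx⟩⟩

/-- A time primitive, vanishing for late times, of a test function on the cylinder. -/
theorem exists_timePrimitive {Ω : Set (Space N)} {T : ℝ} (hT : 0 < T)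
    {ζ : Space N × ℝ → ℝ} (hζ : IsTestFunction (cylinder Ω T) ζ) :
    ∃ (Z : Space N × ℝ → ℝ) (K : Set (Space N)) (a b : ℝ), ContDiff ℝ ∞ Z ∧
      (∀ z, fderiv ℝ Z z (0, 1) = ζ z) ∧ IsCompact K ∧ K ⊆ Ω ∧ 0 < a ∧ a < b ∧ b < T ∧
      (∀ x t, t < a → Z (x, t) = Z (x, 0)) ∧ (∀ x t, x ∉ K → Z (x, t) = 0) ∧
      (∀ x t, b < t → Z (x, t) = 0) ∧ (∀ x t, t < a → ζ (x, t) = 0) ∧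
      (∀ x t, 0 ≤ t → Z (x, t) = -∫ s in Ioo 0 T, (Ioi t).indicator (fun s => ζ (x, s)) s) := by
  have hc1 : IsCompact (Prod.fst '' tsupport ζ) := hζ.compact.isCompact.image continuous_fst
  have hc2 : IsCompact (Prod.snd '' tsupport ζ) := hζ.compact.isCompact.image continuous_snd
  obtain ⟨a, b, ha, hab, hbT, hsub⟩ := exists_Icc_of_isCompact_subset_Ioo hc2 hT (by
    rintro _ ⟨z, hz, rfl⟩
    exact (hζ.support hz).2)
  have hz0 : ∀ x t, t ∉ Icc a b → ζ (x, t) = 0 := fun x t ht =>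
    image_eq_zero_of_notMem_tsupport fun h => ht (hsub ⟨_, h, rfl⟩)
  have hz1 : ∀ x t, x ∉ Prod.fst '' tsupport ζ → ζ (x, t) = 0 := fun x t hx =>
    image_eq_zero_of_notMem_tsupport fun h => hx ⟨_, h, rfl⟩
  have hcont : ∀ x, Continuous (fun s => ζ (x, s)) := fun x =>
    hζ.smooth.continuous.comp (by fun_prop)
  set Z : Space N × ℝ → ℝ := fun z => ∫ s in z.2..T, -ζ (z.1, s) with hZ
  -- Writing -∫_t^T ζ(x, s) ds as a convolution in time with -1 on the negative half-line gives
  -- smoothness jointly in x and t.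
  have hconv : ∀ z : Space N × ℝ, Z z = convolution ((Iio (0 : ℝ)).indicator fun _ => (-1 : ℝ))
      (fun s => ζ (z.1, s)) (ContinuousLinearMap.lsmul ℝ ℝ) volume z.2 := by
    rintro ⟨x, t⟩
    rw [convolution_eq_swap]
    have h1 : ∀ s, (ContinuousLinearMap.lsmul ℝ ℝ)
        ((Iio (0 : ℝ)).indicator (fun _ => (-1 : ℝ)) (t - s)) (ζ (x, s))
        = (Ioi t).indicator (fun s => -ζ (x, s)) s := by
      intro s
      by_cases hs : t < s
      · simp [indicator, hs]
      · simp [indicator, hs]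
    simp_rw [h1]
    rw [integral_indicator measurableSet_Ioi, hZ]
    simp only
    rcases le_or_gt t T with htT | htT
    · rw [intervalIntegral.integral_of_le htT]
      refine (setIntegral_eq_of_subset_of_forall_sdiff_eq_zero measurableSet_Ioi
        (Ioc_subset_Ioi_self) ?_).symm
      intro s hs
      have : T < s := by
        by_contra h
        exact hs.2 ⟨hs.1, not_lt.1 h⟩
      rw [hz0 x s (fun h => by linarith [h.2]), neg_zero]
    · rw [intervalIntegral.integral_of_ge htT.le]
      rw [setIntegral_eq_zero_of_forall_eq_zero, setIntegral_eq_zero_of_forall_eq_zero]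
      · simp
      · intro s hs
        rw [hz0 x s (fun h => by linarith [h.2, mem_Ioi.1 hs]), neg_zero]
      · intro s hs
        rw [hz0 x s (fun h => by linarith [h.2, hs.1]), neg_zero]
  have hsmooth : ContDiff ℝ ∞ Z := by
    rw [← contDiffOn_univ, ← univ_prod_univ]
    have := contDiffOn_convolution_right_with_param (𝕜 := ℝ) (n := ⊤) (μ := volume)
      (f := (Iio (0 : ℝ)).indicator fun _ => (-1 : ℝ)) (ContinuousLinearMap.lsmul ℝ ℝ)
      (g := fun (x : Space N) s => ζ (x, s)) (s := univ) (k := Icc a b) isOpen_univ isCompact_Icc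
      (fun x t _ ht => hz0 x t ht)
      ((locallyIntegrable_const _).indicator measurableSet_Iio)
      (hζ.smooth.contDiffOn)
    exact this.congr fun z _ => hconv z
  have hZt : ∀ x t, HasDerivAt (fun s => Z (x, s)) (ζ (x, t)) t := by
    intro x t
    have h1 : HasDerivAt (fun s => ∫ r in T..s, ζ (x, r)) (ζ (x, t)) t :=
      intervalIntegral.integral_hasDerivAt_right ((hcont x).intervalIntegrable _ _)
        (hcont x).stronglyMeasurable.stronglyMeasurableAtFilter (hcont x).continuousAt
    convert h1 using 1
    ext s
    simp only [hZ]
    rw [intervalIntegral.integral_neg, intervalIntegral.integral_symm, neg_neg]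
  have hval : ∀ x t, 0 ≤ t → Z (x, t)
      = -∫ s in Ioo 0 T, (Ioi t).indicator (fun s => ζ (x, s)) s := by
    intro x t ht
    rw [hconv, convolution_eq_swap, ← integral_neg]
    rw [setIntegral_eq_integral_of_forall_compl_eq_zero]
    · congr 1
      ext s
      by_cases hs : t < s
      · simp [indicator, hs]
      · simp [indicator, hs]
    · intro s hs
      by_cases hs' : t < s
      · rw [indicator_of_mem (mem_Ioi.2 hs'), hz0 x s, neg_zero]
        intro h
        exact hs ⟨by linarith, by linarith [h.2]⟩
      · rw [indicator_of_notMem (by simpa using hs'), neg_zero]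
  refine ⟨Z, Prod.fst '' tsupport ζ, a, b, hsmooth, ?_, hc1, ?_, ha, hab, hbT, ?_, ?_, ?_, ?_, hval⟩
  · rintro ⟨x, t⟩
    have h1 : HasDerivAt (fun s : ℝ => ((x, s) : Space N × ℝ)) ((0, 1) : Space N × ℝ) t :=
      (hasDerivAt_const t x).prodMk (hasDerivAt_id t)
    have h2 := ((hsmooth.differentiable (by simp)) (x, t)).hasFDerivAt.comp_hasDerivAt t h1
    exact h2.unique (hZt x t)
  · rintro _ ⟨z, hz, rfl⟩
    exact (hζ.support hz).1
  · intro x t ht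
    have : Z (x, t) - Z (x, 0) = ∫ s in t..0, -ζ (x, s) := by
      simp only [hZ]
      rw [sub_eq_iff_eq_add, intervalIntegral.integral_add_adjacent_intervals]
      · exact (hcont x).neg.intervalIntegrable _ _
      · exact (hcont x).neg.intervalIntegrable _ _
    rw [← sub_eq_zero, this]
    refine intervalIntegral.integral_zero_ae (Eventually.of_forall fun s hs => ?_)
    rw [hz0 x s, neg_zero]
    intro h
    have := hs.2
    rcases le_max_iff.1 this with h' | h' <;> linarith [h.1]
  · intro x t hx
    simp only [hZ]
    refine intervalIntegral.integral_zero_ae (Eventually.of_forall fun s hs => ?_)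
    rw [hz1 x s hx, neg_zero]
  · intro x t ht
    simp only [hZ]
    refine intervalIntegral.integral_zero_ae (Eventually.of_forall fun s hs => ?_)
    rw [hz0 x s, neg_zero]
    intro h
    have := hs.1
    rcases min_lt_iff.1 this with h' | h' <;> linarith [h.2]
  · intro x t ht
    exact hz0 x t fun h => by linarith [h.1]

/-- Smooth cutoffs in time that vanish near `0` and tend to `1` for positive times. -/
theorem exists_timeCutoff : ∃ (η : ℕ → ℝ → ℝ) (C : ℝ), 0 ≤ C ∧ (∀ k, ContDiff ℝ ∞ (η k)) ∧
    (∀ (k : ℕ) t, t ≤ 1 / ((k : ℝ) + 1) → η k t = 0) ∧ (∀ (k : ℕ) t, 2 / ((k : ℝ) + 1) ≤ t → η k t = 1) ∧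
    (∀ (k : ℕ) t, |η k t| ≤ 1) ∧ (∀ (k : ℕ) t, |deriv (η k) t| ≤ C * ((k : ℝ) + 1)) ∧
    (∀ (k : ℕ) t, t < 1 / ((k : ℝ) + 1) → deriv (η k) t = 0) ∧
    (∀ (k : ℕ) t, 2 / ((k : ℝ) + 1) < t → deriv (η k) t = 0) := by
  have hst : ContDiff ℝ ∞ Real.smoothTransition := Real.smoothTransition.contDiff
  have hcont : Continuous (deriv Real.smoothTransition) := hst.continuous_deriv (by simp)
  have hsupp : HasCompactSupport (deriv Real.smoothTransition) := by
    refine HasCompactSupport.of_support_subset_isCompact (isCompact_Icc (a := (0 : ℝ)) (b := 1)) ?_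
    intro t ht
    by_contra hmem
    apply ht
    rcases lt_or_ge t 0 with h0 | h0
    · have : Real.smoothTransition =ᶠ[𝓝 t] fun _ => 0 := by
        filter_upwards [Iio_mem_nhds h0] with s hs using Real.smoothTransition.zero_of_nonpos hs.le
      rw [this.deriv_eq, deriv_const]
    · have h1 : 1 < t := by
        by_contra h
        exact hmem ⟨h0, not_lt.1 h⟩
      have : Real.smoothTransition =ᶠ[𝓝 t] fun _ => 1 := by
        filter_upwards [Ioi_mem_nhds h1] with s hs using Real.smoothTransition.one_of_one_le hs.le
      rw [this.deriv_eq, deriv_const]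
  obtain ⟨C, hC⟩ := hsupp.exists_bound_of_continuous hcont
  have hpos : ∀ k : ℕ, (0 : ℝ) < (k : ℝ) + 1 := fun k => by positivity
  have hder : ∀ (k : ℕ) t, HasDerivAt (fun t => Real.smoothTransition (((k : ℝ) + 1) * t - 1))
      (deriv Real.smoothTransition (((k : ℝ) + 1) * t - 1) * ((k : ℝ) + 1)) t := by
    intro k t
    have h1 : HasDerivAt (fun t => ((k : ℝ) + 1) * t - 1) ((k : ℝ) + 1) t := by
      simpa using ((hasDerivAt_id t).const_mul ((k : ℝ) + 1)).sub_const 1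
    exact ((hst.differentiable (by simp)) _).hasDerivAt.comp t h1
  have hz : ∀ (k : ℕ) t, t ≤ 1 / ((k : ℝ) + 1) →
      Real.smoothTransition (((k : ℝ) + 1) * t - 1) = 0 := by
    intro k t ht
    apply Real.smoothTransition.zero_of_nonpos
    rw [le_div_iff₀ (hpos k)] at ht
    linarith
  have ho : ∀ (k : ℕ) t, 2 / ((k : ℝ) + 1) ≤ t →
      Real.smoothTransition (((k : ℝ) + 1) * t - 1) = 1 := by
    intro k t ht
    apply Real.smoothTransition.one_of_one_le
    rw [div_le_iff₀ (hpos k)] at ht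
    linarith
  refine ⟨fun k t => Real.smoothTransition (((k : ℝ) + 1) * t - 1), C,
    (norm_nonneg _).trans (hC 0), fun k => ?_, hz, ho, fun k t => ?_, fun k t => ?_,
    fun k t ht => ?_, fun k t ht => ?_⟩
  · exact hst.comp ((contDiff_const.mul contDiff_id).sub contDiff_const)
  · rw [abs_of_nonneg (Real.smoothTransition.nonneg _)]
    exact Real.smoothTransition.le_one _
  · rw [(hder k t).deriv, abs_mul, abs_of_pos (hpos k)]
    exact mul_le_mul_of_nonneg_right (hC _) (hpos k).le
  · have : (fun t => Real.smoothTransition (((k : ℝ) + 1) * t - 1)) =ᶠ[𝓝 t] fun _ => 0 := by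
      filter_upwards [Iio_mem_nhds ht] with s hs using hz k s hs.le
    rw [this.deriv_eq, deriv_const]
  · have : (fun t => Real.smoothTransition (((k : ℝ) + 1) * t - 1)) =ᶠ[𝓝 t] fun _ => 1 := by
      filter_upwards [Ioi_mem_nhds ht] with s hs using ho k s hs.le
    rw [this.deriv_eq, deriv_const]

/-- Near the initial time, approximate identities in time recover the initial value. -/
theorem tendsto_integral_initial {Ω : Set (Space N)} [IsFiniteMeasure (volume.restrict Ω)] {T : ℝ}
    {w : Space N × ℝ → ℝ} {w₀ : Space N → ℝ}
    (hw : MemLp w 2 (cylMeasure Ω T)) (h₀ : MemLp w₀ 2 (volume.restrict Ω))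
    (hi : HasInitialValue Ω w w₀) {Z₀ : Space N → ℝ} (hZm : Continuous Z₀) {B : ℝ}
    (hB : ∀ x, |Z₀ x| ≤ B) {θ : ℕ → ℝ → ℝ} {C : ℝ} (hθ : ∀ k, Continuous (θ k))
    (hθb : ∀ k t, |θ k t| ≤ C * ((k : ℝ) + 1))
    (hθ2 : ∀ (k : ℕ) t, 2 / ((k : ℝ) + 1) < t → θ k t = 0) :
    Tendsto (fun k => ∫ z, (w z - w₀ z.1) * (Z₀ z.1 * θ k z.2) ∂(cylMeasure Ω T)) atTop (𝓝 0) := by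
  set μ := volume.restrict Ω with hμ
  set ν := (volume : Measure ℝ).restrict (Ioo 0 T) with hν
  have hcyl : cylMeasure Ω T = μ.prod ν := cylMeasure_eq_prod Ω T
  have hB0 : 0 ≤ B := (abs_nonneg _).trans (hB 0)
  have hC0 : 0 ≤ C := by
    have := (abs_nonneg _).trans (hθb 0 0)
    simpa using this
  set A : ℝ := (μ univ ^ (1 / (1 : ℝ≥0∞).toReal - 1 / (2 : ℝ≥0∞).toReal)).toReal with hA
  have hAt : μ univ ^ (1 / (1 : ℝ≥0∞).toReal - 1 / (2 : ℝ≥0∞).toReal) ≠ ⊤ :=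
    ENNReal.rpow_ne_top_of_nonneg (by norm_num) (by finiteness)
  have hA0 : 0 ≤ A := ENNReal.toReal_nonneg
  rw [Metric.tendsto_atTop]
  intro ε hε
  -- The weight `θ k` is at most C(k+1) and lives on a time interval of length 2/(k+1), so its mass
  -- is at most 2C uniformly in k. With `A` the Hölder factor from L² to L¹, the whole integral is
  -- then at most B A (2C) δ < ε.
  set δ : ℝ := ε / (2 * (B * A * (2 * C)) + 1) with hδ
  have hδ0 : 0 < δ := by positivity
  have hev : ∀ᶠ t in ae (volume : Measure ℝ) ⊓ 𝓝[>] 0,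
      eLpNorm (fun x => w (x, t) - w₀ x) 2 μ ≤ ENNReal.ofReal δ :=
    hi.eventually_le_const (ENNReal.ofReal_pos.2 hδ0)
  obtain ⟨s, hs, s', hs', hss⟩ := eventually_inf.1 hev
  obtain ⟨τ, hτ, hτs⟩ := mem_nhdsGT_iff_exists_Ioo_subset.1 hs'
  have hτ0 : 0 < τ := hτ
  have hwi : Integrable w (μ.prod ν) := by
    rw [← hcyl]; exact hw.integrable (by norm_num)
  have hslice : ∀ᵐ t ∂ν, AEStronglyMeasurable (fun x => w (x, t)) μ := by
    have h1 : AEStronglyMeasurable (fun z : ℝ × Space N => w z.swap) (ν.prod μ) :=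
      hwi.1.prod_swap
    exact h1.prodMk_left
  obtain ⟨n₀, hn₀⟩ := exists_nat_gt (2 / τ)
  refine ⟨n₀, fun k hk => ?_⟩
  have hkpos : (0 : ℝ) < (k : ℝ) + 1 := by positivity
  have hkτ : 2 / ((k : ℝ) + 1) < τ := by
    have : (n₀ : ℝ) ≤ k := by exact_mod_cast hk
    rw [div_lt_iff₀ hkpos]
    rw [div_lt_iff₀ hτ0] at hn₀
    nlinarith
  rw [dist_zero_right, hcyl]
  have hinteg : Integrable (fun z : Space N × ℝ => (w z - w₀ z.1) * (Z₀ z.1 * θ k z.2)) (μ.prod ν) := by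
    have h1 : Integrable (fun z : Space N × ℝ => w z - w₀ z.1) (μ.prod ν) :=
      hwi.sub ((h₀.integrable (by norm_num)).comp_fst ν)
    refine h1.mul_bdd (c := B * (C * ((k : ℝ) + 1))) ?_ (Eventually.of_forall fun z => ?_)
    · exact ((hZm.comp continuous_fst).mul ((hθ k).comp continuous_snd)).aestronglyMeasurable
    · rw [norm_mul]
      exact mul_le_mul (hB _) (hθb _ _) (norm_nonneg _) hB0
  rw [integral_prod_symm _ hinteg]
  have hbound : ∀ᵐ t ∂ν, ‖∫ x, (w (x, t) - w₀ x) * (Z₀ x * θ k t) ∂μ‖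
      ≤ (Icc 0 (2 / ((k : ℝ) + 1))).indicator (fun _ => B * (C * ((k : ℝ) + 1)) * (A * δ)) t := by
    filter_upwards [hslice, ae_restrict_mem measurableSet_Ioo, ae_restrict_of_ae hs]
      with t ht1 ht2 ht3
    by_cases ht : 2 / ((k : ℝ) + 1) < t
    · simp only [hθ2 k t ht, mul_zero, integral_zero, norm_zero]
      exact indicator_nonneg (fun _ _ => by positivity) _
    · have htτ : t < τ := by linarith [not_lt.1 ht]
      rw [indicator_of_mem (show t ∈ Icc 0 (2 / ((k : ℝ) + 1)) from ⟨ht2.1.le, not_lt.1 ht⟩)]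
      have hle := hss t ⟨ht3, hτs ⟨ht2.1, htτ⟩⟩
      have hm : AEStronglyMeasurable (fun x => w (x, t) - w₀ x) μ := ht1.sub h₀.1
      have h1 : eLpNorm (fun x => w (x, t) - w₀ x) 1 μ ≤ ENNReal.ofReal (A * δ) := by
        refine (eLpNorm_le_eLpNorm_mul_rpow_measure_univ (p := 1) (q := 2) (by norm_num) hm).trans ?_
        rw [mul_comm, ENNReal.ofReal_mul hA0, hA, ENNReal.ofReal_toReal hAt]
        gcongr
      have hint1 : Integrable (fun x => w (x, t) - w₀ x) μ := by
        rw [← memLp_one_iff_integrable]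
        exact ⟨hm, h1.trans_lt ENNReal.ofReal_lt_top⟩
      have h2 : ∫ x, ‖w (x, t) - w₀ x‖ ∂μ ≤ A * δ := by
        rw [integral_norm_eq_lintegral_enorm hm, ← eLpNorm_one_eq_lintegral_enorm]
        exact ENNReal.toReal_le_of_le_ofReal (by positivity) h1
      calc ‖∫ x, (w (x, t) - w₀ x) * (Z₀ x * θ k t) ∂μ‖
          ≤ ∫ x, B * (C * ((k : ℝ) + 1)) * ‖w (x, t) - w₀ x‖ ∂μ := by
            refine norm_integral_le_of_norm_le (hint1.norm.const_mul _)
              (Eventually.of_forall fun x => ?_)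
            rw [norm_mul, norm_mul, mul_comm]
            gcongr
            · exact hB x
            · exact hθb k t
        _ = B * (C * ((k : ℝ) + 1)) * ∫ x, ‖w (x, t) - w₀ x‖ ∂μ := integral_const_mul _ _
        _ ≤ _ := by gcongr
  have hind : Integrable ((Icc 0 (2 / ((k : ℝ) + 1))).indicator
      (fun _ => B * (C * ((k : ℝ) + 1)) * (A * δ))) ν :=
    (integrable_const _).indicator measurableSet_Icc
  calc ‖∫ t, ∫ x, (w (x, t) - w₀ x) * (Z₀ x * θ k t) ∂μ ∂ν‖
      ≤ ∫ t, (Icc 0 (2 / ((k : ℝ) + 1))).indicator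
          (fun _ => B * (C * ((k : ℝ) + 1)) * (A * δ)) t ∂ν := norm_integral_le_of_norm_le hind hbound
    _ ≤ ∫ t, (Icc 0 (2 / ((k : ℝ) + 1))).indicator
          (fun _ => B * (C * ((k : ℝ) + 1)) * (A * δ)) t := by
        refine setIntegral_le_integral ?_ (Eventually.of_forall fun t =>
          indicator_nonneg (fun _ _ => by positivity) _)
        rw [integrable_indicator_iff measurableSet_Icc]
        exact integrableOn_const (by simp)
    _ = 2 / ((k : ℝ) + 1) * (B * (C * ((k : ℝ) + 1)) * (A * δ)) := by
        rw [integral_indicator measurableSet_Icc, setIntegral_const, smul_eq_mul, Real.volume_real_Icc,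
          sub_zero, max_eq_left (by positivity)]
    _ = (B * A * (2 * C)) * δ := by field_simp
    _ < ε := by
        rw [hδ, mul_div_assoc', div_lt_iff₀ (by positivity)]
        nlinarith [show 0 ≤ B * A * (2 * C) by positivity]

theorem integrable_mul_of_bounded {α : Type*} [MeasurableSpace α] {μ : Measure α}
    {f g : α → ℝ} (hf : Integrable f μ) (hg : AEStronglyMeasurable g μ) {B : ℝ}
    (hB : ∀ x, |g x| ≤ B) : Integrable (fun x => f x * g x) μ :=
  hf.mul_bdd (c := B) hg (Eventually.of_forall hB)

/-- Testing the weak time derivative with functions that do not vanish at the initial time. -/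
theorem integral_timePrimitive {Ω : Set (Space N)} [IsFiniteMeasure (volume.restrict Ω)]
    {T : ℝ} (hT : 0 < T)
    {w w' : Space N × ℝ → ℝ} {w₀ : Space N → ℝ} (hw : MemLp w 2 (cylMeasure Ω T))
    (hw' : MemLp w' 2 (cylMeasure Ω T)) (hd : HasWeakTimeDeriv Ω T w w')
    (hi : HasInitialValue Ω w w₀) (h₀ : MemLp w₀ 2 (volume.restrict Ω))
    {ζ Z : Space N × ℝ → ℝ} (hζ : IsTestFunction (cylinder Ω T) ζ) {K : Set (Space N)} {a b : ℝ}
    (hZ : ContDiff ℝ ∞ Z) (hZd : ∀ z, fderiv ℝ Z z (0, 1) = ζ z) (hK : IsCompact K) (hKΩ : K ⊆ Ω)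
    (ha : 0 < a) (hab : a < b) (hbT : b < T) (hZa : ∀ x t, t < a → Z (x, t) = Z (x, 0))
    (hZK : ∀ x t, x ∉ K → Z (x, t) = 0) (hZb : ∀ x t, b < t → Z (x, t) = 0)
    (hζa : ∀ x t, t < a → ζ (x, t) = 0) :
    ∫ z, w z * ζ z ∂(cylMeasure Ω T) + ∫ x in Ω, w₀ x * Z (x, 0)
      = -∫ z, w' z * Z z ∂(cylMeasure Ω T) := by
  obtain ⟨η, C, hC0, hη, hη0, hη1, hηb, hηd, hηd0, hηd1⟩ := exists_timeCutoff
  have hwi : Integrable w (cylMeasure Ω T) := hw.integrable (by norm_num)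
  have hwi' : Integrable w' (cylMeasure Ω T) := hw'.integrable (by norm_num)
  have hwi₀ : Integrable w₀ (volume.restrict Ω) := h₀.integrable (by norm_num)
  have hwi₀' : Integrable (fun z : Space N × ℝ => w₀ z.1) (cylMeasure Ω T) := by
    rw [cylMeasure_eq_prod]; exact hwi₀.comp_fst _
  have hZ0c : Continuous (fun x => Z (x, 0)) := hZ.continuous.comp (by fun_prop)
  obtain ⟨B, hB⟩ : ∃ B, ∀ z, |Z z| ≤ B := by
    obtain ⟨B, hB⟩ := (hK.prod (isCompact_Icc (a := 0) (b := b))).exists_bound_of_continuousOn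
      hZ.continuous.continuousOn
    refine ⟨max B 0, ?_⟩
    rintro ⟨x, t⟩
    by_cases hx : x ∈ K
    · rcases lt_or_ge b t with hbt | hbt
      · rw [hZb x t hbt, abs_zero]; exact le_max_right _ _
      · rcases lt_or_ge t 0 with ht0 | ht0
        · rw [hZa x t (by linarith)]
          exact (hB (x, 0) ⟨hx, le_rfl, by linarith⟩).trans (le_max_left _ _)
        · exact (hB (x, t) ⟨hx, ht0, hbt⟩).trans (le_max_left _ _)
    · rw [hZK x t hx, abs_zero]; exact le_max_right _ _
  obtain ⟨B', hB'⟩ := hζ.compact.exists_bound_of_continuous hζ.smooth.continuous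
  have hdη : ∀ k, Continuous (deriv (η k)) := fun k => (hη k).continuous_deriv (by simp)
  have hI1 : Integrable (fun z => w z * ζ z) (cylMeasure Ω T) :=
    integrable_mul_of_bounded hwi hζ.smooth.continuous.aestronglyMeasurable hB'
  have hI2 : ∀ k : ℕ, Integrable (fun z : Space N × ℝ =>
      (w z - w₀ z.1) * (Z (z.1, 0) * deriv (η k) z.2)) (cylMeasure Ω T) := fun k => by
    refine integrable_mul_of_bounded (hwi.sub hwi₀') ?_ (B := B * (C * ((k : ℝ) + 1))) fun z => ?_
    · exact ((hZ0c.comp continuous_fst).mul ((hdη k).comp continuous_snd)).aestronglyMeasurable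
    · rw [abs_mul]
      exact mul_le_mul (hB _) (hηd k _) (abs_nonneg _) ((abs_nonneg _).trans (hB (0, 0)))
  have hI3 : ∀ k : ℕ, Integrable (fun z : Space N × ℝ =>
      (w₀ z.1 * Z (z.1, 0)) * deriv (η k) z.2) (cylMeasure Ω T) := fun k => by
    refine integrable_mul_of_bounded ?_ ((hdη k).comp continuous_snd).aestronglyMeasurable
      (B := C * ((k : ℝ) + 1)) fun z => hηd k _
    exact integrable_mul_of_bounded hwi₀' (hZ0c.comp continuous_fst).aestronglyMeasurable
      fun z => hB _
  -- The function Z η_k is an admissible test function. For large k the cutoff acts only where Z(x,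
  -- t) = Z(x, 0) and ζ = 0, so its time derivative is ζ + Z(x, 0) η_k'. As η_k' has integral 1, the
  -- last term isolates the contribution of the initial value.
  have hident : ∀ᶠ k : ℕ in atTop,
      ∫ z, w z * ζ z ∂(cylMeasure Ω T) +
        ∫ z, (w z - w₀ z.1) * (Z (z.1, 0) * deriv (η k) z.2) ∂(cylMeasure Ω T)
        + ∫ x in Ω, w₀ x * Z (x, 0)
      = -∫ z, w' z * (Z z * η k z.2) ∂(cylMeasure Ω T) := by
    have hlarge : ∀ᶠ k : ℕ in atTop, 2 / ((k : ℝ) + 1) < a := by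
      have : Tendsto (fun k : ℕ => 2 / ((k : ℝ) + 1)) atTop (𝓝 0) := by
        simpa [div_eq_mul_inv] using
          (tendsto_one_div_add_atTop_nhds_zero_nat (𝕜 := ℝ)).const_mul 2
      exact this.eventually_lt_const ha
    filter_upwards [hlarge] with k hk
    have hk0 : (0 : ℝ) < 1 / ((k : ℝ) + 1) := by positivity
    have hk1 : 1 / ((k : ℝ) + 1) < 2 / ((k : ℝ) + 1) := by gcongr; norm_num
    have hsupp : Function.support (fun z : Space N × ℝ => Z z * η k z.2)
        ⊆ K ×ˢ Icc (1 / ((k : ℝ) + 1)) b := by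
      rintro ⟨x, t⟩ hxt
      simp only [Function.mem_support] at hxt
      refine ⟨?_, ?_, ?_⟩
      · by_contra hx
        exact hxt (by rw [hZK x t hx, zero_mul])
      · by_contra ht
        exact hxt (by rw [hη0 k t (not_le.1 ht).le, mul_zero])
      · by_contra ht
        exact hxt (by rw [hZb x t (not_le.1 ht), zero_mul])
    have hKc : IsCompact (K ×ˢ Icc (1 / ((k : ℝ) + 1)) b) := hK.prod isCompact_Icc
    have htest : IsTestFunction (cylinder Ω T) (fun z : Space N × ℝ => Z z * η k z.2) := by
      refine ⟨hZ.mul ((hη k).comp contDiff_snd),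
        HasCompactSupport.of_support_subset_isCompact hKc hsupp,
        (closure_minimal hsupp hKc.isClosed).trans ?_⟩
      rintro ⟨x, t⟩ ⟨hx, ht⟩
      exact ⟨hKΩ hx, lt_of_lt_of_le hk0 ht.1, lt_of_le_of_lt ht.2 hbT⟩
    have hder : ∀ z : Space N × ℝ, fderiv ℝ (fun z : Space N × ℝ => Z z * η k z.2) z (0, 1)
        = ζ z + Z (z.1, 0) * deriv (η k) z.2 := by
      rintro ⟨x, t⟩
      have h1 : HasFDerivAt Z (fderiv ℝ Z (x, t)) (x, t) :=
        ((hZ.differentiable (by simp)) (x, t)).hasFDerivAt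
      have h2 : HasFDerivAt (fun z : Space N × ℝ => η k z.2)
          (deriv (η k) t • ContinuousLinearMap.snd ℝ (Space N) ℝ) (x, t) :=
        (((hη k).differentiable (by simp)) t).hasDerivAt.comp_hasFDerivAt (x, t) hasFDerivAt_snd
      rw [(h1.fun_mul h2).fderiv]
      simp only [add_apply, _root_.smul_apply, ContinuousLinearMap.coe_snd', smul_eq_mul,
        mul_one, hZd]
      have e1 : η k t * ζ (x, t) = ζ (x, t) := by
        rcases lt_or_ge t a with h | h
        · rw [hζa x t h, mul_zero]
        · rw [hη1 k t (by linarith), one_mul]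
      have e2 : Z (x, t) * deriv (η k) t = Z (x, 0) * deriv (η k) t := by
        rcases lt_or_ge t a with h | h
        · rw [hZa x t h]
        · rw [hηd1 k t (by linarith), mul_zero, mul_zero]
      rw [e1, e2, add_comm]
    have h1 := hd _ htest
    rw [← h1]
    have h3 : ∫ x in Ω, w₀ x * Z (x, 0)
        = ∫ z, (w₀ z.1 * Z (z.1, 0)) * deriv (η k) z.2 ∂(cylMeasure Ω T) := by
      rw [cylMeasure_eq_prod, integral_prod_mul (fun x => w₀ x * Z (x, 0)) (deriv (η k))]
      have : ∫ t in Ioo 0 T, deriv (η k) t = 1 := by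
        rw [← integral_Ioc_eq_integral_Ioo, ← intervalIntegral.integral_of_le hT.le,
          intervalIntegral.integral_deriv_eq_sub (fun t _ => (hη k).differentiable (by simp) t)
            ((hdη k).intervalIntegrable _ _), hη1 k T (by linarith), hη0 k 0 hk0.le, sub_zero]
      rw [this, mul_one]
    have h4 : Integrable (fun z => w z * ζ z + (w z - w₀ z.1) * (Z (z.1, 0) * deriv (η k) z.2))
        (cylMeasure Ω T) := hI1.add (hI2 k)
    rw [h3, ← integral_add hI1 (hI2 k), ← integral_add h4 (hI3 k)]
    congr 1
    ext z
    rw [hder]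
    ring
  have hlim2 := tendsto_integral_initial hw h₀ hi hZ0c (fun x => hB (x, 0)) hdη hηd hηd1
  have hlim1 : Tendsto (fun k => -∫ z, w' z * (Z z * η k z.2) ∂(cylMeasure Ω T)) atTop
      (𝓝 (-∫ z, w' z * Z z ∂(cylMeasure Ω T))) := by
    refine Tendsto.neg (tendsto_integral_of_dominated_convergence (fun z => ‖w' z‖ * B) ?_ ?_ ?_ ?_)
    · intro k
      exact hwi'.1.mul (hZ.continuous.mul
        ((hη k).continuous.comp continuous_snd)).aestronglyMeasurable
    · exact hwi'.norm.mul_const B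
    · intro k
      refine Eventually.of_forall fun z => ?_
      rw [norm_mul]
      gcongr
      rw [norm_mul]
      calc ‖Z z‖ * ‖η k z.2‖ ≤ B * 1 := mul_le_mul (hB z) (hηb k _) (norm_nonneg _)
            ((abs_nonneg _).trans (hB z))
        _ = B := mul_one B
    · have hmem : ∀ᵐ z ∂(cylMeasure Ω T), 0 < z.2 := by
        rw [cylMeasure_eq_prod]
        have : ∀ᵐ t ∂((volume : Measure ℝ).restrict (Ioo 0 T)), 0 < t :=
          (ae_restrict_mem measurableSet_Ioo).mono fun t ht => ht.1
        exact Measure.quasiMeasurePreserving_snd.ae this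
      filter_upwards [hmem] with z hz
      refine tendsto_const_nhds.congr' ?_
      have : Tendsto (fun k : ℕ => 2 / ((k : ℝ) + 1)) atTop (𝓝 0) := by
        simpa [div_eq_mul_inv] using
          (tendsto_one_div_add_atTop_nhds_zero_nat (𝕜 := ℝ)).const_mul 2
      filter_upwards [this.eventually_lt_const hz] with k hk
      rw [hη1 k _ hk.le, mul_one]
  have hlim3 := (hlim2.const_add (∫ z, w z * ζ z ∂(cylMeasure Ω T))).add_const
    (∫ x in Ω, w₀ x * Z (x, 0))
  rw [add_zero] at hlim3
  exact tendsto_nhds_unique (hlim3.congr' hident) hlim1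

/-- The representative of `w` that is absolutely continuous in time. -/
noncomputable def timeRep (w₀ : Space N → ℝ) (w' : Space N × ℝ → ℝ) (x : Space N) (t : ℝ) : ℝ :=
  w₀ x + ∫ s in Ioo 0 t, w' (x, s)

/-- Moving the variable endpoint into the integrand puts iterated time integrals on a fixed product
space, ready for Fubini. -/
theorem setIntegral_Ioo_eq_indicator (f : ℝ → ℝ) {t T : ℝ} (ht : t ≤ T) :
    ∫ s in Ioo 0 t, f s = ∫ s in Ioo 0 T, (Iio t).indicator f s := by
  rw [setIntegral_indicator measurableSet_Iio]
  congr 2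
  ext s
  simp only [mem_Ioo, mem_inter_iff, mem_Iio]
  constructor
  · rintro ⟨h1, h2⟩; exact ⟨⟨h1, by linarith⟩, h2⟩
  · rintro ⟨⟨h1, _⟩, h2⟩; exact ⟨h1, h2⟩

theorem integrable_timePart {Ω : Set (Space N)} [IsFiniteMeasure (volume.restrict Ω)] {T : ℝ}
    {w' : Space N × ℝ → ℝ} (hw' : Integrable w' (cylMeasure Ω T)) :
    Integrable (fun z : Space N × ℝ => ∫ s in Ioo 0 z.2, w' (z.1, s)) (cylMeasure Ω T) := by
  set μ := volume.restrict Ω with hμ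
  set ν := (volume : Measure ℝ).restrict (Ioo 0 T) with hν
  have hcyl : cylMeasure Ω T = μ.prod ν := cylMeasure_eq_prod Ω T
  rw [hcyl] at hw' ⊢
  have hswap : MeasurePreserving (fun y : (Space N × ℝ) × ℝ => ((y.1.1, y.2), y.1.2))
      ((μ.prod ν).prod ν) ((μ.prod ν).prod ν) := by
    have h1 := measurePreserving_prodAssoc μ ν ν
    have h2 := (MeasurePreserving.id μ).prod (Measure.measurePreserving_swap (μ := ν) (ν := ν))
    exact h1.symm.comp (h2.comp h1)
  have h1 : Integrable (fun y : (Space N × ℝ) × ℝ => w' (y.1.1, y.2)) ((μ.prod ν).prod ν) :=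
    (hswap.integrable_comp (hw'.comp_fst ν).1).2 (hw'.comp_fst ν)
  have hmeas : MeasurableSet {y : (Space N × ℝ) × ℝ | y.2 < y.1.2} :=
    measurableSet_lt measurable_snd (measurable_snd.comp measurable_fst)
  refine (h1.indicator hmeas).integral_prod_left.congr ?_
  have hmem : ∀ᵐ z ∂(μ.prod ν), z.2 ∈ Ioo 0 T :=
    Measure.quasiMeasurePreserving_snd.ae (ae_restrict_mem measurableSet_Ioo)
  filter_upwards [hmem] with z hz
  rw [setIntegral_Ioo_eq_indicator _ hz.2.le]
  rfl

/-- By the fundamental lemma of the calculus of variations it suffices to test the difference with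
ζ. The time primitive Z of ζ, vanishing at late times, is inserted into the weak derivative; it does
not vanish at time 0, which is how the initial value enters. -/
theorem ae_eq_timeRep {Ω : Set (Space N)} (hΩ : IsOpen Ω) [IsFiniteMeasure (volume.restrict Ω)]
    {T : ℝ} (hT : 0 < T)
    {w w' : Space N × ℝ → ℝ} {w₀ : Space N → ℝ} (hw : MemLp w 2 (cylMeasure Ω T))
    (hw' : MemLp w' 2 (cylMeasure Ω T)) (hd : HasWeakTimeDeriv Ω T w w')
    (hi : HasInitialValue Ω w w₀) (h₀ : MemLp w₀ 2 (volume.restrict Ω)) :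
    ∀ᵐ z ∂(cylMeasure Ω T), w z = timeRep w₀ w' z.1 z.2 := by
  set μ := volume.restrict Ω with hμ
  set ν := (volume : Measure ℝ).restrict (Ioo 0 T) with hν
  have hcyl : cylMeasure Ω T = μ.prod ν := cylMeasure_eq_prod Ω T
  have hwi : Integrable w (cylMeasure Ω T) := hw.integrable (by norm_num)
  have hwi' : Integrable w' (cylMeasure Ω T) := hw'.integrable (by norm_num)
  have hwi₀ : Integrable w₀ μ := h₀.integrable (by norm_num)
  have hwi₀' : Integrable (fun z : Space N × ℝ => w₀ z.1) (cylMeasure Ω T) := by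
    rw [hcyl]; exact hwi₀.comp_fst _
  have hP := integrable_timePart hwi'
  have hF : Integrable (fun z => w z - timeRep w₀ w' z.1 z.2) (cylMeasure Ω T) :=
    hwi.sub (hwi₀'.add hP)
  have hmeas : MeasurableSet (cylinder Ω T) := hΩ.measurableSet.prod measurableSet_Ioo
  have key := IsOpen.ae_eq_zero_of_integral_contDiff_smul_eq_zero (μ := volume)
    (U := cylinder Ω T) (f := fun z => w z - timeRep w₀ w' z.1 z.2) (hΩ.prod isOpen_Ioo)
    (IntegrableOn.locallyIntegrableOn hF) (fun ζ h1 h2 h3 => ?_)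
  · rw [cylMeasure, ae_restrict_iff' hmeas]
    filter_upwards [key] with z hz hz'
    exact sub_eq_zero.1 (hz hz')
  have hζ : IsTestFunction (cylinder Ω T) ζ := ⟨h1, h2, h3⟩
  rw [← setIntegral_eq_integral_of_forall_compl_eq_zero (s := cylinder Ω T) (fun z hz => by
    rw [image_eq_zero_of_notMem_tsupport (fun h => hz (h3 h)), zero_smul])]
  change ∫ z, ζ z • (w z - timeRep w₀ w' z.1 z.2) ∂(cylMeasure Ω T) = 0
  obtain ⟨Z, K, a, b, hZ, hZd, hK, hKΩ, ha, hab, hbT, hZa, hZK, hZb, hζa, hZv⟩ :=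
    exists_timePrimitive hT hζ
  have hmain := integral_timePrimitive hT hw hw' hd hi h₀ hζ hZ hZd hK hKΩ ha hab hbT hZa hZK hZb hζa
  obtain ⟨B, hB⟩ := hζ.compact.exists_bound_of_continuous hζ.smooth.continuous
  have hζm : AEStronglyMeasurable ζ (cylMeasure Ω T) := hζ.smooth.continuous.aestronglyMeasurable
  have e1 : ∫ x in Ω, w₀ x * Z (x, 0) = -∫ z, w₀ z.1 * ζ z ∂(cylMeasure Ω T) := by
    rw [hcyl, integral_prod, ← integral_neg]
    · congr 1
      ext x
      rw [hZv x 0 le_rfl, mul_neg]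
      simp only [integral_const_mul]
      congr 2
      refine integral_congr_ae ?_
      filter_upwards [ae_restrict_mem measurableSet_Ioo] with s hs
      rw [indicator_of_mem (mem_Ioi.2 hs.1)]
    · rw [← hcyl]
      exact integrable_mul_of_bounded hwi₀' hζm hB
  have hI : Integrable (fun z => (∫ s in Ioo 0 z.2, w' (z.1, s)) * ζ z) (cylMeasure Ω T) :=
    integrable_mul_of_bounded hP hζm hB
  have hBZ : ∃ B', ∀ z ∈ cylinder Ω T, |Z z| ≤ B' := by
    obtain ⟨B', hB'⟩ := (hK.prod (isCompact_Icc (a := 0) (b := T))).exists_bound_of_continuousOn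
      hZ.continuous.continuousOn
    refine ⟨max B' 0, ?_⟩
    rintro ⟨x, t⟩ ⟨hx, ht⟩
    by_cases hxK : x ∈ K
    · exact (hB' (x, t) ⟨hxK, ht.1.le, ht.2.le⟩).trans (le_max_left _ _)
    · rw [hZK x t hxK, abs_zero]; exact le_max_right _ _
  have hI' : Integrable (fun z => w' z * Z z) (cylMeasure Ω T) := by
    obtain ⟨B', hB'⟩ := hBZ
    exact hwi'.mul_bdd (c := B') hZ.continuous.aestronglyMeasurable
      ((ae_restrict_iff' hmeas).2 (Eventually.of_forall hB'))
  -- Fubini on the triangle t < s moves the time primitive from the test function to the weak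
  -- derivative.
  have e2 : ∫ z, w' z * Z z ∂(cylMeasure Ω T)
      = -∫ z, (∫ s in Ioo 0 z.2, w' (z.1, s)) * ζ z ∂(cylMeasure Ω T) := by
    rw [hcyl] at hI hI' ⊢
    rw [integral_prod _ hI, integral_prod _ hI', ← integral_neg]
    refine integral_congr_ae ?_
    have hwx : ∀ᵐ x ∂μ, Integrable (fun t => w' (x, t)) ν := by
      rw [hcyl] at hwi'
      exact hwi'.prod_right_ae
    filter_upwards [hwx] with x hx
    have hcx : Continuous (fun s => ζ (x, s)) := hζ.smooth.continuous.comp (by fun_prop)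
    have hinteg : Integrable (Function.uncurry fun t s =>
        {y : ℝ × ℝ | y.1 < y.2}.indicator (fun y => w' (x, y.1) * ζ (x, y.2)) (t, s)) (ν.prod ν) := by
      refine Integrable.indicator (f := fun y : ℝ × ℝ => w' (x, y.1) * ζ (x, y.2)) ?_
        (measurableSet_lt measurable_fst measurable_snd)
      exact integrable_mul_of_bounded (hx.comp_fst ν)
        (hcx.comp continuous_snd).aestronglyMeasurable fun y => hB _
    calc ∫ t, w' (x, t) * Z (x, t) ∂ν
        = -∫ t, ∫ s, {y : ℝ × ℝ | y.1 < y.2}.indicator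
            (fun y => w' (x, y.1) * ζ (x, y.2)) (t, s) ∂ν ∂ν := by
          rw [← integral_neg]
          refine integral_congr_ae ?_
          filter_upwards [ae_restrict_mem measurableSet_Ioo] with t ht
          rw [hZv x t ht.1.le, mul_neg, ← integral_const_mul]
          congr 2
          ext s
          by_cases hs : t < s
          · simp [indicator, hs]
          · simp [indicator, hs]
      _ = -∫ s, ∫ t, {y : ℝ × ℝ | y.1 < y.2}.indicator
            (fun y => w' (x, y.1) * ζ (x, y.2)) (t, s) ∂ν ∂ν := by
          rw [integral_integral_swap hinteg]
      _ = -∫ s, (∫ t in Ioo 0 s, w' (x, t)) * ζ (x, s) ∂ν := by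
          congr 1
          refine integral_congr_ae ?_
          filter_upwards [ae_restrict_mem measurableSet_Ioo] with s hs
          rw [setIntegral_Ioo_eq_indicator _ hs.2.le, ← integral_mul_const]
          congr 1
          ext t
          by_cases hst : t < s
          · simp [indicator, hst]
          · simp [indicator, hst]
  have hI0 : Integrable (fun z => w z * ζ z) (cylMeasure Ω T) :=
    integrable_mul_of_bounded hwi hζm hB
  have hI1 : Integrable (fun z => w₀ z.1 * ζ z) (cylMeasure Ω T) :=
    integrable_mul_of_bounded hwi₀' hζm hB
  have e3 : ∀ z, ζ z • (w z - timeRep w₀ w' z.1 z.2)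
      = w z * ζ z - (w₀ z.1 * ζ z + (∫ s in Ioo 0 z.2, w' (z.1, s)) * ζ z) := fun z => by
    rw [smul_eq_mul, timeRep]; ring
  have hI2 : Integrable (fun z => w₀ z.1 * ζ z + (∫ s in Ioo 0 z.2, w' (z.1, s)) * ζ z)
      (cylMeasure Ω T) := hI1.add hI
  simp_rw [e3]
  rw [integral_sub hI0 hI2, integral_add hI1 hI]
  rw [e1, e2] at hmain
  linarith

/-- Lipschitz continuity is required only along the values of the path. Absolutely continuous paths
are bounded, so any C¹ outer function qualifies. -/
theorem absolutelyContinuousOnInterval_comp_of_lipschitz {Φ y : ℝ → ℝ} {a b L : ℝ} (hL : 0 ≤ L)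
    (hy : AbsolutelyContinuousOnInterval y a b)
    (h : ∀ s ∈ uIcc a b, ∀ t ∈ uIcc a b, |Φ (y s) - Φ (y t)| ≤ L * |y s - y t|) :
    AbsolutelyContinuousOnInterval (fun t => Φ (y t)) a b := by
  rw [absolutelyContinuousOnInterval_iff] at hy ⊢
  intro ε hε
  obtain ⟨δ, hδ, hδ'⟩ := hy (ε / (L + 1)) (by positivity)
  refine ⟨δ, hδ, fun E hE hEδ => ?_⟩
  have h1 := hδ' E hE hEδ
  calc ∑ i ∈ Finset.range E.1, dist (Φ (y (E.2 i).1)) (Φ (y (E.2 i).2))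
      ≤ ∑ i ∈ Finset.range E.1, L * dist (y (E.2 i).1) (y (E.2 i).2) := by
        refine Finset.sum_le_sum fun i hi => ?_
        rw [Real.dist_eq, Real.dist_eq]
        exact h _ (hE.1 i hi).1 _ (hE.1 i hi).2
    _ = L * ∑ i ∈ Finset.range E.1, dist (y (E.2 i).1) (y (E.2 i).2) := by rw [Finset.mul_sum]
    _ ≤ L * (ε / (L + 1)) := by gcongr
    _ < ε := by
        rw [mul_div_assoc', div_lt_iff₀ (by positivity)]
        nlinarith

/-- The chain rule along absolutely continuous paths. -/
theorem sub_eq_integral_of_path {Φ φ : ℝ → ℝ} (hΦ : ∀ x, HasDerivAt Φ (φ x) x)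
    (hφ : Continuous φ) {k y : ℝ → ℝ} {a b : ℝ} (hab : a ≤ b)
    (hk : IntervalIntegrable k volume a b) (hy : ∀ t ∈ Icc a b, y t = y a + ∫ s in a..t, k s) :
    Φ (y b) - Φ (y a) = ∫ s in a..b, φ (y s) * k s := by
  set z : ℝ → ℝ := fun t => y a + ∫ s in a..t, k s with hz
  have hzac : AbsolutelyContinuousOnInterval z a b := by
    refine AbsolutelyContinuousOnInterval.add (f := fun _ => y a) ?_
      (hk.absolutelyContinuousOnInterval_intervalIntegral left_mem_uIcc)
    exact (LipschitzWith.const (y a)).lipschitzOnWith.absolutelyContinuousOnInterval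
  obtain ⟨B, hB⟩ := hzac.exists_bound
  obtain ⟨L, hL⟩ := (isCompact_Icc (a := -B) (b := B)).exists_bound_of_continuousOn hφ.continuousOn
  have hΦac : AbsolutelyContinuousOnInterval (fun t => Φ (z t)) a b := by
    refine absolutelyContinuousOnInterval_comp_of_lipschitz (L := max L 0) (le_max_right _ _) hzac ?_
    intro s hs t ht
    have := (convex_Icc (-B) B).norm_image_sub_le_of_norm_hasDerivWithin_le (f := Φ) (f' := φ)
      (C := max L 0) (fun x _ => (hΦ x).hasDerivWithinAt)
      (fun x hx => (hL x hx).trans (le_max_left _ _)) (x := z t) (y := z s)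
      (abs_le.1 (hB t ht)) (abs_le.1 (hB s hs))
    simpa using this
  have h1 := hΦac.integral_deriv_eq_sub
  have hyz : ∀ t ∈ Icc a b, y t = z t := hy
  rw [hyz b (right_mem_Icc.2 hab), hyz a (left_mem_Icc.2 hab), ← h1]
  refine intervalIntegral.integral_congr_ae ?_
  filter_upwards [hk.ae_hasDerivAt_integral] with t ht ht'
  have ht'' : t ∈ uIcc a b := uIoc_subset_uIcc ht'
  have h2 := (ht ht'' a left_mem_uIcc).const_add (y a)
  have h3 := (hΦ (z t)).comp t h2
  rw [hyz t (by rwa [uIcc_of_le hab] at ht'')]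
  exact h3.deriv

theorem ae_integrable_slice {Ω : Set (Space N)} [IsFiniteMeasure (volume.restrict Ω)] {T : ℝ}
    {F : Space N × ℝ → ℝ} (hF : Integrable F (cylMeasure Ω T)) :
    ∀ᵐ x ∂(volume.restrict Ω), IntegrableOn (fun t => F (x, t)) (Ioo 0 T) := by
  rw [cylMeasure_eq_prod] at hF
  exact hF.prod_right_ae

theorem timeRep_eq_intervalIntegral (w₀ : Space N → ℝ) (w' : Space N × ℝ → ℝ) (x : Space N)
    {t : ℝ} (ht : 0 ≤ t) : timeRep w₀ w' x t = w₀ x + ∫ s in (0 : ℝ)..t, w' (x, s) := by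
  rw [timeRep, intervalIntegral.integral_of_le ht, integral_Ioc_eq_integral_Ioo]

theorem continuousOn_timeRep {w₀ : Space N → ℝ} {w' : Space N × ℝ → ℝ} {x : Space N} {T : ℝ}
    (hT : 0 < T) (h : IntegrableOn (fun t => w' (x, t)) (Ioo 0 T)) :
    ContinuousOn (timeRep w₀ w' x) (Icc 0 T) := by
  have h1 : IntervalIntegrable (fun t => w' (x, t)) volume 0 T := by
    rw [intervalIntegrable_iff_integrableOn_Ioo_of_le hT.le]; exact h
  have h2 := (h1.absolutelyContinuousOnInterval_intervalIntegral
    (left_mem_uIcc (a := (0 : ℝ)) (b := T))).continuousOn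
  rw [uIcc_of_le hT.le] at h2
  exact (continuousOn_const.add h2).congr fun t ht => timeRep_eq_intervalIntegral w₀ w' x ht.1

theorem timeRep_zero (w₀ : Space N → ℝ) (w' : Space N × ℝ → ℝ) (x : Space N) :
    timeRep w₀ w' x 0 = w₀ x := by simp [timeRep]

/-- The representative is square integrable at every time, not just almost every one, so energies
can be evaluated at arbitrary endpoints. The reason is Cauchy–Schwarz in time, (∫|w'|)² ≤ T ∫|w'|²,
for almost every x. -/
theorem memLp_timeRep {Ω : Set (Space N)} [IsFiniteMeasure (volume.restrict Ω)] {T : ℝ}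
    (hT : 0 < T) {w' : Space N × ℝ → ℝ} {w₀ : Space N → ℝ} (hw' : MemLp w' 2 (cylMeasure Ω T))
    (h₀ : MemLp w₀ 2 (volume.restrict Ω)) {t : ℝ} (ht : t ≤ T) :
    MemLp (fun x => timeRep w₀ w' x t) 2 (volume.restrict Ω) := by
  set μ := volume.restrict Ω with hμ
  set ν := (volume : Measure ℝ).restrict (Ioo 0 T) with hν
  have hcyl : cylMeasure Ω T = μ.prod ν := cylMeasure_eq_prod Ω T
  have hνT : ν.real univ = T := by simp [hν, hT.le]
  rw [hcyl] at hw'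
  have hwi' : Integrable w' (μ.prod ν) := hw'.integrable (by norm_num)
  have hsq : Integrable (fun z => w' z ^ 2) (μ.prod ν) := hw'.integrable_sq
  have hm : AEStronglyMeasurable (fun x => ∫ s in Ioo 0 t, w' (x, s)) μ := by
    have h1 : AEStronglyMeasurable ({z : Space N × ℝ | z.2 < t}.indicator w') (μ.prod ν) :=
      hwi'.1.indicator (measurableSet_lt measurable_snd measurable_const)
    refine h1.integral_prod_right'.congr (Eventually.of_forall fun x => ?_)
    simp only
    rw [setIntegral_Ioo_eq_indicator _ ht]
    rfl
  refine h₀.add ((memLp_two_iff_integrable_sq hm).2 ?_)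
  refine (hsq.integral_prod_left.const_mul T).mono' (hm.pow 2) ?_
  filter_upwards [hwi'.prod_right_ae, hsq.prod_right_ae] with x hx1 hx2
  set A := ∫ s, |w' (x, s)| ∂ν with hA
  set Q := ∫ s, w' (x, s) ^ 2 ∂ν with hQ
  have h1 : |∫ s in Ioo 0 t, w' (x, s)| ≤ A := by
    rw [setIntegral_Ioo_eq_indicator _ ht]
    refine (abs_integral_le_integral_abs).trans (integral_mono_of_nonneg
      (Eventually.of_forall fun s => abs_nonneg _) hx1.abs (Eventually.of_forall fun s => ?_))
    by_cases hs : s < t <;> simp [indicator, hs]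
  -- Expanding the square of the deviation from the mean A/T gives A² ≤ T Q.
  have h2 : 0 ≤ ∫ s, (|w' (x, s)| - A / T) ^ 2 ∂ν := integral_nonneg fun s => sq_nonneg _
  have h3 : ∫ s, (|w' (x, s)| - A / T) ^ 2 ∂ν = Q - 2 * (A / T) * A + (A / T) ^ 2 * T := by
    have e : ∀ s, (|w' (x, s)| - A / T) ^ 2
        = w' (x, s) ^ 2 - 2 * (A / T) * |w' (x, s)| + (A / T) ^ 2 := fun s => by
      rw [sub_sq, sq_abs]; ring
    have i1 : Integrable (fun s => w' (x, s) ^ 2 - 2 * (A / T) * |w' (x, s)|) ν :=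
      hx2.sub (hx1.abs.const_mul _)
    simp_rw [e]
    rw [integral_add i1 (integrable_const _), integral_sub hx2 (hx1.abs.const_mul _),
      integral_const_mul, integral_const, hνT, smul_eq_mul]
    ring
  rw [h3] at h2
  have h4 : A ^ 2 ≤ T * Q := by
    have e : Q - 2 * (A / T) * A + (A / T) ^ 2 * T = (T * Q - A ^ 2) / T := by
      field_simp; ring
    rw [e] at h2
    have := (le_div_iff₀ hT).1 h2
    linarith
  rw [Real.norm_of_nonneg (sq_nonneg _)]
  refine le_trans ?_ h4
  rw [← sq_abs]
  gcongr

/-! ### Scalar Dirichlet problems and the energy identity -/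

/-- Fubini for the weak gradient: slices in `W_0^{1,p}` have weak gradients. -/
theorem HasZeroTrace.hasWeakGrad {Ω : Set (Space N)} (hΩ : IsOpen Ω)
    [IsFiniteMeasure (volume.restrict Ω)] {T p : ℝ} (hp : 1 < p) {w : Space N × ℝ → ℝ}
    {g : Space N × ℝ → Space N} (hw : Integrable w (cylMeasure Ω T))
    (hg : Integrable g (cylMeasure Ω T)) (h : HasZeroTrace p Ω T w g) : HasWeakGrad Ω T w g := by
  intro ζ hζ e
  have hcyl := cylMeasure_eq_prod Ω T
  have hd : Continuous (fun z => fderiv ℝ ζ z (e, 0)) :=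
    (hζ.smooth.continuous_fderiv (by simp)).clm_apply continuous_const
  obtain ⟨B, hB⟩ := hζ.compact.exists_bound_of_continuous hζ.smooth.continuous
  obtain ⟨B', hB'⟩ := (hζ.compact.fderiv_apply ℝ ((e, 0) : Space N × ℝ)).exists_bound_of_continuous hd
  have hI1 : Integrable (fun z => w z * fderiv ℝ ζ z (e, 0)) (cylMeasure Ω T) :=
    integrable_mul_of_bounded hw hd.aestronglyMeasurable hB'
  have hI2 : Integrable (fun z => inner ℝ (g z) e * ζ z) (cylMeasure Ω T) :=
    integrable_mul_of_bounded (hg.inner_const e) hζ.smooth.continuous.aestronglyMeasurable hB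
  rw [hcyl] at hI1 hI2 ⊢
  rw [integral_prod_symm _ hI1, integral_prod_symm _ hI2, ← integral_neg]
  refine integral_congr_ae ?_
  filter_upwards [h] with t ht
  have hζt : ContDiff ℝ 1 (fun x => ζ (x, t)) :=
    (hζ.smooth.of_le (by simp)).comp (contDiff_id.prodMk contDiff_const)
  have hder : ∀ x, fderiv ℝ (fun x => ζ (x, t)) x e = fderiv ℝ ζ (x, t) (e, 0) := by
    intro x
    have h1 : HasFDerivAt (fun x : Space N => ((x, t) : Space N × ℝ))
        ((ContinuousLinearMap.id ℝ (Space N)).prod 0) x :=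
      (hasFDerivAt_id x).prodMk (hasFDerivAt_const t x)
    have h2 := ((hζ.smooth.differentiable (by simp)) (x, t)).hasFDerivAt.comp x h1
    have h3 : fderiv ℝ (fun x => ζ (x, t)) x = _ := h2.fderiv
    rw [h3]
    simp
  have := ht.integral_mul_fderiv hΩ hp hζt (B := max B B') e
    (fun x _ => (hB (x, t)).trans (le_max_left _ _))
    (fun x _ => by rw [hder]; exact (hB' (x, t)).trans (le_max_right _ _))
  simp only [hder] at this
  exact this

/-- One equation of the system: `w` solves `w_t = div(|∇w|^{p-2}∇w) + f` in `Q_T` with zero lateral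
boundary values and initial value `w₀`. -/
structure IsDirichletSolution (p : ℝ) (Ω : Set (Space N)) (T : ℝ) (w w' : Space N × ℝ → ℝ)
    (g : Space N × ℝ → Space N) (f : Space N × ℝ → ℝ) (w₀ : Space N → ℝ) : Prop where
  memLp_two : MemLp w 2 (cylMeasure Ω T)
  memLp_deriv : MemLp w' 2 (cylMeasure Ω T)
  memLp_grad : MemLp g (ENNReal.ofReal p) (cylMeasure Ω T)
  weakDeriv : HasWeakTimeDeriv Ω T w w'
  zeroTrace : HasZeroTrace p Ω T w g
  equation : SatisfiesEquation p Ω T w' g f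
  initial : HasInitialValue Ω w w₀
  source : MemLp f 2 (cylMeasure Ω T)
  memLp_initial : MemLp w₀ 2 (volume.restrict Ω)

theorem memLp_comp_fst {E : Type*} [NormedAddCommGroup E] {Ω : Set (Space N)}
    [IsFiniteMeasure (volume.restrict Ω)] {T : ℝ} {q : ℝ≥0∞} {h : Space N → E}
    (hh : MemLp h q (volume.restrict Ω)) : MemLp (fun z : Space N × ℝ => h z.1) q (cylMeasure Ω T) := by
  rw [cylMeasure_eq_prod]
  exact hh.comp_fst _

theorem ae_cylMeasure_mem (Ω : Set (Space N)) (T : ℝ) :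
    ∀ᵐ z ∂(cylMeasure Ω T), z.2 ∈ Ioo 0 T := by
  rw [cylMeasure_eq_prod]
  exact Measure.quasiMeasurePreserving_snd.ae (ae_restrict_mem measurableSet_Ioo)

theorem ae_cylMeasure_of_ae_fst {Ω : Set (Space N)} {T : ℝ} {P : Space N → Prop}
    (h : ∀ᵐ x ∂(volume.restrict Ω), P x) : ∀ᵐ z ∂(cylMeasure Ω T), P z.1 := by
  rw [cylMeasure_eq_prod]
  exact Measure.quasiMeasurePreserving_fst.ae h

theorem ae_slice {Ω : Set (Space N)} {T : ℝ} {P : Space N × ℝ → Prop}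
    (h : ∀ᵐ z ∂(cylMeasure Ω T), P z) :
    ∀ᵐ t ∂((volume : Measure ℝ).restrict (Ioo 0 T)), ∀ᵐ x ∂(volume.restrict Ω), P (x, t) := by
  rw [cylMeasure_eq_prod] at h
  have h1 := Measure.ae_ae_of_ae_prod
    ((Measure.measurePreserving_swap (μ := (volume : Measure ℝ).restrict (Ioo 0 T))
      (ν := volume.restrict Ω)).quasiMeasurePreserving.ae h)
  exact h1

theorem ae_slice' {Ω : Set (Space N)} {T : ℝ} {P : Space N × ℝ → Prop}
    (h : ∀ᵐ z ∂(cylMeasure Ω T), P z) :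
    ∀ᵐ x ∂(volume.restrict Ω), ∀ᵐ t ∂((volume : Measure ℝ).restrict (Ioo 0 T)), P (x, t) := by
  rw [cylMeasure_eq_prod] at h
  exact Measure.ae_ae_of_ae_prod h

/-- Truncations of the solution, localized in time, are admissible test functions. -/
theorem memTestSpace_comp {Ω : Set (Space N)} (hΩ : IsOpen Ω)
    [IsFiniteMeasure (volume.restrict Ω)] {T p : ℝ} (hp : 1 < p) {w : Space N × ℝ → ℝ}
    {g : Space N × ℝ → Space N} (hw : MemLp w 2 (cylMeasure Ω T))
    (hg : MemLp g (ENNReal.ofReal p) (cylMeasure Ω T)) (hz : HasZeroTrace p Ω T w g)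
    {φ : ℝ → ℝ} (hφ : ContDiff ℝ 1 φ) {L : ℝ} (hL : ∀ y, |deriv φ y| ≤ L)
    {h : Space N → ℝ} {gh : Space N → Space N} (hh : MemW0 p Ω h gh)
    (hh2 : MemLp h 2 (volume.restrict Ω)) {c : ℝ → ℝ} (hc : Continuous c)
    (hc0 : ∀ t ∈ Ioo 0 T, φ (-c t) = 0) {I : Set ℝ} (hI : MeasurableSet I) :
    MemTestSpace p Ω T (fun z => I.indicator 1 z.2 * φ (w z - h z.1 - c z.2))
      (fun z => (I.indicator 1 z.2 : ℝ) • (deriv φ (w z - h z.1 - c z.2) • (g z - gh z.1))) := by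
  have hp' : 1 ≤ ENNReal.ofReal p := by simpa using ENNReal.ofReal_le_ofReal hp.le
  have hL0 : 0 ≤ L := (abs_nonneg _).trans (hL 0)
  have hind : ∀ t : ℝ, ‖(I.indicator 1 t : ℝ)‖ ≤ 1 := fun t => by
    by_cases ht : t ∈ I <;> simp [ht]
  have him : AEStronglyMeasurable (fun z : Space N × ℝ => (I.indicator 1 z.2 : ℝ))
      (cylMeasure Ω T) :=
    ((measurable_const.indicator hI).comp measurable_snd).aestronglyMeasurable
  have hWm : AEStronglyMeasurable (fun z : Space N × ℝ => w z - h z.1 - c z.2) (cylMeasure Ω T) :=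
    (hw.1.sub (memLp_comp_fst hh2).1).sub (hc.comp continuous_snd).aestronglyMeasurable
  have hcd : Continuous (deriv φ) := hφ.continuous_deriv le_rfl
  have hmem2 : MemLp (fun z => I.indicator 1 z.2 * φ (w z - h z.1 - c z.2)) 2 (cylMeasure Ω T) := by
    refine (hw.sub (memLp_comp_fst hh2)).of_le_mul (c := L)
      (him.mul (hφ.continuous.comp_aestronglyMeasurable hWm)) ?_
    filter_upwards [ae_cylMeasure_mem Ω T] with z hz
    rw [norm_mul]
    have h1 := abs_sub_le_of_deriv_le hφ hL (w z - h z.1 - c z.2) (-c z.2)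
    rw [hc0 _ hz, sub_zero] at h1
    calc ‖(I.indicator 1 z.2 : ℝ)‖ * ‖φ (w z - h z.1 - c z.2)‖
        ≤ 1 * ‖φ (w z - h z.1 - c z.2)‖ := by gcongr; exact hind _
      _ ≤ L * |w z - h z.1 - c z.2 - -c z.2| := by rw [one_mul]; exact h1
      _ = _ := by rw [Pi.sub_apply, Real.norm_eq_abs]; congr 2; ring
  have hmemg : MemLp (fun z => (I.indicator 1 z.2 : ℝ) •
      (deriv φ (w z - h z.1 - c z.2) • (g z - gh z.1))) (ENNReal.ofReal p) (cylMeasure Ω T) := by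
    have hgg := hg.sub (memLp_comp_fst (T := T) hh.2.1)
    refine hgg.of_le_mul (c := L)
      (him.smul ((hcd.comp_aestronglyMeasurable hWm).smul hgg.1)) (Eventually.of_forall fun z => ?_)
    rw [norm_smul, norm_smul]
    calc ‖(I.indicator 1 z.2 : ℝ)‖ * (‖deriv φ (w z - h z.1 - c z.2)‖ * ‖g z - gh z.1‖)
        ≤ 1 * (L * ‖g z - gh z.1‖) := by
          gcongr
          · exact hind _
          · exact hL _
      _ = _ := by rw [one_mul]; rfl
  have htrace : HasZeroTrace p Ω T (fun z => I.indicator 1 z.2 * φ (w z - h z.1 - c z.2))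
      (fun z => (I.indicator 1 z.2 : ℝ) • (deriv φ (w z - h z.1 - c z.2) • (g z - gh z.1))) := by
    filter_upwards [hz, ae_restrict_mem measurableSet_Ioo] with t ht ht'
    exact ((ht.sub hp.le hh).comp_sub_const hΩ hp.le hφ hL (hc0 t ht')).const_mul _
  exact ⟨hmem2, hmemg, htrace.hasWeakGrad hΩ hp (hmem2.integrable (by norm_num))
    (hmemg.integrable hp'), htrace⟩

theorem integrable_mul_of_memLp_two {α : Type*} [MeasurableSpace α] {μ : Measure α}
    {f g : α → ℝ} (hf : MemLp f 2 μ) (hg : MemLp g 2 μ) : Integrable (fun x => f x * g x) μ :=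
  hf.integrable_mul hg

/-- A function with bounded derivative has a primitive of at most quadratic growth, which is
integrable along L² functions. -/
theorem abs_primitive_le {φ : ℝ → ℝ} (hφ : ContDiff ℝ 1 φ) {L : ℝ} (hL : ∀ y, |deriv φ y| ≤ L)
    (x : ℝ) : |primitive φ x| ≤ |φ 0| * |x| + L * x ^ 2 := by
  have hL0 : 0 ≤ L := (abs_nonneg _).trans (hL 0)
  have h1 : ∀ t ∈ uIoc 0 x, ‖φ t‖ ≤ |φ 0| + L * |x| := by
    intro t ht
    have h2 := abs_sub_le_of_deriv_le hφ hL t 0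
    have h3 : |t| ≤ |x| := by
      rcases le_total 0 x with hx | hx
      · rw [uIoc_of_le hx] at ht
        rw [abs_of_pos ht.1, abs_of_nonneg hx]; exact ht.2
      · rw [uIoc_of_ge hx] at ht
        rw [abs_of_nonpos ht.2, abs_of_nonpos hx]; linarith [ht.1]
    rw [sub_zero] at h2
    have h4 : |φ t| ≤ |φ t - φ 0| + |φ 0| := by
      simpa using abs_add_le (φ t - φ 0) (φ 0)
    have h5 : L * |t| ≤ L * |x| := by gcongr
    rw [Real.norm_eq_abs]
    linarith
  have := intervalIntegral.norm_integral_le_of_norm_le_const h1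
  rw [sub_zero] at this
  rw [primitive, ← Real.norm_eq_abs (∫ t in (0 : ℝ)..x, φ t)]
  refine this.trans (le_of_eq ?_)
  rw [add_mul, mul_assoc, ← sq, sq_abs]

theorem integrable_primitive_comp {α : Type*} [MeasurableSpace α] {μ : Measure α}
    [IsFiniteMeasure μ] {φ : ℝ → ℝ} (hφ : ContDiff ℝ 1 φ) {L : ℝ} (hL : ∀ y, |deriv φ y| ≤ L)
    {F : α → ℝ} (hF : MemLp F 2 μ) : Integrable (fun x => primitive φ (F x)) μ := by
  have h1 : Integrable (fun x => |φ 0| * |F x| + L * F x ^ 2) μ :=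
    ((hF.integrable (by norm_num)).abs.const_mul _).add (hF.integrable_sq.const_mul _)
  exact h1.mono' ((continuous_primitive hφ.continuous).comp_aestronglyMeasurable hF.1)
    (Eventually.of_forall fun x => abs_primitive_le hφ hL _)

theorem cylMeasure_sub_le {Ω : Set (Space N)} {T t₁ t₂ : ℝ} (h1 : 0 ≤ t₁) (h2 : t₂ ≤ T) :
    (volume.restrict Ω).prod ((volume : Measure ℝ).restrict (Ioo t₁ t₂)) ≤ cylMeasure Ω T := by
  rw [Measure.prod_restrict, cylMeasure, cylinder, ← Measure.volume_eq_prod]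
  exact Measure.restrict_mono (prod_mono_right (Ioo_subset_Ioo h1 h2)) le_rfl

/-- The energy identity. -/
theorem IsDirichletSolution.energy {Ω : Set (Space N)} (hΩ : IsOpen Ω)
    [IsFiniteMeasure (volume.restrict Ω)] {T p : ℝ} (hT : 0 < T) (hp : 1 < p)
    {w w' f : Space N × ℝ → ℝ} {g : Space N × ℝ → Space N} {w₀ : Space N → ℝ}
    (hs : IsDirichletSolution p Ω T w w' g f w₀)
    {φ : ℝ → ℝ} (hφ : ContDiff ℝ 1 φ) {L : ℝ} (hL : ∀ y, |deriv φ y| ≤ L)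
    {h : Space N → ℝ} {gh : Space N → Space N} (hh : MemW0 p Ω h gh)
    (hh2 : MemLp h 2 (volume.restrict Ω)) {c : ℝ → ℝ} (hc : ContDiff ℝ 1 c)
    (hc0 : ∀ t ∈ Ioo 0 T, φ (-c t) = 0)
    (hpos : ∀ᵐ z ∂(cylMeasure Ω T), 0 ≤ φ (w z - h z.1 - c z.2)) {t₁ t₂ : ℝ} (ht₁ : 0 ≤ t₁)
    (ht : t₁ ≤ t₂) (ht₂ : t₂ ≤ T) :
    Integrable (fun z => (f z - deriv c z.2) * φ (w z - h z.1 - c z.2)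
        - deriv φ (w z - h z.1 - c z.2) * inner ℝ (flux p (g z)) (g z - gh z.1)) (cylMeasure Ω T) ∧
    (∫ x in Ω, primitive φ (timeRep w₀ w' x t₂ - h x - c t₂))
      - (∫ x in Ω, primitive φ (timeRep w₀ w' x t₁ - h x - c t₁))
      = ∫ z, ((f z - deriv c z.2) * φ (w z - h z.1 - c z.2)
        - deriv φ (w z - h z.1 - c z.2) * inner ℝ (flux p (g z)) (g z - gh z.1))
        ∂((volume.restrict Ω).prod ((volume : Measure ℝ).restrict (Ioo t₁ t₂))) := by
  set μ := volume.restrict Ω with hμ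
  have hcc := hc.continuous
  have hdc : Continuous (deriv c) := hc.continuous_deriv le_rfl
  set W : Space N × ℝ → ℝ := fun z => w z - h z.1 - c z.2 with hW
  -- The test space demands no regularity in time, so the equation may be localized to (t₁, t₂) by a
  -- sharp indicator.
  set I : Set ℝ := Ioo t₁ t₂ with hIdef
  have hIm : MeasurableSet I := measurableSet_Ioo
  have htest := memTestSpace_comp hΩ hp hs.memLp_two hs.memLp_grad hs.zeroTrace hφ hL hh hh2 hcc hc0
    hIm
  have htest1 := memTestSpace_comp hΩ hp hs.memLp_two hs.memLp_grad hs.zeroTrace hφ hL hh hh2 hcc hc0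
    MeasurableSet.univ
  simp only [indicator_univ, Pi.one_apply, one_mul, one_smul] at htest1
  have hφW2 : MemLp (fun z => φ (W z)) 2 (cylMeasure Ω T) := htest1.memLp_two
  have hdc2 : MemLp (fun z : Space N × ℝ => deriv c z.2) 2 (cylMeasure Ω T) := by
    obtain ⟨B, hB⟩ := (isCompact_Icc (a := (0 : ℝ)) (b := T)).exists_bound_of_continuousOn
      hdc.continuousOn
    refine MemLp.of_bound (hdc.comp continuous_snd).aestronglyMeasurable B ?_
    filter_upwards [ae_cylMeasure_mem Ω T] with z hz using hB _ ⟨hz.1.le, hz.2.le⟩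
  have i1 : Integrable (fun z => w' z * φ (W z)) (cylMeasure Ω T) :=
    integrable_mul_of_memLp_two hs.memLp_deriv hφW2
  have i2 : Integrable (fun z => f z * φ (W z)) (cylMeasure Ω T) :=
    integrable_mul_of_memLp_two hs.source hφW2
  have i3 : Integrable (fun z => deriv c z.2 * φ (W z)) (cylMeasure Ω T) :=
    integrable_mul_of_memLp_two hdc2 hφW2
  have i4 : Integrable (fun z => deriv φ (W z) * inner ℝ (flux p (g z)) (g z - gh z.1))
      (cylMeasure Ω T) := by
    have := integrable_inner_flux hp hs.memLp_grad htest1.memLp_grad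
    simpa only [real_inner_smul_right] using this
  have hle := cylMeasure_sub_le (Ω := Ω) ht₁ ht₂
  have hrestr : ∀ F : Space N × ℝ → ℝ, ∫ z, I.indicator 1 z.2 * F z ∂(cylMeasure Ω T)
      = ∫ z, F z ∂(μ.prod ((volume : Measure ℝ).restrict I)) := by
    intro F
    have e1 : μ.prod ((volume : Measure ℝ).restrict I)
        = (cylMeasure Ω T).restrict (Prod.snd ⁻¹' I) := by
      rw [cylMeasure, Measure.restrict_restrict (measurable_snd hIm), hμ, Measure.prod_restrict,
        ← Measure.volume_eq_prod]
      congr 1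
      ext ⟨x, t⟩
      simp only [cylinder, mem_prod, mem_inter_iff, mem_preimage]
      constructor
      · rintro ⟨hx, hxt⟩
        exact ⟨hxt, hx, by linarith [hxt.1], by linarith [hxt.2]⟩
      · rintro ⟨hxt, hx, -⟩; exact ⟨hx, hxt⟩
    rw [e1, ← integral_indicator (measurable_snd hIm)]
    congr 1
    ext z
    by_cases hz : z.2 ∈ I
    · simp [indicator, hz]
    · simp [indicator, hz]
  have heq := hs.equation _ _ htest (by
    filter_upwards [hpos] with z hz
    exact mul_nonneg (indicator_nonneg (fun _ _ => zero_le_one) _) hz)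
  have heq' : ∫ z, w' z * φ (W z) ∂(μ.prod ((volume : Measure ℝ).restrict I))
      = ∫ z, (f z * φ (W z) - deriv φ (W z) * inner ℝ (flux p (g z)) (g z - gh z.1))
        ∂(μ.prod ((volume : Measure ℝ).restrict I)) := by
    have e1 : ∀ z, w' z * (I.indicator 1 z.2 * φ (w z - h z.1 - c z.2)) + ‖g z‖ ^ (p - 2) *
        inner ℝ (g z) ((I.indicator 1 z.2 : ℝ) • (deriv φ (w z - h z.1 - c z.2) • (g z - gh z.1)))
        = I.indicator 1 z.2 * (w' z * φ (W z) +
          deriv φ (W z) * inner ℝ (flux p (g z)) (g z - gh z.1)) := fun z => by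
      rw [real_inner_smul_right, real_inner_smul_right, inner_flux]; ring
    have e2 : ∀ z, f z * (I.indicator 1 z.2 * φ (w z - h z.1 - c z.2))
        = I.indicator 1 z.2 * (f z * φ (W z)) := fun z => by ring
    simp_rw [e1, e2] at heq
    rw [hrestr, hrestr, integral_add (i1.mono_measure hle) (i4.mono_measure hle)] at heq
    rw [integral_sub (i2.mono_measure hle) (i4.mono_measure hle), ← heq]
    ring
  have hrep := ae_eq_timeRep hΩ hT hs.memLp_two hs.memLp_deriv hs.weakDeriv hs.initial
    hs.memLp_initial
  have hWt : ∀ t ≤ T, MemLp (fun x => timeRep w₀ w' x t - h x - c t) 2 μ := fun t htT =>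
    ((memLp_timeRep hT hs.memLp_deriv hs.memLp_initial htT).sub hh2).sub (memLp_const _)
  have i5 : Integrable (fun z => φ (W z) * (w' z - deriv c z.2)) (cylMeasure Ω T) := by
    refine (i1.sub i3).congr (Eventually.of_forall fun z => ?_)
    simp only [Pi.sub_apply]; ring
  have htime : (∫ x, primitive φ (timeRep w₀ w' x t₂ - h x - c t₂) ∂μ)
      - (∫ x, primitive φ (timeRep w₀ w' x t₁ - h x - c t₁) ∂μ)
      = ∫ z, φ (W z) * (w' z - deriv c z.2) ∂(μ.prod ((volume : Measure ℝ).restrict I)) := by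
    rw [integral_prod _ (i5.mono_measure hle), ← integral_sub
      (integrable_primitive_comp hφ hL (hWt t₂ ht₂))
      (integrable_primitive_comp hφ hL (hWt t₁ (ht.trans ht₂)))]
    refine integral_congr_ae ?_
    filter_upwards [ae_slice' hrep, ae_integrable_slice (hs.memLp_deriv.integrable (by norm_num))]
      with x hx hxi
    have hk1 : IntervalIntegrable (fun t => w' (x, t)) volume 0 T := by
      rw [intervalIntegrable_iff_integrableOn_Ioo_of_le hT.le]; exact hxi
    have hk2 : ∀ a b, 0 ≤ a → a ≤ b → b ≤ T →
        IntervalIntegrable (fun t => w' (x, t)) volume a b := fun a b h0 h1 h2 =>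
      hk1.mono_set (by
        rw [uIcc_of_le h1, uIcc_of_le hT.le]
        exact Icc_subset_Icc h0 h2)
    -- For almost every x the shifted representative is absolutely continuous in time with
    -- derivative w' - c', and the chain rule along this path is integrated over x afterwards.
    have hpath := sub_eq_integral_of_path (Φ := primitive φ) (φ := φ)
      (fun y => hasDerivAt_primitive hφ.continuous y) hφ.continuous
      (k := fun t => w' (x, t) - deriv c t) (y := fun t => timeRep w₀ w' x t - h x - c t) ht
      ((hk2 t₁ t₂ ht₁ ht ht₂).sub (hdc.intervalIntegrable _ _)) (fun t htt => by
        rw [intervalIntegral.integral_sub (hk2 t₁ t ht₁ htt.1 (htt.2.trans ht₂))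
          (hdc.intervalIntegrable _ _), intervalIntegral.integral_deriv_eq_sub
            (fun s _ => hc.differentiable one_ne_zero s) (hdc.intervalIntegrable _ _),
          timeRep_eq_intervalIntegral _ _ _ ht₁, timeRep_eq_intervalIntegral _ _ _ (ht₁.trans htt.1),
          ← intervalIntegral.integral_add_adjacent_intervals
            (hk2 0 t₁ le_rfl ht₁ (ht.trans ht₂)) (hk2 t₁ t ht₁ htt.1 (htt.2.trans ht₂))]
        ring)
    rw [hpath, intervalIntegral.integral_of_le ht, integral_Ioc_eq_integral_Ioo]
    refine integral_congr_ae ?_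
    have hx' := ae_restrict_of_ae_restrict_of_subset (Ioo_subset_Ioo ht₁ ht₂) hx
    filter_upwards [hx'] with t htx
    simp only [hW, htx]
  refine ⟨?_, ?_⟩
  · refine ((i2.sub i3).sub i4).congr (Eventually.of_forall fun z => ?_)
    simp only [Pi.sub_apply]; ring
  · rw [htime]
    have e1 : ∀ z, φ (W z) * (w' z - deriv c z.2) = w' z * φ (W z) - deriv c z.2 * φ (W z) :=
      fun z => by ring
    have e2 : ∀ z, (f z - deriv c z.2) * φ (W z)
        - deriv φ (W z) * inner ℝ (flux p (g z)) (g z - gh z.1)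
        = (f z * φ (W z) - deriv φ (W z) * inner ℝ (flux p (g z)) (g z - gh z.1))
          - deriv c z.2 * φ (W z) := fun z => by ring
    have i6 : Integrable (fun z => f z * φ (W z)
        - deriv φ (W z) * inner ℝ (flux p (g z)) (g z - gh z.1))
        (μ.prod ((volume : Measure ℝ).restrict I)) := (i2.sub i4).mono_measure hle
    simp_rw [e1]
    rw [integral_sub (i1.mono_measure hle) (i3.mono_measure hle), heq',
      ← integral_sub i6 (i3.mono_measure hle)]
    congr 1
    ext z
    exact (e2 z).symm

/-! ### Comparison of coupled systems with barriers -/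

/-- Integral Gronwall inequality with vanishing initial value. -/
theorem integral_eq_zero_of_le_mul_primitive {T C : ℝ} (hT : 0 < T) {G : ℝ → ℝ}
    (hG : IntegrableOn G (Ioo 0 T)) (h0 : ∀ᵐ t ∂(volume.restrict (Ioo 0 T)), 0 ≤ G t)
    (h : ∀ᵐ t ∂(volume.restrict (Ioo 0 T)), G t ≤ C * ∫ s in Ioo 0 t, G s) :
    ∫ t in Ioo 0 T, G t = 0 := by
  set g := (Ioo 0 T).indicator G with hg
  have hgi : Integrable g := hG.integrable_indicator measurableSet_Ioo
  have hg0 : ∀ᵐ t, 0 ≤ g t := by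
    rw [ae_restrict_iff' measurableSet_Ioo] at h0
    filter_upwards [h0] with t ht
    by_cases htm : t ∈ Ioo 0 T
    · simp [hg, htm, ht htm]
    · simp [hg, htm]
  set H : ℝ → ℝ := fun t => ∫ s in (0 : ℝ)..t, g s with hH
  have hHc : Continuous H := intervalIntegral.continuous_primitive
    (fun a b => hgi.intervalIntegrable) 0
  have hH0 : ∀ t, 0 ≤ t → 0 ≤ H t := fun t ht =>
    intervalIntegral.integral_nonneg_of_ae ht hg0
  have hHe : ∀ t ∈ Icc 0 T, H t = ∫ s in Ioo 0 t, G s := by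
    intro t ht
    rw [hH]
    simp only
    rw [intervalIntegral.integral_of_le ht.1, integral_Ioc_eq_integral_Ioo]
    refine setIntegral_congr_fun measurableSet_Ioo fun s hs => ?_
    have : s ∈ Ioo 0 T := ⟨hs.1, hs.2.trans_le ht.2⟩
    simp [hg, this]
  have hle : ∀ᵐ t ∂(volume.restrict (Ioo 0 T)), G t ≤ C * H t := by
    filter_upwards [h, ae_restrict_mem measurableSet_Ioo] with t ht htm
    rw [hHe t ⟨htm.1.le, htm.2.le⟩]; exact ht
  -- `G` is merely integrable, so its primitive `H` need not be differentiable everywhere. One more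
  -- integration gives the C¹ function `primitive H`, to which the differential form of Gronwall
  -- applies.
  have hK : ∀ t ∈ Icc 0 T, H t ≤ C * primitive H t := by
    intro t ht
    rw [hHe t ht, primitive, intervalIntegral.integral_of_le ht.1, integral_Ioc_eq_integral_Ioo,
      ← integral_const_mul]
    refine integral_mono_ae (hG.mono_set (Ioo_subset_Ioo_right ht.2)) ?_
      (ae_restrict_of_ae_restrict_of_subset (Ioo_subset_Ioo_right ht.2) hle)
    exact ((hHc.const_mul C).continuousOn.integrableOn_Icc (a := 0) (b := t)).mono_set
      Ioo_subset_Icc_self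
  have hz := eq_zero_of_abs_deriv_le_mul_abs_self_of_eq_zero_right (f := primitive H) (f' := H)
    (K := |C|) (a := 0) (b := T) (continuous_primitive hHc).continuousOn
    (fun x _ => (hasDerivAt_primitive hHc x).hasDerivWithinAt) (primitive_zero H) (fun t ht => by
      rw [Real.norm_of_nonneg (hH0 t ht.1), Real.norm_eq_abs, ← abs_mul]
      exact (hK t ⟨ht.1, ht.2.le⟩).trans (le_abs_self _))
  have h1 := hK T ⟨hT.le, le_rfl⟩
  rw [hz T ⟨hT.le, le_rfl⟩, mul_zero] at h1
  rw [← hHe T ⟨hT.le, le_rfl⟩]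
  exact le_antisymm h1 (hH0 T hT.le)

/-- `h ∈ W_0^{1,p}(Ω)` with gradient `gh` satisfies `-div(|∇h|^{p-2}∇h) = κ` weakly in `Ω`. -/
structure IsBarrier (p : ℝ) (Ω : Set (Space N)) (κ : ℝ) (h : Space N → ℝ)
    (gh : Space N → Space N) : Prop where
  memW0 : MemW0 p Ω h gh
  memLp_two : MemLp h 2 (volume.restrict Ω)
  nonneg : ∀ᵐ x ∂(volume.restrict Ω), 0 ≤ h x
  integral_eq : ∀ (φ : Space N → ℝ) (gφ : Space N → Space N), MemW0 p Ω φ gφ →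
    ∫ x in Ω, inner ℝ (flux p (gh x)) (gφ x) = κ * ∫ x in Ω, φ x

/-- The excess of a solution over a barrier `h(x) + c(t)` that dominates it initially is controlled
by the excess of its source. -/
theorem IsDirichletSolution.excess_le {Ω : Set (Space N)} (hΩ : IsOpen Ω)
    [IsFiniteMeasure (volume.restrict Ω)] {T p : ℝ} (hT : 0 < T) (hp : 1 < p)
    {w w' f : Space N × ℝ → ℝ} {g : Space N × ℝ → Space N} {w₀ : Space N → ℝ}
    (hs : IsDirichletSolution p Ω T w w' g f w₀) {k : ℝ → ℝ} (hk : Continuous k) {L : ℝ}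
    (hk0 : ∀ y, 0 ≤ k y) (hkL : ∀ y, k y ≤ L) (hkn : ∀ y ≤ 0, k y = 0) {κ : ℝ}
    {h : Space N → ℝ} {gh : Space N → Space N} (hh : IsBarrier p Ω κ h gh) {c : ℝ → ℝ}
    (hc : ContDiff ℝ 1 c) (hc0 : ∀ t, 0 ≤ c t)
    (hi : ∀ᵐ x ∂(volume.restrict Ω), w₀ x ≤ h x + c 0) {D : Space N × ℝ → ℝ}
    (hD : Integrable D (cylMeasure Ω T))
    (hfD : ∀ᵐ z ∂(cylMeasure Ω T),
      (f z - deriv c z.2 - κ) * primitive k (w z - h z.1 - c z.2) ≤ D z) :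
    ∀ᵐ t ∂((volume : Measure ℝ).restrict (Ioo 0 T)),
      ∫ x in Ω, primitive (primitive k) (w (x, t) - h x - c t)
        ≤ ∫ s in Ioo 0 t, ∫ x in Ω, D (x, s) := by
  set μ := volume.restrict Ω with hμ
  set φ := primitive k with hφdef
  have hφ : ContDiff ℝ 1 φ := contDiff_primitive hk
  have hdφ : deriv φ = k := deriv_primitive hk
  have hL : ∀ y, |deriv φ y| ≤ L := fun y => by rw [hdφ, abs_of_nonneg (hk0 y)]; exact hkL y
  have hφn : ∀ y ≤ 0, φ y = 0 := fun y hy => primitive_of_nonpos hkn hy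
  have hφ0 : ∀ y, 0 ≤ φ y := primitive_nonneg_of_nonpos_eq_zero hk hk0 hkn
  have hφc : ∀ t ∈ Ioo 0 T, φ (-c t) = 0 := fun t _ => hφn _ (by linarith [hc0 t])
  have hrep := ae_eq_timeRep hΩ hT hs.memLp_two hs.memLp_deriv hs.weakDeriv hs.initial
    hs.memLp_initial
  have htest := memTestSpace_comp hΩ hp hs.memLp_two hs.memLp_grad hs.zeroTrace hφ hL hh.memW0
    hh.memLp_two hc.continuous hφc MeasurableSet.univ
  simp only [indicator_univ, Pi.one_apply, one_mul, one_smul] at htest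
  have i1 : Integrable (fun z : Space N × ℝ => deriv φ (w z - h z.1 - c z.2) *
      inner ℝ (flux p (gh z.1)) (g z - gh z.1)) (cylMeasure Ω T) := by
    have := integrable_inner_flux hp (memLp_comp_fst (T := T) hh.memW0.2.1) htest.memLp_grad
    simpa only [real_inner_smul_right] using this
  have i2 : Integrable (fun z : Space N × ℝ => κ * φ (w z - h z.1 - c z.2)) (cylMeasure Ω T) :=
    (htest.memLp_two.integrable (by norm_num)).const_mul κ
  have hslice : ∀ᵐ t ∂((volume : Measure ℝ).restrict (Ioo 0 T)),
      ∫ x in Ω, deriv φ (w (x, t) - h x - c t) * inner ℝ (flux p (gh x)) (g (x, t) - gh x)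
        = ∫ x in Ω, κ * φ (w (x, t) - h x - c t) := by
    filter_upwards [htest.zeroTrace] with t ht
    rw [integral_const_mul, ← hh.integral_eq _ _ ht]
    simp only [real_inner_smul_right]
  filter_upwards [ae_slice hrep, ae_restrict_mem measurableSet_Ioo] with t htr htm
  obtain ⟨hI, hE⟩ := hs.energy hΩ hT hp hφ hL hh.memW0 hh.memLp_two hc hφc
    (Eventually.of_forall fun z => hφ0 _) le_rfl htm.1.le htm.2.le
  have hle := cylMeasure_sub_le (Ω := Ω) (le_refl (0 : ℝ)) htm.2.le
  have hinit : ∫ x in Ω, primitive φ (timeRep w₀ w' x 0 - h x - c 0) = 0 := by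
    refine integral_eq_zero_of_ae ?_
    filter_upwards [hi] with x hx
    rw [timeRep_zero]
    exact primitive_of_nonpos hφn (by linarith)
  rw [hinit, sub_zero] at hE
  have hlhs : ∫ x in Ω, primitive φ (w (x, t) - h x - c t)
      = ∫ x in Ω, primitive φ (timeRep w₀ w' x t - h x - c t) := by
    refine integral_congr_ae ?_
    filter_upwards [htr] with x hx
    simp only [hx]
  rw [hlhs, hE]
  have i6 : Integrable (fun z : Space N × ℝ => deriv φ (w z - h z.1 - c z.2) *
      inner ℝ (flux p (gh z.1)) (g z - gh z.1) - κ * φ (w z - h z.1 - c z.2))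
      (μ.prod ((volume : Measure ℝ).restrict (Ioo 0 t))) := (i1.sub i2).mono_measure hle
  -- The barrier's weak equation, tested on almost every time slice. Adding this zero replaces the
  -- flux of g by the difference of the two fluxes, whose contribution has a sign by monotonicity,
  -- and brings in κ.
  have hzero : ∫ z, (deriv φ (w z - h z.1 - c z.2) * inner ℝ (flux p (gh z.1)) (g z - gh z.1)
      - κ * φ (w z - h z.1 - c z.2)) ∂(μ.prod ((volume : Measure ℝ).restrict (Ioo 0 t))) = 0 := by
    rw [integral_prod_symm _ i6]
    refine integral_eq_zero_of_ae ?_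
    have i4 := i1; have i5 := i2
    rw [cylMeasure_eq_prod] at i4 i5
    filter_upwards [ae_restrict_of_ae_restrict_of_subset (Ioo_subset_Ioo_right htm.2.le) hslice,
      ae_restrict_of_ae_restrict_of_subset (Ioo_subset_Ioo_right htm.2.le) i4.prod_left_ae,
      ae_restrict_of_ae_restrict_of_subset (Ioo_subset_Ioo_right htm.2.le) i5.prod_left_ae]
      with s hs1 hs2 hs3
    simp only [Pi.zero_apply]
    rw [integral_sub hs2 hs3, hs1, sub_self]
  rw [← integral_prod_symm _ (hD.mono_measure hle)]
  have hsum := integral_add (hI.mono_measure hle) i6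
  rw [hzero, add_zero] at hsum
  rw [← hsum]
  refine integral_mono_ae ((hI.mono_measure hle).add i6) (hD.mono_measure hle) ?_
  filter_upwards [Measure.absolutelyContinuous_of_le hle hfD] with z hz
  have h1 := flux_monotone hp (g z) (gh z.1)
  rw [inner_sub_left] at h1
  have h2 : 0 ≤ deriv φ (w z - h z.1 - c z.2) := by rw [hdφ]; exact hk0 _
  nlinarith [mul_nonneg h2 h1]

/-- Each integration of a nondecreasing nonnegative function loses at most the factor obtained by
keeping only the upper half of the interval. With the matching upper bound below, a doubling weight
k has second primitive comparable to x² k(x). -/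
theorem sq_mul_le_primitive_primitive {k : ℝ → ℝ} (hk : Continuous k) (hk0 : ∀ t, 0 ≤ k t)
    (hm : Monotone k) {x : ℝ} (hx : 0 ≤ x) :
    x ^ 2 / 8 * k (x / 4) ≤ primitive (primitive k) x := by
  have hc := continuous_primitive hk
  have h1 := half_mul_le_primitive hk hk0 (hm.monotoneOn _) (show 0 ≤ x / 2 by linarith)
  have hpm := monotone_primitive hk hk0
  have h2 : x / 2 * primitive k (x / 2) ≤ primitive (primitive k) x := by
    have h3 : primitive (primitive k) x = (∫ t in (0 : ℝ)..(x / 2), primitive k t)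
        + ∫ t in (x / 2)..x, primitive k t :=
      (intervalIntegral.integral_add_adjacent_intervals (hc.intervalIntegrable _ _)
        (hc.intervalIntegrable _ _)).symm
    have h4 : (0 : ℝ) ≤ ∫ t in (0 : ℝ)..(x / 2), primitive k t :=
      intervalIntegral.integral_nonneg (by linarith) fun t ht => primitive_nonneg hk hk0 ht.1
    have h5 : ∫ _ in (x / 2)..x, primitive k (x / 2) ≤ ∫ t in (x / 2)..x, primitive k t :=
      intervalIntegral.integral_mono_on (by linarith) (by simp) (hc.intervalIntegrable _ _)
        fun t ht => hpm ht.1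
    rw [intervalIntegral.integral_const, smul_eq_mul] at h5
    rw [h3]
    nlinarith
  calc x ^ 2 / 8 * k (x / 4) = x / 2 * (x / 2 / 2 * k (x / 2 / 2)) := by
        rw [show x / 2 / 2 = x / 4 by ring]; ring
    _ ≤ x / 2 * primitive k (x / 2) := by gcongr
    _ ≤ _ := h2

theorem primitive_primitive_le {k : ℝ → ℝ} (hk : Continuous k) (hk0 : ∀ t, 0 ≤ k t)
    (hm : Monotone k) {x : ℝ} (hx : 0 ≤ x) : primitive (primitive k) x ≤ x ^ 2 * k x := by
  calc primitive (primitive k) x ≤ x * primitive k x :=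
        primitive_le_mul (continuous_primitive hk) ((monotone_primitive hk hk0).monotoneOn _) hx
    _ ≤ x * (x * k x) := by gcongr; exact primitive_le_mul hk (hm.monotoneOn _) hx
    _ = _ := by ring

theorem primitive_mono {h k : ℝ → ℝ} (hh : Continuous h) (hk : Continuous k)
    (hle : ∀ t, h t ≤ k t) {x : ℝ} (hx : 0 ≤ x) : primitive h x ≤ primitive k x :=
  intervalIntegral.integral_mono_on hx (hh.intervalIntegrable _ _) (hk.intervalIntegrable _ _)
    fun t _ => hle t

theorem primitive_congr {h k : ℝ → ℝ} {j x : ℝ} (hj : 0 ≤ j) (heq : ∀ t ≤ j, h t = k t)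
    (hx : x ≤ j) : primitive h x = primitive k x :=
  intervalIntegral.integral_congr fun t ht => heq t (by
    rcases le_total 0 x with h0 | h0
    · rw [uIcc_of_le h0] at ht; exact ht.2.trans hx
    · rw [uIcc_of_ge h0] at ht; exact ht.2.trans hj)

/-- The weight `min(y_+, 1) (1 + min(y_+, j))^{2ρ-2}`. -/
noncomputable def truncWeight (ρ j y : ℝ) : ℝ := ramp y * (1 + min (max y 0) j) ^ (2 * ρ - 2)

/-- The weight `min(y_+, 1) (1 + y_+)^{2ρ-2}`. -/
noncomputable def powWeight (ρ y : ℝ) : ℝ := ramp y * (1 + max y 0) ^ (2 * ρ - 2)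

theorem continuous_truncWeight (ρ : ℝ) {j : ℝ} (hj : 0 ≤ j) : Continuous (truncWeight ρ j) := by
  refine continuous_ramp.mul (Continuous.rpow_const (by fun_prop) fun y => Or.inl ?_)
  have : 0 ≤ min (max y 0) j := le_min (le_max_right _ _) hj
  linarith

theorem continuous_powWeight (ρ : ℝ) : Continuous (powWeight ρ) := by
  refine continuous_ramp.mul (Continuous.rpow_const (by fun_prop) fun y => Or.inl ?_)
  have : 0 ≤ max y 0 := le_max_right _ _
  linarith

theorem powWeight_nonneg (ρ y : ℝ) : 0 ≤ powWeight ρ y := by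
  have := ramp_nonneg y
  unfold powWeight; positivity

theorem truncWeight_nonneg (ρ : ℝ) {j : ℝ} (hj : 0 ≤ j) (y : ℝ) : 0 ≤ truncWeight ρ j y := by
  have := ramp_nonneg y
  have : 0 ≤ min (max y 0) j := le_min (le_max_right _ _) hj
  unfold truncWeight; positivity

theorem powWeight_of_nonpos (ρ : ℝ) {y : ℝ} (hy : y ≤ 0) : powWeight ρ y = 0 := by
  rw [powWeight, ramp_of_nonpos hy, zero_mul]

theorem truncWeight_of_nonpos (ρ j : ℝ) {y : ℝ} (hy : y ≤ 0) : truncWeight ρ j y = 0 := by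
  rw [truncWeight, ramp_of_nonpos hy, zero_mul]

theorem monotone_powWeight {ρ : ℝ} (hρ : 1 ≤ ρ) : Monotone (powWeight ρ) := fun a b h => by
  unfold powWeight
  have : 0 ≤ max a 0 := le_max_right _ _
  have := ramp_nonneg b
  have := ramp_nonneg a
  gcongr
  · exact monotone_ramp h
  · linarith

/-- The power weight is unbounded when ρ > 1, so its primitive is not an admissible nonlinearity;
the truncated weights are bounded, increase to it, and agree with it up to level j. -/
theorem truncWeight_le_powWeight {ρ : ℝ} (hρ : 1 ≤ ρ) {j : ℝ} (hj : 0 ≤ j) (y : ℝ) :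
    truncWeight ρ j y ≤ powWeight ρ y := by
  unfold truncWeight powWeight
  have : 0 ≤ min (max y 0) j := le_min (le_max_right _ _) hj
  have := ramp_nonneg y
  gcongr
  · linarith
  · exact min_le_left _ _

theorem truncWeight_le {ρ : ℝ} (hρ : 1 ≤ ρ) {j : ℝ} (hj : 0 ≤ j) (y : ℝ) :
    truncWeight ρ j y ≤ (1 + j) ^ (2 * ρ - 2) := by
  unfold truncWeight
  have : 0 ≤ min (max y 0) j := le_min (le_max_right _ _) hj
  have := ramp_nonneg y
  calc _ ≤ 1 * (1 + j) ^ (2 * ρ - 2) := by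
        gcongr
        · exact ramp_le_one y
        · linarith
        · exact min_le_right _ _
    _ = _ := one_mul _

theorem truncWeight_eq_powWeight (ρ : ℝ) {j : ℝ} (hj : 0 ≤ j) {y : ℝ} (hy : y ≤ j) :
    truncWeight ρ j y = powWeight ρ y := by
  rw [truncWeight, powWeight, min_eq_left (max_le hy hj)]

theorem ramp_mul_le {a y : ℝ} (ha : 1 ≤ a) : ramp (a * y) ≤ a * ramp y := by
  rcases le_total y 0 with h | h
  · rw [ramp_of_nonpos h, ramp_of_nonpos (by nlinarith), mul_zero]
  · unfold ramp
    rw [max_eq_left (by positivity), max_eq_left h]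
    rcases le_total y 1 with h1 | h1
    · rw [min_eq_left h1]; exact min_le_left _ _
    · rw [min_eq_right h1, mul_one]; exact (min_le_right _ _).trans ha

/-- The weight is doubling: passing from y/4 to y costs a factor 4 from the ramp and 4^(2ρ-2) from
the power. With the 8 of the two halvings this makes 32 · 4^(2ρ-2). -/
theorem sq_mul_powWeight_le {ρ : ℝ} (hρ : 1 ≤ ρ) {y : ℝ} (hy : 0 ≤ y) :
    y ^ 2 * powWeight ρ y ≤ 32 * 4 ^ (2 * ρ - 2) * primitive (primitive (powWeight ρ)) y := by
  have h1 := sq_mul_le_primitive_primitive (continuous_powWeight ρ) (powWeight_nonneg ρ)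
    (monotone_powWeight hρ) hy
  have h2 : powWeight ρ y ≤ 4 * 4 ^ (2 * ρ - 2) * powWeight ρ (y / 4) := by
    unfold powWeight
    rw [max_eq_left hy, max_eq_left (by positivity)]
    have h3 : ramp y ≤ 4 * ramp (y / 4) := by
      have := ramp_mul_le (a := 4) (y := y / 4) (by norm_num)
      rwa [show 4 * (y / 4) = y by ring] at this
    have h4 : (1 + y) ^ (2 * ρ - 2) ≤ 4 ^ (2 * ρ - 2) * (1 + y / 4) ^ (2 * ρ - 2) := by
      rw [← Real.mul_rpow (by norm_num) (by positivity)]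
      exact Real.rpow_le_rpow (by positivity) (by linarith) (by linarith)
    calc _ ≤ (4 * ramp (y / 4)) * (4 ^ (2 * ρ - 2) * (1 + y / 4) ^ (2 * ρ - 2)) := by
          have := ramp_nonneg (y / 4)
          gcongr
      _ = _ := by ring
  calc y ^ 2 * powWeight ρ y ≤ y ^ 2 * (4 * 4 ^ (2 * ρ - 2) * powWeight ρ (y / 4)) := by gcongr
    _ = 32 * 4 ^ (2 * ρ - 2) * (y ^ 2 / 8 * powWeight ρ (y / 4)) := by ring
    _ ≤ _ := by gcongr

theorem sq_mul_ramp_le {x : ℝ} (hx : 0 ≤ x) :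
    x ^ 2 * ramp x ≤ 32 * primitive (primitive ramp) x := by
  have h1 := sq_mul_le_primitive_primitive continuous_ramp ramp_nonneg monotone_ramp hx
  have h3 : ramp x ≤ 4 * ramp (x / 4) := by
    have := ramp_mul_le (a := 4) (y := x / 4) (by norm_num)
    rwa [show 4 * (x / 4) = x by ring] at this
  nlinarith [mul_le_mul_of_nonneg_left h3 (sq_nonneg x)]

/-- The coupling terms of two excesses are controlled by the energies. -/
theorem coupling_le_energy {ρ : ℝ} (hρ : 1 ≤ ρ) : ∃ C, 0 ≤ C ∧ ∀ x y : ℝ, 0 ≤ x → 0 ≤ y →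
    (y + y ^ ρ) * primitive ramp x + min x (x ^ (1 / ρ)) * primitive (powWeight ρ) y ≤
      C * (primitive (primitive ramp) x + primitive (primitive (powWeight ρ)) y) := by
  have hρ0 : 0 < ρ := by linarith
  -- The two summands belong to the two cases below: (2 + 2^(2ρ-2)) x² `ramp x` in the first, (8 +
  -- 1) y² `powWeight ρ y` in the second, each converted to energies by the preceding bounds.
  refine ⟨32 * (2 + 2 ^ (2 * ρ - 2)) + 9 * (32 * 4 ^ (2 * ρ - 2)), by positivity,
    fun x y hx hy => ?_⟩
  have hΦ := sq_mul_ramp_le hx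
  have hΨ := sq_mul_powWeight_le hρ hy
  have hφ := primitive_le_mul continuous_ramp (monotone_ramp.monotoneOn _) hx
  have hψ := primitive_le_mul (continuous_powWeight ρ) ((monotone_powWeight hρ).monotoneOn _) hy
  have hΦ0 : 0 ≤ primitive (primitive ramp) x := by
    have := ramp_nonneg x; nlinarith [mul_nonneg (sq_nonneg x) this]
  have hΨ0 : 0 ≤ primitive (primitive (powWeight ρ)) y := by
    by_contra hneg
    have : 0 < 32 * (4 : ℝ) ^ (2 * ρ - 2) := by positivity
    nlinarith [mul_nonneg (sq_nonneg y) (powWeight_nonneg ρ y)]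
  set ζ := min x (x ^ (1 / ρ)) with hζ
  have hζ0 : 0 ≤ ζ := le_min hx (by positivity)
  have hA : (0 : ℝ) ≤ 2 ^ (2 * ρ - 2) := by positivity
  have hB : (0 : ℝ) ≤ 4 ^ (2 * ρ - 2) := by positivity
  have hrx := ramp_nonneg x
  have hpx : 0 ≤ primitive ramp x := primitive_nonneg continuous_ramp ramp_nonneg hx
  -- The threshold separates y + y^ρ ≤ 2x from x ≤ y + y^ρ. The exponent 2ρ-2 is chosen so that
  -- y²(1+y)^(2ρ-2) is comparable to (y + y^ρ)²; hence the two energies balance there, and on each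
  -- side one of them dominates both coupling terms.
  rcases le_or_gt y ζ with hyz | hyz
  · have h1 : y ≤ x := hyz.trans (min_le_left _ _)
    have h2 : y ^ ρ ≤ x := by
      calc y ^ ρ ≤ (x ^ (1 / ρ)) ^ ρ :=
            Real.rpow_le_rpow hy (hyz.trans (min_le_right _ _)) hρ0.le
        _ = x := by rw [← Real.rpow_mul hx, one_div, inv_mul_cancel₀ hρ0.ne', Real.rpow_one]
    have h3 : (y + y ^ ρ) * primitive ramp x ≤ 2 * (x ^ 2 * ramp x) := by
      calc _ ≤ (x + x) * (x * ramp x) := by gcongr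
        _ = _ := by ring
    have h4 : ζ ^ 2 * (1 + ζ) ^ (2 * ρ - 2) ≤ 2 ^ (2 * ρ - 2) * x ^ 2 := by
      rcases le_total x 1 with hx1 | hx1
      · have : ζ ≤ x := min_le_left _ _
        have h5 : (1 + ζ) ^ (2 * ρ - 2) ≤ 2 ^ (2 * ρ - 2) :=
          Real.rpow_le_rpow (by positivity) (by linarith) (by linarith)
        calc _ ≤ x ^ 2 * 2 ^ (2 * ρ - 2) := by gcongr
          _ = _ := by ring
      · have hζ1 : ζ ≤ x ^ (1 / ρ) := min_le_right _ _
        have h6 : 1 ≤ x ^ (1 / ρ) := Real.one_le_rpow hx1 (by positivity)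
        have h7 : (x ^ (1 / ρ)) ^ 2 * (x ^ (1 / ρ)) ^ (2 * ρ - 2) = x ^ 2 := by
          rw [← Real.rpow_natCast, ← Real.rpow_add (by positivity), ← Real.rpow_mul hx,
            ← Real.rpow_natCast]
          congr 1; push_cast; field_simp; ring
        calc ζ ^ 2 * (1 + ζ) ^ (2 * ρ - 2)
            ≤ (x ^ (1 / ρ)) ^ 2 * (2 * x ^ (1 / ρ)) ^ (2 * ρ - 2) := by
              gcongr
              · linarith
              · linarith
          _ = 2 ^ (2 * ρ - 2) * ((x ^ (1 / ρ)) ^ 2 * (x ^ (1 / ρ)) ^ (2 * ρ - 2)) := by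
              rw [Real.mul_rpow (by norm_num) (by positivity)]; ring
          _ = _ := by rw [h7]
    have h5 : ζ * primitive (powWeight ρ) y ≤ 2 ^ (2 * ρ - 2) * (x ^ 2 * ramp x) := by
      calc ζ * primitive (powWeight ρ) y ≤ ζ * (ζ * powWeight ρ ζ) := by
            gcongr
            exact hψ.trans (mul_le_mul hyz (monotone_powWeight hρ hyz) (powWeight_nonneg _ _) hζ0)
        _ = (ζ ^ 2 * (1 + ζ) ^ (2 * ρ - 2)) * ramp ζ := by
            rw [powWeight, max_eq_left hζ0]; ring
        _ ≤ (2 ^ (2 * ρ - 2) * x ^ 2) * ramp x := by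
            have := ramp_nonneg ζ
            gcongr
            exact monotone_ramp (min_le_left _ _)
        _ = _ := by ring
    have h8 : (2 + (2 : ℝ) ^ (2 * ρ - 2)) * (x ^ 2 * ramp x)
        ≤ (2 + (2 : ℝ) ^ (2 * ρ - 2)) * (32 * primitive (primitive ramp) x) := by gcongr
    have h9 : 0 ≤ 32 * (2 + (2 : ℝ) ^ (2 * ρ - 2)) * primitive (primitive (powWeight ρ)) y := by
      positivity
    have h10 : 0 ≤ 9 * (32 * (4 : ℝ) ^ (2 * ρ - 2)) * (primitive (primitive ramp) x
        + primitive (primitive (powWeight ρ)) y) := by positivity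
    nlinarith
  · set ξ := y + y ^ ρ with hξ
    have hyρ : 0 ≤ y ^ ρ := by positivity
    have h1 : x ≤ ξ := by
      rcases min_lt_iff.1 hyz with h | h
      · linarith
      · have : x ≤ y ^ ρ := by
          calc x = (x ^ (1 / ρ)) ^ ρ := by
                rw [← Real.rpow_mul hx, one_div, inv_mul_cancel₀ hρ0.ne', Real.rpow_one]
            _ ≤ y ^ ρ := Real.rpow_le_rpow (by positivity) h.le hρ0.le
        linarith
    have hξ0 : 0 ≤ ξ := by positivity
    have hy0 : 0 < y := lt_of_le_of_lt hζ0 hyz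
    have h2 : ξ ≤ 2 * (y * (1 + y) ^ (ρ - 1)) := by
      have e1 : y ^ ρ = y * y ^ (ρ - 1) := by
        rw [mul_comm, ← Real.rpow_add_one hy0.ne']; congr 1; ring
      have e2 : y ^ (ρ - 1) ≤ (1 + y) ^ (ρ - 1) :=
        Real.rpow_le_rpow hy (by linarith) (by linarith)
      have e3 : 1 ≤ (1 + y) ^ (ρ - 1) := Real.one_le_rpow (by linarith) (by linarith)
      rw [hξ, e1]
      nlinarith
    have h3 : ξ ^ 2 ≤ 4 * (y ^ 2 * (1 + y) ^ (2 * ρ - 2)) := by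
      have e1 : ((1 + y) ^ (ρ - 1)) ^ 2 = (1 + y) ^ (2 * ρ - 2) := by
        rw [← Real.rpow_natCast, ← Real.rpow_mul (by positivity)]; congr 1; push_cast; ring
      calc ξ ^ 2 ≤ (2 * (y * (1 + y) ^ (ρ - 1))) ^ 2 := by gcongr
        _ = _ := by rw [← e1]; ring
    have h4 : ramp ξ ≤ 2 * ramp y := by
      rcases le_total y 1 with h | h
      · refine (monotone_ramp (?_ : ξ ≤ 2 * y)).trans (ramp_mul_le (by norm_num))
        have : y ^ ρ ≤ y := by
          simpa using Real.rpow_le_rpow_of_exponent_ge hy0 h hρ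
        linarith
      · have : ramp y = 1 := by unfold ramp; rw [max_eq_left hy, min_eq_right h]
        rw [this]; linarith [ramp_le_one ξ]
    have hry := ramp_nonneg y
    have h5 : ξ * primitive ramp x ≤ 8 * (y ^ 2 * powWeight ρ y) := by
      calc ξ * primitive ramp x ≤ ξ * (ξ * ramp ξ) := by
            gcongr
            exact hφ.trans (mul_le_mul h1 (monotone_ramp h1) hrx hξ0)
        _ = ξ ^ 2 * ramp ξ := by ring
        _ ≤ (4 * (y ^ 2 * (1 + y) ^ (2 * ρ - 2))) * (2 * ramp y) := by
            have := ramp_nonneg ξ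
            gcongr
        _ = _ := by rw [powWeight, max_eq_left hy]; ring
    have h6 : ζ * primitive (powWeight ρ) y ≤ y ^ 2 * powWeight ρ y := by
      calc ζ * primitive (powWeight ρ) y ≤ y * (y * powWeight ρ y) :=
            mul_le_mul hyz.le hψ (primitive_nonneg (continuous_powWeight ρ) (powWeight_nonneg ρ) hy)
              hy
        _ = _ := by ring
    have h9 : 0 ≤ 9 * (32 * (4 : ℝ) ^ (2 * ρ - 2)) * primitive (primitive ramp) x := by
      positivity
    have h10 : 0 ≤ 32 * (2 + (2 : ℝ) ^ (2 * ρ - 2)) * (primitive (primitive ramp) x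
        + primitive (primitive (powWeight ρ)) y) := by positivity
    nlinarith

theorem primitive_primitive_ramp_pos {x : ℝ} (hx : 0 < x) : 0 < primitive (primitive ramp) x := by
  have := sq_mul_ramp_le hx.le
  have := ramp_pos hx
  have : 0 < x ^ 2 * ramp x := by positivity
  linarith

theorem primitive_primitive_powWeight_pos {ρ : ℝ} (hρ : 1 ≤ ρ) {x : ℝ} (hx : 0 < x) :
    0 < primitive (primitive (powWeight ρ)) x := by
  have h1 := sq_mul_powWeight_le hρ hx.le
  have := ramp_pos hx
  have h2 : 0 < x ^ 2 * powWeight ρ x := by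
    have : 0 ≤ max x 0 := le_max_right _ _
    unfold powWeight; positivity
  have h3 : 0 < 32 * (4 : ℝ) ^ (2 * ρ - 2) := by positivity
  exact pos_of_mul_pos_right (h2.trans_le h1) h3.le

set_option maxHeartbeats 1000000 in
/-- Comparison of a solution of a coupled system with a pair of barriers. -/
theorem comparison {Ω : Set (Space N)} (hΩ : IsOpen Ω) [IsFiniteMeasure (volume.restrict Ω)]
    {T p q : ℝ} (hT : 0 < T) (hp : 1 < p) (hq : 1 < q)
    {u u' f₁ v v' f₂ : Space N × ℝ → ℝ} {gu gv : Space N × ℝ → Space N} {u₀ v₀ : Space N → ℝ}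
    (hu : IsDirichletSolution p Ω T u u' gu f₁ u₀) (hv : IsDirichletSolution q Ω T v v' gv f₂ v₀)
    (hpos : ∀ᵐ z ∂(cylMeasure Ω T), 0 ≤ u z ∧ 0 ≤ v z)
    {κ₁ κ₂ : ℝ} {h₁ h₂ : Space N → ℝ} {gh₁ gh₂ : Space N → Space N}
    (hb₁ : IsBarrier p Ω κ₁ h₁ gh₁) (hb₂ : IsBarrier q Ω κ₂ h₂ gh₂) {c₁ c₂ : ℝ → ℝ}
    (hc₁ : ContDiff ℝ 1 c₁) (hc₂ : ContDiff ℝ 1 c₂) (hc₁0 : ∀ t, 0 ≤ c₁ t) (hc₂0 : ∀ t, 0 ≤ c₂ t)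
    (hi₁ : ∀ᵐ x ∂(volume.restrict Ω), u₀ x ≤ h₁ x + c₁ 0)
    (hi₂ : ∀ᵐ x ∂(volume.restrict Ω), v₀ x ≤ h₂ x + c₂ 0)
    {ρ : ℝ} (hρ : 1 ≤ ρ) (hvρ : MemLp v (ENNReal.ofReal (2 * ρ)) (cylMeasure Ω T)) {C : ℝ}
    (hC : 0 ≤ C)
    (hf₁ : ∀ᵐ z ∂(cylMeasure Ω T), f₁ z - deriv c₁ z.2 - κ₁ ≤
      C * (max (v z - h₂ z.1 - c₂ z.2) 0 + max (v z - h₂ z.1 - c₂ z.2) 0 ^ ρ))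
    (hf₂ : ∀ᵐ z ∂(cylMeasure Ω T), f₂ z - deriv c₂ z.2 - κ₂ ≤
      C * min (max (u z - h₁ z.1 - c₁ z.2) 0) (max (u z - h₁ z.1 - c₁ z.2) 0 ^ (1 / ρ))) :
    ∀ᵐ z ∂(cylMeasure Ω T), u z ≤ h₁ z.1 + c₁ z.2 ∧ v z ≤ h₂ z.1 + c₂ z.2 := by
  obtain ⟨C', hC', hcoup⟩ := coupling_le_energy hρ
  set X : Space N × ℝ → ℝ := fun z => u z - h₁ z.1 - c₁ z.2 with hX
  set Y : Space N × ℝ → ℝ := fun z => v z - h₂ z.1 - c₂ z.2 with hY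
  set Φ := primitive (primitive ramp) with hΦ
  set Ψ := primitive (primitive (powWeight ρ)) with hΨ
  have hkc := continuous_powWeight ρ
  have hk0 := powWeight_nonneg ρ
  have hkn : ∀ y ≤ 0, powWeight ρ y = 0 := fun y hy => powWeight_of_nonpos ρ hy
  have hrn : ∀ y ≤ 0, ramp y = 0 := fun y hy => ramp_of_nonpos hy
  have hφn : ∀ y ≤ 0, primitive ramp y = 0 := fun y hy => primitive_of_nonpos hrn hy
  have hψn : ∀ y ≤ 0, primitive (powWeight ρ) y = 0 := fun y hy => primitive_of_nonpos hkn hy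
  have hφ0 := primitive_nonneg_of_nonpos_eq_zero continuous_ramp ramp_nonneg hrn
  have hψ0 := primitive_nonneg_of_nonpos_eq_zero hkc hk0 hkn
  have hφc := continuous_primitive continuous_ramp
  have hψc := continuous_primitive hkc
  have hΦ0 : ∀ y, 0 ≤ Φ y := primitive_nonneg_of_nonpos_eq_zero hφc hφ0 hφn
  have hΨ0 : ∀ y, 0 ≤ Ψ y := primitive_nonneg_of_nonpos_eq_zero hψc hψ0 hψn
  have hmax : ∀ F : ℝ → ℝ, (∀ y ≤ 0, F y = 0) → ∀ y, F (max y 0) = F y := fun F hF y => by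
    rcases le_total y 0 with h | h
    · rw [max_eq_right h, hF y h, hF 0 le_rfl]
    · rw [max_eq_left h]
  have hΦn : ∀ y ≤ 0, Φ y = 0 := fun y hy => primitive_of_nonpos hφn hy
  have hΨn : ∀ y ≤ 0, Ψ y = 0 := fun y hy => primitive_of_nonpos hψn hy
  have hpt : ∀ x y : ℝ, (max y 0 + max y 0 ^ ρ) * primitive ramp x
      + min (max x 0) (max x 0 ^ (1 / ρ)) * primitive (powWeight ρ) y ≤ C' * (Φ x + Ψ y) := by
    intro x y
    have := hcoup (max x 0) (max y 0) (le_max_right _ _) (le_max_right _ _)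
    rwa [hmax _ hφn, hmax _ hψn, hmax _ hΦn, hmax _ hΨn] at this
  have hXm : AEStronglyMeasurable X (cylMeasure Ω T) :=
    (hu.memLp_two.1.sub (memLp_comp_fst hb₁.memLp_two).1).sub
      (hc₁.continuous.comp continuous_snd).aestronglyMeasurable
  have hYm : AEStronglyMeasurable Y (cylMeasure Ω T) :=
    (hv.memLp_two.1.sub (memLp_comp_fst hb₂.memLp_two).1).sub
      (hc₂.continuous.comp continuous_snd).aestronglyMeasurable
  have hΦi : Integrable (fun z => Φ (X z)) (cylMeasure Ω T) := by
    refine hu.memLp_two.integrable_sq.mono'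
      ((continuous_primitive hφc).comp_aestronglyMeasurable hXm) ?_
    filter_upwards [hpos, ae_cylMeasure_of_ae_fst hb₁.nonneg] with z hz hz1
    rw [Real.norm_of_nonneg (hΦ0 _)]
    have h1 : X z ≤ u z := by have := hc₁0 z.2; simp only [hX]; linarith
    have hΦmono : Monotone Φ := monotone_primitive hφc hφ0
    calc Φ (X z) ≤ Φ (u z) := hΦmono h1
      _ ≤ u z ^ 2 * ramp (u z) := primitive_primitive_le continuous_ramp ramp_nonneg
          monotone_ramp hz.1
      _ ≤ u z ^ 2 := by nlinarith [sq_nonneg (u z), ramp_le_one (u z)]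
  -- The second energy grows like v^(2ρ), which is why v must lie in L^(2ρ).
  have hΨi : Integrable (fun z => Ψ (Y z)) (cylMeasure Ω T) := by
    have h0 : MemLp (fun _ : Space N × ℝ => (1 : ℝ)) (ENNReal.ofReal (2 * ρ)) (cylMeasure Ω T) :=
      memLp_const 1
    have h1 : MemLp (fun z => 1 + v z) (ENNReal.ofReal (2 * ρ)) (cylMeasure Ω T) := h0.add hvρ
    have h2 := h1.integrable_norm_rpow (by simp; linarith) ENNReal.ofReal_ne_top
    rw [ENNReal.toReal_ofReal (by linarith)] at h2
    refine h2.mono' ((continuous_primitive hψc).comp_aestronglyMeasurable hYm) ?_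
    filter_upwards [hpos, ae_cylMeasure_of_ae_fst hb₂.nonneg] with z hz hz1
    rw [Real.norm_of_nonneg (hΨ0 _), Real.norm_of_nonneg (by linarith [hz.2])]
    have h1 : Y z ≤ v z := by have := hc₂0 z.2; simp only [hY]; linarith
    have hΨmono : Monotone Ψ := monotone_primitive hψc hψ0
    have hv0 := hz.2
    calc Ψ (Y z) ≤ Ψ (v z) := hΨmono h1
      _ ≤ v z ^ 2 * powWeight ρ (v z) := primitive_primitive_le hkc hk0 (monotone_powWeight hρ) hz.2
      _ ≤ (1 + v z) ^ 2 * (1 + v z) ^ (2 * ρ - 2) := by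
          have h3 : powWeight ρ (v z) ≤ (1 + v z) ^ (2 * ρ - 2) := by
            rw [powWeight, max_eq_left hz.2]
            exact mul_le_of_le_one_left (by positivity) (ramp_le_one _)
          have := hk0 (v z)
          gcongr
          linarith
      _ = (1 + v z) ^ (2 * ρ) := by
          rw [← Real.rpow_natCast, ← Real.rpow_add (by positivity)]; congr 1; push_cast; ring
  set D : Space N × ℝ → ℝ := fun z => C * C' * (Φ (X z) + Ψ (Y z)) with hD
  have hΦΨi : Integrable (fun z => Φ (X z) + Ψ (Y z)) (cylMeasure Ω T) := hΦi.add hΨi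
  have hDi : Integrable D (cylMeasure Ω T) := hΦΨi.const_mul _
  have hminnn : ∀ x : ℝ, 0 ≤ min (max x 0) (max x 0 ^ (1 / ρ)) := fun x =>
    le_min (le_max_right _ _) (Real.rpow_nonneg (le_max_right _ _) _)
  have hmaxnn : ∀ y : ℝ, 0 ≤ max y 0 + max y 0 ^ ρ := fun y =>
    add_nonneg (le_max_right _ _) (Real.rpow_nonneg (le_max_right _ _) _)
  have hux := hu.excess_le hΩ hT hp continuous_ramp ramp_nonneg ramp_le_one hrn hb₁ hc₁ hc₁0 hi₁
    hDi (by
      filter_upwards [hf₁] with z hz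
      calc _ ≤ C * (max (Y z) 0 + max (Y z) 0 ^ ρ) * primitive ramp (X z) :=
            mul_le_mul_of_nonneg_right hz (hφ0 _)
        _ = C * ((max (Y z) 0 + max (Y z) 0 ^ ρ) * primitive ramp (X z)) := by ring
        _ ≤ C * (C' * (Φ (X z) + Ψ (Y z))) := by
            refine mul_le_mul_of_nonneg_left ?_ hC
            have := hpt (X z) (Y z)
            have := mul_nonneg (hminnn (X z)) (hψ0 (Y z))
            linarith
        _ = _ := by rw [hD]; ring)
  -- The second excess estimate is run with the truncated weights. Its right side already involves
  -- the untruncated energy, so it is independent of j and dominated convergence removes the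
  -- truncation afterwards.
  have hvy : ∀ᵐ t ∂((volume : Measure ℝ).restrict (Ioo 0 T)), ∀ j : ℕ,
      ∫ x in Ω, primitive (primitive (truncWeight ρ j)) (Y (x, t))
        ≤ ∫ s in Ioo 0 t, ∫ x in Ω, D (x, s) := by
    rw [ae_all_iff]
    intro j
    have hj : (0 : ℝ) ≤ j := Nat.cast_nonneg j
    refine hv.excess_le hΩ hT hq (continuous_truncWeight ρ hj) (truncWeight_nonneg ρ hj)
      (truncWeight_le hρ hj) (fun y hy => truncWeight_of_nonpos ρ j hy) hb₂ hc₂ hc₂0 hi₂ hDi ?_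
    filter_upwards [hf₂] with z hz
    have h0 : 0 ≤ primitive (truncWeight ρ j) (Y z) := primitive_nonneg_of_nonpos_eq_zero
      (continuous_truncWeight ρ hj) (truncWeight_nonneg ρ hj)
      (fun y hy => truncWeight_of_nonpos ρ j hy) _
    have h1 : primitive (truncWeight ρ j) (Y z) ≤ primitive (powWeight ρ) (Y z) := by
      rcases le_total (Y z) 0 with h | h
      · rw [hψn _ h, primitive_of_nonpos (fun y hy => truncWeight_of_nonpos ρ j hy) h]
      · exact primitive_mono (continuous_truncWeight ρ hj) hkc (truncWeight_le_powWeight hρ hj) h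
    have hmn := hminnn (X z)
    calc _ ≤ C * min (max (X z) 0) (max (X z) 0 ^ (1 / ρ)) * primitive (truncWeight ρ j) (Y z) :=
          mul_le_mul_of_nonneg_right hz h0
      _ ≤ C * min (max (X z) 0) (max (X z) 0 ^ (1 / ρ)) * primitive (powWeight ρ) (Y z) := by
          gcongr
      _ = C * (min (max (X z) 0) (max (X z) 0 ^ (1 / ρ)) * primitive (powWeight ρ) (Y z)) := by
          ring
      _ ≤ C * (C' * (Φ (X z) + Ψ (Y z))) := by
          refine mul_le_mul_of_nonneg_left ?_ hC
          have := hpt (X z) (Y z)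
          have := mul_nonneg (hmaxnn (Y z)) (hφ0 (X z))
          linarith
      _ = _ := by rw [hD]; ring
  have hΦi' := hΦi
  have hΨi' := hΨi
  have hG' := hΦΨi
  rw [cylMeasure_eq_prod] at hΦi' hΨi' hG'
  have hvy' : ∀ᵐ t ∂((volume : Measure ℝ).restrict (Ioo 0 T)),
      ∫ x in Ω, Ψ (Y (x, t)) ≤ ∫ s in Ioo 0 t, ∫ x in Ω, D (x, s) := by
    have hYm' := hYm
    rw [cylMeasure_eq_prod] at hYm'
    filter_upwards [hvy, hΨi'.prod_left_ae, hYm'.prodMk_right] with t ht hti htm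
    refine le_of_tendsto' (tendsto_integral_of_dominated_convergence (fun x => Ψ (Y (x, t)))
      (fun j => (continuous_primitive (continuous_primitive
        (continuous_truncWeight ρ (Nat.cast_nonneg j)))).comp_aestronglyMeasurable htm) hti
      (fun j => Eventually.of_forall fun x => ?_) (Eventually.of_forall fun x => ?_)) ht
    · have hj : (0 : ℝ) ≤ j := Nat.cast_nonneg j
      have hjn : ∀ y ≤ 0, truncWeight ρ j y = 0 := fun y hy => truncWeight_of_nonpos ρ j hy
      have hj0 := primitive_nonneg_of_nonpos_eq_zero (continuous_truncWeight ρ hj)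
        (truncWeight_nonneg ρ hj) hjn
      have hjn' : ∀ y ≤ 0, primitive (truncWeight ρ j) y = 0 := fun y hy =>
        primitive_of_nonpos hjn hy
      have hcj := continuous_primitive (continuous_truncWeight ρ hj)
      rw [Real.norm_of_nonneg (primitive_nonneg_of_nonpos_eq_zero hcj hj0 hjn' _)]
      rcases le_total (Y (x, t)) 0 with h | h
      · rw [primitive_of_nonpos hjn' h]; exact hΨ0 _
      · refine primitive_mono hcj hψc (fun y => ?_) h
        rcases le_total y 0 with h | h
        · rw [hψn _ h, hjn' _ h]
        · exact primitive_mono (continuous_truncWeight ρ hj) hkc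
            (truncWeight_le_powWeight hρ hj) h
    · refine tendsto_const_nhds.congr' ?_
      filter_upwards [eventually_ge_atTop ⌈Y (x, t)⌉₊] with j hj
      have hj0 : (0 : ℝ) ≤ j := Nat.cast_nonneg j
      refine (primitive_congr hj0 (fun y hy => ?_) (Nat.ceil_le.1 hj)).symm
      exact primitive_congr hj0 (fun s hs => truncWeight_eq_powWeight ρ hj0 hs) hy
  -- Adding the two excess estimates gives twice the common right side, hence the constant 2 C C'.
  have hgron := integral_eq_zero_of_le_mul_primitive (C := 2 * (C * C')) hT
    (G := fun t => ∫ x in Ω, (Φ (X (x, t)) + Ψ (Y (x, t)))) hG'.integral_prod_right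
    (Eventually.of_forall fun t => integral_nonneg fun x => add_nonneg (hΦ0 _) (hΨ0 _)) (by
      filter_upwards [hux, hvy', hΦi'.prod_left_ae, hΨi'.prod_left_ae] with t h1 h2 h3 h4
      rw [integral_add h3 h4]
      have h5 : ∫ s in Ioo 0 t, ∫ x in Ω, D (x, s)
          = C * C' * ∫ s in Ioo 0 t, ∫ x in Ω, (Φ (X (x, s)) + Ψ (Y (x, s))) := by
        rw [← integral_const_mul]
        simp only [hD, integral_const_mul]
      rw [h5] at h1 h2
      linarith)
  rw [← integral_prod_symm _ hG', ← cylMeasure_eq_prod,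
    integral_eq_zero_iff_of_nonneg (fun z => add_nonneg (hΦ0 _) (hΨ0 _)) hΦΨi] at hgron
  filter_upwards [hgron] with z hz
  simp only [Pi.zero_apply] at hz
  have e1 : Φ (X z) = 0 := by linarith [hΦ0 (X z), hΨ0 (Y z)]
  have e2 : Ψ (Y z) = 0 := by linarith [hΦ0 (X z), hΨ0 (Y z)]
  constructor
  · by_contra hne
    have : 0 < X z := by simp only [hX]; linarith
    exact (primitive_primitive_ramp_pos this).ne' e1
  · by_contra hne
    have : 0 < Y z := by simp only [hY]; linarith
    exact (primitive_primitive_powWeight_pos hρ this).ne' e2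

/-! ### A priori bounds for the system -/

/-- Bernoulli's inequality, that is, the convex power lies above its tangent at s. -/
theorem rpow_sub_rpow_le_of_one_le {m R s : ℝ} (hm : 1 ≤ m) (hR : 0 ≤ R)
    (hs0 : 0 < s) : s ^ m - R ^ m ≤ m * s ^ (m - 1) * (s - R) := by
  have h1 := one_add_mul_self_le_rpow_one_add (s := R / s - 1)
    (by have : 0 ≤ R / s := by positivity
        linarith) hm
  rw [add_sub_cancel, Real.div_rpow hR hs0.le, le_div_iff₀ (by positivity)] at h1
  have h2 : s ^ m = s ^ (m - 1) * s := by rw [← Real.rpow_add_one hs0.ne']; congr 1; ring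
  have h3 : (1 + m * (R / s - 1)) * s ^ m = s ^ m - m * s ^ (m - 1) * (s - R) := by
    rw [h2]; field_simp; ring
  linarith

/-- The concave power lies below its tangent at R > 0. Its slope there is finite although the power
may be singular at 0. -/
theorem rpow_sub_rpow_le_of_le_one {m R s : ℝ} (hm0 : 0 ≤ m) (hm : m ≤ 1) (hR : 0 < R)
    (hs : R ≤ s) : s ^ m - R ^ m ≤ R ^ (m - 1) * (s - R) := by
  have h0 : 0 ≤ s / R - 1 := by rw [sub_nonneg, one_le_div hR]; exact hs
  have h1 := rpow_one_add_le_one_add_mul_self (s := s / R - 1) (by linarith) hm0 hm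
  rw [add_sub_cancel, Real.div_rpow (hR.le.trans hs) hR.le, div_le_iff₀ (by positivity)] at h1
  have h2 : R ^ m = R ^ (m - 1) * R := by rw [← Real.rpow_add_one hR.ne']; congr 1; ring
  have h3 : (1 + m * (s / R - 1)) * R ^ m = R ^ m + m * (R ^ (m - 1) * (s - R)) := by
    rw [h2]; field_simp
  have h4 : 0 ≤ R ^ (m - 1) * (s - R) := mul_nonneg (by positivity) (by linarith)
  nlinarith

/-- One-sided Lipschitz bound for a power on a compact interval. -/
theorem exists_rpow_sub_le {m R : ℝ} (hm : 0 < m) (hR : 0 < R) (B : ℝ) :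
    ∃ C, 0 ≤ C ∧ ∀ s, R ≤ s → s ≤ B → s ^ m - R ^ m ≤ C * (s - R) := by
  rcases le_total m 1 with h | h
  · exact ⟨R ^ (m - 1), by positivity, fun s hs _ => rpow_sub_rpow_le_of_le_one hm.le h hR hs⟩
  · refine ⟨m * |B| ^ (m - 1), by positivity, fun s hs hB => ?_⟩
    refine (rpow_sub_rpow_le_of_one_le h hR.le (hR.trans_le hs)).trans ?_
    have h1 : s ≤ |B| := hB.trans (le_abs_self B)
    have h2 : 0 ≤ s := hR.le.trans hs
    gcongr

theorem memW0_zero (p : ℝ) (Ω : Set (Space N)) : MemW0 p Ω (fun _ => 0) (fun _ => 0) := by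
  have hg : ∀ x : Space N, gradient (fun _ : Space N => (0 : ℝ)) x = 0 := fun x => by
    simp [gradient]
  refine ⟨MemLp.zero, MemLp.zero, fun _ _ => 0, fun _ => ⟨contDiff_const, ?_, ?_⟩, ?_, ?_⟩
  · exact HasCompactSupport.zero
  · simp [tsupport]
  · simp
  · simp [hg]

/-- With the zero barrier, the comparison function reduces to its time-dependent part c(t). -/
theorem isBarrier_zero (p : ℝ) (Ω : Set (Space N)) :
    IsBarrier p Ω 0 (fun _ => 0) (fun _ => 0) where
  memW0 := memW0_zero p Ω
  memLp_two := MemLp.zero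
  nonneg := Eventually.of_forall fun _ => le_rfl
  integral_eq := fun φ gφ _ => by simp [flux]

theorem flux_smul {p K : ℝ} (hK : 0 < K) (ξ : Space N) : flux p (K • ξ) = K ^ (p - 1) • flux p ξ := by
  rw [flux, flux, norm_smul, Real.norm_of_nonneg hK.le, Real.mul_rpow hK.le (norm_nonneg _),
    smul_smul, smul_smul]
  congr 1
  rw [show p - 1 = p - 2 + 1 by ring, Real.rpow_add_one hK.ne']
  ring

/-- Multiples of the torsion function are barriers. -/
theorem IsTorsionFunction.isBarrier (hN : 1 ≤ N) {Ω : Set (Space N)} (hΩ : IsOpen Ω)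
    (hb : Bornology.IsBounded Ω) [IsFiniteMeasure (volume.restrict Ω)]
    {p : ℝ} (hp : 1 < p) {δ₀ : ℝ} {ψ : Space N → ℝ} (h : IsTorsionFunction p Ω δ₀ ψ) {K : ℝ}
    (hK : 0 < K) :
    ∃ gh, IsBarrier p Ω (K ^ (p - 1)) (fun x => K * (ψ x - δ₀)) gh := by
  obtain ⟨M, hM⟩ := h.bounded hN hΩ hb hp
  obtain ⟨g, hψ, heq⟩ := h
  refine ⟨fun x => K • g x, hψ.const_mul K, ?_, ?_, fun φ gφ hφ => ?_⟩
  · refine MemLp.of_bound (hψ.const_mul K).1.1 (K * (M - δ₀)) ?_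
    filter_upwards [hM] with x hx
    rw [Real.norm_of_nonneg (mul_nonneg hK.le (by linarith [hx.1]))]
    gcongr
    exact hx.2
  · filter_upwards [hM] with x hx
    exact mul_nonneg hK.le (by linarith [hx.1])
  · simp_rw [flux_smul hK, real_inner_smul_left]
    rw [integral_const_mul, IsTorsionFunction.integral_eq hp hψ.2.1 heq hφ]

theorem ae_abs_le_of_memLp_top {α : Type*} [MeasurableSpace α] {μ : Measure α} {f : α → ℝ}
    (h : MemLp f ⊤ μ) : ∀ᵐ x ∂μ, |f x| ≤ (eLpNorm f ⊤ μ).toReal := by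
  have h1 := h.2
  rw [eLpNorm_exponent_top] at h1 ⊢
  filter_upwards [ae_le_eLpNormEssSup (f := f) (μ := μ)] with x hx
  have := ENNReal.toReal_mono h1.ne hx
  simpa using this

theorem IsInitialDatum.memLp {p : ℝ} {Ω : Set (Space N)} [IsFiniteMeasure (volume.restrict Ω)]
    {w₀ : Space N → ℝ} (h : IsInitialDatum p Ω w₀) (s : ℝ≥0∞) : MemLp w₀ s (volume.restrict Ω) :=
  h.bounded.mono_exponent le_top

/-- This is the role of L^(2m) and L^(2n) in the solution class: the sources become square
integrable and pair with L² test functions. -/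
theorem memLp_rpow_two {α : Type*} [MeasurableSpace α] {μ : Measure α} {f : α → ℝ} {a : ℝ}
    (ha : 0 < a) (hf0 : ∀ᵐ x ∂μ, 0 ≤ f x) (hf : MemLp f (ENNReal.ofReal (2 * a)) μ) :
    MemLp (fun x => f x ^ a) 2 μ := by
  have h1 := hf.norm_rpow_div (ENNReal.ofReal a)
  rw [ENNReal.toReal_ofReal ha.le, ← ENNReal.ofReal_div_of_pos ha,
    mul_div_cancel_right₀ _ ha.ne'] at h1
  rw [show (2 : ℝ≥0∞) = ENNReal.ofReal 2 by simp]
  refine h1.ae_eq ?_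
  filter_upwards [hf0] with x hx
  rw [Real.norm_of_nonneg hx]

/-- A weak solution of the system solves two scalar problems. -/
theorem IsWeakSolutionOn.exists_isDirichletSolution {p q m n : ℝ} (hm : 0 < m) (hn : 0 < n)
    {Ω : Set (Space N)} [IsFiniteMeasure (volume.restrict Ω)] {T : ℝ} {u₀ v₀ : Space N → ℝ}
    (hu₀ : IsInitialDatum p Ω u₀) (hv₀ : IsInitialDatum q Ω v₀) {u v : Space N × ℝ → ℝ}
    (h : IsWeakSolutionOn p q m n Ω u₀ v₀ T u v) :
    ∃ (u' v' : Space N × ℝ → ℝ) (gu gv : Space N × ℝ → Space N),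
      IsDirichletSolution p Ω T u u' gu (fun z => v z ^ m) u₀ ∧
      IsDirichletSolution q Ω T v v' gv (fun z => u z ^ n) v₀ ∧
      MemLp u (ENNReal.ofReal (2 * n)) (cylMeasure Ω T) ∧
      MemLp v (ENNReal.ofReal (2 * m)) (cylMeasure Ω T) := by
  obtain ⟨hpos, hiu, hiv, u', v', gu, gv, hu, hv, htu, htv, heu, hev⟩ := h
  exact ⟨u', v', gu, gv,
    ⟨hu.memLp_two, hu.memLp_deriv, hu.memLp_grad, hu.weakDeriv, htu, heu, hiu,
      memLp_rpow_two hm (hpos.mono fun z hz => hz.2) hv.memLp_pow, hu₀.memLp 2⟩,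
    ⟨hv.memLp_two, hv.memLp_deriv, hv.memLp_grad, hv.weakDeriv, htv, hev, hiv,
      memLp_rpow_two hn (hpos.mono fun z hz => hz.1) hu.memLp_pow, hv₀.memLp 2⟩,
    hu.memLp_pow, hv.memLp_pow⟩

set_option maxHeartbeats 1000000 in
/-- Boundedness of solutions of the subcritical system, when the source of the second equation is
sublinear. -/
theorem exists_bound_of_sublinear {Ω : Set (Space N)} (hΩ : IsOpen Ω)
    [IsFiniteMeasure (volume.restrict Ω)] {T p q m n : ℝ} (hT : 0 < T) (hp : 1 < p) (hq : 1 < q)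
    (hm : 0 < m) (hn : 0 < n) (hmn : m * n ≤ 1) (hn1 : n ≤ 1)
    {u u' v v' : Space N × ℝ → ℝ} {gu gv : Space N × ℝ → Space N} {u₀ v₀ : Space N → ℝ}
    (hu : IsDirichletSolution p Ω T u u' gu (fun z => v z ^ m) u₀)
    (hv : IsDirichletSolution q Ω T v v' gv (fun z => u z ^ n) v₀)
    (hpos : ∀ᵐ z ∂(cylMeasure Ω T), 0 ≤ u z ∧ 0 ≤ v z)
    (hvm : MemLp v (ENNReal.ofReal (2 * m)) (cylMeasure Ω T)) {B : ℝ}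
    (hu₀ : ∀ᵐ x ∂(volume.restrict Ω), u₀ x ≤ B) (hv₀ : ∀ᵐ x ∂(volume.restrict Ω), v₀ x ≤ B) :
    ∃ M, ∀ᵐ z ∂(cylMeasure Ω T), u z ≤ M ∧ v z ≤ M := by
  set ρ := max m 1 with hρdef
  have hρ : 1 ≤ ρ := le_max_right _ _
  have hρ0 : 0 < ρ := by linarith
  have hmρ : m ≤ ρ := le_max_left _ _
  -- Since ρ = max(m, 1), one has ρ n = max(mn, n), and both entries are at most 1.
  have hnρ : n ≤ 1 / ρ := by
    rw [le_div_iff₀ hρ0, hρdef, mul_max_of_nonneg _ _ hn.le]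
    exact max_le (by linarith) (by linarith)
  set L := max B 1 with hL
  have hL1 : 1 ≤ L := le_max_right _ _
  have hL0 : 0 < L := by linarith
  -- The pair (c₂^ρ, c₂) with c₂ = L e^t is a supersolution: c₂ ≥ 1 for t ≥ 0, so (c₂^ρ)' = ρ c₂^ρ ≥
  -- c₂^m, and c₂' = c₂ = (c₂^ρ)^(1/ρ) ≥ (c₂^ρ)^n because n ≤ 1/ρ.
  set c₂ : ℝ → ℝ := fun t => L * Real.exp t with hc₂
  set c₁ : ℝ → ℝ := fun t => L ^ ρ * Real.exp (ρ * t) with hc₁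
  have hc₁c₂ : ∀ t, c₁ t = c₂ t ^ ρ := fun t => by
    simp only [hc₁, hc₂]
    rw [Real.mul_rpow hL0.le (Real.exp_pos _).le, ← Real.exp_mul, mul_comm ρ t]
  have hd₁ : ∀ t, deriv c₁ t = ρ * c₁ t := fun t => by
    have : HasDerivAt c₁ (L ^ ρ * (Real.exp (ρ * t) * (ρ * 1))) t :=
      (((hasDerivAt_id t).const_mul ρ).exp).const_mul _
    rw [this.deriv]; simp only [hc₁]; ring
  have hd₂ : ∀ t, deriv c₂ t = c₂ t := fun t => by
    have : HasDerivAt c₂ (L * Real.exp t) t := (Real.hasDerivAt_exp t).const_mul _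
    rw [this.deriv]
  have hc₂1 : ∀ t, 0 ≤ t → 1 ≤ c₂ t := fun t ht => by
    have := Real.one_le_exp ht
    simp only [hc₂]; nlinarith
  have hc₂T : ∀ t, t ≤ T → c₂ t ≤ c₂ T := fun t ht => by
    simp only [hc₂]; gcongr
  have hvρ : MemLp v (ENNReal.ofReal (2 * ρ)) (cylMeasure Ω T) := by
    rcases le_total m 1 with h | h
    · rw [hρdef, max_eq_right h]; simpa using hv.memLp_two
    · rw [hρdef, max_eq_left h]; exact hvm
  have hcT : 0 < c₂ T := by linarith [hc₂1 T hT.le]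
  -- The first summand bounds (V + y)^ρ - V^ρ by a multiple of y + y^ρ uniformly for V ≤ c₂(T); the
  -- added 1 covers the second equation, where constant 1 suffices.
  set C := ρ * (2 ^ (ρ - 1) * (c₂ T ^ (ρ - 1) + 1)) + 1 with hC
  have hC0 : 0 ≤ C := by positivity
  have hC1 : 1 ≤ C := by
    have : 0 ≤ ρ * (2 ^ (ρ - 1) * (c₂ T ^ (ρ - 1) + 1)) := by positivity
    linarith
  have key := comparison hΩ hT hp hq hu hv hpos (isBarrier_zero p Ω) (isBarrier_zero q Ω)
    (c₁ := c₁) (c₂ := c₂) (by fun_prop) (by fun_prop) (fun t => by positivity)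
    (fun t => by positivity)
    (by
      filter_upwards [hu₀] with x hx
      have h1 : B ≤ L := le_max_left _ _
      have h2 : L ≤ L ^ ρ := by simpa using Real.rpow_le_rpow_of_exponent_le hL1 hρ
      simp only [hc₁, mul_zero, Real.exp_zero]
      linarith)
    (by
      filter_upwards [hv₀] with x hx
      have h1 : B ≤ L := le_max_left _ _
      simp only [hc₂, Real.exp_zero]
      linarith) hρ hvρ (C := C) hC0 ?_ ?_
  · refine ⟨max (c₂ T ^ ρ) (c₂ T), ?_⟩
    filter_upwards [key, ae_cylMeasure_mem Ω T] with z hz hzt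
    rw [hc₁c₂] at hz
    have h1 := hc₂T z.2 hzt.2.le
    have h2 : 0 ≤ c₂ z.2 := by linarith [hc₂1 z.2 hzt.1.le]
    refine ⟨le_max_of_le_left ?_, le_max_of_le_right ?_⟩
    · have : c₂ z.2 ^ ρ ≤ c₂ T ^ ρ := by gcongr
      linarith [hz.1]
    · linarith [hz.2]
  · filter_upwards [hpos, ae_cylMeasure_mem Ω T] with z hz hzt
    rw [hd₁, hc₁c₂]
    have hV1 := hc₂1 z.2 hzt.1.le
    have hVT := hc₂T z.2 hzt.2.le
    set V := c₂ z.2 with hV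
    simp only [sub_zero]
    have hVρ : 0 ≤ V ^ ρ := by positivity
    rcases le_or_gt (v z) V with h | h
    · have h1 : v z ^ m ≤ V ^ ρ := by
        calc v z ^ m ≤ V ^ m := Real.rpow_le_rpow hz.2 h hm.le
          _ ≤ V ^ ρ := Real.rpow_le_rpow_of_exponent_le hV1 hmρ
      rw [max_eq_right (by linarith), Real.zero_rpow hρ0.ne']
      nlinarith
    · set y := v z - V with hy
      have hy0 : 0 < y := by linarith
      have hvz : v z = V + y := by linarith
      have hv1 : 1 ≤ v z := by linarith
      rw [max_eq_left hy0.le]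
      have h1 : v z ^ m ≤ v z ^ ρ := Real.rpow_le_rpow_of_exponent_le hv1 hmρ
      have h2 := rpow_sub_rpow_le_of_one_le hρ (by linarith : 0 ≤ V) (by linarith : 0 < v z)
      have h3 : v z ^ (ρ - 1) ≤ 2 ^ (ρ - 1) * (c₂ T ^ (ρ - 1) + y ^ (ρ - 1)) := by
        have h4 : v z ≤ 2 * max (c₂ T) y := by
          have := le_max_left (c₂ T) y
          have := le_max_right (c₂ T) y
          linarith
        calc v z ^ (ρ - 1) ≤ (2 * max (c₂ T) y) ^ (ρ - 1) :=
              Real.rpow_le_rpow (by linarith) h4 (by linarith)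
          _ = 2 ^ (ρ - 1) * max (c₂ T) y ^ (ρ - 1) :=
              Real.mul_rpow (by norm_num) (le_max_of_le_right hy0.le)
          _ ≤ _ := by
              gcongr
              have e1 : 0 ≤ c₂ T ^ (ρ - 1) := by positivity
              have e2 : 0 ≤ y ^ (ρ - 1) := by positivity
              rcases le_total (c₂ T) y with h | h
              · rw [max_eq_right h]; linarith
              · rw [max_eq_left h]; linarith
      have h5 : y ^ ρ = y ^ (ρ - 1) * y := by
        rw [← Real.rpow_add_one hy0.ne']; congr 1; ring
      have h6 : v z ^ ρ - V ^ ρ ≤ ρ * (2 ^ (ρ - 1) * (c₂ T ^ (ρ - 1) * y + y ^ ρ)) := by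
        calc _ ≤ ρ * v z ^ (ρ - 1) * y := h2
          _ ≤ ρ * (2 ^ (ρ - 1) * (c₂ T ^ (ρ - 1) + y ^ (ρ - 1))) * y := by gcongr
          _ = _ := by rw [h5]; ring
      have h7 : c₂ T ^ (ρ - 1) * y + y ^ ρ ≤ (c₂ T ^ (ρ - 1) + 1) * (y + y ^ ρ) := by
        have e1 : 0 ≤ c₂ T ^ (ρ - 1) := by positivity
        have e2 : 0 ≤ y ^ ρ := by positivity
        nlinarith
      have h8 : ρ * (2 ^ (ρ - 1) * (c₂ T ^ (ρ - 1) * y + y ^ ρ))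
          ≤ ρ * (2 ^ (ρ - 1) * ((c₂ T ^ (ρ - 1) + 1) * (y + y ^ ρ))) := by gcongr
      have h9 : 0 ≤ y + y ^ ρ := by positivity
      have h10 : V ^ ρ ≤ ρ * V ^ ρ := le_mul_of_one_le_left hVρ hρ
      calc v z ^ m - ρ * V ^ ρ ≤ v z ^ ρ - V ^ ρ := by linarith
        _ ≤ ρ * (2 ^ (ρ - 1) * ((c₂ T ^ (ρ - 1) + 1) * (y + y ^ ρ))) := h6.trans h8
        _ ≤ C * (y + y ^ ρ) := by rw [hC]; linarith
  · filter_upwards [hpos, ae_cylMeasure_mem Ω T] with z hz hzt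
    rw [hd₂, hc₁c₂]
    have hV1 := hc₂1 z.2 hzt.1.le
    set V := c₂ z.2 with hV
    simp only [sub_zero]
    set U := V ^ ρ with hU
    have hU1 : 1 ≤ U := Real.one_le_rpow hV1 hρ0.le
    have hVU : V = U ^ (1 / ρ) := by
      rw [hU, ← Real.rpow_mul (by linarith), mul_one_div_cancel hρ0.ne', Real.rpow_one]
    rw [hVU]
    have ha1 : 1 / ρ ≤ 1 := by rw [div_le_one hρ0]; exact hρ
    have ha0 : 0 ≤ 1 / ρ := by positivity
    rcases le_or_gt (u z) U with h | h
    · have h1 : u z ^ n ≤ U ^ (1 / ρ) := by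
        calc u z ^ n ≤ U ^ n := Real.rpow_le_rpow hz.1 h hn.le
          _ ≤ _ := Real.rpow_le_rpow_of_exponent_le hU1 hnρ
      have h2 : 0 ≤ min (max (u z - U) 0) (max (u z - U) 0 ^ (1 / ρ)) :=
        le_min (le_max_right _ _) (Real.rpow_nonneg (le_max_right _ _) _)
      exact le_trans (by linarith) (mul_nonneg hC0 h2)
    · set x := u z - U with hx
      have hx0 : 0 < x := by linarith
      have hu1 : 1 ≤ u z := by linarith
      rw [max_eq_left hx0.le]
      have h1 : u z ^ n ≤ u z ^ (1 / ρ) := Real.rpow_le_rpow_of_exponent_le hu1 hnρ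
      have h2 : u z ^ (1 / ρ) - U ^ (1 / ρ) ≤ x := by
        refine (rpow_sub_rpow_le_of_le_one ha0 ha1 (by linarith) h.le).trans ?_
        have : U ^ (1 / ρ - 1) ≤ 1 := Real.rpow_le_one_of_one_le_of_nonpos hU1 (by linarith)
        nlinarith
      have h3 : u z ^ (1 / ρ) - U ^ (1 / ρ) ≤ x ^ (1 / ρ) := by
        have := Real.rpow_add_le_add_rpow (p := 1 / ρ) (by linarith : 0 ≤ U) hx0.le ha0 ha1
        rw [show U + x = u z by rw [hx]; ring] at this
        linarith
      have h4 : u z ^ (1 / ρ) - U ^ (1 / ρ) ≤ min x (x ^ (1 / ρ)) := le_min h2 h3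
      have h5 : 0 ≤ min x (x ^ (1 / ρ)) := le_min hx0.le (by positivity)
      exact le_trans (by linarith) (le_mul_of_one_le_left h5 hC1)

/-- Solutions of the subcritical system are bounded on finite cylinders. -/
theorem exists_bound_of_subcritical {Ω : Set (Space N)} (hΩ : IsOpen Ω)
    [IsFiniteMeasure (volume.restrict Ω)] {T p q m n : ℝ} (hT : 0 < T) (hp : 1 < p) (hq : 1 < q)
    (hm : 0 < m) (hn : 0 < n) (hmn : m * n ≤ 1)
    {u u' v v' : Space N × ℝ → ℝ} {gu gv : Space N × ℝ → Space N} {u₀ v₀ : Space N → ℝ}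
    (hu : IsDirichletSolution p Ω T u u' gu (fun z => v z ^ m) u₀)
    (hv : IsDirichletSolution q Ω T v v' gv (fun z => u z ^ n) v₀)
    (hpos : ∀ᵐ z ∂(cylMeasure Ω T), 0 ≤ u z ∧ 0 ≤ v z)
    (hun : MemLp u (ENNReal.ofReal (2 * n)) (cylMeasure Ω T))
    (hvm : MemLp v (ENNReal.ofReal (2 * m)) (cylMeasure Ω T)) {B : ℝ}
    (hu₀ : ∀ᵐ x ∂(volume.restrict Ω), u₀ x ≤ B) (hv₀ : ∀ᵐ x ∂(volume.restrict Ω), v₀ x ≤ B) :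
    ∃ M, ∀ᵐ z ∂(cylMeasure Ω T), u z ≤ M ∧ v z ≤ M := by
  rcases le_total n 1 with h | h
  · exact exists_bound_of_sublinear hΩ hT hp hq hm hn hmn h hu hv hpos hvm hu₀ hv₀
  -- If n ≥ 1 then mn ≤ 1 forces m ≤ 1, and the two equations exchange roles.
  · obtain ⟨M, hM⟩ := exists_bound_of_sublinear hΩ hT hq hp hn hm (by linarith) (by nlinarith) hv hu
      (hpos.mono fun z hz => hz.symm) hun hv₀ hu₀
    exact ⟨M, hM.mono fun z hz => hz.symm⟩

/-- Bounded solutions starting below small multiples of the torsion functions stay below them. -/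
theorem le_torsion_of_bounded (hN : 1 ≤ N) {Ω : Set (Space N)} (hΩ : IsOpen Ω)
    (hb : Bornology.IsBounded Ω) [IsFiniteMeasure (volume.restrict Ω)] {T p q m n : ℝ} (hT : 0 < T)
    (hp : 1 < p) (hq : 1 < q) (hm : 0 < m) (hn : 0 < n)
    {u u' v v' : Space N × ℝ → ℝ} {gu gv : Space N × ℝ → Space N} {u₀ v₀ : Space N → ℝ}
    (hu : IsDirichletSolution p Ω T u u' gu (fun z => v z ^ m) u₀)
    (hv : IsDirichletSolution q Ω T v v' gv (fun z => u z ^ n) v₀)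
    (hpos : ∀ᵐ z ∂(cylMeasure Ω T), 0 ≤ u z ∧ 0 ≤ v z) {B : ℝ}
    (hB : ∀ᵐ z ∂(cylMeasure Ω T), u z ≤ B ∧ v z ≤ B) {δ₀ : ℝ} (hδ₀ : 0 < δ₀)
    {ψp ψq : Space N → ℝ} (hψp : IsTorsionFunction p Ω δ₀ ψp) (hψq : IsTorsionFunction q Ω δ₀ ψq)
    {Mp Mq K₁ K₂ : ℝ} (hMp0 : 0 < Mp) (hMq0 : 0 < Mq)
    (hMp : ∀ᵐ x ∂(volume.restrict Ω), ψp x ≤ Mp)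
    (hMq : ∀ᵐ x ∂(volume.restrict Ω), ψq x ≤ Mq) (hK₁ : 0 < K₁) (hK₂ : 0 < K₂)
    (h₁ : (K₂ * Mq) ^ m ≤ K₁ ^ (p - 1)) (h₂ : (K₁ * Mp) ^ n ≤ K₂ ^ (q - 1))
    (hu₀ : ∀ᵐ x ∂(volume.restrict Ω), u₀ x ≤ K₁ * ψp x)
    (hv₀ : ∀ᵐ x ∂(volume.restrict Ω), v₀ x ≤ K₂ * ψq x) :
    ∀ᵐ z ∂(cylMeasure Ω T), u z ≤ K₁ * Mp ∧ v z ≤ K₂ * Mq := by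
  obtain ⟨gh₁, hb₁⟩ := hψp.isBarrier hN hΩ hb hp hK₁
  obtain ⟨gh₂, hb₂⟩ := hψq.isBarrier hN hΩ hb hq hK₂
  -- Excess sources arise only above the positive levels K₂ Mq and K₁ Mp. Between these levels and
  -- the bound `B`, powers are one-sided Lipschitz even for exponents below 1.
  obtain ⟨C₁, hC₁, hC₁'⟩ := exists_rpow_sub_le hm (mul_pos hK₂ hMq0) B
  obtain ⟨C₂, hC₂, hC₂'⟩ := exists_rpow_sub_le hn (mul_pos hK₁ hMp0) B
  -- A barrier must lie in W_0^{1,p}, so K ψ is split into K (ψ - δ₀) and the constant K δ₀.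
  have key := comparison hΩ hT hp hq hu hv hpos hb₁ hb₂ (c₁ := fun _ => K₁ * δ₀)
    (c₂ := fun _ => K₂ * δ₀) contDiff_const contDiff_const (fun t => by positivity)
    (fun t => by positivity)
    (by filter_upwards [hu₀] with x hx; linarith) (by filter_upwards [hv₀] with x hx; linarith)
    le_rfl (by simpa using hv.memLp_two) (C := C₁ + C₂) (by positivity) ?_ ?_
  · filter_upwards [key, ae_cylMeasure_of_ae_fst hMp, ae_cylMeasure_of_ae_fst hMq] with z hz h3 h4
    have h5 : K₁ * ψp z.1 ≤ K₁ * Mp := by gcongr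
    have h6 : K₂ * ψq z.1 ≤ K₂ * Mq := by gcongr
    constructor <;> linarith
  · filter_upwards [hpos, hB, ae_cylMeasure_of_ae_fst hMq] with z hz hzB h4
    have h6 : K₂ * ψq z.1 ≤ K₂ * Mq := by gcongr
    simp only [deriv_const, sub_zero, Real.rpow_one]
    rw [show v z - K₂ * (ψq z.1 - δ₀) - K₂ * δ₀ = v z - K₂ * ψq z.1 by ring]
    have hy0 := le_max_right (v z - K₂ * ψq z.1) 0
    have hy1 := le_max_left (v z - K₂ * ψq z.1) 0
    rcases le_total (v z) (K₂ * Mq) with h | h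
    · have : v z ^ m ≤ (K₂ * Mq) ^ m := Real.rpow_le_rpow hz.2 h hm.le
      have : 0 ≤ (C₁ + C₂) * (max (v z - K₂ * ψq z.1) 0 + max (v z - K₂ * ψq z.1) 0) := by
        positivity
      linarith
    · have h7 := hC₁' _ h hzB.2
      have h8 : C₁ * (v z - K₂ * Mq) ≤ C₁ * max (v z - K₂ * ψq z.1) 0 := by
        gcongr; linarith
      nlinarith [mul_nonneg hC₁ hy0, mul_nonneg hC₂ hy0]
  · filter_upwards [hpos, hB, ae_cylMeasure_of_ae_fst hMp] with z hz hzB h4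
    have h6 : K₁ * ψp z.1 ≤ K₁ * Mp := by gcongr
    simp only [deriv_const, sub_zero, div_one, Real.rpow_one, min_self]
    rw [show u z - K₁ * (ψp z.1 - δ₀) - K₁ * δ₀ = u z - K₁ * ψp z.1 by ring]
    have hy0 := le_max_right (u z - K₁ * ψp z.1) 0
    have hy1 := le_max_left (u z - K₁ * ψp z.1) 0
    rcases le_total (u z) (K₁ * Mp) with h | h
    · have : u z ^ n ≤ (K₁ * Mp) ^ n := Real.rpow_le_rpow hz.1 h hn.le
      have : 0 ≤ (C₁ + C₂) * max (u z - K₁ * ψp z.1) 0 := by positivity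
      linarith
    · have h7 := hC₂' _ h hzB.1
      have h8 : C₂ * (u z - K₁ * Mp) ≤ C₂ * max (u z - K₁ * ψp z.1) 0 := by
        gcongr; linarith
      nlinarith [mul_nonneg hC₁ hy0, mul_nonneg hC₂ hy0]

/-! ### Evolution of the L^s norms -/

/-- The regularized power `(y + ε)^a`, with `y` clamped to `[0, M]`. -/
noncomputable def shiftWeight (M ε a y : ℝ) : ℝ := (max 0 (min y M) + ε) ^ a

theorem shiftWeight_pos (M : ℝ) {ε : ℝ} (hε : 0 < ε) (a y : ℝ) : 0 < shiftWeight M ε a y := by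
  have : 0 ≤ max 0 (min y M) := le_max_left _ _
  unfold shiftWeight; positivity

theorem continuous_shiftWeight (M : ℝ) {ε : ℝ} (hε : 0 < ε) (a : ℝ) :
    Continuous (shiftWeight M ε a) := by
  refine Continuous.rpow_const (by fun_prop) fun y => Or.inl ?_
  have : 0 ≤ max 0 (min y M) := le_max_left _ _
  linarith

/-- The shift by ε controls negative exponents near 0 and the clamp at M controls positive
exponents. On solutions with values in [0, M] the clamp has no effect. -/
theorem shiftWeight_le {M ε : ℝ} (hM : 0 ≤ M) (hε : 0 < ε) (a y : ℝ) :
    shiftWeight M ε a y ≤ ε ^ a + (M + ε) ^ a := by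
  have h0 : 0 ≤ max 0 (min y M) := le_max_left _ _
  have h1 : max 0 (min y M) ≤ M := max_le hM (min_le_right _ _)
  unfold shiftWeight
  have e1 : 0 ≤ ε ^ a := by positivity
  have e2 : 0 ≤ (M + ε) ^ a := by positivity
  rcases le_total 0 a with h | h
  · have : (max 0 (min y M) + ε) ^ a ≤ (M + ε) ^ a := by gcongr
    linarith
  · have : (max 0 (min y M) + ε) ^ a ≤ ε ^ a :=
      Real.rpow_le_rpow_of_nonpos hε (by linarith) h
    linarith

theorem shiftWeight_eq {M y : ℝ} (hy : y ∈ Icc 0 M) (ε a : ℝ) :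
    shiftWeight M ε a y = (y + ε) ^ a := by
  rw [shiftWeight, min_eq_left hy.2, max_eq_right hy.1]

/-- Used with exponent a/p and power p: the weighted density (w+ε)^a |∇w|^p becomes the p-th power
of the norm of (w+ε)^(a/p) ∇w, the gradient of a function in W_0^{1,p}. -/
theorem shiftWeight_rpow (M : ℝ) {ε : ℝ} (hε : 0 < ε) (a b y : ℝ) :
    shiftWeight M ε a y ^ b = shiftWeight M ε (a * b) y := by
  have : 0 ≤ max 0 (min y M) := le_max_left _ _
  rw [shiftWeight, shiftWeight, Real.rpow_mul (by positivity)]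

theorem primitive_shiftWeight {M y : ℝ} (hy : y ∈ Icc 0 M) {ε a : ℝ} (ha : -1 < a) :
    primitive (shiftWeight M ε a) y = ((y + ε) ^ (a + 1) - ε ^ (a + 1)) / (a + 1) := by
  rw [primitive, intervalIntegral.integral_congr (g := fun t => (t + ε) ^ a)
    (fun t ht => by
      rw [uIcc_of_le hy.1] at ht
      exact shiftWeight_eq ⟨ht.1, ht.2.trans hy.2⟩ ε a),
    intervalIntegral.integral_comp_add_right (fun t => t ^ a), integral_rpow (Or.inl ha), zero_add]

theorem primitive_primitive_shiftWeight {M y : ℝ} (hy : y ∈ Icc 0 M) {ε a : ℝ} (hε : 0 < ε)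
    (ha : -1 < a) :
    primitive (primitive (shiftWeight M ε a)) y
      = ((y + ε) ^ (a + 2) - ε ^ (a + 2)) / ((a + 1) * (a + 2)) - ε ^ (a + 1) / (a + 1) * y := by
  have h1 : a + 1 ≠ 0 := by linarith
  have h2 : a + 2 ≠ 0 := by linarith
  rw [primitive, intervalIntegral.integral_congr
    (g := fun t => (a + 1)⁻¹ * (t + ε) ^ (a + 1) - ε ^ (a + 1) / (a + 1))
    (fun t ht => by
      rw [uIcc_of_le hy.1] at ht
      simp only
      rw [primitive_shiftWeight ⟨ht.1, ht.2.trans hy.2⟩ ha]; ring)]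
  have hc : ContinuousOn (fun t : ℝ => (a + 1)⁻¹ * (t + ε) ^ (a + 1)) (uIcc 0 y) := by
    refine continuousOn_const.mul (ContinuousOn.rpow_const (by fun_prop) fun t ht => Or.inl ?_)
    rw [uIcc_of_le hy.1] at ht
    linarith [ht.1]
  rw [intervalIntegral.integral_sub hc.intervalIntegrable (by simp),
    intervalIntegral.integral_const_mul,
    intervalIntegral.integral_comp_add_right (fun t => t ^ (a + 1)),
    integral_rpow (Or.inl (by linarith)), zero_add, intervalIntegral.integral_const,
    show a + 1 + 1 = a + 2 by ring]
  simp only [smul_eq_mul, sub_zero]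
  field_simp

theorem tendsto_add_rpow {ε : ℕ → ℝ} (hε : Tendsto ε atTop (𝓝 0)) (y : ℝ) {b : ℝ} (hb : 0 < b) :
    Tendsto (fun k => (y + ε k) ^ b) atTop (𝓝 (y ^ b)) := by
  have h1 : Tendsto (fun k => y + ε k) atTop (𝓝 y) := by simpa using hε.const_add y
  exact ((Real.continuous_rpow_const hb.le).tendsto y).comp h1

theorem tendsto_primitive_shiftWeight {M y : ℝ} (hy : y ∈ Icc 0 M) {a : ℝ} (ha : -1 < a)
    {ε : ℕ → ℝ} (hε : Tendsto ε atTop (𝓝 0)) :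
    Tendsto (fun k => primitive (shiftWeight M (ε k) a) y) atTop (𝓝 (y ^ (a + 1) / (a + 1))) := by
  have h1 : 0 < a + 1 := by linarith
  simp_rw [primitive_shiftWeight hy ha]
  have h2 := tendsto_add_rpow hε y h1
  have h3 := tendsto_add_rpow hε 0 h1
  simp only [zero_add, Real.zero_rpow h1.ne'] at h3
  simpa using (h2.sub h3).div_const (a + 1)

theorem tendsto_primitive_primitive_shiftWeight {M y : ℝ} (hy : y ∈ Icc 0 M) {a : ℝ} (ha : -1 < a)
    {ε : ℕ → ℝ} (hε0 : ∀ k, 0 < ε k) (hε : Tendsto ε atTop (𝓝 0)) :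
    Tendsto (fun k => primitive (primitive (shiftWeight M (ε k) a)) y) atTop
      (𝓝 (y ^ (a + 2) / ((a + 1) * (a + 2)))) := by
  have h1 : 0 < a + 1 := by linarith
  have h1' : 0 < a + 2 := by linarith
  simp_rw [fun k => primitive_primitive_shiftWeight hy (hε0 k) ha]
  have h2 := tendsto_add_rpow hε y h1'
  have h3 := tendsto_add_rpow hε 0 h1'
  have h4 := tendsto_add_rpow hε 0 h1
  simp only [zero_add, Real.zero_rpow h1.ne', Real.zero_rpow h1'.ne'] at h3 h4
  simpa using ((h2.sub h3).div_const ((a + 1) * (a + 2))).sub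
    ((h4.div_const (a + 1)).mul_const y)

theorem primitive_shiftWeight_nonneg (M : ℝ) {ε : ℝ} (hε : 0 < ε) (a : ℝ) {y : ℝ} (hy : 0 ≤ y) :
    0 ≤ primitive (shiftWeight M ε a) y :=
  primitive_nonneg (continuous_shiftWeight M hε a) (fun t => (shiftWeight_pos M hε a t).le) hy

/-- The bound is uniform in ε ≤ 1 and serves as the dominating function when ε tends to 0; a > -1
makes the singularity at 0 integrable. -/
theorem primitive_shiftWeight_le {M y : ℝ} (hy : y ∈ Icc 0 M) {ε a : ℝ} (hε : 0 < ε) (hε1 : ε ≤ 1)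
    (ha : -1 < a) : primitive (shiftWeight M ε a) y ≤ (M + 1) ^ (a + 1) / (a + 1) := by
  have h1 : 0 < a + 1 := by linarith
  rw [primitive_shiftWeight hy ha]
  have h2 : (y + ε) ^ (a + 1) ≤ (M + 1) ^ (a + 1) :=
    Real.rpow_le_rpow (by linarith [hy.1]) (by linarith [hy.2]) h1.le
  have h3 : 0 ≤ ε ^ (a + 1) := by positivity
  gcongr
  linarith

theorem abs_primitive_primitive_shiftWeight_le {M y : ℝ} (hy : y ∈ Icc 0 M) {ε a : ℝ} (hε : 0 < ε)
    (hε1 : ε ≤ 1) (ha : -1 < a) :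
    |primitive (primitive (shiftWeight M ε a)) y| ≤ M * ((M + 1) ^ (a + 1) / (a + 1)) := by
  have hc := continuous_shiftWeight M hε a
  have hp : ∀ t, 0 ≤ shiftWeight M ε a t := fun t => (shiftWeight_pos M hε a t).le
  have hM : 0 ≤ M := hy.1.trans hy.2
  have h1 : 0 ≤ primitive (primitive (shiftWeight M ε a)) y :=
    intervalIntegral.integral_nonneg hy.1 fun t ht => primitive_shiftWeight_nonneg M hε a ht.1
  rw [abs_of_nonneg h1]
  calc _ ≤ y * primitive (shiftWeight M ε a) y :=
        primitive_le_mul (continuous_primitive hc) ((monotone_primitive hc hp).monotoneOn _) hy.1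
    _ ≤ M * ((M + 1) ^ (a + 1) / (a + 1)) :=
        mul_le_mul hy.2 (primitive_shiftWeight_le hy hε hε1 ha)
          (primitive_shiftWeight_nonneg M hε a hy.1) hM

/-- The Sobolev inequality combined with Hölder's inequality, in terms of integrals. -/
theorem MemW0.rpow_integral_le (hN : 1 ≤ N) {Ω : Set (Space N)}
    [IsFiniteMeasure (volume.restrict Ω)] {p : ℝ} (hp : 1 < p) (hp2 : p < 2)
    (hγ : 0 < embeddingConst p Ω) (hV : 0 < volume.real Ω) {f : Space N → ℝ}
    {g : Space N → Space N} (h : MemW0 p Ω f g) {τ : ℝ} (hτ : 0 < τ)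
    (hτp : τ ≤ sobolevExponent N p) :
    embeddingConst p Ω ^ (-p) * volume.real Ω ^ (-p * (1 / τ - 1 / sobolevExponent N p)) *
      (∫ x in Ω, |f x| ^ τ) ^ (p / τ) ≤ ∫ x in Ω, ‖g x‖ ^ p := by
  set γ := embeddingConst p Ω
  set V := volume.real Ω with hVdef
  set P := sobolevExponent N p with hP
  set μ := volume.restrict Ω with hμ
  have hP0 : 0 < P := hτ.trans_le hτp
  have h1 := h.eLpNorm_le_embeddingConst hN hp hp2
  have hfP : MemLp f (ENNReal.ofReal P) μ :=
    ⟨h.1.1, h1.trans_lt (ENNReal.mul_lt_top ENNReal.ofReal_lt_top h.2.1.2)⟩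
  have hfτ : MemLp f (ENNReal.ofReal τ) μ := hfP.mono_exponent (ENNReal.ofReal_le_ofReal hτp)
  have h2 := eLpNorm_le_eLpNorm_mul_rpow_measure_univ (ENNReal.ofReal_le_ofReal hτp) hfP.1
  have h3 := h2.trans (mul_le_mul_left h1 _)
  rw [ENNReal.toReal_ofReal hτ.le, ENNReal.toReal_ofReal hP0.le,
    hfτ.eLpNorm_eq_integral_rpow_norm (by simpa using hτ) ENNReal.ofReal_ne_top,
    h.2.1.eLpNorm_eq_integral_rpow_norm (by simp; linarith) ENNReal.ofReal_ne_top,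
    ENNReal.toReal_ofReal hτ.le, ENNReal.toReal_ofReal (by linarith)] at h3
  have he : 0 ≤ 1 / τ - 1 / P := sub_nonneg.2 (one_div_le_one_div_of_le hτ hτp)
  have hμV : μ univ = ENNReal.ofReal V := by
    rw [hVdef, Measure.real, ENNReal.ofReal_toReal, hμ, Measure.restrict_apply_univ]
    have := measure_ne_top μ univ
    rwa [hμ, Measure.restrict_apply_univ] at this
  have hg0 : 0 ≤ ∫ x, ‖g x‖ ^ p ∂μ := integral_nonneg fun x => by positivity
  rw [hμV, ENNReal.ofReal_rpow_of_nonneg hV.le he, ← ENNReal.ofReal_mul hγ.le,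
    ← ENNReal.ofReal_mul (by positivity), ENNReal.ofReal_le_ofReal_iff (by positivity)] at h3
  have hf0 : 0 ≤ ∫ x, ‖f x‖ ^ τ ∂μ := integral_nonneg fun x => by positivity
  have h4 := Real.rpow_le_rpow (by positivity) h3 (show 0 ≤ p by linarith)
  rw [Real.mul_rpow (by positivity) (by positivity), Real.mul_rpow hγ.le (by positivity),
    ← Real.rpow_mul hf0, ← Real.rpow_mul hg0, inv_mul_cancel₀ (by linarith), Real.rpow_one,
    ← Real.rpow_mul hV.le, ← div_eq_inv_mul] at h4
  simp only [Real.norm_eq_abs] at h4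
  have e1 : γ ^ (-p) * γ ^ p = 1 := by rw [← Real.rpow_add hγ]; simp
  have e2 : V ^ (-p * (1 / τ - 1 / P)) * V ^ ((1 / τ - 1 / P) * p) = 1 := by
    rw [← Real.rpow_add hV]; ring_nf; simp
  calc γ ^ (-p) * V ^ (-p * (1 / τ - 1 / P)) * (∫ x, |f x| ^ τ ∂μ) ^ (p / τ)
      ≤ γ ^ (-p) * V ^ (-p * (1 / τ - 1 / P)) *
        (γ ^ p * (∫ x, ‖g x‖ ^ p ∂μ) * V ^ ((1 / τ - 1 / P) * p)) := by gcongr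
    _ = (γ ^ (-p) * γ ^ p) * (V ^ (-p * (1 / τ - 1 / P)) * V ^ ((1 / τ - 1 / P) * p)) *
        ∫ x, ‖g x‖ ^ p ∂μ := by ring
    _ = _ := by rw [e1, e2, one_mul, one_mul]

/-- The integrability exponent produced by the weighted energy is below the Sobolev exponent. -/
theorem div_le_sobolevExponent (hN : 1 ≤ N) {p s : ℝ} (hp : 1 < p) (hp2 : p < 2) (hs : 1 < s)
    (hmin : minExponent N p ≤ s) : s / ((s + p - 2) / p) ≤ sobolevExponent N p := by
  have h0 : 0 < s + p - 2 := by linarith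
  rw [div_div_eq_mul_div, div_le_iff₀ h0]
  unfold minExponent at hmin
  unfold sobolevExponent
  -- For N = 1 the claim is (s-2)(2-p) ≥ 0; for N ≥ 2 it is s p ≥ N(2-p). Both are the minimality
  -- condition on s.
  split_ifs at hmin ⊢ with h
  · nlinarith
  · have hN2 : (2 : ℝ) ≤ N := by exact_mod_cast (by omega : 2 ≤ N)
    rw [div_le_iff₀ (by linarith)] at hmin
    rw [div_mul_eq_mul_div, le_div_iff₀ (by linarith)]
    have : s * (N - p) ≤ N * (s + p - 2) := by nlinarith
    nlinarith

/-- Pointwise bounds for a solution carry over to its continuous representative. -/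
theorem IsDirichletSolution.timeRep_mem_Icc {Ω : Set (Space N)} (hΩ : IsOpen Ω)
    [IsFiniteMeasure (volume.restrict Ω)] {T p : ℝ} (hT : 0 < T)
    {w w' f : Space N × ℝ → ℝ} {g : Space N × ℝ → Space N} {w₀ : Space N → ℝ}
    (hs : IsDirichletSolution p Ω T w w' g f w₀) {M : ℝ} (hM : 0 ≤ M)
    (hw : ∀ᵐ z ∂(cylMeasure Ω T), w z ∈ Icc 0 M) :
    ∀ᵐ x ∂(volume.restrict Ω), ∀ t ∈ Icc 0 T, timeRep w₀ w' x t ∈ Icc 0 M := by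
  have hrep := ae_eq_timeRep hΩ hT hs.memLp_two hs.memLp_deriv hs.weakDeriv hs.initial
    hs.memLp_initial
  filter_upwards [ae_slice' hrep, ae_slice' hw,
    ae_integrable_slice (hs.memLp_deriv.integrable (by norm_num))] with x h1 h2 h3
  have hc := continuousOn_timeRep (w₀ := w₀) hT h3
  -- The representative equals its clamp to [0, M] for almost every time, and both are continuous,
  -- so they agree at every time.
  have heq : EqOn (timeRep w₀ w' x) (fun t => max 0 (min (timeRep w₀ w' x t) M)) (Icc 0 T) := by
    refine Measure.eqOn_Icc_of_ae_eq volume hT.ne ?_ hc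
      (continuousOn_const.sup (hc.inf continuousOn_const))
    rw [← restrict_Ioo_eq_restrict_Icc]
    filter_upwards [h1, h2] with t ht1 ht2
    rw [ht1] at ht2
    rw [min_eq_left ht2.2, max_eq_right ht2.1]
  intro t ht
  rw [heq ht]
  exact ⟨le_max_left _ _, max_le hM (min_le_right _ _)⟩

/-- Weighted energy inequality with a regularized power weight. -/
theorem IsDirichletSolution.shifted_energy_le (hN : 1 ≤ N) {Ω : Set (Space N)} (hΩ : IsOpen Ω)
    [IsFiniteMeasure (volume.restrict Ω)] {T p : ℝ} (hT : 0 < T) (hp : 1 < p) (hp2 : p < 2)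
    (hγ : 0 < embeddingConst p Ω) (hV : 0 < volume.real Ω)
    {w w' f : Space N × ℝ → ℝ} {g : Space N × ℝ → Space N} {w₀ : Space N → ℝ}
    (hs : IsDirichletSolution p Ω T w w' g f w₀) {M : ℝ} (hM : 0 ≤ M)
    (hw : ∀ᵐ z ∂(cylMeasure Ω T), w z ∈ Icc 0 M) {a ε τ : ℝ} (hε : 0 < ε) (hε1 : ε ≤ 1)
    (ha : -1 < a) (hap : -1 < a / p) (hτ : 0 < τ)
    (hτp : τ ≤ sobolevExponent N p) {t₁ t₂ : ℝ} (ht₁ : 0 ≤ t₁) (ht : t₁ ≤ t₂) (ht₂ : t₂ ≤ T) :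
    (∫ x in Ω, primitive (primitive (shiftWeight M ε a)) (timeRep w₀ w' x t₂))
      - (∫ x in Ω, primitive (primitive (shiftWeight M ε a)) (timeRep w₀ w' x t₁))
      ≤ ∫ t in Ioo t₁ t₂, ((∫ x in Ω, f (x, t) * primitive (shiftWeight M ε a) (w (x, t)))
        - embeddingConst p Ω ^ (-p) * volume.real Ω ^ (-p * (1 / τ - 1 / sobolevExponent N p)) *
          (∫ x in Ω, primitive (shiftWeight M ε (a / p)) (w (x, t)) ^ τ) ^ (p / τ)) := by
  set μ := volume.restrict Ω with hμ
  set k := shiftWeight M ε a with hk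
  set A := embeddingConst p Ω ^ (-p) * volume.real Ω ^ (-p * (1 / τ - 1 / sobolevExponent N p))
    with hA
  have hA0 : 0 ≤ A := by positivity
  have hkc : Continuous k := continuous_shiftWeight M hε a
  have hk0 : ∀ y, 0 ≤ k y := fun y => (shiftWeight_pos M hε a y).le
  have hφ := contDiff_primitive hkc
  have hdφ := deriv_primitive hkc
  have hkL : ∀ y, |k y| ≤ ε ^ a + (M + ε) ^ a := fun y => by
    rw [abs_of_nonneg (hk0 y)]; exact shiftWeight_le hM hε a y
  have hL : ∀ y, |deriv (primitive k) y| ≤ ε ^ a + (M + ε) ^ a := fun y => by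
    rw [hdφ]; exact hkL y
  obtain ⟨-, hE⟩ := hs.energy hΩ hT hp hφ hL (memW0_zero p Ω) MemLp.zero
    (c := fun _ => 0) contDiff_const (fun t _ => by simp [primitive_zero])
    (by
      filter_upwards [hw] with z hz
      simpa using primitive_shiftWeight_nonneg M hε a hz.1) ht₁ ht ht₂
  simp only [sub_zero, deriv_const, hdφ, inner_flux_self hp] at hE
  rw [hE]
  have hle := cylMeasure_sub_le (Ω := Ω) ht₁ ht₂
  have hwm := hs.memLp_two.1
  have hm1 : AEStronglyMeasurable (fun z => primitive k (w z)) (cylMeasure Ω T) :=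
    hφ.continuous.comp_aestronglyMeasurable hwm
  have i1 : Integrable (fun z => f z * primitive k (w z)) (cylMeasure Ω T) := by
    refine (hs.source.integrable (by norm_num)).mul_bdd (c := (M + 1) ^ (a + 1) / (a + 1)) hm1 ?_
    filter_upwards [hw] with z hz
    rw [Real.norm_of_nonneg (primitive_shiftWeight_nonneg M hε a hz.1)]
    exact primitive_shiftWeight_le hz hε hε1 ha
  have ig : Integrable (fun z => ‖g z‖ ^ p) (cylMeasure Ω T) := by
    have := hs.memLp_grad.integrable_norm_rpow (by simp; linarith) ENNReal.ofReal_ne_top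
    rwa [ENNReal.toReal_ofReal (by linarith)] at this
  have i2 : Integrable (fun z => k (w z) * ‖g z‖ ^ p) (cylMeasure Ω T) :=
    ig.bdd_mul (hkc.comp_aestronglyMeasurable hwm) (Eventually.of_forall fun z => hkL _)
  have i12 : Integrable (fun z => f z * primitive k (w z) - k (w z) * ‖g z‖ ^ p)
      (μ.prod ((volume : Measure ℝ).restrict (Ioo t₁ t₂))) := (i1.sub i2).mono_measure hle
  rw [integral_prod_symm _ i12]
  have j1 := i1.mono_measure hle
  have j2 := i2.mono_measure hle
  have hkpc := continuous_shiftWeight M hε (a / p)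
  have hBW : ∀ᵐ z ∂(cylMeasure Ω T), primitive (shiftWeight M ε (a / p)) (w z) ^ τ
      ∈ Icc 0 (((M + 1) ^ (a / p + 1) / (a / p + 1)) ^ τ) := by
    filter_upwards [hw] with z hz
    have h0 := primitive_shiftWeight_nonneg M hε (a / p) hz.1
    exact ⟨by positivity, Real.rpow_le_rpow h0 (primitive_shiftWeight_le hz hε hε1 hap) hτ.le⟩
  set Bτ := ((M + 1) ^ (a / p + 1) / (a / p + 1)) ^ τ with hBτ
  have hm2 : AEStronglyMeasurable (fun z => primitive (shiftWeight M ε (a / p)) (w z) ^ τ)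
      (cylMeasure Ω T) :=
    (((continuous_primitive hkpc).comp_aestronglyMeasurable hwm).aemeasurable.pow_const
      τ).aestronglyMeasurable
  have i3 : Integrable (fun z => primitive (shiftWeight M ε (a / p)) (w z) ^ τ)
      (cylMeasure Ω T) := by
    refine Integrable.of_bound hm2 Bτ ?_
    filter_upwards [hBW] with z hz
    rw [Real.norm_of_nonneg hz.1]; exact hz.2
  have j3 := i3.mono_measure hle
  have i4 : Integrable (fun t => A * (∫ x, primitive (shiftWeight M ε (a / p)) (w (x, t)) ^ τ ∂μ)
      ^ (p / τ)) ((volume : Measure ℝ).restrict (Ioo t₁ t₂)) := by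
    refine Integrable.const_mul ?_ A
    refine Integrable.of_bound
      (j3.integral_prod_right.1.aemeasurable.pow_const _).aestronglyMeasurable
      ((Bτ * μ.real univ) ^ (p / τ)) ?_
    filter_upwards [ae_restrict_of_ae_restrict_of_subset (Ioo_subset_Ioo ht₁ ht₂)
      (ae_slice hBW)] with t htb
    have h0 : 0 ≤ ∫ x, primitive (shiftWeight M ε (a / p)) (w (x, t)) ^ τ ∂μ :=
      integral_nonneg_of_ae (htb.mono fun x hx => hx.1)
    rw [Real.norm_of_nonneg (by positivity)]
    refine Real.rpow_le_rpow h0 ?_ (by positivity)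
    have := norm_integral_le_of_norm_le_const (μ := μ) (C := Bτ) (htb.mono fun x hx => by
      rw [Real.norm_of_nonneg hx.1]; exact hx.2)
    exact (le_abs_self _).trans this
  refine integral_mono_ae i12.integral_prod_right (j1.integral_prod_right.sub i4) ?_
  filter_upwards [ae_restrict_of_ae_restrict_of_subset (Ioo_subset_Ioo ht₁ ht₂) hs.zeroTrace,
    ae_restrict_of_ae_restrict_of_subset (Ioo_subset_Ioo ht₁ ht₂) (ae_slice hw),
    j1.prod_left_ae, j2.prod_left_ae] with t htz htw hi1 hi2
  rw [integral_sub hi1 hi2]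
  gcongr
  have hL' : ∀ y, |deriv (primitive (shiftWeight M ε (a / p))) y| ≤
      ε ^ (a / p) + (M + ε) ^ (a / p) := fun y => by
    rw [deriv_primitive hkpc, abs_of_nonneg (shiftWeight_pos M hε _ y).le]
    exact shiftWeight_le hM hε _ y
  -- Sobolev is applied to the primitive of the weight with exponent a/p, since the p-th power of
  -- its gradient norm is exactly the dissipation density.
  have hW := htz.comp_sub_const hΩ hp.le (contDiff_primitive hkpc) hL' (c := 0)
    (by simp [primitive_zero])
  simp only [sub_zero, deriv_primitive hkpc] at hW
  have h1 := hW.rpow_integral_le hN hp hp2 hγ hV hτ hτp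
  have e1 : ∫ x, |primitive (shiftWeight M ε (a / p)) (w (x, t))| ^ τ ∂μ
      = ∫ x, primitive (shiftWeight M ε (a / p)) (w (x, t)) ^ τ ∂μ := by
    refine integral_congr_ae ?_
    filter_upwards [htw] with x hx
    rw [abs_of_nonneg (primitive_shiftWeight_nonneg M hε _ hx.1)]
  have e2 : ∀ x, ‖shiftWeight M ε (a / p) (w (x, t)) • g (x, t)‖ ^ p
      = k (w (x, t)) * ‖g (x, t)‖ ^ p := fun x => by
    have h0 := (shiftWeight_pos M hε (a / p) (w (x, t))).le
    rw [norm_smul, Real.norm_of_nonneg h0, Real.mul_rpow h0 (norm_nonneg _),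
      shiftWeight_rpow M hε, div_mul_cancel₀ _ (by linarith)]
  simp_rw [e2] at h1
  rw [← hμ, e1] at h1
  exact h1

/-- Evolution inequality for the `L^s` norm of a bounded solution. -/
theorem IsDirichletSolution.integral_rpow_le (hN : 1 ≤ N) {Ω : Set (Space N)} (hΩ : IsOpen Ω)
    [IsFiniteMeasure (volume.restrict Ω)] {T p : ℝ} (hT : 0 < T) (hp : 1 < p) (hp2 : p < 2)
    (hγ : 0 < embeddingConst p Ω) (hV : 0 < volume.real Ω)
    {w w' f : Space N × ℝ → ℝ} {g : Space N × ℝ → Space N} {w₀ : Space N → ℝ}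
    (hs : IsDirichletSolution p Ω T w w' g f w₀) {M : ℝ} (hM : 0 ≤ M)
    (hw : ∀ᵐ z ∂(cylMeasure Ω T), w z ∈ Icc 0 M) {s : ℝ} (hs1 : 1 < s)
    (hmin : minExponent N p ≤ s) {t₁ t₂ : ℝ} (ht₁ : 0 ≤ t₁) (ht : t₁ ≤ t₂) (ht₂ : t₂ ≤ T) :
    ((∫ x in Ω, timeRep w₀ w' x t₂ ^ s) - ∫ x in Ω, timeRep w₀ w' x t₁ ^ s) / s
      ≤ ∫ t in Ioo t₁ t₂, ((∫ x in Ω, f (x, t) * w (x, t) ^ (s - 1))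
        - diffusionCoeff p Ω s * (∫ x in Ω, w (x, t) ^ s) ^ ((s + p - 2) / s)) := by
  set μ := volume.restrict Ω with hμ
  -- In the limit ε → 0 the Sobolev function is w^σ/σ, whose gradient is w^((s-2)/p) ∇w. The
  -- exponent τ = s/σ turns its τ-th power back into a multiple of w^s.
  set σ := (s + p - 2) / p with hσ
  have hsp : 0 < s + p - 2 := by linarith
  have hp0 : 0 < p := by linarith
  have hσ0 : 0 < σ := by positivity
  set τ := s / σ with hτ
  have hτ0 : 0 < τ := by positivity
  have hτP : τ ≤ sobolevExponent N p := div_le_sobolevExponent hN hp hp2 hs1 hmin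
  have ha : -1 < s - 2 := by linarith
  have haσ : (s - 2) / p + 1 = σ := by rw [hσ]; field_simp; ring
  have hap : -1 < (s - 2) / p := by linarith
  set A := embeddingConst p Ω ^ (-p) * volume.real Ω ^ (-p * (1 / τ - 1 / sobolevExponent N p))
    with hA
  have hA0 : 0 ≤ A := by positivity
  -- Here σ^(-p) comes from the normalization w^σ/σ, and s - 1 from clearing the denominator of the
  -- test function w^(s-1)/(s-1).
  have hcoef : diffusionCoeff p Ω s = (s - 1) * (A * σ⁻¹ ^ p) := by
    have e1 : 1 / τ = (s + p - 2) / (s * p) := by rw [hτ, hσ]; field_simp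
    have e2 : σ⁻¹ ^ p = p ^ p / (s + p - 2) ^ p := by
      rw [hσ, inv_div, Real.div_rpow hp0.le hsp.le]
    rw [diffusionCoeff, hA, e1, e2]
    ring
  set ε : ℕ → ℝ := fun k => 1 / ((k : ℝ) + 1) with hε
  have hε0 : ∀ k, 0 < ε k := fun k => by positivity
  have hε1 : ∀ k, ε k ≤ 1 := fun k => by
    rw [hε]; simp only
    rw [div_le_one (by positivity)]
    have : (0 : ℝ) ≤ k := Nat.cast_nonneg k
    linarith
  have hεt : Tendsto ε atTop (𝓝 0) := tendsto_one_div_add_atTop_nhds_zero_nat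
  have hbd := hs.timeRep_mem_Icc hΩ hT hM hw
  have hL : ∀ t ∈ Icc 0 T, Tendsto (fun k => ∫ x, primitive (primitive
      (shiftWeight M (ε k) (s - 2))) (timeRep w₀ w' x t) ∂μ) atTop
      (𝓝 (∫ x, timeRep w₀ w' x t ^ s / ((s - 1) * s) ∂μ)) := by
    intro t htm
    refine tendsto_integral_of_dominated_convergence
      (fun _ => M * ((M + 1) ^ (s - 2 + 1) / (s - 2 + 1))) (fun k => ?_)
      (integrable_const _) (fun k => ?_) ?_
    · exact (continuous_primitive (continuous_primitive
        (continuous_shiftWeight M (hε0 k) _))).comp_aestronglyMeasurable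
        (memLp_timeRep hT hs.memLp_deriv hs.memLp_initial htm.2).1
    · filter_upwards [hbd] with x hx
      exact abs_primitive_primitive_shiftWeight_le (hx t htm) (hε0 k) (hε1 k) ha
    · filter_upwards [hbd] with x hx
      have := tendsto_primitive_primitive_shiftWeight (hx t htm) ha hε0 hεt
      rwa [show s - 2 + 2 = s by ring, show s - 2 + 1 = s - 1 by ring] at this
  have hfi : Integrable f (cylMeasure Ω T) := hs.source.integrable (by norm_num)
  have hfn := hfi.norm
  have hwm := hs.memLp_two.1
  have hf' := hfi
  rw [cylMeasure_eq_prod] at hf' hfn hwm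
  set B₁ := (M + 1) ^ (s - 2 + 1) / (s - 2 + 1) with hB₁
  set B₂ := ((M + 1) ^ ((s - 2) / p + 1) / ((s - 2) / p + 1)) ^ τ with hB₂
  have hB₁0 : 0 ≤ B₁ := by
    have : 0 < s - 2 + 1 := by linarith
    positivity
  have hR : Tendsto (fun k => ∫ t in Ioo t₁ t₂,
      ((∫ x, f (x, t) * primitive (shiftWeight M (ε k) (s - 2)) (w (x, t)) ∂μ)
        - A * (∫ x, primitive (shiftWeight M (ε k) ((s - 2) / p)) (w (x, t)) ^ τ ∂μ) ^ (p / τ)))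
      atTop (𝓝 (∫ t in Ioo t₁ t₂,
        ((∫ x, f (x, t) * (w (x, t) ^ (s - 1) / (s - 1)) ∂μ)
        - A * (∫ x, (w (x, t) ^ σ / σ) ^ τ ∂μ) ^ (p / τ)))) := by
    have hsub := Ioo_subset_Ioo ht₁ ht₂
    refine tendsto_integral_of_dominated_convergence
      (fun t => B₁ * (∫ x, ‖f (x, t)‖ ∂μ) + A * (B₂ * μ.real univ) ^ (p / τ)) (fun k => ?_)
      ?_ (fun k => ?_) ?_
    · have m1 : AEStronglyMeasurable
          (fun z => f z * primitive (shiftWeight M (ε k) (s - 2)) (w z))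
          (μ.prod ((volume : Measure ℝ).restrict (Ioo 0 T))) :=
        hf'.1.mul ((continuous_primitive
          (continuous_shiftWeight M (hε0 k) _)).comp_aestronglyMeasurable hwm)
      have m2 : AEStronglyMeasurable
          (fun z => primitive (shiftWeight M (ε k) ((s - 2) / p)) (w z) ^ τ)
          (μ.prod ((volume : Measure ℝ).restrict (Ioo 0 T))) :=
        (((continuous_primitive (continuous_shiftWeight M (hε0 k) _)).comp_aestronglyMeasurable
          hwm).aemeasurable.pow_const τ).aestronglyMeasurable
      have m3 := m1.prod_swap.integral_prod_right'
      have m4 := (m2.prod_swap.integral_prod_right'.aemeasurable.pow_const (p / τ)).const_mul A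
      exact (m3.sub m4.aestronglyMeasurable).mono_measure (Measure.restrict_mono hsub le_rfl)
    · refine Integrable.add (Integrable.const_mul ?_ _) (integrable_const _)
      exact (hfn.integral_prod_right).mono_measure (Measure.restrict_mono hsub le_rfl)
    · filter_upwards [ae_restrict_of_ae_restrict_of_subset hsub (ae_slice hw),
        ae_restrict_of_ae_restrict_of_subset hsub hf'.prod_left_ae] with t htw htf
      have h0 : 0 ≤ ∫ x, primitive (shiftWeight M (ε k) ((s - 2) / p)) (w (x, t)) ^ τ ∂μ := by
        refine integral_nonneg_of_ae (htw.mono fun x hx => ?_)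
        have := primitive_shiftWeight_nonneg M (hε0 k) ((s - 2) / p) hx.1
        simp only [Pi.zero_apply]; positivity
      refine (norm_sub_le _ _).trans (add_le_add ?_ ?_)
      · refine (norm_integral_le_integral_norm _).trans ?_
        rw [← integral_const_mul]
        refine integral_mono_of_nonneg (Eventually.of_forall fun x => norm_nonneg _)
          (htf.norm.const_mul _) ?_
        filter_upwards [htw] with x hx
        rw [norm_mul, mul_comm]
        gcongr
        rw [Real.norm_of_nonneg (primitive_shiftWeight_nonneg M (hε0 k) _ hx.1)]
        exact primitive_shiftWeight_le hx (hε0 k) (hε1 k) ha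
      · rw [norm_mul, Real.norm_of_nonneg hA0, Real.norm_of_nonneg (by positivity)]
        gcongr
        have := norm_integral_le_of_norm_le_const (μ := μ) (C := B₂)
          (f := fun x => primitive (shiftWeight M (ε k) ((s - 2) / p)) (w (x, t)) ^ τ)
          (htw.mono fun x hx => by
            have h1 := primitive_shiftWeight_nonneg M (hε0 k) ((s - 2) / p) hx.1
            rw [Real.norm_of_nonneg (by positivity)]
            exact Real.rpow_le_rpow h1 (primitive_shiftWeight_le hx (hε0 k) (hε1 k) hap) hτ0.le)
        exact (le_abs_self _).trans this
    · filter_upwards [ae_restrict_of_ae_restrict_of_subset hsub (ae_slice hw),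
        ae_restrict_of_ae_restrict_of_subset hsub hf'.prod_left_ae,
        ae_restrict_of_ae_restrict_of_subset hsub hwm.prodMk_right] with t htw htf htm
      refine Tendsto.sub ?_ (Tendsto.const_mul A ?_)
      · refine tendsto_integral_of_dominated_convergence (fun x => B₁ * ‖f (x, t)‖) (fun k => ?_)
          (htf.norm.const_mul _) (fun k => ?_) ?_
        · exact htf.1.mul ((continuous_primitive
            (continuous_shiftWeight M (hε0 k) _)).comp_aestronglyMeasurable htm)
        · filter_upwards [htw] with x hx
          rw [norm_mul, mul_comm]
          gcongr
          rw [Real.norm_of_nonneg (primitive_shiftWeight_nonneg M (hε0 k) _ hx.1)]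
          exact primitive_shiftWeight_le hx (hε0 k) (hε1 k) ha
        · filter_upwards [htw] with x hx
          have := tendsto_primitive_shiftWeight hx ha hεt
          rw [show s - 2 + 1 = s - 1 by ring] at this
          exact this.const_mul _
      · refine Tendsto.rpow_const ?_ (Or.inr (by positivity))
        refine tendsto_integral_of_dominated_convergence (fun x => B₂) (fun k => ?_)
          (integrable_const _) (fun k => ?_) ?_
        · exact (((continuous_primitive
            (continuous_shiftWeight M (hε0 k) _)).comp_aestronglyMeasurable
            htm).aemeasurable.pow_const τ).aestronglyMeasurable
        · filter_upwards [htw] with x hx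
          have h1 := primitive_shiftWeight_nonneg M (hε0 k) ((s - 2) / p) hx.1
          rw [Real.norm_of_nonneg (by positivity)]
          exact Real.rpow_le_rpow h1 (primitive_shiftWeight_le hx (hε0 k) (hε1 k) hap) hτ0.le
        · filter_upwards [htw] with x hx
          have := tendsto_primitive_shiftWeight hx hap hεt
          rw [haσ] at this
          exact this.rpow_const (Or.inr hτ0.le)
  have hlim := le_of_tendsto_of_tendsto' ((hL t₂ ⟨ht₁.trans ht, ht₂⟩).sub
    (hL t₁ ⟨ht₁, ht.trans ht₂⟩)) hR fun k =>
      hs.shifted_energy_le hN hΩ hT hp hp2 hγ hV hM hw (hε0 k) (hε1 k) ha hap hτ0 hτP ht₁ ht ht₂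
  have hs10 : 0 < s - 1 := by linarith
  rw [integral_div, integral_div, ← sub_div] at hlim
  have hlim2 := mul_le_mul_of_nonneg_left hlim hs10.le
  rw [← integral_const_mul] at hlim2
  have eL : ∀ y : ℝ, y / s = (s - 1) * (y / ((s - 1) * s)) := fun y => by field_simp
  rw [eL]
  refine hlim2.trans (le_of_eq ?_)
  refine integral_congr_ae ?_
  filter_upwards [ae_restrict_of_ae_restrict_of_subset (Ioo_subset_Ioo ht₁ ht₂) (ae_slice hw)]
    with t htw
  have e1 : ∫ x, f (x, t) * (w (x, t) ^ (s - 1) / (s - 1)) ∂μ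
      = (∫ x, f (x, t) * w (x, t) ^ (s - 1) ∂μ) / (s - 1) := by
    rw [← integral_div]
    congr 1; ext x; ring
  have e2 : ∫ x, (w (x, t) ^ σ / σ) ^ τ ∂μ = (∫ x, w (x, t) ^ s ∂μ) * σ⁻¹ ^ τ := by
    rw [← integral_mul_const]
    refine integral_congr_ae ?_
    filter_upwards [htw] with x hx
    rw [div_eq_mul_inv, Real.mul_rpow (by have := hx.1; positivity) (by positivity),
      ← Real.rpow_mul hx.1, hτ, mul_div_cancel₀ _ hσ0.ne']
  have h0 : 0 ≤ ∫ x, w (x, t) ^ s ∂μ := by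
    refine integral_nonneg_of_ae (htw.mono fun x hx => ?_)
    have := hx.1
    simp only [Pi.zero_apply]; positivity
  have e3 : p / τ = (s + p - 2) / s := by rw [hτ, hσ]; field_simp
  have e4 : (σ⁻¹ ^ τ) ^ (p / τ) = σ⁻¹ ^ p := by
    rw [← Real.rpow_mul (by positivity), mul_div_cancel₀ _ hτ0.ne']
  rw [e1, e2, Real.mul_rpow h0 (by positivity), e4, e3, hcoef]
  field_simp

/-- The `L^s` norm of a bounded solution is continuous in time. -/
theorem IsDirichletSolution.continuousOn_integral_rpow {Ω : Set (Space N)} (hΩ : IsOpen Ω)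
    [IsFiniteMeasure (volume.restrict Ω)] {T p : ℝ} (hT : 0 < T)
    {w w' f : Space N × ℝ → ℝ} {g : Space N × ℝ → Space N} {w₀ : Space N → ℝ}
    (hs : IsDirichletSolution p Ω T w w' g f w₀) {M : ℝ} (hM : 0 ≤ M)
    (hw : ∀ᵐ z ∂(cylMeasure Ω T), w z ∈ Icc 0 M) {s : ℝ} (hs0 : 0 ≤ s) :
    ContinuousOn (fun t => ∫ x in Ω, timeRep w₀ w' x t ^ s) (Icc 0 T) := by
  have hbd := hs.timeRep_mem_Icc hΩ hT hM hw
  refine continuousOn_of_dominated (bound := fun _ => M ^ s) (fun t ht => ?_) (fun t ht => ?_)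
    (integrable_const _) ?_
  · exact ((memLp_timeRep hT hs.memLp_deriv hs.memLp_initial
      ht.2).1.aemeasurable.pow_const s).aestronglyMeasurable
  · filter_upwards [hbd] with x hx
    have := (hx t ht).1
    rw [Real.norm_of_nonneg (by positivity)]
    exact Real.rpow_le_rpow (hx t ht).1 (hx t ht).2 hs0
  · filter_upwards [ae_integrable_slice (hs.memLp_deriv.integrable (by norm_num))] with x hx
    exact (continuousOn_timeRep hT hx).rpow_const fun t _ => Or.inr hs0

/-! ### Finite-time extinction for coupled differential inequalities -/

/-- Continuity keeps the rate negative shortly before t, so over that interval the integral bound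
forces the earlier value to be at least A(t) = 0. This contradicts a first contact from below and
needs no differentiability of A. -/
theorem nonneg_before_of_integral_bound {T t : ℝ} {A R : ℝ → ℝ} (hR : ContinuousOn R (Icc 0 T))
    (hAi : ∀ t₁ t₂, 0 ≤ t₁ → t₁ ≤ t₂ → t₂ ≤ T → A t₂ - A t₁ ≤ ∫ t in t₁..t₂, R t)
    (ht0 : 0 < t) (htT : t ≤ T) (hAt : A t = 0) (hRt : R t < 0) : ∃ t', 0 ≤ t' ∧ t' < t ∧ 0 ≤ A t' := by
  have h1 : ∀ᶠ y in 𝓝[Icc 0 T] t, R y < 0 := (hR t ⟨ht0.le, htT⟩).eventually_lt_const hRt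
  rw [eventually_nhdsWithin_iff, Metric.eventually_nhds_iff] at h1
  obtain ⟨η, hη, h2⟩ := h1
  refine ⟨max 0 (t - η / 2), le_max_left _ _, max_lt ht0 (by linarith), ?_⟩
  have hle : max 0 (t - η / 2) ≤ t := max_le ht0.le (by linarith)
  have h3 := hAi _ t (le_max_left 0 (t - η / 2)) hle htT
  have h4 : ∫ y in (max 0 (t - η / 2))..t, R y ≤ 0 := by
    rw [intervalIntegral.integral_of_le hle]
    refine setIntegral_nonpos measurableSet_Ioc fun y hy => ?_
    have h5 := le_max_left 0 (t - η / 2)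
    have h6 := le_max_right 0 (t - η / 2)
    refine (h2 ?_ ⟨by linarith [hy.1], by linarith [hy.2]⟩).le
    rw [Real.dist_eq, abs_lt]
    constructor <;> linarith [hy.1, hy.2]
  linarith

/-- Two quantities that start negative and cannot cross zero one at a time remain negative. -/
theorem neg_of_integral_bound {T : ℝ} {A B RA RB : ℝ → ℝ} (hA : ContinuousOn A (Icc 0 T))
    (hB : ContinuousOn B (Icc 0 T)) (hRA : ContinuousOn RA (Icc 0 T))
    (hRB : ContinuousOn RB (Icc 0 T)) (hA0 : A 0 < 0) (hB0 : B 0 < 0)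
    (hAi : ∀ t₁ t₂, 0 ≤ t₁ → t₁ ≤ t₂ → t₂ ≤ T → A t₂ - A t₁ ≤ ∫ t in t₁..t₂, RA t)
    (hBi : ∀ t₁ t₂, 0 ≤ t₁ → t₁ ≤ t₂ → t₂ ≤ T → B t₂ - B t₁ ≤ ∫ t in t₁..t₂, RB t)
    (h1 : ∀ t ∈ Icc 0 T, A t = 0 → B t ≤ 0 → RA t < 0)
    (h2 : ∀ t ∈ Icc 0 T, B t = 0 → A t ≤ 0 → RB t < 0) :
    ∀ t ∈ Icc 0 T, A t < 0 ∧ B t < 0 := by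
  by_contra hcon
  push Not at hcon
  obtain ⟨t₀, ht₀, hcon⟩ := hcon
  set S := Icc 0 T ∩ (fun t => max (A t) (B t)) ⁻¹' Ici 0 with hS
  have hSc : IsClosed S := (hA.sup hB).preimage_isClosed_of_isClosed isClosed_Icc isClosed_Ici
  have hSn : S.Nonempty := ⟨t₀, ht₀, by
    by_cases h : A t₀ < 0
    · exact le_max_of_le_right (hcon h)
    · exact le_max_of_le_left (not_lt.1 h)⟩
  -- At the first time when one quantity reaches zero, both are still nonpositive, so the rate
  -- hypothesis for that quantity applies.
  obtain ⟨t, ⟨htm, htS⟩, htl⟩ := (isCompact_Icc.of_isClosed_subset hSc inter_subset_left).exists_isLeast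
    hSn
  have htS' : 0 ≤ max (A t) (B t) := htS
  have hbefore : ∀ y, 0 ≤ y → y < t → A y < 0 ∧ B y < 0 := fun y hy0 hyt => by
    by_contra hne
    refine absurd (htl (show y ∈ S from ⟨⟨hy0, hyt.le.trans htm.2⟩, ?_⟩)) (not_le.2 hyt)
    rw [not_and_or, not_lt, not_lt] at hne
    exact hne.elim le_max_of_le_left le_max_of_le_right
  have ht0 : 0 < t := by
    rcases htm.1.lt_or_eq with h | h
    · exact h
    · rw [← h] at htS'
      exact absurd htS' (not_le.2 (max_lt hA0 hB0))
  have hlim : ∀ F : ℝ → ℝ, ContinuousOn F (Icc 0 T) → (∀ y, 0 ≤ y → y < t → F y < 0) → F t ≤ 0 := by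
    intro F hF hFn
    have hF' : Tendsto F (𝓝[Ico 0 t] t) (𝓝 (F t)) :=
      (hF t htm).mono_left (nhdsWithin_mono _ fun y hy => ⟨hy.1, hy.2.le.trans htm.2⟩)
    have hne : (𝓝[Ico 0 t] t).NeBot := by
      rw [← mem_closure_iff_nhdsWithin_neBot, closure_Ico ht0.ne]
      exact ⟨ht0.le, le_rfl⟩
    exact le_of_tendsto hF' (eventually_nhdsWithin_of_forall fun y hy => (hFn y hy.1 hy.2).le)
  have hAt := hlim A hA fun y h0 h1 => (hbefore y h0 h1).1
  have hBt := hlim B hB fun y h0 h1 => (hbefore y h0 h1).2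
  rcases le_max_iff.1 htS' with h | h
  · have hz : A t = 0 := le_antisymm hAt h
    obtain ⟨y, hy0, hyt, hy⟩ := nonneg_before_of_integral_bound hRA hAi ht0 htm.2 hz
      (h1 t htm hz hBt)
    exact absurd hy (not_le.2 (hbefore y hy0 hyt).1)
  · have hz : B t = 0 := le_antisymm hBt h
    obtain ⟨y, hy0, hyt, hy⟩ := nonneg_before_of_integral_bound hRB hBi ht0 htm.2 hz
      (h2 t htm hz hAt)
    exact absurd hy (not_le.2 (hbefore y hy0 hyt).2)

theorem hasDerivAt_max_sq (y : ℝ) : HasDerivAt (fun y : ℝ => max y 0 ^ 2) (2 * max y 0) y := by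
  have hc : Continuous fun y : ℝ => 2 * max y 0 := by fun_prop
  have h1 : (fun y : ℝ => max y 0 ^ 2) = primitive fun y => 2 * max y 0 := by
    ext y
    rcases le_total y 0 with h | h
    · rw [max_eq_right h, primitive_of_nonpos (fun t ht => by rw [max_eq_right ht, mul_zero]) h]
      norm_num
    · rw [max_eq_left h, primitive, intervalIntegral.integral_congr (g := fun t => 2 * t)
        (fun t ht => by
          rw [uIcc_of_le h] at ht
          simp only
          rw [max_eq_left ht.1]), intervalIntegral.integral_const_mul, integral_id]
      ring
  rw [h1]
  exact hasDerivAt_primitive hc y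

/-- Strict supersolution property of the profile `X₀ θ^σ₁` coupled with `Y₀ θ^σ₂`. -/
theorem profile_rate_neg {p m a b δ δ' X₀ Y₀ σ₁ σ₂ ε θ θ' : ℝ} (hX₀ : 0 < X₀) (hY₀ : 0 < Y₀)
    (ha : 0 < a) (hcmp : b * Y₀ ^ m ≤ δ * a * X₀ ^ (p - 1)) (hθ : 0 < θ) (hθ2 : θ ≤ 2)
    (hε : 0 ≤ ε) (hθ' : -(2 * ε * θ ^ (1 / 2 : ℝ)) ≤ θ') (hσ₁ : 0 ≤ σ₁)
    (hD : δ * θ ^ (σ₂ * m - σ₁ * (p - 1)) ≤ δ') (hσp : 1 / 2 ≤ σ₁ * (2 - p))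
    (hεs : 2 * ε * σ₁ * X₀ * 2 ^ (σ₁ * (2 - p) - 1 / 2) < (1 - δ') * a * X₀ ^ (p - 1)) :
    b * (Y₀ * θ ^ σ₂) ^ m - a * (X₀ * θ ^ σ₁) ^ (p - 1) - X₀ * (θ' * σ₁ * θ ^ (σ₁ - 1)) < 0 := by
  have e1 : (Y₀ * θ ^ σ₂) ^ m = Y₀ ^ m * (θ ^ (σ₁ * (p - 1)) * θ ^ (σ₂ * m - σ₁ * (p - 1))) := by
    rw [Real.mul_rpow hY₀.le (by positivity), ← Real.rpow_mul hθ.le, ← Real.rpow_add hθ]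
    congr 2; ring
  have e2 : (X₀ * θ ^ σ₁) ^ (p - 1) = X₀ ^ (p - 1) * θ ^ (σ₁ * (p - 1)) := by
    rw [Real.mul_rpow hX₀.le (by positivity), ← Real.rpow_mul hθ.le]
  -- The loss from θ' is of order θ^(1/2) θ^(σ₁-1). Factoring out the absorption power θ^(σ₁(p-1))
  -- leaves a nonnegative power of θ, because σ₁(2-p) ≥ 1/2; with θ ≤ 2 it is bounded.
  have e3 : θ ^ (1 / 2 : ℝ) * θ ^ (σ₁ - 1) = θ ^ (σ₁ * (p - 1)) * θ ^ (σ₁ * (2 - p) - 1 / 2) := by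
    rw [← Real.rpow_add hθ, ← Real.rpow_add hθ]
    congr 1; ring
  set G := θ ^ (σ₁ * (p - 1)) with hG
  have hG0 : 0 < G := by positivity
  have h1 : b * (Y₀ * θ ^ σ₂) ^ m ≤ G * (δ' * (a * X₀ ^ (p - 1))) := by
    rw [e1]
    calc b * (Y₀ ^ m * (G * θ ^ (σ₂ * m - σ₁ * (p - 1))))
        = (b * Y₀ ^ m) * (G * θ ^ (σ₂ * m - σ₁ * (p - 1))) := by ring
      _ ≤ (δ * a * X₀ ^ (p - 1)) * (G * θ ^ (σ₂ * m - σ₁ * (p - 1))) := by gcongr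
      _ = G * ((δ * θ ^ (σ₂ * m - σ₁ * (p - 1))) * (a * X₀ ^ (p - 1))) := by ring
      _ ≤ _ := by gcongr
  have h2 : θ ^ (σ₁ * (2 - p) - 1 / 2) ≤ 2 ^ (σ₁ * (2 - p) - 1 / 2) :=
    Real.rpow_le_rpow hθ.le hθ2 (by linarith)
  have h3 : -(X₀ * (θ' * σ₁ * θ ^ (σ₁ - 1))) ≤ G * (2 * ε * σ₁ * X₀ * 2 ^ (σ₁ * (2 - p) - 1 / 2)) := by
    calc -(X₀ * (θ' * σ₁ * θ ^ (σ₁ - 1))) = -θ' * (X₀ * σ₁ * θ ^ (σ₁ - 1)) := by ring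
      _ ≤ (2 * ε * θ ^ (1 / 2 : ℝ)) * (X₀ * σ₁ * θ ^ (σ₁ - 1)) := by
          gcongr
          linarith
      _ = 2 * ε * σ₁ * X₀ * (θ ^ (1 / 2 : ℝ) * θ ^ (σ₁ - 1)) := by ring
      _ = G * (2 * ε * σ₁ * X₀ * θ ^ (σ₁ * (2 - p) - 1 / 2)) := by rw [e3]; ring
      _ ≤ _ := by gcongr
  rw [e2]
  nlinarith [mul_lt_mul_of_pos_left hεs hG0]

/-- The decreasing profile `λ + ((1 - ε t)_+)^2`. -/
noncomputable def profile (ε l t : ℝ) : ℝ := l + max (1 - ε * t) 0 ^ 2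

theorem profile_pos (ε : ℝ) {l : ℝ} (hl : 0 < l) (t : ℝ) : 0 < profile ε l t := by
  unfold profile; positivity

theorem profile_le {ε : ℝ} (hε : 0 ≤ ε) (l : ℝ) {t : ℝ} (ht : 0 ≤ t) : profile ε l t ≤ 1 + l := by
  have h1 : max (1 - ε * t) 0 ≤ 1 := max_le (by nlinarith) zero_le_one
  have h2 := le_max_right (1 - ε * t) 0
  unfold profile; nlinarith

theorem hasDerivAt_profile (ε l t : ℝ) :
    HasDerivAt (profile ε l) (2 * max (1 - ε * t) 0 * -ε) t := by
  have h1 : HasDerivAt (fun t : ℝ => 1 - ε * t) (-ε) t := by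
    simpa using ((hasDerivAt_id t).const_mul ε).const_sub 1
  exact ((hasDerivAt_max_sq _).comp t h1).const_add l

theorem profile_deriv_ge {ε l : ℝ} (hε : 0 ≤ ε) (hl : 0 < l) (t : ℝ) :
    -(2 * ε * profile ε l t ^ (1 / 2 : ℝ)) ≤ 2 * max (1 - ε * t) 0 * -ε := by
  have h0 := le_max_right (1 - ε * t) 0
  have h1 : max (1 - ε * t) 0 ≤ profile ε l t ^ (1 / 2 : ℝ) := by
    rw [← Real.sqrt_eq_rpow]
    refine Real.le_sqrt_of_sq_le ?_
    unfold profile; linarith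
  nlinarith [mul_le_mul_of_nonneg_left h1 hε]

/-- The differential inequality for one component, compared with the profile. -/
theorem exists_rate_of_profile {p m a b δ δ' X₀ Y₀ σ₁ σ₂ ε l s r T : ℝ} (hX₀ : 0 < X₀)
    (hY₀ : 0 < Y₀) (hp : 1 < p) (ha : 0 < a) (hb : 0 ≤ b) (hm : 0 ≤ m) (hδ : 0 ≤ δ)
    (hs : 1 < s) (hr : 1 < r) (hcmp : b * Y₀ ^ m ≤ δ * a * X₀ ^ (p - 1)) (hl : 0 < l) (hl1 : l ≤ 1)
    (hε : 0 ≤ ε) (hσ₁ : 0 ≤ σ₁) (hDpos : 0 ≤ σ₂ * m - σ₁ * (p - 1))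
    (hD : δ * (1 + l) ^ (σ₂ * m - σ₁ * (p - 1)) ≤ δ') (hσp : 1 / 2 ≤ σ₁ * (2 - p))
    (hεs : 2 * ε * σ₁ * X₀ * 2 ^ (σ₁ * (2 - p) - 1 / 2) < (1 - δ') * a * X₀ ^ (p - 1))
    {Z W : ℝ → ℝ} (hZ : ContinuousOn Z (Icc 0 T)) (hW : ContinuousOn W (Icc 0 T))
    (hW0 : ∀ t ∈ Icc 0 T, 0 ≤ W t)
    (hode : ∀ t₁ t₂, 0 ≤ t₁ → t₁ ≤ t₂ → t₂ ≤ T → (Z t₂ - Z t₁) / s ≤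
      ∫ t in t₁..t₂, (b * W t ^ (m / r) * Z t ^ ((s - 1) / s) - a * Z t ^ ((s + p - 2) / s))) :
    ∃ R : ℝ → ℝ, ContinuousOn R (Icc 0 T) ∧
      (∀ t₁ t₂, 0 ≤ t₁ → t₁ ≤ t₂ → t₂ ≤ T →
        (Z t₂ - (X₀ * profile ε l t₂ ^ σ₁) ^ s) / s - (Z t₁ - (X₀ * profile ε l t₁ ^ σ₁) ^ s) / s
          ≤ ∫ t in t₁..t₂, R t) ∧
      ∀ t ∈ Icc 0 T, (Z t - (X₀ * profile ε l t ^ σ₁) ^ s) / s = 0 →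
        (W t - (Y₀ * profile ε l t ^ σ₂) ^ r) / r ≤ 0 → R t < 0 := by
  have hs0 : 0 < s := by linarith
  have hr0 : 0 < r := by linarith
  have hθ := profile_pos ε hl
  set θ := profile ε l with hθdef
  set θ' : ℝ → ℝ := fun t => 2 * max (1 - ε * t) 0 * -ε with hθ'
  set x : ℝ → ℝ := fun t => X₀ * θ t ^ σ₁ with hx
  have hx0 : ∀ t, 0 < x t := fun t => mul_pos hX₀ (Real.rpow_pos_of_pos (hθ t) _)
  have hdx : ∀ t, HasDerivAt x (X₀ * (θ' t * σ₁ * θ t ^ (σ₁ - 1))) t := fun t =>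
    ((hasDerivAt_profile ε l t).rpow_const (Or.inl (hθ t).ne')).const_mul X₀
  set x' : ℝ → ℝ := fun t => X₀ * (θ' t * σ₁ * θ t ^ (σ₁ - 1)) with hx'
  have hdxs : ∀ t, HasDerivAt (fun t => x t ^ s / s) (x' t * x t ^ (s - 1)) t := fun t => by
    have := ((hdx t).rpow_const (p := s) (Or.inl (hx0 t).ne')).div_const s
    refine this.congr_deriv ?_
    field_simp
    simp only [hx']
    ring
  have hθc : Continuous θ := by
    rw [hθdef]; unfold profile; fun_prop
  have hxc : Continuous x := continuous_const.mul (hθc.rpow_const fun t => Or.inl (hθ t).ne')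
  have hx'c : Continuous fun t => x' t * x t ^ (s - 1) := by
    refine Continuous.mul (continuous_const.mul (Continuous.mul ?_ ?_)) ?_
    · simp only [hθ']; fun_prop
    · exact hθc.rpow_const fun t => Or.inl (hθ t).ne'
    · exact hxc.rpow_const fun t => Or.inl (hx0 t).ne'
  set F : ℝ → ℝ := fun t => b * W t ^ (m / r) * Z t ^ ((s - 1) / s) - a * Z t ^ ((s + p - 2) / s)
    with hF
  have hFc : ContinuousOn F (Icc 0 T) := by
    refine ((continuousOn_const.mul (hW.rpow_const fun t _ => Or.inr (by positivity))).mul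
      (hZ.rpow_const fun t _ => Or.inr ?_)).sub (continuousOn_const.mul
        (hZ.rpow_const fun t _ => Or.inr ?_))
    · exact div_nonneg (by linarith) hs0.le
    · exact div_nonneg (by linarith) hs0.le
  -- At contact Z = x^s this rate is x^(s-1) times the strict supersolution defect of the profile.
  refine ⟨fun t => F t - x' t * x t ^ (s - 1), hFc.sub hx'c.continuousOn, ?_, ?_⟩
  · intro t₁ t₂ h1 h2 h3
    have hFi : IntervalIntegrable F volume t₁ t₂ := by
      refine (hFc.mono ?_).intervalIntegrable
      rw [uIcc_of_le h2]
      exact Icc_subset_Icc h1 h3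
    rw [intervalIntegral.integral_sub hFi (hx'c.intervalIntegrable _ _),
      intervalIntegral.integral_eq_sub_of_hasDerivAt (fun t _ => hdxs t)
        (hx'c.intervalIntegrable _ _)]
    have := hode t₁ t₂ h1 h2 h3
    rw [sub_div] at this
    simp only [sub_div]
    linarith
  · intro t ht hZt hWt
    have hz : Z t = x t ^ s := by
      rw [div_eq_zero_iff] at hZt
      rcases hZt with h | h
      · linarith
      · exact absurd h hs0.ne'
    have hw : W t ≤ (Y₀ * θ t ^ σ₂) ^ r := by
      rw [div_nonpos_iff] at hWt
      rcases hWt with h | h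
      · linarith
      · linarith [h.1]
    have hy0 : 0 < Y₀ * θ t ^ σ₂ := mul_pos hY₀ (Real.rpow_pos_of_pos (hθ t) _)
    have hwm : W t ^ (m / r) ≤ (Y₀ * θ t ^ σ₂) ^ m := by
      calc W t ^ (m / r) ≤ ((Y₀ * θ t ^ σ₂) ^ r) ^ (m / r) :=
            Real.rpow_le_rpow (hW0 t ht) hw (by positivity)
        _ = _ := by rw [← Real.rpow_mul hy0.le, mul_div_cancel₀ _ hr0.ne']
    have hθ1 : θ t ≤ 1 + l := profile_le hε l ht.1
    have hD' : δ * θ t ^ (σ₂ * m - σ₁ * (p - 1)) ≤ δ' := by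
      refine le_trans ?_ hD
      have := hθ t
      gcongr
    have key := profile_rate_neg (θ' := θ' t) hX₀ hY₀ ha hcmp (hθ t) (by linarith) hε
      (profile_deriv_ge hε hl t) hσ₁ hD' hσp hεs
    have hxt := hx0 t
    have e1 : Z t ^ ((s - 1) / s) = x t ^ (s - 1) := by
      rw [hz, ← Real.rpow_mul hxt.le, mul_div_cancel₀ _ hs0.ne']
    have e2 : Z t ^ ((s + p - 2) / s) = x t ^ (s - 1) * x t ^ (p - 1) := by
      rw [hz, ← Real.rpow_mul hxt.le, mul_div_cancel₀ _ hs0.ne', ← Real.rpow_add hxt]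
      congr 1; ring
    simp only [hF]
    rw [e1, e2]
    have hxs : 0 < x t ^ (s - 1) := by positivity
    calc b * W t ^ (m / r) * x t ^ (s - 1) - a * (x t ^ (s - 1) * x t ^ (p - 1))
          - x' t * x t ^ (s - 1)
        ≤ b * (Y₀ * θ t ^ σ₂) ^ m * x t ^ (s - 1) - a * (x t ^ (s - 1) * x t ^ (p - 1))
          - x' t * x t ^ (s - 1) := by gcongr
      _ = x t ^ (s - 1) * (b * (Y₀ * θ t ^ σ₂) ^ m - a * (X₀ * θ t ^ σ₁) ^ (p - 1)
          - X₀ * (θ' t * σ₁ * θ t ^ (σ₁ - 1))) := by simp only [hx, hx']; ring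
      _ < 0 := mul_neg_of_pos_of_neg hxs key

set_option maxHeartbeats 1000000 in
/-- Extinction in finite time for a pair of differential inequalities, in a time independent of the
length of the interval. -/
theorem exists_extinction_time {p q m n a₁ b₁ a₂ b₂ δ s r X₀ Y₀ : ℝ} (hp : 1 < p) (hp2 : p < 2)
    (hq : 1 < q) (hq2 : q < 2) (hm : 0 < m) (hn : 0 < n) (hmn : (p - 1) * (q - 1) ≤ m * n)
    (ha₁ : 0 < a₁) (hb₁ : 0 ≤ b₁) (ha₂ : 0 < a₂) (hb₂ : 0 ≤ b₂) (hδ : 0 < δ) (hδ1 : δ < 1)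
    (hs : 1 < s) (hr : 1 < r) (hX₀ : 0 < X₀) (hY₀ : 0 < Y₀)
    (h₁ : b₁ * Y₀ ^ m ≤ δ * a₁ * X₀ ^ (p - 1)) (h₂ : b₂ * X₀ ^ n ≤ δ * a₂ * Y₀ ^ (q - 1)) :
    ∃ τ, 0 < τ ∧ ∀ (T : ℝ) (Z W : ℝ → ℝ), 0 < T → ContinuousOn Z (Icc 0 T) →
      ContinuousOn W (Icc 0 T) → (∀ t ∈ Icc 0 T, 0 ≤ Z t) → (∀ t ∈ Icc 0 T, 0 ≤ W t) →
      Z 0 = X₀ ^ s → W 0 = Y₀ ^ r →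
      (∀ t₁ t₂, 0 ≤ t₁ → t₁ ≤ t₂ → t₂ ≤ T → (Z t₂ - Z t₁) / s ≤
        ∫ t in t₁..t₂, (b₁ * W t ^ (m / r) * Z t ^ ((s - 1) / s) - a₁ * Z t ^ ((s + p - 2) / s))) →
      (∀ t₁ t₂, 0 ≤ t₁ → t₁ ≤ t₂ → t₂ ≤ T → (W t₂ - W t₁) / r ≤
        ∫ t in t₁..t₂, (b₂ * Z t ^ (n / s) * W t ^ ((r - 1) / r) - a₂ * W t ^ ((r + q - 2) / r))) →
      ∀ t ∈ Icc τ T, Z t = 0 ∧ W t = 0 := by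
  have hp1 : 0 < p - 1 := by linarith
  have hp2' : 0 < 2 - p := by linarith
  have hq2' : 0 < 2 - q := by linarith
  -- The ratio σ₁ : σ₂ = m : (p-1) makes the first source-to-absorption ratio constant in θ and
  -- gives the second the exponent κ(mn - (p-1)(q-1)) ≥ 0. The two summands of κ ensure σ₁(2-p) ≥ 1
  -- and σ₂(2-q) ≥ 1.
  set κ := 1 / (m * (2 - p)) + 1 / ((p - 1) * (2 - q)) with hκ
  have hκ0 : 0 < κ := by positivity
  set σ₁ := κ * m with hσ₁
  set σ₂ := κ * (p - 1) with hσ₂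
  have hσ₁0 : 0 < σ₁ := by positivity
  have hσ₂0 : 0 < σ₂ := by positivity
  have hσ₁p : 1 / 2 ≤ σ₁ * (2 - p) := by
    have h1 : σ₁ * (2 - p) = 1 + m * (2 - p) / ((p - 1) * (2 - q)) := by
      rw [hσ₁, hκ]; field_simp
    have : 0 ≤ m * (2 - p) / ((p - 1) * (2 - q)) := by positivity
    linarith
  have hσ₂q : 1 / 2 ≤ σ₂ * (2 - q) := by
    have h1 : σ₂ * (2 - q) = (p - 1) * (2 - q) / (m * (2 - p)) + 1 := by
      rw [hσ₂, hκ]; field_simp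
    have : 0 ≤ (p - 1) * (2 - q) / (m * (2 - p)) := by positivity
    linarith
  have hD₁ : 0 ≤ σ₂ * m - σ₁ * (p - 1) := le_of_eq (by rw [hσ₁, hσ₂]; ring)
  have hD₂ : 0 ≤ σ₁ * n - σ₂ * (q - 1) := by
    have : σ₁ * n - σ₂ * (q - 1) = κ * (m * n - (p - 1) * (q - 1)) := by rw [hσ₁, hσ₂]; ring
    rw [this]
    exact mul_nonneg hκ0.le (by linarith)
  -- Room between δ and 1 is shared: half absorbs the start at θ = 1 + l, slightly above 1, and half
  -- pays for the motion of the profile.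
  set δ' := (1 + δ) / 2 with hδ'
  have hδδ' : δ < δ' := by rw [hδ']; linarith
  have hδ'1 : δ' < 1 := by rw [hδ']; linarith
  set P₁ := (1 - δ') * a₁ * X₀ ^ (p - 1) with hP₁
  set P₂ := (1 - δ') * a₂ * Y₀ ^ (q - 1) with hP₂
  have hδ'0 : 0 < 1 - δ' := by linarith
  have hP₁0 : 0 < P₁ := by positivity
  have hP₂0 : 0 < P₂ := by positivity
  set Q₁ := 2 * σ₁ * X₀ * 2 ^ (σ₁ * (2 - p) - 1 / 2) with hQ₁
  set Q₂ := 2 * σ₂ * Y₀ * 2 ^ (σ₂ * (2 - q) - 1 / 2) with hQ₂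
  have hQ₁0 : 0 < Q₁ := by positivity
  have hQ₂0 : 0 < Q₂ := by positivity
  -- `Q₁` and `Q₂` bound the speed of the two profiles per unit ε, `P₁` and `P₂` the available
  -- absorption; halving the smaller quotient makes both inequalities strict.
  set ε := min (P₁ / Q₁) (P₂ / Q₂) / 2 with hε
  have hmin : 0 < min (P₁ / Q₁) (P₂ / Q₂) := lt_min (by positivity) (by positivity)
  have hε0 : 0 < ε := by positivity
  have hε₁ : ε * Q₁ < P₁ := by
    have h1 : ε < P₁ / Q₁ := by
      have := min_le_left (P₁ / Q₁) (P₂ / Q₂)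
      rw [hε]; linarith
    rwa [lt_div_iff₀ hQ₁0] at h1
  have hε₂ : ε * Q₂ < P₂ := by
    have h1 : ε < P₂ / Q₂ := by
      have := min_le_right (P₁ / Q₁) (P₂ / Q₂)
      rw [hε]; linarith
    rwa [lt_div_iff₀ hQ₂0] at h1
  have hsmall : ∀ D : ℝ, 0 ≤ D → ∀ᶠ l in 𝓝[>] (0 : ℝ), δ * (1 + l) ^ D ≤ δ' := by
    intro D hD
    have h1 : Tendsto (fun l : ℝ => δ * (1 + l) ^ D) (𝓝 0) (𝓝 (δ * (1 + 0) ^ D)) := by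
      refine ContinuousAt.tendsto ?_
      refine continuousAt_const.mul (ContinuousAt.rpow_const (by fun_prop) (Or.inr hD))
    rw [add_zero, Real.one_rpow, mul_one] at h1
    exact ((h1.eventually_lt_const hδδ').mono fun l hl => hl.le).filter_mono nhdsWithin_le_nhds
  -- At time 1/ε the profile has come down to its floor l. This time depends neither on l nor on T,
  -- and letting l → 0 gives zero.
  refine ⟨1 / ε, by positivity, fun T Z W hT hZ hW hZ0 hW0 hZi hWi hodeZ hodeW t ht => ?_⟩
  have hs0 : 0 < s := by linarith
  have hr0 : 0 < r := by linarith
  have ht0 : 0 ≤ t := le_trans (by positivity) ht.1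
  have hbound : ∀ᶠ l in 𝓝[>] (0 : ℝ), Z t ≤ (X₀ * l ^ σ₁) ^ s ∧ W t ≤ (Y₀ * l ^ σ₂) ^ r := by
    filter_upwards [hsmall _ hD₁, hsmall _ hD₂, self_mem_nhdsWithin,
      nhdsWithin_le_nhds (Iic_mem_nhds (zero_lt_one' ℝ))] with l hl₁ hl₂ hl0 hl1
    have hl0' : 0 < l := hl0
    obtain ⟨R₁, hR₁c, hR₁i, hR₁n⟩ := exists_rate_of_profile (T := T) (s := s) (r := r) hX₀ hY₀ hp ha₁
      hb₁ hm.le hδ.le hs hr h₁ hl0' hl1 hε0.le hσ₁0.le hD₁ hl₁ hσ₁p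
      (lt_of_eq_of_lt (by rw [hQ₁]; ring) hε₁) hZ hW hW0 hodeZ
    obtain ⟨R₂, hR₂c, hR₂i, hR₂n⟩ := exists_rate_of_profile (T := T) (s := r) (r := s) hY₀ hX₀ hq ha₂
      hb₂ hn.le hδ.le hr hs h₂ hl0' hl1 hε0.le hσ₂0.le hD₂ hl₂ hσ₂q
      (lt_of_eq_of_lt (by rw [hQ₂]; ring) hε₂) hW hZ hZ0 hodeW
    have hpc : Continuous (profile ε l) := by unfold profile; fun_prop
    have hpp := profile_pos ε hl0'
    have hp0 : profile ε l 0 = 1 + l := by simp [profile]; ring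
    have hcont : ∀ X₀ σ s : ℝ, 0 ≤ s → Continuous fun t => (X₀ * profile ε l t ^ σ) ^ s :=
      fun X₀ σ s hs => Continuous.rpow_const
        (continuous_const.mul (hpc.rpow_const fun t => Or.inl (hpp t).ne')) fun t => Or.inr hs
    -- The profile starts at 1 + l, so both quantities begin strictly below it.
    have hstart : ∀ X₀ σ s : ℝ, 0 < X₀ → 0 < σ → 0 < s →
        (X₀ ^ s - (X₀ * profile ε l 0 ^ σ) ^ s) / s < 0 := by
      intro X₀ σ s hX hσ hs
      refine div_neg_of_neg_of_pos (sub_neg.2 (Real.rpow_lt_rpow hX.le ?_ hs)) hs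
      have : 1 < profile ε l 0 ^ σ := by
        rw [hp0]; exact Real.one_lt_rpow (by linarith) hσ
      exact lt_mul_of_one_lt_right hX this
    have key := neg_of_integral_bound
      (A := fun t => (Z t - (X₀ * profile ε l t ^ σ₁) ^ s) / s)
      (B := fun t => (W t - (Y₀ * profile ε l t ^ σ₂) ^ r) / r)
      ((hZ.sub (hcont X₀ σ₁ s hs0.le).continuousOn).div_const s)
      ((hW.sub (hcont Y₀ σ₂ r hr0.le).continuousOn).div_const r) hR₁c hR₂c
      (by simp only [hZi]; exact hstart X₀ σ₁ s hX₀ hσ₁0 hs0)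
      (by simp only [hWi]; exact hstart Y₀ σ₂ r hY₀ hσ₂0 hr0) hR₁i hR₂i hR₁n hR₂n t ⟨ht0, ht.2⟩
    have hpt : profile ε l t = l := by
      have : 1 - ε * t ≤ 0 := by
        have := ht.1
        rw [div_le_iff₀ hε0] at this
        linarith
      simp [profile, max_eq_right this]
    rw [hpt] at key
    constructor
    · have := key.1
      rw [div_neg_iff] at this
      rcases this with h | h <;> linarith [h.1, h.2]
    · have := key.2
      rw [div_neg_iff] at this
      rcases this with h | h <;> linarith [h.1, h.2]
  have hlim : ∀ X₀ σ s : ℝ, 0 < σ → 0 < s →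
      Tendsto (fun l : ℝ => (X₀ * l ^ σ) ^ s) (𝓝[>] 0) (𝓝 0) := by
    intro X₀ σ s hσ hs
    have h1 : ContinuousAt (fun l : ℝ => (X₀ * l ^ σ) ^ s) 0 :=
      ContinuousAt.rpow_const (continuousAt_const.mul
        (continuousAt_id.rpow_const (Or.inr hσ.le))) (Or.inr hs.le)
    have h2 := h1.tendsto
    simp only [Real.zero_rpow hσ.ne', mul_zero, Real.zero_rpow hs.ne'] at h2
    exact h2.mono_left nhdsWithin_le_nhds
  exact ⟨le_antisymm (ge_of_tendsto (hlim X₀ σ₁ s hσ₁0 hs0) (hbound.mono fun l hl => hl.1))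
      (hZ0 t ⟨ht0, ht.2⟩),
    le_antisymm (ge_of_tendsto (hlim Y₀ σ₂ r hσ₂0 hr0) (hbound.mono fun l hl => hl.2))
      (hW0 t ⟨ht0, ht.2⟩)⟩

/-! ### Extinction of bounded weak solutions -/

theorem memLp_rpow_of_mem_Icc {α : Type*} [MeasurableSpace α] {μ : Measure α} [IsFiniteMeasure μ]
    {f : α → ℝ} {M : ℝ} (hfm : AEStronglyMeasurable f μ) (hf : ∀ᵐ x ∂μ, f x ∈ Icc 0 M) {a : ℝ}
    (ha : 0 ≤ a) (s : ℝ≥0∞) : MemLp (fun x => f x ^ a) s μ := by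
  refine MemLp.of_bound (hfm.aemeasurable.pow_const a).aestronglyMeasurable (M ^ a) ?_
  filter_upwards [hf] with x hx
  rw [Real.norm_of_nonneg (Real.rpow_nonneg hx.1 _)]
  exact Real.rpow_le_rpow hx.1 hx.2 ha

/-- Hölder's inequality for a product of powers of bounded functions. -/
theorem integral_rpow_mul_rpow_le {α : Type*} [MeasurableSpace α] {μ : Measure α}
    [IsFiniteMeasure μ] {f h : α → ℝ} {M : ℝ} (hfm : AEStronglyMeasurable f μ)
    (hhm : AEStronglyMeasurable h μ) (hf : ∀ᵐ x ∂μ, f x ∈ Icc 0 M) (hh : ∀ᵐ x ∂μ, h x ∈ Icc 0 M)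
    {m s r : ℝ} (hm : 0 < m) (hs : 1 < s) (hr : 0 < r) (hmsr : m * s ≤ r) :
    ∫ x, f x ^ m * h x ^ (s - 1) ∂μ ≤
      μ.real univ ^ (1 / s - m / r) * (∫ x, f x ^ r ∂μ) ^ (m / r) *
        (∫ x, h x ^ s ∂μ) ^ ((s - 1) / s) := by
  have hs0 : 0 < s := by linarith
  have hs1 : 0 < s - 1 := by linarith
  have hms : 0 < m * s := by positivity
  have h1 := integral_mul_le_Lp_mul_Lq_of_nonneg (μ := μ) (Real.HolderConjugate.conjExponent hs)
    (f := fun x => f x ^ m) (g := fun x => h x ^ (s - 1))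
    (hf.mono fun x hx => Real.rpow_nonneg hx.1 _) (hh.mono fun x hx => Real.rpow_nonneg hx.1 _)
    (memLp_rpow_of_mem_Icc hfm hf hm.le _) (memLp_rpow_of_mem_Icc hhm hh hs1.le _)
  have e1 : ∫ x, (f x ^ m) ^ s ∂μ = ∫ x, f x ^ (m * s) ∂μ := by
    refine integral_congr_ae ?_
    filter_upwards [hf] with x hx
    rw [← Real.rpow_mul hx.1]
  have e2 : ∫ x, (h x ^ (s - 1)) ^ s.conjExponent ∂μ = ∫ x, h x ^ s ∂μ := by
    refine integral_congr_ae ?_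
    filter_upwards [hh] with x hx
    rw [← Real.rpow_mul hx.1, Real.conjExponent, mul_div_cancel₀ _ hs1.ne']
  have e3 : 1 / s.conjExponent = (s - 1) / s := by rw [Real.conjExponent, one_div_div]
  rw [e1, e2, e3] at h1
  refine h1.trans ?_
  have hpos : ∀ a : ℝ, 0 ≤ ∫ x, f x ^ a ∂μ := fun a =>
    integral_nonneg_of_ae (hf.mono fun x hx => Real.rpow_nonneg hx.1 _)
  have hfp : ∀ a : ℝ, 0 < a → eLpNorm f (ENNReal.ofReal a) μ
      = ENNReal.ofReal ((∫ x, f x ^ a ∂μ) ^ a⁻¹) := fun a ha => by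
    have hmem : MemLp f (ENNReal.ofReal a) μ := by
      simpa using memLp_rpow_of_mem_Icc hfm hf zero_le_one (ENNReal.ofReal a)
    rw [hmem.eLpNorm_eq_integral_rpow_norm (by simpa using ha) ENNReal.ofReal_ne_top,
      ENNReal.toReal_ofReal ha.le]
    congr 2
    refine integral_congr_ae ?_
    filter_upwards [hf] with x hx
    rw [Real.norm_of_nonneg hx.1]
  -- After Hölder with exponents s and s/(s-1), the source appears in L^(ms). Since ms ≤ r on a
  -- finite measure space this is bounded by the L^r norm, with the power of the measure found in
  -- the source coefficient.
  have h2 := eLpNorm_le_eLpNorm_mul_rpow_measure_univ (ENNReal.ofReal_le_ofReal hmsr) hfm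
  have he : 0 ≤ 1 / (m * s) - 1 / r := sub_nonneg.2 (one_div_le_one_div_of_le hms hmsr)
  rw [hfp _ hms, hfp _ hr, ENNReal.toReal_ofReal hms.le, ENNReal.toReal_ofReal hr.le,
    ← ofReal_measureReal, ENNReal.ofReal_rpow_of_nonneg measureReal_nonneg he,
    ← ENNReal.ofReal_mul (by have := hpos r; positivity),
    ENNReal.ofReal_le_ofReal_iff (by have := hpos r; positivity)] at h2
  have h3 := Real.rpow_le_rpow (by have := hpos (m * s); positivity) h2 hm.le
  rw [Real.mul_rpow (by have := hpos r; positivity) (by positivity),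
    ← Real.rpow_mul (hpos _), ← Real.rpow_mul (hpos _), ← Real.rpow_mul measureReal_nonneg,
    show (m * s)⁻¹ * m = 1 / s by field_simp, show r⁻¹ * m = m / r by field_simp,
    show (1 / (m * s) - 1 / r) * m = 1 / s - m / r by field_simp] at h3
  have h4 : 0 ≤ ∫ x, h x ^ s ∂μ :=
    integral_nonneg_of_ae (hh.mono fun x hx => Real.rpow_nonneg hx.1 _)
  gcongr
  linarith

/-- Differential inequality for the `L^s` norm of a component of a coupled pair. -/
theorem IsDirichletSolution.rate_le (hN : 1 ≤ N) {Ω : Set (Space N)} (hΩ : IsOpen Ω)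
    [IsFiniteMeasure (volume.restrict Ω)] {T p q : ℝ} (hT : 0 < T) (hp : 1 < p) (hp2 : p < 2)
    (hγ : 0 < embeddingConst p Ω) (hV : 0 < volume.real Ω)
    {w w' f v v' fv : Space N × ℝ → ℝ} {g gv : Space N × ℝ → Space N} {w₀ v₀ : Space N → ℝ}
    (hs : IsDirichletSolution p Ω T w w' g f w₀) (hv : IsDirichletSolution q Ω T v v' gv fv v₀)
    {M : ℝ} (hM : 0 ≤ M) (hw : ∀ᵐ z ∂(cylMeasure Ω T), w z ∈ Icc 0 M)
    (hvM : ∀ᵐ z ∂(cylMeasure Ω T), v z ∈ Icc 0 M) {s r m κ : ℝ} (hs1 : 1 < s) (hr : 1 < r)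
    (hm : 0 < m) (hκ : 0 ≤ κ) (hmsr : m * s ≤ r) (hmin : minExponent N p ≤ s)
    (hf : ∀ᵐ z ∂(cylMeasure Ω T), f z ≤ κ * v z ^ m)
    {t₁ t₂ : ℝ} (ht₁ : 0 ≤ t₁) (ht : t₁ ≤ t₂) (ht₂ : t₂ ≤ T) :
    ((∫ x in Ω, timeRep w₀ w' x t₂ ^ s) - ∫ x in Ω, timeRep w₀ w' x t₁ ^ s) / s
      ≤ ∫ t in t₁..t₂, (κ * sourceCoeff m Ω s r * (∫ x in Ω, timeRep v₀ v' x t ^ r) ^ (m / r) *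
          (∫ x in Ω, timeRep w₀ w' x t ^ s) ^ ((s - 1) / s)
        - diffusionCoeff p Ω s * (∫ x in Ω, timeRep w₀ w' x t ^ s) ^ ((s + p - 2) / s)) := by
  have hs0 : 0 < s := by linarith
  refine (hs.integral_rpow_le hN hΩ hT hp hp2 hγ hV hM hw hs1 hmin ht₁ ht ht₂).trans ?_
  set μ := volume.restrict Ω with hμ
  have hsub := Ioo_subset_Ioo ht₁ ht₂
  have hrepw := ae_eq_timeRep hΩ hT hs.memLp_two hs.memLp_deriv hs.weakDeriv hs.initial
    hs.memLp_initial
  have hrepv := ae_eq_timeRep hΩ hT hv.memLp_two hv.memLp_deriv hv.weakDeriv hv.initial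
    hv.memLp_initial
  set Z : ℝ → ℝ := fun t => ∫ x, timeRep w₀ w' x t ^ s ∂μ with hZ
  set W : ℝ → ℝ := fun t => ∫ x, timeRep v₀ v' x t ^ r ∂μ with hW
  have hZc : ContinuousOn Z (Icc 0 T) := hs.continuousOn_integral_rpow hΩ hT hM hw hs0.le
  have hWc : ContinuousOn W (Icc 0 T) := hv.continuousOn_integral_rpow hΩ hT hM hvM (by linarith)
  have hZeq : ∀ᵐ t ∂((volume : Measure ℝ).restrict (Ioo 0 T)), ∫ x, w (x, t) ^ s ∂μ = Z t := by
    filter_upwards [ae_slice hrepw] with t htx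
    refine integral_congr_ae ?_
    filter_upwards [htx] with x hx
    simp only [hx]
  have hWeq : ∀ᵐ t ∂((volume : Measure ℝ).restrict (Ioo 0 T)), ∫ x, v (x, t) ^ r ∂μ = W t := by
    filter_upwards [ae_slice hrepv] with t htx
    refine integral_congr_ae ?_
    filter_upwards [htx] with x hx
    simp only [hx]
  have hci : ∀ F : ℝ → ℝ, ContinuousOn F (Icc 0 T) → IntegrableOn F (Ioo t₁ t₂) := fun F hF =>
    (hF.integrableOn_Icc).mono_set (hsub.trans Ioo_subset_Icc_self)
  have hZp : ∀ a : ℝ, 0 ≤ a → ContinuousOn (fun t => Z t ^ a) (Icc 0 T) := fun a ha =>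
    hZc.rpow_const fun t _ => Or.inr ha
  have hWp : ∀ a : ℝ, 0 ≤ a → ContinuousOn (fun t => W t ^ a) (Icc 0 T) := fun a ha =>
    hWc.rpow_const fun t _ => Or.inr ha
  have e1 : 0 ≤ (s + p - 2) / s := div_nonneg (by linarith) hs0.le
  have e2 : 0 ≤ (s - 1) / s := div_nonneg (by linarith) hs0.le
  have e3 : 0 ≤ m / r := div_nonneg hm.le (by linarith)
  have hfw : Integrable (fun z => f z * w z ^ (s - 1)) (cylMeasure Ω T) :=
    integrable_mul_of_memLp_two hs.source
      (memLp_rpow_of_mem_Icc hs.memLp_two.1 hw (by linarith) 2)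
  have hvw : Integrable (fun z => v z ^ m * w z ^ (s - 1)) (cylMeasure Ω T) :=
    integrable_mul_of_memLp_two (memLp_rpow_of_mem_Icc hv.memLp_two.1 hvM hm.le 2)
      (memLp_rpow_of_mem_Icc hs.memLp_two.1 hw (by linarith) 2)
  have hwm := hs.memLp_two.1
  have hvm := hv.memLp_two.1
  rw [cylMeasure_eq_prod] at hfw hvw hwm hvm
  rw [intervalIntegral.integral_of_le ht, integral_Ioc_eq_integral_Ioo]
  refine integral_mono_ae ?_ ?_ ?_
  · refine Integrable.sub (hfw.integral_prod_right.mono_measure (Measure.restrict_mono hsub le_rfl))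
      (((hci _ (hZp _ e1)).congr ?_).const_mul _)
    filter_upwards [ae_restrict_of_ae_restrict_of_subset hsub hZeq] with t htz
    rw [htz]
  · exact hci _ (((continuousOn_const.mul (hWp _ e3)).mul (hZp _ e2)).sub
      (continuousOn_const.mul (hZp _ e1)))
  · filter_upwards [ae_restrict_of_ae_restrict_of_subset hsub hZeq,
      ae_restrict_of_ae_restrict_of_subset hsub hWeq,
      ae_restrict_of_ae_restrict_of_subset hsub (ae_slice hw),
      ae_restrict_of_ae_restrict_of_subset hsub (ae_slice hvM),
      ae_restrict_of_ae_restrict_of_subset hsub (ae_slice hf),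
      ae_restrict_of_ae_restrict_of_subset hsub hfw.prod_left_ae,
      ae_restrict_of_ae_restrict_of_subset hsub hvw.prod_left_ae,
      ae_restrict_of_ae_restrict_of_subset hsub hwm.prodMk_right,
      ae_restrict_of_ae_restrict_of_subset hsub hvm.prodMk_right]
      with t hz hwt hwb hvb hft hi1 hi2 hm1 hm2
    have h1 := integral_rpow_mul_rpow_le hm2 hm1 hvb hwb hm hs1 (by linarith) hmsr
    rw [hz, hwt, measureReal_restrict_apply_univ] at h1
    have h2 : ∫ x, f (x, t) * w (x, t) ^ (s - 1) ∂μ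
        ≤ κ * ∫ x, v (x, t) ^ m * w (x, t) ^ (s - 1) ∂μ := by
      rw [← integral_const_mul]
      refine integral_mono_ae hi1 (hi2.const_mul κ) ?_
      filter_upwards [hft, hwb] with x hx hxb
      have := Real.rpow_nonneg hxb.1 (s - 1)
      calc f (x, t) * w (x, t) ^ (s - 1) ≤ κ * v (x, t) ^ m * w (x, t) ^ (s - 1) := by gcongr
        _ = _ := by ring
    have h3 := mul_le_mul_of_nonneg_left h1 hκ
    rw [hz]
    simp only [sourceCoeff]
    linarith

theorem IsInitialDatum.normLs_rpow {p : ℝ} {Ω : Set (Space N)}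
    [IsFiniteMeasure (volume.restrict Ω)] {w₀ : Space N → ℝ} (h : IsInitialDatum p Ω w₀) {s : ℝ}
    (hs : 0 < s) : normLs Ω s w₀ ^ s = ∫ x in Ω, w₀ x ^ s := by
  have h0 : 0 ≤ ∫ x in Ω, ‖w₀ x‖ ^ s := integral_nonneg fun x => by positivity
  rw [normLs, (h.memLp _).eLpNorm_eq_integral_rpow_norm (by simpa using hs) ENNReal.ofReal_ne_top,
    ENNReal.toReal_ofReal hs.le, ENNReal.toReal_ofReal (by positivity), ← Real.rpow_mul h0,
    inv_mul_cancel₀ hs.ne', Real.rpow_one]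
  refine integral_congr_ae ?_
  filter_upwards [h.nonneg] with x hx
  rw [Real.norm_of_nonneg hx]

theorem IsInitialDatum.normLs_pos {p : ℝ} {Ω : Set (Space N)}
    [IsFiniteMeasure (volume.restrict Ω)] {w₀ : Space N → ℝ} (h : IsInitialDatum p Ω w₀) {s : ℝ}
    (hs : 0 < s) : 0 < normLs Ω s w₀ := by
  have hm := h.memLp (ENNReal.ofReal s)
  refine ENNReal.toReal_pos (fun h0 => h.nontrivial ?_) hm.2.ne
  rw [eLpNorm_eq_zero_iff hm.1 (by simpa using hs)] at h0
  exact h0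

/-- Raising to the power p-1 removes the roots: the initial source is at most δ times the initial
absorption. -/
theorem Comparable.le_left {p q m n a₁ b₁ a₂ b₂ δ X Y : ℝ} (h : Comparable p q m n a₁ b₁ a₂ b₂ δ X Y)
    (hp : 1 < p) (ha : 0 < a₁) (hb : 0 ≤ b₁) (hδ : 0 < δ) (hY : 0 < Y) :
    b₁ * Y ^ m ≤ δ * a₁ * X ^ (p - 1) := by
  have hp1 : 0 < p - 1 := by linarith
  have h1 := Real.rpow_le_rpow (by positivity) h.1 hp1.le
  rw [Real.mul_rpow (by positivity) (by positivity), ← Real.rpow_mul (by positivity),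
    ← Real.rpow_mul hY.le, one_div_mul_cancel hp1.ne', Real.rpow_one, div_mul_cancel₀ _ hp1.ne',
    div_mul_eq_mul_div, div_le_iff₀ (by positivity)] at h1
  linarith

theorem Comparable.le_right {p q m n a₁ b₁ a₂ b₂ δ X Y : ℝ}
    (h : Comparable p q m n a₁ b₁ a₂ b₂ δ X Y) (hn : 0 < n) (ha : 0 < a₂) (hb : 0 < b₂) (hδ : 0 < δ)
    (hX : 0 < X) (hY : 0 < Y) : b₂ * X ^ n ≤ δ * a₂ * Y ^ (q - 1) := by
  have h1 := Real.rpow_le_rpow hX.le h.2 hn.le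
  rw [Real.mul_rpow (by positivity) (by positivity), ← Real.rpow_mul (by positivity),
    ← Real.rpow_mul hY.le, one_div_mul_cancel hn.ne', Real.rpow_one, div_mul_cancel₀ _ hn.ne',
    div_mul_eq_mul_div, le_div_iff₀ hb] at h1
  linarith

theorem diffusionCoeff_pos {p s : ℝ} {Ω : Set (Space N)} (hp : 1 < p) (hs : 1 < s)
    (hγ : 0 < embeddingConst p Ω) (hV : 0 < volume.real Ω) : 0 < diffusionCoeff p Ω s := by
  have h1 : 0 < s - 1 := by linarith
  have h2 : 0 < s + p - 2 := by linarith
  have h3 : 0 < p := by linarith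
  unfold diffusionCoeff
  positivity

/-- A solution whose `L^s` norm vanishes from time `τ` on is zero there. -/
theorem IsDirichletSolution.ae_eq_zero {Ω : Set (Space N)} (hΩ : IsOpen Ω)
    [IsFiniteMeasure (volume.restrict Ω)] {T p : ℝ} (hT : 0 < T)
    {w w' f : Space N × ℝ → ℝ} {g : Space N × ℝ → Space N} {w₀ : Space N → ℝ}
    (hs : IsDirichletSolution p Ω T w w' g f w₀) {M : ℝ}
    (hw : ∀ᵐ z ∂(cylMeasure Ω T), w z ∈ Icc 0 M) {s : ℝ} (hs0 : 0 < s) {τ : ℝ}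
    (hz : ∀ t ∈ Icc τ T, ∫ x in Ω, timeRep w₀ w' x t ^ s = 0) :
    ∀ᵐ z ∂(cylMeasure Ω T), τ < z.2 → w z = 0 := by
  have hrep := ae_eq_timeRep hΩ hT hs.memLp_two hs.memLp_deriv hs.weakDeriv hs.initial
    hs.memLp_initial
  set F : Space N × ℝ → ℝ := fun z => (Ioi τ).indicator 1 z.2 * w z ^ s with hF
  have hws : Integrable (fun z => w z ^ s) (cylMeasure Ω T) :=
    (memLp_rpow_of_mem_Icc hs.memLp_two.1 hw hs0.le 1).integrable le_rfl
  have hFi : Integrable F (cylMeasure Ω T) := by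
    refine hws.bdd_mul (c := 1)
      ((measurable_const.indicator measurableSet_Ioi).comp measurable_snd).aestronglyMeasurable
      (Eventually.of_forall fun z => ?_)
    by_cases h : z.2 ∈ Ioi τ <;> simp [h]
  have hF0 : 0 ≤ᵐ[cylMeasure Ω T] F := by
    filter_upwards [hw] with z hz
    exact mul_nonneg (indicator_nonneg (fun _ _ => zero_le_one) _) (Real.rpow_nonneg hz.1 _)
  have hinteg : ∫ z, F z ∂(cylMeasure Ω T) = 0 := by
    have hFi' := hFi
    rw [cylMeasure_eq_prod] at hFi' ⊢
    rw [integral_prod_symm _ hFi']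
    refine integral_eq_zero_of_ae ?_
    filter_upwards [ae_slice hrep, ae_restrict_mem measurableSet_Ioo] with t ht htm
    simp only [hF, Pi.zero_apply, integral_const_mul]
    by_cases h : t ∈ Ioi τ
    · have h1 : ∫ x in Ω, w (x, t) ^ s = 0 := by
        rw [← hz t ⟨h.le, htm.2.le⟩]
        refine integral_congr_ae ?_
        filter_upwards [ht] with x hx
        simp only [hx]
      rw [h1, mul_zero]
    · simp [h]
  rw [integral_eq_zero_iff_of_nonneg_ae hF0 hFi] at hinteg
  filter_upwards [hinteg, hw] with z hz1 hz2 hzt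
  have h1 : w z ^ s = 0 := by simpa [hF, hzt] using hz1
  exact (Real.rpow_eq_zero hz2.1 hs0.ne').1 h1

/-- Extinction for weak solutions that are bounded on finite cylinders and whose sources are
controlled by powers with admissible exponents. -/
theorem IsWeakSolution.exists_extinction_time (hN : 1 ≤ N) {Ω : Set (Space N)} (hΩ : IsOpen Ω)
    [IsFiniteMeasure (volume.restrict Ω)] (hV : 0 < volume.real Ω) {p q m n m₁ n₁ : ℝ}
    (hp : 1 < p) (hp2 : p < 2) (hq : 1 < q) (hq2 : q < 2) (hm : 0 < m) (hn : 0 < n)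
    (hm₁ : 0 < m₁) (hn₁ : 0 < n₁) (hmn : (p - 1) * (q - 1) < m₁ * n₁) {s r : ℝ}
    (hsr : AdmissibleExponents N p q m₁ n₁ s r) {u₀ v₀ : Space N → ℝ}
    (hu₀ : IsInitialDatum p Ω u₀) (hv₀ : IsInitialDatum q Ω v₀) {δ κ₁ κ₂ : ℝ} (hδ : 0 < δ)
    (hδ1 : δ < 1) (hκ₁ : 0 < κ₁) (hκ₂ : 0 < κ₂)
    (hcmp : Comparable p q m₁ n₁ (diffusionCoeff p Ω s) (κ₁ * sourceCoeff m₁ Ω s r)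
      (diffusionCoeff q Ω r) (κ₂ * sourceCoeff n₁ Ω r s) δ (normLs Ω s u₀) (normLs Ω r v₀))
    {u v : Space N × ℝ → ℝ} (hsol : IsWeakSolution p q m n Ω u₀ v₀ u v)
    (hbd : ∀ T, 0 < T → ∃ M, ∀ᵐ z ∂(cylMeasure Ω T), u z ≤ M ∧ v z ≤ M)
    (hsource : ∀ T, 0 < T → ∀ᵐ z ∂(cylMeasure Ω T), v z ^ m ≤ κ₁ * v z ^ m₁ ∧
      u z ^ n ≤ κ₂ * u z ^ n₁) :
    ∃ τ, 0 < τ ∧ ∀ T, 0 < T → ∀ᵐ z ∂(cylMeasure Ω T), τ < z.2 → u z = 0 ∧ v z = 0 := by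
  have hs1 := hsr.one_lt_s
  have hr1 := hsr.one_lt_r
  have hs0 : 0 < s := by linarith
  have hr0 : 0 < r := by linarith
  obtain ⟨gu₀, hgu₀⟩ := hu₀.sobolev
  obtain ⟨gv₀, hgv₀⟩ := hv₀.sobolev
  have hγp := embeddingConst_pos hN hp hp2 hgu₀ hu₀.nontrivial
  have hγq := embeddingConst_pos hN hq hq2 hgv₀ hv₀.nontrivial
  have ha₁ := diffusionCoeff_pos hp hs1 hγp hV
  have ha₂ := diffusionCoeff_pos hq hr1 hγq hV
  have hb₁ : 0 < κ₁ * sourceCoeff m₁ Ω s r := by unfold sourceCoeff; positivity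
  have hb₂ : 0 < κ₂ * sourceCoeff n₁ Ω r s := by unfold sourceCoeff; positivity
  have hX := hu₀.normLs_pos hs0
  have hY := hv₀.normLs_pos hr0
  have hms : m₁ * s ≤ r := by
    have := hsr.lower
    rwa [le_div_iff₀ hs0] at this
  have hnr : n₁ * r ≤ s := by
    have := hsr.upper
    rw [div_le_div_iff₀ hs0 hn₁] at this
    linarith
  -- The time is fixed before T: it depends only on coefficients and initial norms, whereas the weak
  -- derivatives are chosen separately on each cylinder.
  obtain ⟨τ, hτ, hext⟩ := FastDiffusion.exists_extinction_time hp hp2 hq hq2 hm₁ hn₁ hmn.le ha₁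
    hb₁.le ha₂ hb₂.le hδ hδ1 hs1 hr1 hX hY (hcmp.le_left hp ha₁ hb₁.le hδ hY)
    (hcmp.le_right hn₁ ha₂ hb₂ hδ hX hY)
  refine ⟨τ, hτ, fun T hT => ?_⟩
  have hpos := (hsol T hT).1
  obtain ⟨u', v', gu, gv, hu, hv, -, -⟩ := (hsol T hT).exists_isDirichletSolution hm hn hu₀ hv₀
  obtain ⟨M, hM⟩ := hbd T hT
  have hM0 : 0 ≤ max M 0 := le_max_right _ _
  have huM : ∀ᵐ z ∂(cylMeasure Ω T), u z ∈ Icc 0 (max M 0) := by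
    filter_upwards [hpos, hM] with z h1 h2 using ⟨h1.1, le_max_of_le_left h2.1⟩
  have hvM : ∀ᵐ z ∂(cylMeasure Ω T), v z ∈ Icc 0 (max M 0) := by
    filter_upwards [hpos, hM] with z h1 h2 using ⟨h1.2, le_max_of_le_left h2.2⟩
  have hZ0 : ∀ t ∈ Icc 0 T, 0 ≤ ∫ x in Ω, timeRep u₀ u' x t ^ s := fun t ht =>
    integral_nonneg_of_ae ((hu.timeRep_mem_Icc hΩ hT hM0 huM).mono fun x hx =>
      Real.rpow_nonneg (hx t ht).1 _)
  have hW0 : ∀ t ∈ Icc 0 T, 0 ≤ ∫ x in Ω, timeRep v₀ v' x t ^ r := fun t ht =>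
    integral_nonneg_of_ae ((hv.timeRep_mem_Icc hΩ hT hM0 hvM).mono fun x hx =>
      Real.rpow_nonneg (hx t ht).1 _)
  have key := hext T (fun t => ∫ x in Ω, timeRep u₀ u' x t ^ s)
    (fun t => ∫ x in Ω, timeRep v₀ v' x t ^ r) hT
    (hu.continuousOn_integral_rpow hΩ hT hM0 huM hs0.le)
    (hv.continuousOn_integral_rpow hΩ hT hM0 hvM hr0.le) hZ0 hW0
    (by simp only [timeRep_zero]; exact (hu₀.normLs_rpow hs0).symm)
    (by simp only [timeRep_zero]; exact (hv₀.normLs_rpow hr0).symm)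
    (fun t₁ t₂ h1 h2 h3 => hu.rate_le hN hΩ hT hp hp2 hγp hV hv hM0 huM hvM hs1 hr1 hm₁ hκ₁.le hms
      hsr.min_s ((hsource T hT).mono fun z hz => hz.1) h1 h2 h3)
    (fun t₁ t₂ h1 h2 h3 => hv.rate_le hN hΩ hT hq hq2 hγq hV hu hM0 hvM huM hr1 hs1 hn₁ hκ₂.le hnr
      hsr.min_r ((hsource T hT).mono fun z hz => hz.2) h1 h2 h3)
  filter_upwards [hu.ae_eq_zero hΩ hT huM hs0 fun t ht => (key t ht).1,
    hv.ae_eq_zero hΩ hT hvM hr0 fun t ht => (key t ht).2] with z h1 h2 hz using ⟨h1 hz, h2 hz⟩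

/-- A nontrivial initial value excludes immediate extinction. -/
theorem HasInitialValue.not_ae_eq_zero {Ω : Set (Space N)} {w : Space N × ℝ → ℝ} {w₀ : Space N → ℝ}
    (h : HasInitialValue Ω w w₀) (hm : AEStronglyMeasurable w₀ (volume.restrict Ω))
    (hne : ¬ ∀ᵐ x ∂(volume.restrict Ω), w₀ x = 0) :
    ¬ ∀ᵐ z ∂((volume : Measure (Space N × ℝ)).restrict (Ω ×ˢ Ioi 0)), w z = 0 := by
  intro hz
  have hz1 : ∀ᵐ z ∂(cylMeasure Ω 1), w z = 0 :=
    ae_restrict_of_ae_restrict_of_subset (prod_mono_right Ioo_subset_Ioi_self) hz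
  have hc : 0 < eLpNorm w₀ 2 (volume.restrict Ω) := by
    rw [pos_iff_ne_zero]
    intro h0
    rw [eLpNorm_eq_zero_iff hm (by norm_num)] at h0
    exact hne h0
  have h1 := h.eventually_lt_const hc
  rw [eventually_inf] at h1
  obtain ⟨A, hA, B, hB, hAB⟩ := h1
  rw [mem_nhdsGT_iff_exists_Ioo_subset] at hB
  obtain ⟨ε, hε, hεB⟩ := hB
  have hε' : (0 : ℝ) < ε := hε
  -- If w vanished, its slices would stay at distance ‖w₀‖₂ from the initial value for almost every
  -- small t, against the essential limit.
  have h2 : ∀ᵐ t ∂((volume : Measure ℝ).restrict (Ioo 0 (min ε 1))), False := by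
    have h3 := ae_restrict_of_ae_restrict_of_subset
      (Ioo_subset_Ioo_right (min_le_right ε 1)) (ae_slice hz1)
    filter_upwards [h3, ae_restrict_mem measurableSet_Ioo, ae_restrict_of_ae hA] with t h4 h5 h6
    have h7 := hAB t ⟨h6, hεB ⟨h5.1, h5.2.trans_le (min_le_left _ _)⟩⟩
    have h8 : eLpNorm (fun x => w (x, t) - w₀ x) 2 (volume.restrict Ω)
        = eLpNorm w₀ 2 (volume.restrict Ω) := by
      rw [← eLpNorm_neg w₀]
      refine eLpNorm_congr_ae ?_
      filter_upwards [h4] with x hx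
      rw [hx, zero_sub]; rfl
    rw [h8] at h7
    exact lt_irrefl _ h7
  rw [ae_iff] at h2
  simp at h2
  linarith

/-- Vanishing after some time yields a smallest extinction time. -/
theorem vanishesInFiniteTime_of_ae_eq_zero {Ω : Set (Space N)} {u v : Space N × ℝ → ℝ}
    {u₀ : Space N → ℝ} (hi : HasInitialValue Ω u u₀)
    (hm : AEStronglyMeasurable u₀ (volume.restrict Ω))
    (hne : ¬ ∀ᵐ x ∂(volume.restrict Ω), u₀ x = 0) {τ : ℝ} (hτ : 0 < τ)
    (h : ∀ T, 0 < T → ∀ᵐ z ∂(cylMeasure Ω T), τ < z.2 → u z = 0 ∧ v z = 0) :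
    VanishesInFiniteTime Ω u v := by
  set S := {τ : ℝ | 0 < τ ∧ ∀ᵐ z ∂((volume : Measure (Space N × ℝ)).restrict (Ω ×ˢ Ioi τ)),
    u z = 0 ∧ v z = 0} with hS
  have hτS : τ ∈ S := by
    refine ⟨hτ, ?_⟩
    have hU : Ω ×ˢ Ioi τ = ⋃ k : ℕ, Ω ×ˢ Ioo τ (τ + k + 1) := by
      rw [← prod_iUnion]
      congr 1
      ext t
      simp only [mem_iUnion, mem_Ioo, mem_Ioi]
      refine ⟨fun ht => ?_, fun ⟨k, hk⟩ => hk.1⟩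
      obtain ⟨k, hk⟩ := exists_nat_gt (t - τ)
      exact ⟨k, ht, by linarith⟩
    rw [hU, ae_restrict_iUnion_iff]
    intro k
    have hk : (0 : ℝ) ≤ k := Nat.cast_nonneg k
    have h1 := ae_restrict_of_ae_restrict_of_subset (s := Ω ×ˢ Ioo τ (τ + k + 1))
      (prod_mono_right (Ioo_subset_Ioo_left hτ.le)) (h (τ + k + 1) (by linarith))
    have h2 : ∀ᵐ z ∂((volume : Measure (Space N × ℝ)).restrict (Ω ×ˢ Ioo τ (τ + k + 1))),
        τ < z.2 := by
      rw [Measure.volume_eq_prod, ← Measure.prod_restrict]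
      exact (Measure.quasiMeasurePreserving_snd.ae (ae_restrict_mem measurableSet_Ioo)).mono
        fun z hz => hz.1
    filter_upwards [h1, h2] with z h3 h4 using h3 h4
  have hbdd : BddBelow S := ⟨0, fun t ht => ht.1.le⟩
  have hnonneg : 0 ≤ sInf S := le_csInf ⟨τ, hτS⟩ fun t ht => ht.1.le
  have hae : ∀ᵐ z ∂((volume : Measure (Space N × ℝ)).restrict (Ω ×ˢ Ioi (sInf S))),
      u z = 0 ∧ v z = 0 := by
    -- A countable exhaustion from the right shows that the infimum is attained; nontriviality of
    -- the initial value then makes it positive.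
    have hU : Ω ×ˢ Ioi (sInf S) = ⋃ k : ℕ, Ω ×ˢ Ioi (sInf S + 1 / ((k : ℝ) + 1)) := by
      rw [← prod_iUnion]
      congr 1
      ext t
      simp only [mem_iUnion, mem_Ioi]
      constructor
      · intro ht
        obtain ⟨k, hk⟩ := exists_nat_one_div_lt (sub_pos.2 ht)
        exact ⟨k, by linarith⟩
      · rintro ⟨k, hk⟩
        have : (0 : ℝ) < 1 / ((k : ℝ) + 1) := by positivity
        linarith
    rw [hU, ae_restrict_iUnion_iff]
    intro k
    have hk : sInf S < sInf S + 1 / ((k : ℝ) + 1) := by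
      have : (0 : ℝ) < 1 / ((k : ℝ) + 1) := by positivity
      linarith
    obtain ⟨t, htS, ht⟩ := exists_lt_of_csInf_lt ⟨τ, hτS⟩ hk
    exact ae_restrict_of_ae_restrict_of_subset (prod_mono_right (Ioi_subset_Ioi ht.le)) htS.2
  refine ⟨sInf S, ⟨?_, hae⟩, fun t ht => csInf_le hbdd ht⟩
  rcases hnonneg.lt_or_eq with h0 | h0
  · exact h0
  · rw [← h0] at hae
    exact absurd (hae.mono fun z hz => hz.1) (hi.not_ae_eq_zero hm hne)

/-! ### Choice of parameters and the main theorem -/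

/-- Take r = m s, so that the lower constraint is an equality and the upper one is mn ≤ 1; then s is
chosen large enough for the remaining bounds on both s and m s. -/
theorem exists_admissibleExponents (N : ℕ) (p q : ℝ) {m n : ℝ} (hm : 0 < m) (hn : 0 < n)
    (hmn : m * n ≤ 1) : ∃ s r : ℝ, AdmissibleExponents N p q m n s r := by
  set s := 2 + |minExponent N p| + (2 + |minExponent N q|) / m with hs
  have h1 := abs_nonneg (minExponent N p)
  have h2 := abs_nonneg (minExponent N q)
  have h3 := le_abs_self (minExponent N p)
  have h4 := le_abs_self (minExponent N q)
  have h5 : 0 < (2 + |minExponent N q|) / m := by positivity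
  have hs0 : 0 < s := by positivity
  have hr : m * s = m * (2 + |minExponent N p|) + (2 + |minExponent N q|) := by
    rw [hs]; field_simp
  have h6 : 0 < m * (2 + |minExponent N p|) := by positivity
  have h7 : m * s / s = m := mul_div_cancel_right₀ _ hs0.ne'
  refine ⟨s, m * s, by linarith, by linarith, h7.ge, ?_, by linarith, by linarith⟩
  rw [h7, le_div_iff₀ hn]
  exact hmn

theorem IsWeakSolution.exists_bound {Ω : Set (Space N)} (hΩ : IsOpen Ω)
    [IsFiniteMeasure (volume.restrict Ω)] {p q m n : ℝ} (hp : 1 < p) (hq : 1 < q) (hm : 0 < m)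
    (hn : 0 < n) (hmn : m * n ≤ 1) {u₀ v₀ : Space N → ℝ} (hu₀ : IsInitialDatum p Ω u₀)
    (hv₀ : IsInitialDatum q Ω v₀) {u v : Space N × ℝ → ℝ}
    (hsol : IsWeakSolution p q m n Ω u₀ v₀ u v) {T : ℝ} (hT : 0 < T) :
    ∃ M, ∀ᵐ z ∂(cylMeasure Ω T), u z ≤ M ∧ v z ≤ M := by
  obtain ⟨u', v', gu, gv, hu, hv, hun, hvm⟩ :=
    (hsol T hT).exists_isDirichletSolution hm hn hu₀ hv₀
  refine exists_bound_of_subcritical hΩ hT hp hq hm hn hmn hu hv (hsol T hT).1 hun hvm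
    (B := max (eLpNorm u₀ ⊤ (volume.restrict Ω)).toReal (eLpNorm v₀ ⊤ (volume.restrict Ω)).toReal)
    ?_ ?_
  · filter_upwards [ae_abs_le_of_memLp_top hu₀.bounded] with x hx
    exact le_max_of_le_left ((le_abs_self _).trans hx)
  · filter_upwards [ae_abs_le_of_memLp_top hv₀.bounded] with x hx
    exact le_max_of_le_right ((le_abs_self _).trans hx)

theorem IsTorsionFunction.normLinfty_pos (hN : 1 ≤ N) {Ω : Set (Space N)} (hΩ : IsOpen Ω)
    (hb : Bornology.IsBounded Ω) [IsFiniteMeasure (volume.restrict Ω)] (hV : 0 < volume.real Ω)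
    {p : ℝ} (hp : 1 < p) {δ₀ : ℝ} (hδ₀ : 0 < δ₀) {ψ : Space N → ℝ}
    (h : IsTorsionFunction p Ω δ₀ ψ) :
    0 < normLinfty Ω ψ ∧ ∀ᵐ x ∂(volume.restrict Ω), ψ x ≤ normLinfty Ω ψ := by
  obtain ⟨M, hM⟩ := h.bounded hN hΩ hb hp
  obtain ⟨g, hg, -⟩ := h
  have hm : AEStronglyMeasurable ψ (volume.restrict Ω) := by
    refine (hg.1.1.add (aestronglyMeasurable_const (b := δ₀))).congr
      (Eventually.of_forall fun x => ?_)
    simp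
  have hmem : MemLp ψ ⊤ (volume.restrict Ω) := by
    refine MemLp.of_bound hm M ?_
    filter_upwards [hM] with x hx
    rw [Real.norm_of_nonneg (hδ₀.le.trans hx.1)]
    exact hx.2
  have hle : ∀ᵐ x ∂(volume.restrict Ω), ψ x ≤ normLinfty Ω ψ := by
    filter_upwards [ae_abs_le_of_memLp_top hmem] with x hx
    exact (le_abs_self _).trans hx
  refine ⟨?_, hle⟩
  have hne : (ae (volume.restrict Ω)).NeBot := by
    rw [ae_neBot]
    intro h0
    have : volume Ω = 0 := Measure.restrict_eq_zero.1 h0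
    rw [Measure.real, this] at hV
    simp at hV
  obtain ⟨x, hx1, hx2⟩ := (hM.and hle).exists
  linarith [hx1.1]

/-- The left side carries the higher power of k, so smallness of k beats the constant M^e. For
multiples of the torsion functions these are the two supersolution inequalities, and l₁/l₂ lies in
the interval where both power comparisons are strict. -/
theorem exists_small_rpow {l e d M : ℝ} (hM : 0 < M) (hd : d < l * e) :
    ∃ k₀ : ℝ, 0 < k₀ ∧ ∀ k, 0 < k → k ≤ k₀ → (k ^ l * M) ^ e ≤ k ^ d := by
  have hE : 0 < l * e - d := by linarith
  have hMe : 0 < M ^ e := Real.rpow_pos_of_pos hM _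
  refine ⟨(M ^ e)⁻¹ ^ (l * e - d)⁻¹, by positivity, fun k hk hkk => ?_⟩
  have h1 : k ^ (l * e - d) ≤ (M ^ e)⁻¹ := by
    have := Real.rpow_le_rpow hk.le hkk hE.le
    rwa [← Real.rpow_mul (by positivity), inv_mul_cancel₀ hE.ne', Real.rpow_one] at this
  have h2 : k ^ (l * e) = k ^ (l * e - d) * k ^ d := by
    rw [← Real.rpow_add hk]; congr 1; ring
  rw [Real.mul_rpow (by positivity) hM.le, ← Real.rpow_mul hk.le, h2]
  calc k ^ (l * e - d) * k ^ d * M ^ e ≤ (M ^ e)⁻¹ * k ^ d * M ^ e := by gcongr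
    _ = k ^ d := by field_simp

/-- Lowers a source exponent at the price of the supremum, reducing mn > 1 to m₁ n₁ ≤ 1. -/
theorem rpow_le_mul_rpow {m m₁ y R : ℝ} (hm₁ : 0 < m₁) (hm : m₁ ≤ m) (hy : 0 ≤ y) (hyR : y ≤ R) :
    y ^ m ≤ R ^ (m - m₁) * y ^ m₁ := by
  rcases hy.eq_or_lt with rfl | hy0
  · rw [Real.zero_rpow (by linarith), Real.zero_rpow hm₁.ne', mul_zero]
  · calc y ^ m = y ^ (m - m₁) * y ^ m₁ := by rw [← Real.rpow_add hy0]; congr 1; ring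
      _ ≤ R ^ (m - m₁) * y ^ m₁ := by gcongr

end FastDiffusion

theorem theorem3p1 (N : ℕ) (hN : 1 ≤ N) (Ω : Set (FastDiffusion.Space N))
    (hΩ : FastDiffusion.IsSmoothBoundedDomain Ω)
    (p q m n : ℝ) (hp : 1 < p) (hp2 : p < 2) (hq : 1 < q) (hq2 : q < 2) (hm : 0 < m) (hn : 0 < n)
    (hmn : (p - 1) * (q - 1) < m * n) :
    (m * n ≤ 1 →
      (∃ s r : ℝ, FastDiffusion.AdmissibleExponents N p q m n s r) ∧
      ∀ s r : ℝ, FastDiffusion.AdmissibleExponents N p q m n s r →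
      ∀ u₀ v₀ : FastDiffusion.Space N → ℝ,
        FastDiffusion.IsInitialDatum p Ω u₀ → FastDiffusion.IsInitialDatum q Ω v₀ →
      ∀ δ₁ : ℝ, 0 < δ₁ → δ₁ < 1 →
        FastDiffusion.Comparable p q m n
          (FastDiffusion.diffusionCoeff p Ω s) (FastDiffusion.sourceCoeff m Ω s r)
          (FastDiffusion.diffusionCoeff q Ω r) (FastDiffusion.sourceCoeff n Ω r s)
          δ₁ (FastDiffusion.normLs Ω s u₀) (FastDiffusion.normLs Ω r v₀) →
      ∀ u v : FastDiffusion.Space N × ℝ → ℝ,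
        FastDiffusion.IsWeakSolution p q m n Ω u₀ v₀ u v →
        FastDiffusion.VanishesInFiniteTime Ω u v) ∧
    (1 < m * n →
      (∃ l₁ l₂ : ℝ, 0 < l₁ ∧ 0 < l₂ ∧ l₁ / l₂ < m / (p - 1) ∧ (q - 1) / n < l₁ / l₂) ∧
      (∃ m₁ n₁ s r : ℝ, 0 < m₁ ∧ m₁ < m ∧ 0 < n₁ ∧ n₁ ≤ n ∧
        (p - 1) * (q - 1) < m₁ * n₁ ∧ m₁ * n₁ ≤ 1 ∧
        FastDiffusion.AdmissibleExponents N p q m₁ n₁ s r) ∧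
      ∀ l₁ l₂ : ℝ, 0 < l₁ → 0 < l₂ → l₁ / l₂ < m / (p - 1) → (q - 1) / n < l₁ / l₂ →
      ∀ δ₀ : ℝ, 0 < δ₀ →
      ∀ ψp ψq : FastDiffusion.Space N → ℝ,
        FastDiffusion.IsTorsionFunction p Ω δ₀ ψp → FastDiffusion.IsTorsionFunction q Ω δ₀ ψq →
      ∃ k₀ : ℝ, 0 < k₀ ∧ ∀ k : ℝ, 0 < k → k ≤ k₀ →
      ∀ m₁ n₁ : ℝ, 0 < m₁ → m₁ ≤ m → 0 < n₁ → n₁ ≤ n →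
        (p - 1) * (q - 1) < m₁ * n₁ → m₁ * n₁ ≤ 1 →
      ∀ s r : ℝ, FastDiffusion.AdmissibleExponents N p q m₁ n₁ s r →
      ∀ u₀ v₀ : FastDiffusion.Space N → ℝ,
        FastDiffusion.IsInitialDatum p Ω u₀ → FastDiffusion.IsInitialDatum q Ω v₀ →
        (∀ᵐ x ∂(MeasureTheory.volume.restrict Ω),
          u₀ x ≤ k ^ l₁ * ψp x ∧ v₀ x ≤ k ^ l₂ * ψq x) →
      ∀ δ₂ : ℝ, 0 < δ₂ → δ₂ < 1 →
        FastDiffusion.Comparable p q m₁ n₁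
          (FastDiffusion.diffusionCoeff p Ω s)
          (k ^ (l₂ * (m - m₁)) * FastDiffusion.normLinfty Ω ψq ^ (m - m₁) *
            FastDiffusion.sourceCoeff m₁ Ω s r)
          (FastDiffusion.diffusionCoeff q Ω r)
          (k ^ (l₁ * (n - n₁)) * FastDiffusion.normLinfty Ω ψp ^ (n - n₁) *
            FastDiffusion.sourceCoeff n₁ Ω r s)
          δ₂ (FastDiffusion.normLs Ω s u₀) (FastDiffusion.normLs Ω r v₀) →
      ∀ u v : FastDiffusion.Space N × ℝ → ℝ,
        FastDiffusion.IsWeakSolution p q m n Ω u₀ v₀ u v →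
        FastDiffusion.IsLocallyBoundedInTime Ω u → FastDiffusion.IsLocallyBoundedInTime Ω v →
        FastDiffusion.VanishesInFiniteTime Ω u v) := by
  have hb := hΩ.isBounded
  have hop := hΩ.isOpen
  have hfin : IsFiniteMeasure (volume.restrict Ω) :=
    ⟨by rw [Measure.restrict_apply_univ]; exact hb.measure_lt_top⟩
  have hV : 0 < volume.real Ω := ENNReal.toReal_pos
    (hop.measure_pos volume hΩ.isConnected.nonempty).ne' hb.measure_lt_top.ne
  refine ⟨fun hmn1 => ⟨FastDiffusion.exists_admissibleExponents N p q hm hn hmn1,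
    fun s r hsr u₀ v₀ hu₀ hv₀ δ₁ hδ hδ1 hcmp u v hsol => ?_⟩, fun hmn1 => ⟨?_, ?_, ?_⟩⟩
  · obtain ⟨τ, hτ, hext⟩ := hsol.exists_extinction_time hN hop hV hp hp2 hq hq2 hm hn hm hn hmn hsr
      hu₀ hv₀ hδ hδ1 one_pos one_pos (by simpa using hcmp)
      (fun T hT => hsol.exists_bound hop hp hq hm hn hmn1 hu₀ hv₀ hT)
      (fun T _ => Eventually.of_forall fun z => by simp)
    exact FastDiffusion.vanishesInFiniteTime_of_ae_eq_zero (hsol 1 one_pos).2.1 hu₀.bounded.1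
      hu₀.nontrivial hτ hext
  · have h1 : (q - 1) / n < m / (p - 1) := by
      rw [div_lt_div_iff₀ hn (by linarith)]; linarith
    have h2 : 0 < (q - 1) / n := div_pos (by linarith) hn
    exact ⟨((q - 1) / n + m / (p - 1)) / 2, 1, by linarith, one_pos, by linarith, by linarith⟩
  -- The choice m₁ = 1/n, n₁ = n gives product exactly 1, which exceeds (p-1)(q-1), and m₁ < m
  -- because mn > 1.
  · have h1 : 1 / n * n = 1 := one_div_mul_cancel hn.ne'
    obtain ⟨s, r, hsr⟩ := FastDiffusion.exists_admissibleExponents N p q (one_div_pos.2 hn) hn h1.le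
    exact ⟨1 / n, n, s, r, one_div_pos.2 hn, by rw [div_lt_iff₀ hn]; exact hmn1, hn, le_rfl,
      by rw [h1]; nlinarith, h1.le, hsr⟩
  · intro l₁ l₂ hl₁ hl₂ hlm hln δ₀ hδ₀ ψp ψq hψp hψq
    obtain ⟨hMp0, hMp⟩ := hψp.normLinfty_pos hN hop hb hV hp hδ₀
    obtain ⟨hMq0, hMq⟩ := hψq.normLinfty_pos hN hop hb hV hq hδ₀
    set Mp := FastDiffusion.normLinfty Ω ψp
    set Mq := FastDiffusion.normLinfty Ω ψq
    rw [div_lt_div_iff₀ hl₂ (by linarith)] at hlm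
    rw [div_lt_div_iff₀ hn hl₂] at hln
    -- Each half of the condition on l₁/l₂ gives one supersolution inequality: sup(k^l₂ ψ_q)^m ≤
    -- k^(l₁(p-1)) and sup(k^l₁ ψ_p)^n ≤ k^(l₂(q-1)).
    obtain ⟨k₁, hk₁, hk₁'⟩ := FastDiffusion.exists_small_rpow (l := l₂) (e := m)
      (d := l₁ * (p - 1)) hMq0 (by linarith)
    obtain ⟨k₂, hk₂, hk₂'⟩ := FastDiffusion.exists_small_rpow (l := l₁) (e := n)
      (d := l₂ * (q - 1)) hMp0 (by linarith)
    refine ⟨min k₁ k₂, lt_min hk₁ hk₂, fun k hk hkk m₁ n₁ hm₁ hm₁m hn₁ hn₁n hmn₁ _ s r hsr u₀ v₀ hu₀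
      hv₀ hle δ₂ hδ hδ1 hcmp u v hsol hub hvb => ?_⟩
    have hK₁ : 0 < k ^ l₁ := Real.rpow_pos_of_pos hk _
    have hK₂ : 0 < k ^ l₂ := Real.rpow_pos_of_pos hk _
    have hbd : ∀ T, 0 < T → ∀ᵐ z ∂(FastDiffusion.cylMeasure Ω T),
        u z ≤ k ^ l₁ * Mp ∧ v z ≤ k ^ l₂ * Mq := by
      intro T hT
      obtain ⟨u', v', gu, gv, hu, hv, -, -⟩ :=
        (hsol T hT).exists_isDirichletSolution hm hn hu₀ hv₀
      have hB : ∀ᵐ z ∂(FastDiffusion.cylMeasure Ω T),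
          u z ≤ max (eLpNorm u ⊤ (FastDiffusion.cylMeasure Ω T)).toReal
            (eLpNorm v ⊤ (FastDiffusion.cylMeasure Ω T)).toReal ∧
          v z ≤ max (eLpNorm u ⊤ (FastDiffusion.cylMeasure Ω T)).toReal
            (eLpNorm v ⊤ (FastDiffusion.cylMeasure Ω T)).toReal := by
        filter_upwards [FastDiffusion.ae_abs_le_of_memLp_top (hub T hT),
          FastDiffusion.ae_abs_le_of_memLp_top (hvb T hT)] with z h1 h2
        exact ⟨le_max_of_le_left ((le_abs_self _).trans h1),
          le_max_of_le_right ((le_abs_self _).trans h2)⟩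
      refine FastDiffusion.le_torsion_of_bounded hN hop hb hT hp hq hm hn hu hv (hsol T hT).1 hB
        hδ₀ hψp hψq hMp0 hMq0 hMp hMq hK₁ hK₂ ?_ ?_ (hle.mono fun x hx => hx.1)
        (hle.mono fun x hx => hx.2)
      · rw [← Real.rpow_mul hk.le l₁]
        exact hk₁' k hk (hkk.trans (min_le_left _ _))
      · rw [← Real.rpow_mul hk.le l₂]
        exact hk₂' k hk (hkk.trans (min_le_right _ _))
    -- Rewrites powers of the supremum bounds k^l M in the form in which they enter the coefficients
    -- b₁' and b₂'.
    have hκ : ∀ l a M : ℝ, 0 < M → (k ^ l * M) ^ a = k ^ (l * a) * M ^ a := fun l a M hM => by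
      rw [Real.mul_rpow (Real.rpow_nonneg hk.le _) hM.le, ← Real.rpow_mul hk.le]
    obtain ⟨τ, hτ, hext⟩ := hsol.exists_extinction_time hN hop hV hp hp2 hq hq2 hm hn hm₁ hn₁ hmn₁
      hsr hu₀ hv₀ hδ hδ1
      (κ₁ := (k ^ l₂ * Mq) ^ (m - m₁)) (κ₂ := (k ^ l₁ * Mp) ^ (n - n₁)) (by positivity)
      (by positivity) (by rw [hκ _ _ _ hMq0, hκ _ _ _ hMp0]; exact hcmp)
      (fun T hT => ⟨max (k ^ l₁ * Mp) (k ^ l₂ * Mq), (hbd T hT).mono fun z hz =>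
        ⟨le_max_of_le_left hz.1, le_max_of_le_right hz.2⟩⟩)
      (fun T hT => by
        filter_upwards [hbd T hT, (hsol T hT).1] with z h1 h2
        exact ⟨FastDiffusion.rpow_le_mul_rpow hm₁ hm₁m h2.2 h1.2,
          FastDiffusion.rpow_le_mul_rpow hn₁ hn₁n h2.1 h1.1⟩)
    exact FastDiffusion.vanishesInFiniteTime_of_ae_eq_zero (hsol 1 one_pos).2.1 hu₀.bounded.1
      hu₀.nontrivial hτ hext
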